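/- Graphs are finite multigraphs, with loops and multiple edges allowed, considered up to isomorphism (a bijection of the vertices preserving the number of edges between any two vertices); the genus of a connected graph is $|E|-|V|+1$. A tropical plane curve is smooth if the regular subdivision of its Newton polygon dual to it is a unimodular triangulation. A graph is *troplanar* if it is the skeleton of a smooth tropical plane curve whose Newton polygon has at least $2$ interior lattice points; the skeleton is obtained from the curve by removing all rays, iteratively retracting leaves together with their edges, and then smoothing over all $2$-valent vertices. A graph is *$2$-edge-connected* if it is connected and has no bridges. Let $b$ be a bridge with $3$-valent end vertices $v$ and $w$, let $e_1,e_2$ be the other two edge ends at $v$ and $f_1,f_2$ the other two edge ends at $w$, numbered in any way. A *bridge reduction* with respect to $b$ deletes $b$, $v$ and $w$, attaches $e_1$ and $f_1$ to a new vertex $v'$ and $e_2$ and $f_2$ to a new vertex $w'$, and adds an edge $b'$ between $v'$ and $w'$. We say that $G$ *bridge-reduces* to $G'$ if a finite (possibly empty) sequence of bridge reductions turns $G$ into $G'$. Let $g\ge 2$, let $\mathscr{T}(g)$ be the number of troplanar graphs of genus $g$, and let $\mathscr{T}^{(2)}(g)$ be the number of $2$-edge-connected troplanar graphs of genus $g$.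 Then: 1. $\mathscr{T}(g)$ is finite and $\mathscr{T}(g)\le 2^{g-1}\,\mathscr{T}^{(2)}(g)$. 2. Every troplanar graph of genus $g$ bridge-reduces to some $2$-edge-connected troplanar graph of genus $g$. 3. Let $G'$ be a $2$-edge-connected troplanar graph of genus $g$. At most $2^{g-1}$ troplanar graphs bridge-reduce to $G'$. Moreover, suppose $G'$ is the skeleton of a smooth tropical plane curve dual to the triangulation $\mathcal{T}$ of its Newton polygon, and let $H$ be the subgraph of $\mathcal{T}$ induced by the interior lattice points of the polygon. Then the troplanar graphs that bridge-reduce to $G'$ are indexed by subsets of the set of bridges of $H$: there is a map defined on the subsets of the set of bridges of $H$ whose image contains all of these graphs. -/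

import Mathlib

open Relation

/-!
Graphs are finite multigraphs with loops, modelled by Mathlib's `Graph α β`.
-/

namespace Graph

variable {α β α' β' α'' β'' : Type*}

/-- Finitely many vertices and finitely many edges. -/
def IsFinite (G : Graph α β) : Prop := G.vertexSet.Finite ∧ G.edgeSet.Finite

/-- The degree of a vertex: the number of incident edges, each loop being counted twice. -/
noncomputable def degree (G : Graph α β) (v : α) : ℕ :=
  {e | G.Inc e v}.ncard + {e | G.IsLoopAt e v}.ncard

/-- The set of connected components, each given by its set of vertices. -/
def components (G : Graph α β) : Set (Set α) :=
  {C | ∃ x ∈ G.vertexSet, C = {y | ReflTransGen G.Adj x y}}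

/-- A graph is connected if it is non-empty and any vertex can be reached from any other one. -/
def IsConnected (G : Graph α β) : Prop :=
  G.vertexSet.Nonempty ∧ ∀ x ∈ G.vertexSet, ∀ y ∈ G.vertexSet, ReflTransGen G.Adj x y

/-- A bridge is an edge whose deletion increases the number of connected components. -/
def IsBridge (G : Graph α β) (e : β) : Prop :=
  e ∈ G.edgeSet ∧ G.components.ncard < (G.deleteEdges {e}).components.ncard

/-- Connected and without bridges. -/
def IsTwoEdgeConnected (G : Graph α β) : Prop :=
  G.IsConnected ∧ ∀ e, ¬ G.IsBridge e

/-- The genus `|E| - |V| + 1`. -/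
noncomputable def genus (G : Graph α β) : ℤ :=
  (G.edgeSet.ncard : ℤ) - (G.vertexSet.ncard : ℤ) + 1

/-- Two graphs are isomorphic if there is a bijection of their vertices that preserves the
number of edges between any two (possibly equal) vertices. -/
def IsIsomorphic (G : Graph α β) (G' : Graph α' β') : Prop :=
  ∃ φ : G.vertexSet ≃ G'.vertexSet, ∀ v w : G.vertexSet,
    {e | G.IsLink e v w}.ncard = {e | G'.IsLink e (φ v) (φ w)}.ncard

theorem IsIsomorphic.refl (G : Graph α β) : G.IsIsomorphic G :=
  ⟨Equiv.refl _, fun _ _ => rfl⟩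

theorem IsIsomorphic.symm {G : Graph α β} {G' : Graph α' β'} (h : G.IsIsomorphic G') :
    G'.IsIsomorphic G := by
  obtain ⟨φ, hφ⟩ := h
  exact ⟨φ.symm, fun v w => by rw [hφ]; simp⟩

theorem IsIsomorphic.trans {G : Graph α β} {G' : Graph α' β'} {G'' : Graph α'' β''}
    (h : G.IsIsomorphic G') (h' : G'.IsIsomorphic G'') : G.IsIsomorphic G'' := by
  obtain ⟨φ, hφ⟩ := h
  obtain ⟨ψ, hψ⟩ := h'
  exact ⟨φ.trans ψ, fun v w => by rw [hφ, hψ]; rfl⟩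

/-- `G'` arises from `G` by retracting a leaf, that is, by deleting a 1-valent vertex together
with its edge. -/
def RetractsLeaf (G G' : Graph α β) : Prop :=
  ∃ v ∈ G.vertexSet, G.degree v = 1 ∧ G' = G.deleteVerts {v}

/-- `G'` arises from `G` by smoothing over a 2-valent vertex `v`: the two edges `e` (from `v`
to `x`) and `f` (from `v` to `y`) are merged into a single edge from `x` to `y`, which keeps the
name `e`. The vertices `x` and `y` may coincide, and then the new edge is a loop. -/
def SmoothsVertex (G G' : Graph α β) : Prop :=
  ∃ v x y e f, G.degree v = 2 ∧ e ≠ f ∧ x ≠ v ∧ y ≠ v ∧ G.IsLink e v x ∧ G.IsLink f v y ∧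
    G'.vertexSet = G.vertexSet \ {v} ∧
    ∀ d a b, G'.IsLink d a b ↔
      (d = e ∧ s(a, b) = s(x, y)) ∨ (d ≠ e ∧ d ≠ f ∧ G.IsLink d a b)

/-- `S` is obtained from `C` by retracting leaves until there are none left, and then
smoothing over 2-valent vertices until there are none left. -/
def IsSkeletonOf (S C : Graph α β) : Prop :=
  ∃ C' : Graph α β, ReflTransGen RetractsLeaf C C' ∧ (∀ v ∈ C'.vertexSet, C'.degree v ≠ 1) ∧
    ReflTransGen SmoothsVertex C' S ∧ ∀ v ∈ S.vertexSet, S.degree v ≠ 2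

/-- The vertex `inr (s, i)` is the half `vᵢ` of `v` if `s = false` and the half `wᵢ` of `w` if
`s = true`. This map glues `v₁` to `v₂` and `w₁` to `w₂`. -/
def glueEnds (v w : α) : α ⊕ Bool × Bool → α
  | Sum.inl x => x
  | Sum.inr (s, _) => if s then w else v

/-- This map glues `v₁` to `w₁`, giving the new vertex `v'`, and `v₂` to `w₂`, giving the new
vertex `w'`. The name `v` is reused for `v'`, and the name `w` for `w'`. -/
def glueAcross (v w : α) : α ⊕ Bool × Bool → α
  | Sum.inl x => x
  | Sum.inr (_, i) => if i then w else v

/-- `G'` is a bridge reduction of `G` with respect to some bridge `b` with end vertices `v` and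
`w`. The bridge `b` is deleted, `v` is split into two 1-valent vertices `v₁`, `v₂` and `w`
into two 1-valent vertices `w₁`, `w₂`, which gives the graph `K`; then `v₁` is identified with
`w₁` and `v₂` with `w₂`, and the two resulting vertices are joined by a new edge. The new edge
reuses the name `b`. The numbering of the halves of `v` and of `w` is arbitrary. -/
def IsBridgeReduction (G G' : Graph α β) : Prop :=
  ∃ (b : β) (v w : α) (K : Graph (α ⊕ Bool × Bool) β),
    G.IsBridge b ∧ G.IsLink b v w ∧
    K.vertexSet = Sum.inl '' (G.vertexSet \ {v, w}) ∪ Set.range Sum.inr ∧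
    (∀ h : Bool × Bool, K.degree (Sum.inr h) = 1) ∧
    K.map (glueEnds v w) = G.deleteEdges {b} ∧
    K.map (glueAcross v w) = G'.deleteEdges {b} ∧
    G'.IsLink b v w

/-- `G` can be turned into (a graph isomorphic to) `G'` by a finite, possibly empty, sequence of
bridge reductions. -/
def BridgeReducesTo (G : Graph α β) (G' : Graph α' β') : Prop :=
  ∃ G'' : Graph α β, ReflTransGen IsBridgeReduction G G'' ∧ G''.IsIsomorphic G'

end Graph

/-- A tropical polynomial in two variables: the finite set of exponent vectors of the terms
with coefficient different from `∞`, and the coefficients (relevant only on that set). -/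
structure TropicalPolynomial where
  support : Finset (ℤ × ℤ)
  coeff : ℤ × ℤ → ℝ

namespace TropicalPolynomial

/-- The value at `w` of the term with exponent vector `p`. -/
def term (f : TropicalPolynomial) (p : ℤ × ℤ) (w : ℝ × ℝ) : ℝ :=
  f.coeff p + p.1 * w.1 + p.2 * w.2

/-- The exponent vectors of the terms at which the minimum `f(w)` is attained. The tropical curve
is the set of the `w` for which this set has at least two elements, and the convex hulls of the
sets `f.minimizers w` are the cells of the dual regular subdivision of the Newton polygon, which
is the subdivision induced by the height function `f.coeff`. -/
def minimizers (f : TropicalPolynomial) (w : ℝ × ℝ) : Set (ℤ × ℤ) :=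
  {p | p ∈ f.support ∧ ∀ q ∈ f.support, f.term p w ≤ f.term q w}

/-- The Newton polygon. -/
def newtonPolygon (f : TropicalPolynomial) : Set (ℝ × ℝ) :=
  convexHull ℝ ((fun p : ℤ × ℤ => ((p.1 : ℝ), (p.2 : ℝ))) '' f.support)

/-- The lattice points in the interior of the Newton polygon. -/
def interiorPoints (f : TropicalPolynomial) : Set (ℤ × ℤ) :=
  {p | ((p.1 : ℝ), (p.2 : ℝ)) ∈ interior f.newtonPolygon}

/-- The genus of the Newton polygon: its number of interior lattice points. -/
noncomputable def genus (f : TropicalPolynomial) : ℕ := f.interiorPoints.ncard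

/-- Twice the signed area of the triangle with vertices `p`, `q`, `r`. -/
def doubleArea (p q r : ℤ × ℤ) : ℤ :=
  (q.1 - p.1) * (r.2 - p.2) - (q.2 - p.2) * (r.1 - p.1)

/-- A set of lattice points that does not lie on a line. -/
def IsTwoDimensional (C : Set (ℤ × ℤ)) : Prop :=
  ∃ p ∈ C, ∃ q ∈ C, ∃ r ∈ C, doubleArea p q r ≠ 0

/-- The vertex set of a lattice triangle of area `1/2`. -/
def IsUnimodularTriangle (C : Set (ℤ × ℤ)) : Prop :=
  ∃ p q r, C = {p, q, r} ∧ |doubleArea p q r| = 1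

/-- The tropical curve of `f` is smooth: the Newton polygon is two-dimensional and the dual
subdivision is a unimodular triangulation. -/
def IsSmooth (f : TropicalPolynomial) : Prop :=
  IsTwoDimensional (f.support : Set (ℤ × ℤ)) ∧
    ∀ w, IsTwoDimensional (f.minimizers w) → IsUnimodularTriangle (f.minimizers w)

/-- The tropical curve of `f` as a graph, with its rays removed. The vertices are the vertices of
the curve, i.e. the points dual to the polygons of the subdivision. Two vertices are joined by an
edge if the dual polygons share an edge; this means that two terms attain the minimum at both
vertices, and hence along the segment between them. -/
def curveGraph (f : TropicalPolynomial) : Graph (ℝ × ℝ) (Sym2 (ℝ × ℝ)) where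
  vertexSet := {w | IsTwoDimensional (f.minimizers w)}
  IsLink e u w := IsTwoDimensional (f.minimizers u) ∧ IsTwoDimensional (f.minimizers w) ∧
    u ≠ w ∧ (f.minimizers u ∩ f.minimizers w).Nontrivial ∧ e = s(u, w)
  isLink_symm := by
    intro e _
    refine ⟨fun u w h => ⟨h.2.1, h.1, h.2.2.1.symm, ?_, ?_⟩⟩
    · rw [Set.inter_comm]; exact h.2.2.2.1
    · rw [Sym2.eq_swap]; exact h.2.2.2.2
  eq_or_eq_of_isLink_of_isLink := by
    rintro e x y v w ⟨-, -, -, -, rfl⟩ ⟨-, -, -, -, h⟩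
    rw [Sym2.eq_iff] at h
    tauto
  left_mem_of_isLink := fun _ _ _ h => h.1

/-- The subgraph of the dual subdivision (seen as a graph on the lattice points of the Newton
polygon) that is induced by the interior lattice points: `p` and `q` are joined by an edge if
they are the end points of an edge of the subdivision. -/
def interiorGraph (f : TropicalPolynomial) : Graph (ℤ × ℤ) (Sym2 (ℤ × ℤ)) where
  vertexSet := f.interiorPoints
  IsLink e p q := p ∈ f.interiorPoints ∧ q ∈ f.interiorPoints ∧ p ≠ q ∧
    (∃ w, f.minimizers w = {p, q}) ∧ e = s(p, q)
  isLink_symm := by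
    intro e _
    refine ⟨fun p q h => ⟨h.2.1, h.1, h.2.2.1.symm, ?_, ?_⟩⟩
    · rw [Set.pair_comm]; exact h.2.2.2.1
    · rw [Sym2.eq_swap]; exact h.2.2.2.2
  eq_or_eq_of_isLink_of_isLink := by
    rintro e x y v w ⟨-, -, -, -, rfl⟩ ⟨-, -, -, -, h⟩
    rw [Sym2.eq_iff] at h
    tauto
  left_mem_of_isLink := fun _ _ _ h => h.1

/-- The tropical curve of `f` is smooth, its Newton polygon has genus at least `2`, and `G` is
(isomorphic to) its skeleton. -/
def GivesRiseTo {α β : Type*} (f : TropicalPolynomial) (G : Graph α β) : Prop :=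
  f.IsSmooth ∧ 2 ≤ f.genus ∧
    ∃ S : Graph (ℝ × ℝ) (Sym2 (ℝ × ℝ)), S.IsSkeletonOf f.curveGraph ∧ S.IsIsomorphic G

end TropicalPolynomial

/-- A finite graph is troplanar if it is the skeleton of a smooth tropical plane curve. -/
def Graph.IsTroplanar {α β : Type*} (G : Graph α β) : Prop :=
  G.IsFinite ∧ ∃ f : TropicalPolynomial, f.GivesRiseTo G

/-- Isomorphism as an equivalence relation on graphs with vertices and edges named by natural
numbers; every finite graph is isomorphic to such a graph. -/
def graphSetoid : Setoid (Graph ℕ ℕ) where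
  r := Graph.IsIsomorphic
  iseqv := ⟨Graph.IsIsomorphic.refl, Graph.IsIsomorphic.symm, Graph.IsIsomorphic.trans⟩

/-- Isomorphism classes of graphs. -/
abbrev GraphClass : Type := Quotient graphSetoid

/-- The isomorphism class of a graph. -/
def graphClass (G : Graph ℕ ℕ) : GraphClass := Quotient.mk graphSetoid G

/-- The isomorphism classes of troplanar graphs of genus `g`. -/
def troplanarClasses (g : ℕ) : Set GraphClass :=
  {c | ∃ G : Graph ℕ ℕ, graphClass G = c ∧ G.IsTroplanar ∧ G.genus = g}

/-- The isomorphism classes of 2-edge-connected troplanar graphs of genus `g`. -/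
def twoEdgeConnectedTroplanarClasses (g : ℕ) : Set GraphClass :=
  {c | ∃ G : Graph ℕ ℕ, graphClass G = c ∧ G.IsTroplanar ∧ G.genus = g ∧ G.IsTwoEdgeConnected}

/-- The isomorphism classes of troplanar graphs that can be bridge-reduced to `G'`. -/
def reducingClasses (G' : Graph ℕ ℕ) : Set GraphClass :=
  {c | ∃ G : Graph ℕ ℕ, graphClass G = c ∧ G.IsTroplanar ∧ G.BridgeReducesTo G'}

/-! Everything rests on what the subdivision looks like at a bridge of the skeleton. Let an edge of
the curve be dual to the edge pq of the triangulation. If p is an interior lattice point, the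
triangles around p form a cycle and the edge is not a bridge (`DualTo.not_isCut`). If p and q are
both boundary points, then pq is a chord that separates the triangles on its two sides, so the edge
is a bridge of the curve (`DualTo.exists_isCut`). Such an edge survives in the skeleton only if
there are interior lattice points on both sides of the chord. An argument with supporting lines at p
and q and integrality (`strip_arith`, `isInner_third`) then shows that the two triangles pqr and pqs
form a parallelogram with r and s interior. Hence the skeleton is cubic and no two of its bridges
share a vertex (`SkeletonData.good`).

The diagonal pq of this parallelogram can be flipped to rs without losing regularity or
unimodularity: the coefficients beyond the line pq are lowered linearly until the dual edge has
shrunk to a point, and then a little further (`IsParallelogram.exists_bend`). On the curve, the flip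
regroups the edges at the ends of the bridge, which is a bridge reduction
(`IsFlip.exists_reductionData`). Bridge reductions commute with retraction and smoothing
(`ReductionData.exists_isSkeletonOf`), so a troplanar graph with a bridge has a troplanar bridge
reduction. As bridges are pairwise disjoint, this removes exactly one bridge
(`ReductionData.isBridge_iff`), and induction gives statement 2.

For statement 3, the reductions are undone. In a graph G that reduces to S, the edges of S other
than a reduced bridge b are coloured by the side of b in G on which they lie. This colouring is
constant at each vertex except at the ends of b, where the two other edges have different colours.
If S is 2-edge-connected, such a colouring is unique up to complement (`exists_xor_of_splits`), so G
is determined by S and the set of edges used (`IsEncodedBy.isIsomorphic`). Now let S be the skeleton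
of a curve. An edge with such a colouring is dual to an edge pq with an interior end. If both ends
are interior, following the colours around the interior points gives a cut of H, so pq is a bridge
of H (`isBridge_of_splits`). Otherwise the edge is parallel to one between interior points
(`exists_parallel_of_splits`), and the two may exchange names. So only edges dual to bridges of H
are needed. These are pairwise disjoint in a cubic graph with 2g - 2 vertices, hence there are at
most g - 1 of them and at most 2^(g-1) sets (`ncard_dualBridges_le`). Statement 1 follows by summing
over the finitely many 2-edge-connected troplanar graphs. -/

namespace Graph

/-! ### Connectivity and bridges in terms of two-colourings of the vertices -/

variable {α β α' β' α'' β'' : Type*} {G H : Graph α β}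

/-- The edge `e` is the only edge between the two sides of the vertex colouring `χ`. -/
def IsCut (G : Graph α β) (e : β) (χ : α → Bool) : Prop :=
  ∀ ⦃d x y⦄, G.IsLink d x y → (χ x ≠ χ y ↔ d = e)

/-- Reachability from `x` is itself a colouring that is constant along edges. With this form,
connectivity is transferred between graphs by moving colourings instead of paths. -/
theorem isConnected_iff : G.IsConnected ↔ G.vertexSet.Nonempty ∧
    ∀ ξ : α → Bool, (∀ d x y, G.IsLink d x y → ξ x = ξ y) →
      ∀ x ∈ G.vertexSet, ∀ y ∈ G.vertexSet, ξ x = ξ y := by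
  classical
  constructor
  · rintro ⟨h0, h⟩
    refine ⟨h0, fun ξ hξ x hx y hy => ?_⟩
    have := h x hx y hy
    induction this with
    | refl => rfl
    | tail _ hbc ih =>
      obtain ⟨d, hd⟩ := hbc
      rw [ih hd.left_mem, hξ d _ _ hd]
  · rintro ⟨h0, h⟩
    refine ⟨h0, fun x hx y hy => ?_⟩
    have := h (fun z => decide (ReflTransGen G.Adj x z)) (fun d a b hab => by
      have h1 : G.Adj a b := ⟨d, hab⟩
      simp only [decide_eq_decide]
      exact ⟨fun h => h.tail h1, fun h => h.tail h1.symm⟩) x hx y hy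
    simpa [ReflTransGen.refl] using this.symm

theorem isBridge_iff (hG : G.IsFinite) {e : β} :
    G.IsBridge e ↔ e ∈ G.edgeSet ∧ ∃ χ, G.IsCut e χ := by
  classical
  have key : ∀ {H : Graph α β} {ξ : α → Bool}, (∀ d x y, H.IsLink d x y → ξ x = ξ y) →
      ∀ {x y}, ReflTransGen H.Adj x y → ξ x = ξ y := by
    intro H ξ hξ x y hxy
    induction hxy with
    | refl => rfl
    | tail _ hbc ih => obtain ⟨d, hd⟩ := hbc; rw [ih, hξ d _ _ hd]
  have hfin : ∀ H : Graph α β, H.vertexSet.Finite → H.components.Finite := by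
    intro H hH
    refine (hH.image (fun x => {y | ReflTransGen H.Adj x y})).subset ?_
    rintro C ⟨x, hx, rfl⟩
    exact ⟨x, hx, rfl⟩
  have hsub : ∀ {x y}, ReflTransGen (G.deleteEdges {e}).Adj x y → ReflTransGen G.Adj x y := by
    intro x y h
    induction h with
    | refl => exact .refl
    | tail _ hbc ih =>
      obtain ⟨d, hd⟩ := hbc
      exact ih.tail ⟨d, (by simpa using hd : _ ∧ _).1⟩
  constructor
  · rintro ⟨he, hlt⟩
    refine ⟨he, ?_⟩
    by_contra hno
    obtain ⟨x, y, hxy⟩ := G.exists_isLink_of_mem_edgeSet he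
    have hR : ReflTransGen (G.deleteEdges {e}).Adj x y := by
      by_contra hR
      apply hno
      refine ⟨fun z => decide (ReflTransGen (G.deleteEdges {e}).Adj x z), ?_⟩
      intro d a b hab
      by_cases hde : d = e
      · subst hde
        simp only [iff_true]
        rcases hab.eq_and_eq_or_eq_and_eq hxy with ⟨rfl, rfl⟩ | ⟨rfl, rfl⟩
        · simp [ReflTransGen.refl, hR]
        · simp [ReflTransGen.refl, hR]
      · have h1 : (G.deleteEdges {e}).Adj a b := ⟨d, by simp [hab, hde]⟩
        simp only [hde, iff_false, not_not, decide_eq_decide]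
        exact ⟨fun h => h.tail h1, fun h => h.tail h1.symm⟩
    have hsub' : ∀ {x y}, ReflTransGen G.Adj x y → ReflTransGen (G.deleteEdges {e}).Adj x y := by
      intro a b h
      induction h with
      | refl => exact .refl
      | tail _ hbc ih =>
        refine ih.trans ?_
        obtain ⟨d, hd⟩ := hbc
        by_cases hde : d = e
        · subst hde
          rcases hd.eq_and_eq_or_eq_and_eq hxy with ⟨rfl, rfl⟩ | ⟨rfl, rfl⟩
          · exact hR
          · exact ReflTransGen.stdSymm.symm _ _ hR
        · exact .single ⟨d, by simp [hd, hde]⟩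
    have : G.components = (G.deleteEdges {e}).components := by
      have : ∀ a, {b | ReflTransGen G.Adj a b} = {b | ReflTransGen (G.deleteEdges {e}).Adj a b} :=
        fun a => Set.ext fun b => ⟨hsub', hsub⟩
      simp [components, this]
    rw [this] at hlt
    exact lt_irrefl _ hlt
  · rintro ⟨he, χ, hχ⟩
    refine ⟨he, ?_⟩
    obtain ⟨x, y, hxy⟩ := G.exists_isLink_of_mem_edgeSet he
    -- `F` sends a component of the graph without `e` to the component of `G` that contains it. It
    -- is onto; if the numbers of components were equal it would be injective, but the two ends of
    -- `e`, which `χ` separates, have the same image.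
    set F : Set α → Set α := fun C => {z | ∃ c ∈ C, ReflTransGen G.Adj c z} with hF
    have hFx : ∀ a, F {b | ReflTransGen (G.deleteEdges {e}).Adj a b} =
        {b | ReflTransGen G.Adj a b} := by
      intro a
      ext z
      exact ⟨fun ⟨c, hc, hz⟩ => (hsub hc).trans hz, fun hz => ⟨a, .refl, hz⟩⟩
    have himg : G.components = F '' (G.deleteEdges {e}).components := by
      ext C
      constructor
      · rintro ⟨a, ha, rfl⟩
        exact ⟨_, ⟨a, by simpa using ha, rfl⟩, hFx a⟩
      · rintro ⟨_, ⟨a, ha, rfl⟩, rfl⟩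
        exact ⟨a, by simpa using ha, hFx a⟩
    have hf' := hfin (G.deleteEdges {e}) (by simpa using hG.1)
    rw [himg]
    refine lt_of_le_of_ne (Set.ncard_image_le hf') fun heq => ?_
    have hinj := Set.injOn_of_ncard_image_eq heq hf'
    have h1 := hinj (x₁ := {b | ReflTransGen (G.deleteEdges {e}).Adj x b})
      (x₂ := {b | ReflTransGen (G.deleteEdges {e}).Adj y b}) ⟨x, by simpa using hxy.left_mem, rfl⟩
      ⟨y, by simpa using hxy.right_mem, rfl⟩ (by
        rw [hFx, hFx]
        ext z
        exact ⟨fun h => (ReflTransGen.single ⟨e, hxy.symm⟩).trans h,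
          fun h => (ReflTransGen.single ⟨e, hxy⟩).trans h⟩)
    have h2 : ReflTransGen (G.deleteEdges {e}).Adj x y := by
      have : y ∈ {b | ReflTransGen (G.deleteEdges {e}).Adj y b} := .refl
      rw [← h1] at this
      exact this
    have h3 := key (ξ := χ) (fun d a b hab => by
      by_contra hne
      have hab' : G.IsLink d a b ∧ d ≠ e := by simpa using hab
      exact hab'.2 ((hχ hab'.1).1 hne)) h2
    exact (hχ hxy).2 rfl h3

/-! ### Explicit isomorphisms -/

/-- `H` is the image of `G` under a renaming of the vertices and of the edges. -/
structure IsImage (φ : α → α') (ψ : β → β') (G : Graph α β) (H : Graph α' β') : Prop where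
  injV : Set.InjOn φ G.vertexSet
  injE : Set.InjOn ψ G.edgeSet
  vert : H.vertexSet = φ '' G.vertexSet
  link : ∀ d x y, H.IsLink d x y ↔ ∃ e a b, G.IsLink e a b ∧ ψ e = d ∧ φ a = x ∧ φ b = y

/-- Renaming the vertices and edges. -/
def image (φ : α → α') (ψ : β → β') (G : Graph α β)
    (hψ : Set.InjOn ψ G.edgeSet) : Graph α' β' where
  vertexSet := φ '' G.vertexSet
  IsLink d x y := ∃ e a b, G.IsLink e a b ∧ ψ e = d ∧ φ a = x ∧ φ b = y
  isLink_symm := by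
    intro e _
    refine ⟨fun x y ⟨d, a, b, h, h1, h2, h3⟩ => ⟨d, b, a, h.symm, h1, h3, h2⟩⟩
  eq_or_eq_of_isLink_of_isLink := by
    rintro _ _ _ _ _ ⟨e, a, b, h, rfl, rfl, rfl⟩ ⟨e', a', b', h', he, rfl, rfl⟩
    obtain rfl := hψ h'.edge_mem h.edge_mem he
    rcases h.left_eq_or_eq h' with rfl | rfl <;> simp
  left_mem_of_isLink := by
    rintro _ _ _ ⟨e, a, b, h, rfl, rfl, rfl⟩
    exact ⟨a, h.left_mem, rfl⟩

theorem isImage_image {φ : α → α'} {ψ : β → β'} {G : Graph α β} (hφ : Set.InjOn φ G.vertexSet)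
    (hψ : Set.InjOn ψ G.edgeSet) : IsImage φ ψ G (G.image φ ψ hψ) :=
  ⟨hφ, hψ, rfl, fun _ _ _ => Iff.rfl⟩

namespace IsImage

variable {φ : α → α'} {ψ : β → β'} {G : Graph α β} {H : Graph α' β'}

theorem map_link (h : IsImage φ ψ G H) {e a b} (hl : G.IsLink e a b) :
    H.IsLink (ψ e) (φ a) (φ b) := (h.link _ _ _).2 ⟨e, a, b, hl, rfl, rfl, rfl⟩

theorem of_link (h : IsImage φ ψ G H) {e a b} (he : e ∈ G.edgeSet) (ha : a ∈ G.vertexSet)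
    (hb : b ∈ G.vertexSet) (hl : H.IsLink (ψ e) (φ a) (φ b)) : G.IsLink e a b := by
  obtain ⟨e', a', b', h1, h2, h3, h4⟩ := (h.link _ _ _).1 hl
  obtain rfl := h.injE h1.edge_mem he h2
  obtain rfl := h.injV h1.left_mem ha h3
  obtain rfl := h.injV h1.right_mem hb h4
  exact h1

theorem edge (h : IsImage φ ψ G H) : H.edgeSet = ψ '' G.edgeSet := by
  ext d
  rw [H.edge_mem_iff_exists_isLink]
  constructor
  · rintro ⟨x, y, hl⟩
    obtain ⟨e, a, b, h1, rfl, -, -⟩ := (h.link _ _ _).1 hl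
    exact ⟨e, h1.edge_mem, rfl⟩
  · rintro ⟨e, he, rfl⟩
    obtain ⟨x, y, hl⟩ := G.exists_isLink_of_mem_edgeSet he
    exact ⟨_, _, h.map_link hl⟩

theorem inc_iff (h : IsImage φ ψ G H) {e a} (he : e ∈ G.edgeSet) (ha : a ∈ G.vertexSet) :
    H.Inc (ψ e) (φ a) ↔ G.Inc e a := by
  constructor
  · rintro ⟨y, hy⟩
    obtain ⟨e', a', b', h1, h2, h3, h4⟩ := (h.link _ _ _).1 hy
    obtain rfl := h.injE h1.edge_mem he h2
    obtain rfl := h.injV h1.left_mem ha h3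
    exact ⟨_, h1⟩
  · rintro ⟨y, hy⟩
    exact ⟨_, h.map_link hy⟩

theorem degree_eq (h : IsImage φ ψ G H) {a} (ha : a ∈ G.vertexSet) :
    H.degree (φ a) = G.degree a := by
  have h1 : {d | H.Inc d (φ a)} = ψ '' {e | G.Inc e a} := by
    ext d
    constructor
    · intro hd
      have := Inc.edge_mem hd
      rw [h.edge] at this
      obtain ⟨e, he, rfl⟩ := this
      exact ⟨e, (h.inc_iff he ha).1 hd, rfl⟩
    · rintro ⟨e, he, rfl⟩
      exact (h.inc_iff (Inc.edge_mem he) ha).2 he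
  have h2 : {d | H.IsLoopAt d (φ a)} = ψ '' {e | G.IsLoopAt e a} := by
    ext d
    constructor
    · intro hd
      have := IsLoopAt.edge_mem hd
      rw [h.edge] at this
      obtain ⟨e, he, rfl⟩ := this
      exact ⟨e, h.of_link he ha ha hd, rfl⟩
    · rintro ⟨e, he, rfl⟩
      exact h.map_link he
  rw [degree, degree, h1, h2, Set.InjOn.ncard_image (s := {e | G.Inc e a}) (h.injE.mono fun e he => Inc.edge_mem he),
    Set.InjOn.ncard_image (s := {e | G.IsLoopAt e a})
      (h.injE.mono fun e he => IsLoopAt.edge_mem he)]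

theorem isFinite_iff (h : IsImage φ ψ G H) : H.IsFinite ↔ G.IsFinite := by
  rw [IsFinite, IsFinite, h.vert, h.edge, Set.finite_image_iff h.injV, Set.finite_image_iff h.injE]

theorem genus_eq (h : IsImage φ ψ G H) : H.genus = G.genus := by
  rw [genus, genus, h.vert, h.edge, h.injV.ncard_image, h.injE.ncard_image]

theorem symm [Nonempty α] [Nonempty β] (h : IsImage φ ψ G H) :
    IsImage (Function.invFunOn φ G.vertexSet) (Function.invFunOn ψ G.edgeSet) H G := by
  have hV : ∀ a ∈ G.vertexSet, Function.invFunOn φ G.vertexSet (φ a) = a :=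
    fun a ha => h.injV.leftInvOn_invFunOn ha
  have hE : ∀ a ∈ G.edgeSet, Function.invFunOn ψ G.edgeSet (ψ a) = a :=
    fun a ha => h.injE.leftInvOn_invFunOn ha
  refine ⟨?_, ?_, ?_, ?_⟩
  · rw [h.vert]
    rintro _ ⟨a, ha, rfl⟩ _ ⟨b, hb, rfl⟩ hab
    rw [hV a ha, hV b hb] at hab
    rw [hab]
  · rw [h.edge]
    rintro _ ⟨a, ha, rfl⟩ _ ⟨b, hb, rfl⟩ hab
    rw [hE a ha, hE b hb] at hab
    rw [hab]
  · rw [h.vert, Set.image_image]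
    ext a
    exact ⟨fun ha => ⟨a, ha, hV a ha⟩, by rintro ⟨b, hb, rfl⟩; simpa [hV b hb] using hb⟩
  · intro d x y
    constructor
    · intro hl
      exact ⟨_, _, _, h.map_link hl, hE _ hl.edge_mem, hV _ hl.left_mem, hV _ hl.right_mem⟩
    · rintro ⟨_, _, _, hl, rfl, rfl, rfl⟩
      obtain ⟨e, a, b, h1, rfl, rfl, rfl⟩ := (h.link _ _ _).1 hl
      rwa [hE _ h1.edge_mem, hV _ h1.left_mem, hV _ h1.right_mem]

theorem isIsomorphic (h : IsImage φ ψ G H) : G.IsIsomorphic H := by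
  refine ⟨(Equiv.Set.imageOfInjOn φ G.vertexSet h.injV).trans (Equiv.setCongr h.vert.symm), ?_⟩
  intro v w
  have : {d | H.IsLink d (φ v) (φ w)} = ψ '' {e | G.IsLink e v w} := by
    ext d
    constructor
    · intro hd
      have := IsLink.edge_mem hd
      rw [h.edge] at this
      obtain ⟨e, he, rfl⟩ := this
      exact ⟨e, h.of_link he v.2 w.2 hd, rfl⟩
    · rintro ⟨e, he, rfl⟩
      exact h.map_link he
  change _ = {d | H.IsLink d (φ v) (φ w)}.ncard
  rw [this, Set.InjOn.ncard_image (s := {e | G.IsLink e v w})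
    (h.injE.mono fun e he => IsLink.edge_mem he)]

theorem isCut (h : IsImage φ ψ G H) {e χ} (hc : H.IsCut (ψ e) χ) (he : e ∈ G.edgeSet) :
    G.IsCut e (χ ∘ φ) := by
  intro d x y hl
  have := hc (h.map_link hl)
  rw [Function.comp, Function.comp, this]
  exact ⟨fun h' => h.injE hl.edge_mem he h', fun h' => by rw [h']⟩

theorem isBridge_iff [Nonempty α] [Nonempty β] (h : IsImage φ ψ G H) (hG : G.IsFinite) {e}
    (he : e ∈ G.edgeSet) : H.IsBridge (ψ e) ↔ G.IsBridge e := by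
  have hE : Function.invFunOn ψ G.edgeSet (ψ e) = e := h.injE.leftInvOn_invFunOn he
  rw [Graph.isBridge_iff hG, Graph.isBridge_iff (h.isFinite_iff.2 hG)]
  have he' : ψ e ∈ H.edgeSet := by rw [h.edge]; exact ⟨e, he, rfl⟩
  constructor
  · rintro ⟨-, χ, hχ⟩
    exact ⟨he, _, h.isCut hχ he⟩
  · rintro ⟨-, χ, hχ⟩
    refine ⟨he', _, h.symm.isCut (χ := χ) ?_ he'⟩
    rwa [hE]

theorem isConnected (h : IsImage φ ψ G H) (hG : G.IsConnected) : H.IsConnected := by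
  rw [isConnected_iff] at hG ⊢
  refine ⟨by rw [h.vert]; exact hG.1.image _, fun ξ hξ => ?_⟩
  rw [h.vert]
  rintro _ ⟨a, ha, rfl⟩ _ ⟨b, hb, rfl⟩
  exact hG.2 (ξ ∘ φ) (fun d x y hl => hξ _ _ _ (h.map_link hl)) a ha b hb

theorem isTwoEdgeConnected [Nonempty α] [Nonempty β] (h : IsImage φ ψ G H) (hf : G.IsFinite)
    (hG : G.IsTwoEdgeConnected) : H.IsTwoEdgeConnected := by
  refine ⟨h.isConnected hG.1, fun d hd => ?_⟩
  have := hd.1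
  rw [h.edge] at this
  obtain ⟨e, he, rfl⟩ := this
  exact hG.2 e ((h.isBridge_iff hf he).1 hd)

end IsImage

/-- The edges whose set of end vertices is `z`. -/
def linkSet (G : Graph α β) (z : Sym2 α) : Set β := {e | ∃ a b, z = s(a, b) ∧ G.IsLink e a b}

theorem mem_linkSet {e : β} {a b : α} : e ∈ G.linkSet s(a, b) ↔ G.IsLink e a b := by
  constructor
  · rintro ⟨x, y, h, hl⟩
    rw [Sym2.eq_iff] at h
    rcases h with ⟨rfl, rfl⟩ | ⟨rfl, rfl⟩
    · exact hl
    · exact hl.symm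
  · intro h
    exact ⟨a, b, rfl, h⟩

/-- An isomorphism is only a vertex bijection that preserves numbers of edges. Finiteness allows one
to choose, for each unordered pair of vertices, a bijection between the edges joining them and the
edges joining their images; together these form an edge map. -/
theorem IsIsomorphic.exists_isImage [Nonempty α'] [Nonempty β'] {G : Graph α β}
    {H : Graph α' β'} (h : G.IsIsomorphic H) (hG : G.IsFinite) (hH : H.IsFinite) :
    ∃ φ ψ, IsImage φ ψ G H := by
  classical
  obtain ⟨Φ, hΦ⟩ := h
  set φ : α → α' := fun a => if ha : a ∈ G.vertexSet then Φ ⟨a, ha⟩ else Classical.arbitrary α'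
    with hφ
  have hφV : ∀ a (ha : a ∈ G.vertexSet), φ a = Φ ⟨a, ha⟩ := fun a ha => by simp [hφ, ha]
  have hinj : Set.InjOn φ G.vertexSet := by
    intro a ha b hb hab
    rw [hφV a ha, hφV b hb] at hab
    simpa using Φ.injective (Subtype.ext hab)
  have hvert : H.vertexSet = φ '' G.vertexSet := by
    ext x
    constructor
    · intro hx
      refine ⟨Φ.symm ⟨x, hx⟩, (Φ.symm ⟨x, hx⟩).2, ?_⟩
      rw [hφV _ (Φ.symm ⟨x, hx⟩).2]
      simp
    · rintro ⟨a, ha, rfl⟩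
      rw [hφV a ha]
      exact (Φ ⟨a, ha⟩).2
  have hbij : ∀ z : Sym2 α, ∃ f : β → β', (∀ a ∈ z, a ∈ G.vertexSet) →
      Set.BijOn f (G.linkSet z) (H.linkSet (z.map φ)) := by
    intro z
    induction z with | _ a b
    by_cases hab : a ∈ G.vertexSet ∧ b ∈ G.vertexSet
    · have hc : (G.linkSet s(a, b)).ncard = (H.linkSet (s(a, b).map φ)).ncard := by
        have e1 : G.linkSet s(a, b) = {e | G.IsLink e a b} := by ext e; exact mem_linkSet
        have e2 : H.linkSet s(φ a, φ b) = {e | H.IsLink e (φ a) (φ b)} := by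
          ext e; exact mem_linkSet
        rw [Sym2.map_mk, e1, e2]
        have := hΦ ⟨a, hab.1⟩ ⟨b, hab.2⟩
        rw [← hφV, ← hφV] at this
        exact this
      have hf1 : (G.linkSet s(a, b)).Finite :=
        hG.2.subset fun e ⟨x, y, _, hl⟩ => hl.edge_mem
      have hf2 : (H.linkSet (s(a, b).map φ)).Finite :=
        hH.2.subset fun e ⟨x, y, _, hl⟩ => hl.edge_mem
      obtain ⟨f, hf⟩ := hf1.exists_bijOn_of_encard_eq
        (t := H.linkSet (s(a, b).map φ)) (by rw [← hf1.cast_ncard_eq, ← hf2.cast_ncard_eq, hc])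
      exact ⟨f, fun _ => hf⟩
    · refine ⟨fun _ => Classical.arbitrary β', fun h => absurd ⟨h a ?_, h b ?_⟩ hab⟩ <;> simp
  choose f hf using hbij
  have hψ : ∀ e, ∃ d, ∀ a b, G.IsLink e a b → d = f s(a, b) e := by
    intro e
    by_cases he : e ∈ G.edgeSet
    · obtain ⟨a, b, hab⟩ := G.exists_isLink_of_mem_edgeSet he
      refine ⟨f s(a, b) e, fun a' b' hab' => ?_⟩
      rw [(hab.isLink_iff_sym2_eq).1 hab']
    · exact ⟨Classical.arbitrary _, fun a b hab => absurd hab.edge_mem he⟩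
  choose ψ hψ using hψ
  have hfz : ∀ {e a b}, G.IsLink e a b →
      Set.BijOn (f s(a, b)) (G.linkSet s(a, b)) (H.linkSet s(φ a, φ b)) := by
    intro e a b hab
    refine hf s(a, b) fun c hc => ?_
    rcases Sym2.mem_iff.1 hc with rfl | rfl
    · exact hab.left_mem
    · exact hab.right_mem
  have hmap : ∀ {e a b}, G.IsLink e a b → H.IsLink (ψ e) (φ a) (φ b) := by
    intro e a b hab
    rw [hψ e a b hab, ← mem_linkSet]
    exact (hfz hab).mapsTo (mem_linkSet.2 hab)
  refine ⟨φ, ψ, hinj, ?_, hvert, ?_⟩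
  · intro e he e' he' hee
    obtain ⟨a, b, hab⟩ := G.exists_isLink_of_mem_edgeSet he
    obtain ⟨a', b', hab'⟩ := G.exists_isLink_of_mem_edgeSet he'
    have h1 := hmap hab
    have h2 := hmap hab'
    rw [hee] at h1
    have h3 : G.IsLink e' a b := by
      rcases h1.eq_and_eq_or_eq_and_eq h2 with ⟨h4, h5⟩ | ⟨h4, h5⟩
      · rwa [hinj hab.left_mem hab'.left_mem h4, hinj hab.right_mem hab'.right_mem h5]
      · rw [hinj hab.left_mem hab'.right_mem h4, hinj hab.right_mem hab'.left_mem h5]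
        exact hab'.symm
    rw [hψ e a b hab, hψ e' a b h3] at hee
    exact (hfz hab).injOn (mem_linkSet.2 hab) (mem_linkSet.2 h3) hee
  · intro d x y
    constructor
    · intro hd
      have hx := hd.left_mem
      have hy := hd.right_mem
      rw [hvert] at hx hy
      obtain ⟨a, ha, rfl⟩ := hx
      obtain ⟨b, hb, rfl⟩ := hy
      have hz : Set.BijOn (f s(a, b)) (G.linkSet s(a, b)) (H.linkSet s(φ a, φ b)) := by
        refine hf s(a, b) fun c hc => ?_
        rcases Sym2.mem_iff.1 hc with rfl | rfl <;> assumption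
      obtain ⟨e, he, rfl⟩ := hz.surjOn (mem_linkSet.2 hd)
      exact ⟨e, a, b, mem_linkSet.1 he, hψ e a b (mem_linkSet.1 he), rfl, rfl⟩
    · rintro ⟨e, a, b, h, rfl, rfl, rfl⟩
      exact hmap h

end Graph

/-! ### Vertices of low degree -/

namespace Graph

variable {α β : Type*} {G G' C S : Graph α β}

theorem IsFinite.inc_finite (hG : G.IsFinite) (v : α) : {e | G.Inc e v}.Finite :=
  hG.2.subset fun _ he => Inc.edge_mem he

theorem IsFinite.loop_finite (hG : G.IsFinite) (v : α) : {e | G.IsLoopAt e v}.Finite :=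
  hG.2.subset fun _ he => IsLoopAt.edge_mem he

theorem loop_ncard_le (hG : G.IsFinite) (v : α) :
    {e | G.IsLoopAt e v}.ncard ≤ {e | G.Inc e v}.ncard :=
  Set.ncard_le_ncard (fun _ he => IsLoopAt.inc he) (hG.inc_finite v)

theorem exists_of_degree_eq_one (hG : G.IsFinite) {v : α} (h : G.degree v = 1) :
    ∃ e y, y ≠ v ∧ G.IsLink e v y ∧ ∀ d, G.Inc d v → d = e := by
  have h1 := loop_ncard_le hG v
  rw [degree] at h
  have h2 : {e | G.Inc e v}.ncard = 1 := by omega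
  have h3 : {e | G.IsLoopAt e v}.ncard = 0 := by omega
  obtain ⟨e, he⟩ := Set.ncard_eq_one.1 h2
  rw [Set.ncard_eq_zero (hG.loop_finite v)] at h3
  have he' : e ∈ {e | G.Inc e v} := by rw [he]; rfl
  obtain ⟨y, hy⟩ := he'
  refine ⟨e, y, ?_, hy, fun d hd => ?_⟩
  · rintro rfl
    have : e ∈ {e | G.IsLoopAt e y} := hy
    rw [h3] at this
    exact this
  · have : d ∈ {e | G.Inc e v} := hd
    rw [he] at this
    exact this

/-- An isolated vertex of a connected graph is the whole graph. This excludes that a curve of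
nonzero genus is retracted to a point. -/
theorem genus_eq_zero_of_degree_eq_zero (hG : G.IsFinite) (hc : G.IsConnected) {v : α}
    (hv : v ∈ G.vertexSet) (h : G.degree v = 0) : G.genus = 0 := by
  classical
  have h1 : {e | G.Inc e v} = ∅ := by
    rw [← Set.ncard_eq_zero (hG.inc_finite v)]
    rw [degree] at h
    omega
  have h2 : ∀ e, ¬ G.Inc e v := fun e he => by
    have : e ∈ {e | G.Inc e v} := he
    rw [h1] at this
    exact this
  have hV : G.vertexSet = {v} := by
    ext w
    refine ⟨fun hw => ?_, fun hw => by rwa [Set.mem_singleton_iff.1 hw]⟩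
    have := (isConnected_iff.1 hc).2 (fun z => decide (z = v)) (fun d x y hl => by
      have hx : x ≠ v := fun hx => h2 d (hx ▸ hl.inc_left)
      have hy : y ≠ v := fun hx => h2 d (hx ▸ hl.inc_right)
      simp [hx, hy]) v hv w hw
    simpa using this.symm
  have hE : G.edgeSet = ∅ := by
    ext e
    refine ⟨fun he => ?_, fun he => he.elim⟩
    obtain ⟨x, y, hl⟩ := G.exists_isLink_of_mem_edgeSet he
    have hx := hl.left_mem
    rw [hV] at hx
    exact (h2 e (Set.mem_singleton_iff.1 hx ▸ hl.inc_left)).elim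
  simp [genus, hV, hE]

/-! ### Retracting leaves -/

namespace RetractsLeaf

theorem exists_leaf (h : RetractsLeaf G G') (hG : G.IsFinite) : ∃ v e y, v ∈ G.vertexSet ∧
    G.degree v = 1 ∧ G' = G.deleteVerts {v} ∧ y ≠ v ∧ G.IsLink e v y ∧ ∀ d, G.Inc d v → d = e := by
  obtain ⟨v, hv, hd, rfl⟩ := h
  obtain ⟨e, y, h1⟩ := exists_of_degree_eq_one hG hd
  exact ⟨v, e, y, hv, hd, rfl, h1⟩

theorem isFinite (h : RetractsLeaf G G') (hG : G.IsFinite) : G'.IsFinite := by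
  obtain ⟨v, hv, -, rfl⟩ := h
  refine ⟨hG.1.subset (by simp), hG.2.subset ?_⟩
  intro e he
  obtain ⟨x, y, hl⟩ := Graph.exists_isLink_of_mem_edgeSet he
  exact ((deleteVerts_isLink _ _).1 hl).1.edge_mem

theorem isConnected (h : RetractsLeaf G G') (hG : G.IsFinite) (hc : G.IsConnected) :
    G'.IsConnected := by
  classical
  obtain ⟨v, e, y, hv, -, rfl, hy, hl, hu⟩ := h.exists_leaf hG
  rw [isConnected_iff] at hc ⊢
  refine ⟨⟨y, by simp [hl.right_mem, hy]⟩, fun ξ hξ a ha b hb => ?_⟩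
  have := hc.2 (fun z => if z = v then ξ y else ξ z) (fun d p q hpq => by
    by_cases hp : p = v
    · subst hp
      obtain rfl := hu d hpq.inc_left
      rw [hpq.right_unique hl]
      simp [hy]
    · by_cases hq : q = v
      · subst hq
        obtain rfl := hu d hpq.inc_right
        rw [hpq.symm.right_unique hl]
        simp [hy]
      · simpa [hp, hq] using hξ d p q (by simp [hpq, hp, hq])) a (by simp at ha; exact ha.1) b
      (by simp at hb; exact hb.1)
  have h1 : a ≠ v := by simp at ha; exact ha.2
  have h2 : b ≠ v := by simp at hb; exact hb.2
  simpa [h1, h2] using this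

theorem genus_eq (h : RetractsLeaf G G') (hG : G.IsFinite) : G'.genus = G.genus := by
  obtain ⟨v, e, y, hv, -, rfl, hy, hl, hu⟩ := h.exists_leaf hG
  have hE : (G.deleteVerts {v}).edgeSet = G.edgeSet \ {e} := by
    ext d
    simp only [edgeSet_deleteVerts, Set.mem_ofPred_eq, Set.mem_sdiff, Set.mem_singleton_iff]
    constructor
    · rintro ⟨a, b, hab, ha, hb⟩
      refine ⟨hab.edge_mem, ?_⟩
      rintro rfl
      rcases hab.eq_and_eq_or_eq_and_eq hl with ⟨h1, -⟩ | ⟨-, h1⟩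
      · exact ha h1
      · exact hb h1
    · rintro ⟨hd, hde⟩
      obtain ⟨a, b, hab⟩ := G.exists_isLink_of_mem_edgeSet hd
      refine ⟨a, b, hab, ?_, ?_⟩
      · rintro rfl; exact hde (hu _ hab.inc_left)
      · rintro rfl; exact hde (hu _ hab.inc_right)
  rw [genus, genus, hE, vertexSet_deleteVerts]
  have h1 := Set.ncard_sdiff_singleton_add_one hl.edge_mem hG.2
  have h2 := Set.ncard_sdiff_singleton_add_one hv hG.1
  omega

/-- The leaf takes the colour of its neighbour. -/
theorem exists_isCut (h : RetractsLeaf G G') (hG : G.IsFinite) {b : β} {χ : α → Bool}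
    (hb : b ∈ G'.edgeSet) (hχ : G'.IsCut b χ) : ∃ χ', G.IsCut b χ' := by
  classical
  obtain ⟨v, e, y, hv, -, rfl, hy, hl, hu⟩ := h.exists_leaf hG
  have hbe : b ≠ e := by
    rintro rfl
    obtain ⟨p, q, hpq⟩ := Graph.exists_isLink_of_mem_edgeSet hb
    rw [deleteVerts_isLink] at hpq
    rcases hl.left_eq_or_eq hpq.1 with h | h
    · exact hpq.2.1 h.symm
    · exact hpq.2.2 h.symm
  refine ⟨fun z => if z = v then χ y else χ z, fun d p q hpq => ?_⟩
  by_cases hp : p = v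
  · subst hp
    obtain rfl := hu d hpq.inc_left
    rw [hpq.right_unique hl]
    simp [hy, hbe.symm]
  · by_cases hq : q = v
    · subst hq
      obtain rfl := hu d hpq.inc_right
      rw [hpq.symm.right_unique hl]
      simp [hy, hbe.symm]
    · simpa [hp, hq] using hχ (x := p) (y := q) (d := d) (by simp [hpq, hp, hq])

theorem inc_of_inc (h : RetractsLeaf G G') {d x} (hd : G'.Inc d x) : G.Inc d x := by
  obtain ⟨v, hv, -, rfl⟩ := h
  obtain ⟨y, hy⟩ := hd
  exact ⟨y, ((deleteVerts_isLink _ _).1 hy).1⟩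

theorem degree_le (h : RetractsLeaf G G') (hG : G.IsFinite) (x : α) :
    G'.degree x ≤ G.degree x := by
  refine add_le_add (Set.ncard_le_ncard (fun d hd => h.inc_of_inc hd) (hG.inc_finite x))
    (Set.ncard_le_ncard (fun d hd => ?_) (hG.loop_finite x))
  obtain ⟨v, hv, -, rfl⟩ := h
  exact ((deleteVerts_isLink _ _).1 hd).1

theorem degree_lt (h : RetractsLeaf G G') (hG : G.IsFinite) {d : β} {x : α} (hd : G.Inc d x)
    (hd' : ¬ G'.Inc d x) : G'.degree x < G.degree x := by
  refine add_lt_add_of_lt_of_le (Set.ncard_lt_ncard ⟨fun d hd => h.inc_of_inc hd, fun hs =>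
    hd' (hs hd)⟩ (hG.inc_finite x)) (Set.ncard_le_ncard (fun d hd => ?_) (hG.loop_finite x))
  obtain ⟨v, hv, -, rfl⟩ := h
  exact ((deleteVerts_isLink _ _).1 hd).1

theorem link_iff (h : RetractsLeaf G G') {d x y} :
    G'.IsLink d x y ↔ G.IsLink d x y ∧ x ∈ G'.vertexSet ∧ y ∈ G'.vertexSet := by
  obtain ⟨v, hv, -, rfl⟩ := h
  rw [deleteVerts_isLink]
  constructor
  · rintro ⟨h1, h2, h3⟩
    exact ⟨h1, by simpa [h1.left_mem] using h2, by simpa [h1.right_mem] using h3⟩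
  · rintro ⟨h1, h2, h3⟩
    simp at h2 h3
    exact ⟨h1, h2.2, h3.2⟩

theorem vertexSet_subset (h : RetractsLeaf G G') : G'.vertexSet ⊆ G.vertexSet := by
  obtain ⟨v, hv, -, rfl⟩ := h
  simp

end RetractsLeaf

/-- Repeated retraction of leaves: what is preserved. -/
structure IsRetract (C C' : Graph α β) : Prop where
  isFinite : C'.IsFinite
  isConnected : C.IsConnected → C'.IsConnected
  genus_eq : C'.genus = C.genus
  exists_isCut : ∀ b ∈ C'.edgeSet, (∃ χ, C'.IsCut b χ) → ∃ χ, C.IsCut b χ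
  degree_le : ∀ x, C'.degree x ≤ C.degree x
  link_iff : ∀ d x y, C'.IsLink d x y ↔ C.IsLink d x y ∧ x ∈ C'.vertexSet ∧ y ∈ C'.vertexSet
  subset : C'.vertexSet ⊆ C.vertexSet

theorem isRetract_of_reflTransGen (hC : C.IsFinite) {C' : Graph α β}
    (h : ReflTransGen RetractsLeaf C C') : IsRetract C C' := by
  induction h with
  | refl =>
    exact ⟨hC, id, rfl, fun _ _ h => h, fun _ => le_rfl,
      fun d x y => ⟨fun h => ⟨h, h.left_mem, h.right_mem⟩, fun h => h.1⟩, subset_rfl⟩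
  | tail _ hs ih =>
    refine ⟨hs.isFinite ih.isFinite, fun h => hs.isConnected ih.isFinite (ih.isConnected h),
      (hs.genus_eq ih.isFinite).trans ih.genus_eq, ?_,
      fun x => (hs.degree_le ih.isFinite x).trans (ih.degree_le x), ?_,
      hs.vertexSet_subset.trans ih.subset⟩
    · rintro b hb ⟨χ, hχ⟩
      refine ih.exists_isCut b ?_ (hs.exists_isCut ih.isFinite hb hχ)
      obtain ⟨x, y, hl⟩ := Graph.exists_isLink_of_mem_edgeSet hb
      exact (hs.link_iff.1 hl).1.edge_mem
    · intro d x y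
      rw [hs.link_iff, ih.link_iff]
      exact ⟨fun h => ⟨h.1.1, h.2⟩, fun h => ⟨⟨h.1, hs.vertexSet_subset h.2.1,
        hs.vertexSet_subset h.2.2⟩, h.2⟩⟩

theorem IsRetract.isCut {C C' : Graph α β} (h : IsRetract C C') {e χ} (hχ : C.IsCut e χ) :
    C'.IsCut e χ := fun _ _ _ hl => hχ ((h.link_iff _ _ _).1 hl).1

/-- A set of vertices each of which has two edges within the set survives retraction. -/
theorem subset_of_reflTransGen (hC : C.IsFinite) {C' : Graph α β}
    (h : ReflTransGen RetractsLeaf C C') {X : Set α} (hX : X ⊆ C.vertexSet)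
    (h2 : ∀ x ∈ X, ∃ d d' y y', d ≠ d' ∧ y ∈ X ∧ y' ∈ X ∧ C.IsLink d x y ∧ C.IsLink d' x y') :
    X ⊆ C'.vertexSet := by
  induction h with
  | refl => exact hX
  | tail hp hs ih =>
    have hr := isRetract_of_reflTransGen hC hp
    obtain ⟨v, e, y, hv, -, rfl, hy, hl, hu⟩ := hs.exists_leaf hr.isFinite
    intro x hx
    simp only [vertexSet_deleteVerts, Set.mem_sdiff, Set.mem_singleton_iff]
    refine ⟨ih hx, ?_⟩
    rintro rfl
    -- A removed leaf in `X` would still have both of its edges to `X`, but a leaf has only one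
    -- edge.
    obtain ⟨d, d', y, y', hne, hy, hy', h1, h2⟩ := h2 x hx
    have h3 := (hr.link_iff d x y).2 ⟨h1, ih hx, ih hy⟩
    have h4 := (hr.link_iff d' x y').2 ⟨h2, ih hx, ih hy'⟩
    exact hne ((hu _ h3.inc_left).trans (hu _ h4.inc_left).symm)

/-! ### Smoothing -/

/-- The data of a smoothing step. -/
structure SmoothStep (G G' : Graph α β) (v x y : α) (e f : β) : Prop where
  degree : G.degree v = 2
  ne : e ≠ f
  xv : x ≠ v
  yv : y ≠ v
  le : G.IsLink e v x
  lf : G.IsLink f v y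
  vert : G'.vertexSet = G.vertexSet \ {v}
  link : ∀ d a b, G'.IsLink d a b ↔
      (d = e ∧ s(a, b) = s(x, y)) ∨ (d ≠ e ∧ d ≠ f ∧ G.IsLink d a b)

theorem SmoothsVertex.exists_smoothStep (h : SmoothsVertex G G') :
    ∃ v x y e f, SmoothStep G G' v x y e f := by
  obtain ⟨v, x, y, e, f, h1, h2, h3, h4, h5, h6, h7, h8⟩ := h
  exact ⟨v, x, y, e, f, h1, h2, h3, h4, h5, h6, h7, h8⟩

theorem SmoothStep.smoothsVertex {v x y e f} (h : SmoothStep G G' v x y e f) :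
    SmoothsVertex G G' := ⟨v, x, y, e, f, h.1, h.2, h.3, h.4, h.5, h.6, h.7, h.8⟩

namespace SmoothStep

variable {v x y : α} {e f : β}

theorem inc_v (h : SmoothStep G G' v x y e f) (hG : G.IsFinite) {d} (hd : G.Inc d v) :
    d = e ∨ d = f := by
  have h1 : ({e, f} : Set β) ⊆ {d | G.Inc d v} := by
    rintro _ (rfl | rfl)
    · exact h.le.inc_left
    · exact h.lf.inc_left
  have h2 : {d | G.Inc d v}.ncard ≤ ({e, f} : Set β).ncard := by
    rw [Set.ncard_pair h.ne]
    have := h.degree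
    rw [Graph.degree] at this
    omega
  have := Set.eq_of_subset_of_ncard_le h1 h2 (hG.inc_finite v)
  have hd' : d ∈ {d | G.Inc d v} := hd
  rw [← this] at hd'
  exact hd'

theorem link_e (h : SmoothStep G G' v x y e f) : G'.IsLink e x y :=
  (h.link _ _ _).2 (Or.inl ⟨rfl, rfl⟩)

theorem edge (h : SmoothStep G G' v x y e f) : G'.edgeSet = G.edgeSet \ {f} := by
  ext d
  simp only [Set.mem_sdiff, Set.mem_singleton_iff]
  constructor
  · intro hd
    obtain ⟨a, b, hl⟩ := Graph.exists_isLink_of_mem_edgeSet hd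
    rcases (h.link _ _ _).1 hl with ⟨rfl, -⟩ | ⟨-, h2, h3⟩
    · exact ⟨h.le.edge_mem, h.ne⟩
    · exact ⟨h3.edge_mem, h2⟩
  · rintro ⟨hd, hdf⟩
    obtain ⟨a, b, hl⟩ := Graph.exists_isLink_of_mem_edgeSet hd
    by_cases hde : d = e
    · subst hde
      exact h.link_e.edge_mem
    · exact ((h.link _ _ _).2 (Or.inr ⟨hde, hdf, hl⟩)).edge_mem

theorem isFinite (h : SmoothStep G G' v x y e f) (hG : G.IsFinite) : G'.IsFinite := by
  refine ⟨?_, ?_⟩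
  · rw [h.vert]; exact hG.1.subset Set.sdiff_subset
  · rw [h.edge]; exact hG.2.subset Set.sdiff_subset

theorem genus_eq (h : SmoothStep G G' v x y e f) (hG : G.IsFinite) : G'.genus = G.genus := by
  rw [genus, genus, h.vert, h.edge]
  have h1 := Set.ncard_sdiff_singleton_add_one h.lf.edge_mem hG.2
  have h2 := Set.ncard_sdiff_singleton_add_one h.le.left_mem hG.1
  omega

theorem link_of_ne (h : SmoothStep G G' v x y e f) {d a b}
    (hl : G.IsLink d a b) (ha : a ≠ v) (hb : b ≠ v) : d ≠ e ∧ d ≠ f ∧ G'.IsLink d a b := by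
  have h1 : d ≠ e := by
    rintro rfl
    rcases hl.eq_and_eq_or_eq_and_eq h.le with ⟨h1, -⟩ | ⟨-, h1⟩
    · exact ha h1
    · exact hb h1
  have h2 : d ≠ f := by
    rintro rfl
    rcases hl.eq_and_eq_or_eq_and_eq h.lf with ⟨h1, -⟩ | ⟨-, h1⟩
    · exact ha h1
    · exact hb h1
  exact ⟨h1, h2, (h.link _ _ _).2 (Or.inr ⟨h1, h2, hl⟩)⟩

theorem isConnected (h : SmoothStep G G' v x y e f) (hG : G.IsFinite) (hc : G.IsConnected) :
    G'.IsConnected := by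
  classical
  rw [isConnected_iff] at hc ⊢
  refine ⟨⟨x, by rw [h.vert]; exact ⟨h.le.right_mem, h.xv⟩⟩, fun ξ hξ a ha b hb => ?_⟩
  rw [h.vert] at ha hb
  have hxy : ξ x = ξ y := hξ _ _ _ h.link_e
  have hv : ∀ d q, G.IsLink d v q → q ≠ v ∧ ξ q = ξ y := by
    intro d q hd
    rcases h.inc_v hG hd.inc_left with rfl | rfl
    · rw [hd.right_unique h.le]; exact ⟨h.xv, hxy⟩
    · rw [hd.right_unique h.lf]; exact ⟨h.yv, rfl⟩
  have := hc.2 (fun z => if z = v then ξ y else ξ z) (fun d p q hpq => by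
    by_cases hp : p = v
    · subst hp
      have := hv d q hpq
      simp [this.1, this.2]
    · by_cases hq : q = v
      · subst hq
        have := hv d p hpq.symm
        simp [this.1, this.2]
      · simpa [hp, hq] using hξ d p q (h.link_of_ne hpq hp hq).2.2) a ha.1 b hb.1
  have h1 : a ≠ v := ha.2
  have h2 : b ≠ v := hb.2
  simpa [h1, h2] using this

/-- The removed vertex takes the colour of `y`. Then `f` is monochromatic, and `e` changes colour
exactly if the merged edge does. -/
theorem exists_isCut (h : SmoothStep G G' v x y e f) (hG : G.IsFinite) {b : β} {χ : α → Bool}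
    (hb : b ∈ G'.edgeSet) (hχ : G'.IsCut b χ) : ∃ χ', G.IsCut b χ' := by
  classical
  rw [h.edge] at hb
  have hbf : b ≠ f := hb.2
  have hxy : χ x ≠ χ y ↔ e = b := hχ h.link_e
  have hv : ∀ d q, G.IsLink d v q → q ≠ v ∧ (χ q ≠ χ y ↔ d = b) := by
    intro d q hd
    rcases h.inc_v hG hd.inc_left with rfl | rfl
    · rw [hd.right_unique h.le]; exact ⟨h.xv, hxy⟩
    · rw [hd.right_unique h.lf]; exact ⟨h.yv, by simp [hbf.symm]⟩
  refine ⟨fun z => if z = v then χ y else χ z, fun d p q hpq => ?_⟩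
  by_cases hp : p = v
  · subst hp
    have := hv d q hpq
    simp only [this.1, ite_true, ite_false]
    rw [← this.2, ne_comm]
  · by_cases hq : q = v
    · subst hq
      have := hv d p hpq.symm
      simp only [this.1, ite_true, ite_false]
      rw [← this.2]
    · simpa [hp, hq] using hχ (h.link_of_ne hpq hp hq).2.2

-- A cut at `f` becomes a cut at the merged edge, which bears the name `e`.
open Classical in
theorem isCut (h : SmoothStep G G' v x y e f) {b : β} {χ : α → Bool}
    (hχ : G.IsCut b χ) : G'.IsCut (if b = f then e else b) χ := by
  intro d p q hpq
  rcases (h.link _ _ _).1 hpq with ⟨rfl, hs⟩ | ⟨h1, h2, h3⟩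
  · have h1 := hχ h.le
    have h2 := hχ h.lf
    have h3 : χ p ≠ χ q ↔ χ x ≠ χ y := by
      rcases Sym2.eq_iff.1 hs with ⟨rfl, rfl⟩ | ⟨rfl, rfl⟩
      · rfl
      · exact ne_comm
    rw [h3]
    have hne := h.ne
    by_cases hb : b = f
    · subst hb
      simp only [ite_true, iff_true]
      have := h2.2 rfl
      have h4 := (not_congr h1).2 hne
      cases hx : χ x <;> cases hy : χ y <;> cases hz : χ v <;> simp_all
    · have h5 := (not_congr h2).2 (Ne.symm hb)
      simp only [hb, ite_false]
      rw [← h1]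
      push Not at h5
      rw [← h5, ne_comm]
  · rw [hχ h3]
    split_ifs with hb
    · subst hb; simp [h1, h2]
    · rfl

theorem degree_eq (h : SmoothStep G G' v x y e f) (hG : G.IsFinite) {u : α} (hu : u ≠ v) :
    G'.degree u = G.degree u := by
  classical
  set A := {d | d ≠ e ∧ d ≠ f ∧ G.Inc d u} with hA
  set L := {d | d ≠ e ∧ d ≠ f ∧ G.IsLoopAt d u} with hL
  have hAf : A.Finite := (hG.inc_finite u).subset fun d hd => hd.2.2
  have hLf : L.Finite := (hG.loop_finite u).subset fun d hd => hd.2.2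
  have heA : e ∉ A := fun h => h.1 rfl
  have hfA : f ∉ A := fun h => h.2.1 rfl
  have heL : e ∉ L := fun h => h.1 rfl
  have e1 : G.Inc e u ↔ u = x := by
    constructor
    · exact fun h' => (h'.eq_or_eq_of_isLink h.le).resolve_left hu
    · rintro rfl; exact h.le.inc_right
  have e2 : G.Inc f u ↔ u = y := by
    constructor
    · exact fun h' => (h'.eq_or_eq_of_isLink h.lf).resolve_left hu
    · rintro rfl; exact h.lf.inc_right
  have e3 : G'.Inc e u ↔ u = x ∨ u = y := by
    constructor
    · exact fun h' => h'.eq_or_eq_of_isLink h.link_e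
    · rintro (rfl | rfl)
      · exact h.link_e.inc_left
      · exact h.link_e.inc_right
  have e4 : G'.IsLoopAt e u ↔ u = x ∧ u = y := by
    constructor
    · intro h'
      exact ⟨h'.eq_of_inc h.link_e.inc_left, h'.eq_of_inc h.link_e.inc_right⟩
    · rintro ⟨rfl, rfl⟩; exact h.link_e
  have e5 : ¬ G.IsLoopAt e u := fun h' => hu (h'.eq_of_inc h.le.inc_left)
  have e6 : ¬ G.IsLoopAt f u := fun h' => hu (h'.eq_of_inc h.lf.inc_left)
  have e7 : ¬ G'.Inc f u := fun h' => by
    have := h'.edge_mem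
    rw [h.edge] at this
    exact this.2 rfl
  have e8 : ∀ d, d ≠ e → d ≠ f → (G'.Inc d u ↔ G.Inc d u) := by
    intro d h1 h2
    simp [Inc, h.link, h1, h2]
  have e9 : ∀ d, d ≠ e → d ≠ f → (G'.IsLoopAt d u ↔ G.IsLoopAt d u) := by
    intro d h1 h2
    simp [← isLink_self_iff, h.link, h1, h2]
  have hloopG : {d | G.IsLoopAt d u} = L := by
    ext d
    by_cases h1 : d = e
    · subst h1; simp [hL, e5]
    · by_cases h2 : d = f
      · subst h2; simp [hL, e6]
      · simp [hL, h1, h2]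
  have hloopG' : {d | G'.IsLoopAt d u} = if u = x ∧ u = y then insert e L else L := by
    ext d
    by_cases h1 : d = e
    · subst h1
      by_cases hxy : u = x ∧ u = y
      · simp only [Set.mem_ofPred_eq, e4]; simp [hxy.1.symm, hxy.2.symm]
      · rw [if_neg hxy]; simp only [Set.mem_ofPred_eq, e4]; simp [hL, hxy]
    · by_cases h2 : d = f
      · subst h2
        have : ¬ G'.IsLoopAt d u := fun h' => e7 h'.inc
        split_ifs <;> simp [hL, this, h1]
      · split_ifs <;> simp [hL, h1, h2, e9]
  have hef := h.ne
  have hincG : {d | G.Inc d u} = (if u = x then {e} else ∅) ∪ ((if u = y then {f} else ∅) ∪ A) := by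
    ext d
    by_cases h1 : d = e
    · subst h1; split_ifs <;> simp_all
    · by_cases h2 : d = f
      · subst h2; split_ifs <;> simp_all
      · split_ifs <;> simp [hA, h1, h2]
  have hincG' : {d | G'.Inc d u} = if u = x ∨ u = y then insert e A else A := by
    ext d
    by_cases h1 : d = e
    · subst h1; split_ifs <;> simp_all
    · by_cases h2 : d = f
      · subst h2; split_ifs <;> simp_all
      · split_ifs <;> simp [hA, h1, h2, e8]
  rw [Graph.degree, Graph.degree, hloopG, hloopG', hincG, hincG']
  have c1 := Set.ncard_insert_of_notMem heA hAf
  have c2 := Set.ncard_insert_of_notMem hfA hAf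
  have c3 := Set.ncard_insert_of_notMem heL hLf
  have c4 := Set.ncard_insert_of_notMem (a := e) (s := insert f A)
    (by simp [h.ne, heA]) (hAf.insert f)
  -- If `u = x = y`, the two edges `e` and `f` at `u` turn into one loop, which counts twice.
  by_cases hx : u = x <;> by_cases hy : u = y <;> simp only [hx, hy, and_self, and_true, true_and,
    ite_true, ite_false, true_or, or_true, or_self, Set.empty_union,
    Set.singleton_union] <;> simp_all <;> omega

end SmoothStep

/-- `S` arises from `C` by smoothing; `m` sends each edge to the edge it has been merged into. -/
structure IsSmoothing (C S : Graph α β) (m : β → β) : Prop where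
  isFinite : S.IsFinite
  isConnected : C.IsConnected → S.IsConnected
  genus_eq : S.genus = C.genus
  exists_isCut : ∀ b ∈ S.edgeSet, (∃ χ, S.IsCut b χ) → ∃ χ, C.IsCut b χ
  isCut : ∀ b χ, C.IsCut b χ → S.IsCut (m b) χ
  degree_eq : ∀ t ∈ S.vertexSet, S.degree t = C.degree t
  degree_two : ∀ t ∈ C.vertexSet, t ∉ S.vertexSet → C.degree t = 2
  subset : S.vertexSet ⊆ C.vertexSet
  edge_mem : ∀ d ∈ S.edgeSet, m d = d ∧ d ∈ C.edgeSet
  map_mem : ∀ d ∈ C.edgeSet, m d ∈ S.edgeSet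
  inc : ∀ d t, C.Inc d t → t ∈ S.vertexSet → S.Inc (m d) t
  eq_of_inc : ∀ d d' t, C.Inc d t → C.Inc d' t → t ∉ S.vertexSet → m d = m d'
  exists_inc : ∀ d t, S.Inc d t → ∃ d', m d' = d ∧ C.Inc d' t
  eqvGen : ∀ d ∈ C.edgeSet, ∀ d' ∈ C.edgeSet, m d = m d' →
    EqvGen (fun d d' => ∃ t, t ∉ S.vertexSet ∧ C.Inc d t ∧ C.Inc d' t) d d'

/-- At each step, `m` redirects to `e` whatever was sent to `f`. The field `eqvGen` says that the
edges merged into one edge form a chain through vertices that have disappeared; it serves to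
propagate properties along a subdivided edge. -/
theorem exists_isSmoothing (hC : C.IsFinite) (h : ReflTransGen SmoothsVertex C S) :
    ∃ m, IsSmoothing C S m := by
  classical
  induction h with
  | refl =>
    exact ⟨id, hC, id, rfl, fun _ _ h => h, fun _ _ h => h, fun _ _ => rfl,
      fun t h h' => absurd h h', subset_rfl, fun d h => ⟨rfl, h⟩, fun d h => h,
      fun d t h _ => h, fun d d' t h _ h' => absurd h.vertex_mem h', fun d t h => ⟨d, rfl, h⟩,
      fun d hd d' hd' h => by simp only [id] at h; rw [h]; exact .refl _⟩
  | @tail G G' _ hs ih =>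
    obtain ⟨m, ih⟩ := ih
    obtain ⟨v, x, y, e, f, hs⟩ := hs.exists_smoothStep
    have hG := ih.isFinite
    have hsub : G'.vertexSet ⊆ G.vertexSet := by rw [hs.vert]; exact Set.sdiff_subset
    have hne : ∀ t ∈ G'.vertexSet, t ≠ v := fun t ht => by rw [hs.vert] at ht; exact ht.2
    have hmem : ∀ d ∈ G'.edgeSet, d ∈ G.edgeSet ∧ d ≠ f := fun d hd => by
      rw [hs.edge] at hd; exact hd
    refine ⟨fun d => if m d = f then e else m d, hs.isFinite hG,
      fun h => hs.isConnected hG (ih.isConnected h), (hs.genus_eq hG).trans ih.genus_eq, ?_,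
      fun b χ h => hs.isCut (ih.isCut b χ h), fun t ht => (hs.degree_eq hG (hne t ht)).trans
        (ih.degree_eq t (hsub ht)), ?_, hsub.trans ih.subset, ?_, ?_, ?_, ?_, ?_, ?_⟩
    · rintro b hb ⟨χ, hχ⟩
      exact ih.exists_isCut b (hmem b hb).1 (hs.exists_isCut hG hb hχ)
    · intro t ht ht'
      by_cases htG : t ∈ G.vertexSet
      · have : t = v := by
          by_contra hv
          exact ht' (by rw [hs.vert]; exact ⟨htG, hv⟩)
        rw [← ih.degree_eq t htG, this, hs.degree]
      · exact ih.degree_two t ht htG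
    · intro d hd
      have h1 := ih.edge_mem d (hmem d hd).1
      simp only [h1.1, (hmem d hd).2, ite_false]
      exact ⟨trivial, h1.2⟩
    · intro d hd
      rw [hs.edge]
      split_ifs with h1
      · exact ⟨hs.le.edge_mem, hs.ne⟩
      · exact ⟨ih.map_mem d hd, h1⟩
    · intro d t hd ht
      have h1 := ih.inc d t hd (hsub ht)
      split_ifs with h2
      · rw [h2] at h1
        rw [(h1.eq_or_eq_of_isLink hs.lf).resolve_left (hne t ht)]
        exact hs.link_e.inc_right
      · by_cases h3 : m d = e
        · rw [h3] at h1 ⊢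
          rw [(h1.eq_or_eq_of_isLink hs.le).resolve_left (hne t ht)]
          exact hs.link_e.inc_left
        · obtain ⟨z, hz⟩ := h1
          exact ⟨z, (hs.link _ _ _).2 (Or.inr ⟨h3, h2, hz⟩)⟩
    · intro d d' t hd hd' ht
      by_cases htG : t ∈ G.vertexSet
      · have : t = v := by
          by_contra hv
          exact ht (by rw [hs.vert]; exact ⟨htG, hv⟩)
        subst this
        have h1 := hs.inc_v hG (ih.inc d t hd htG)
        have h2 := hs.inc_v hG (ih.inc d' t hd' htG)
        rcases h1 with h1 | h1 <;> rcases h2 with h2 | h2 <;> simp [h1, h2]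
      · rw [ih.eq_of_inc d d' t hd hd' htG]
    · intro d t hd
      have hdf := (hmem d hd.edge_mem).2
      by_cases hde : d = e
      · subst hde
        rcases hd.eq_or_eq_of_isLink hs.link_e with rfl | rfl
        · obtain ⟨d', h1, h2⟩ := ih.exists_inc _ _ hs.le.inc_right
          exact ⟨d', by simp [h1, hs.ne], h2⟩
        · obtain ⟨d', h1, h2⟩ := ih.exists_inc _ _ hs.lf.inc_right
          exact ⟨d', by simp [h1], h2⟩
      · have : G.Inc d t := by
          obtain ⟨z, hz⟩ := hd
          rcases (hs.link _ _ _).1 hz with h1 | h1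
          · exact absurd h1.1 hde
          · exact ⟨z, h1.2.2⟩
        obtain ⟨d', h1, h2⟩ := ih.exists_inc _ _ this
        exact ⟨d', by simp [h1, hdf], h2⟩
    · have hmono : ∀ {d d'}, d ∈ C.edgeSet → d' ∈ C.edgeSet → m d = m d' → EqvGen
          (fun d d' => ∃ t, t ∉ G'.vertexSet ∧ C.Inc d t ∧ C.Inc d' t) d d' :=
        fun hd hd' h => EqvGen.mono (fun a b ⟨t, ht, h⟩ => ⟨t, fun h => ht (hsub h), h⟩) _ _
          (ih.eqvGen _ hd _ hd' h)
      have hv : v ∉ G'.vertexSet := fun h => hne v h rfl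
      obtain ⟨d1, h1, h1'⟩ := ih.exists_inc _ _ hs.le.inc_left
      obtain ⟨d2, h2, h2'⟩ := ih.exists_inc _ _ hs.lf.inc_left
      -- The chains of `e` and of `f` both reach the vertex `v`, which has just disappeared, and are
      -- joined there.
      have h12 : EqvGen (fun d d' => ∃ t, t ∉ G'.vertexSet ∧ C.Inc d t ∧ C.Inc d' t) d1 d2 :=
        .rel _ _ ⟨v, hv, h1', h2'⟩
      intro d hd d' hd' hm
      split_ifs at hm with ha hb hb
      · exact hmono hd hd' (ha.trans hb.symm)
      · exact ((hmono hd h2'.edge_mem (ha.trans h2.symm)).trans _ _ _ (h12.symm _ _)).trans _ _ _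
          (hmono h1'.edge_mem hd' (h1.trans hm))
      · exact ((hmono hd h1'.edge_mem (hm.trans h1.symm)).trans _ _ _ h12).trans _ _ _
          (hmono h2'.edge_mem hd' (h2.trans hb.symm))
      · exact hmono hd hd' hm

end Graph

/-! ### A single bridge reduction; graphs with pairwise disjoint bridges -/

namespace Graph

variable {α β : Type*} {G G' : Graph α β} {b : β} {v w : α}

theorem IsCut.eq_of_ne {e d : β} {χ : α → Bool} (h : G.IsCut e χ) {x y} (hl : G.IsLink d x y)
    (hd : d ≠ e) : χ x = χ y := by
  by_contra hne
  exact hd ((h hl).1 hne)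

theorem IsCut.eq_of_inc {e d : β} {χ : α → Bool} (h : G.IsCut e χ) {x y} (hx : G.Inc d x)
    (hy : G.Inc d y) (hd : d ≠ e) : χ x = χ y := by
  obtain ⟨z, hz⟩ := hx
  rcases hy.eq_or_eq_of_isLink hz with rfl | rfl
  · rfl
  · exact h.eq_of_ne hz hd

theorem IsBridge.exists_isCut (hG : G.IsFinite) (h : G.IsBridge b) : ∃ χ, G.IsCut b χ :=
  ((isBridge_iff hG).1 h).2

theorem IsCut.isBridge (hG : G.IsFinite) {χ} (h : G.IsCut b χ) (hb : b ∈ G.edgeSet) :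
    G.IsBridge b := (isBridge_iff hG).2 ⟨hb, χ, h⟩

/-- The data of a bridge reduction. -/
structure ReductionData (G G' : Graph α β) (b : β) (v w : α)
    (K : Graph (α ⊕ Bool × Bool) β) : Prop where
  bridge : G.IsBridge b
  link : G.IsLink b v w
  vert : K.vertexSet = Sum.inl '' (G.vertexSet \ {v, w}) ∪ Set.range Sum.inr
  degree : ∀ h : Bool × Bool, K.degree (Sum.inr h) = 1
  ends : K.map (glueEnds v w) = G.deleteEdges {b}
  across : K.map (glueAcross v w) = G'.deleteEdges {b}
  link' : G'.IsLink b v w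

theorem IsBridgeReduction.exists_reductionData (h : IsBridgeReduction G G') :
    ∃ b v w K, ReductionData G G' b v w K := by
  obtain ⟨b, v, w, K, h1, h2, h3, h4, h5, h6, h7⟩ := h
  exact ⟨b, v, w, K, h1, h2, h3, h4, h5, h6, h7⟩

namespace ReductionData

variable {K : Graph (α ⊕ Bool × Bool) β}

theorem isBridgeReduction (h : ReductionData G G' b v w K) : IsBridgeReduction G G' :=
  ⟨b, v, w, K, h.1, h.2, h.3, h.4, h.5, h.6, h.7⟩

theorem link_iff (h : ReductionData G G' b v w K) {d x y} : G.IsLink d x y ∧ d ≠ b ↔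
    ∃ k l, K.IsLink d k l ∧ glueEnds v w k = x ∧ glueEnds v w l = y := by
  have : (K.map (glueEnds v w)).IsLink d x y ↔ (G.deleteEdges {b}).IsLink d x y := by rw [h.ends]
  rw [map_isLink, deleteEdges_isLink] at this
  exact this.symm

theorem link_iff' (h : ReductionData G G' b v w K) {d x y} : G'.IsLink d x y ∧ d ≠ b ↔
    ∃ k l, K.IsLink d k l ∧ glueAcross v w k = x ∧ glueAcross v w l = y := by
  have : (K.map (glueAcross v w)).IsLink d x y ↔ (G'.deleteEdges {b}).IsLink d x y := by
    rw [h.across]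
  rw [map_isLink, deleteEdges_isLink] at this
  exact this.symm

theorem edge (h : ReductionData G G' b v w K) : K.edgeSet = G.edgeSet \ {b} := by
  have : (K.map (glueEnds v w)).edgeSet = (G.deleteEdges {b}).edgeSet := by rw [h.ends]
  simpa using this

theorem edge' (h : ReductionData G G' b v w K) : K.edgeSet = G'.edgeSet \ {b} := by
  have : (K.map (glueAcross v w)).edgeSet = (G'.deleteEdges {b}).edgeSet := by rw [h.across]
  simpa using this

theorem edgeSet_eq (h : ReductionData G G' b v w K) : G'.edgeSet = G.edgeSet := by
  have h1 := h.edge.symm.trans h.edge'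
  ext d
  by_cases hd : d = b
  · subst hd
    exact ⟨fun _ => h.link.edge_mem, fun _ => h.link'.edge_mem⟩
  · have : d ∈ G.edgeSet \ {b} ↔ d ∈ G'.edgeSet \ {b} := by rw [h1]
    simpa [hd] using this.symm

theorem vertexSet_eq (h : ReductionData G G' b v w K) : G'.vertexSet = G.vertexSet := by
  have : (K.map (glueAcross v w)).vertexSet = (G'.deleteEdges {b}).vertexSet := by rw [h.across]
  rw [vertexSet_map, vertexSet_deleteEdges, h.vert] at this
  rw [← this]
  ext x
  constructor
  · rintro ⟨_, (⟨y, hy, rfl⟩ | ⟨⟨s, i⟩, rfl⟩), rfl⟩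
    · exact hy.1
    · cases i
      · exact h.link.left_mem
      · exact h.link.right_mem
  · intro hx
    by_cases hv : x = v
    · exact ⟨Sum.inr (false, false), Or.inr ⟨_, rfl⟩, by simp [glueAcross, hv]⟩
    · by_cases hw : x = w
      · exact ⟨Sum.inr (false, true), Or.inr ⟨_, rfl⟩, by simp [glueAcross, hw]⟩
      · exact ⟨Sum.inl x, Or.inl ⟨x, by simp [hx, hv, hw], rfl⟩, rfl⟩

theorem isFinite' (h : ReductionData G G' b v w K) (hG : G.IsFinite) : G'.IsFinite :=
  ⟨by rw [h.vertexSet_eq]; exact hG.1, by rw [h.edgeSet_eq]; exact hG.2⟩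

theorem finite_K (h : ReductionData G G' b v w K) (hG : G.IsFinite) : K.IsFinite := by
  refine ⟨?_, by rw [h.edge]; exact hG.2.subset Set.sdiff_subset⟩
  rw [h.vert]
  exact ((hG.1.subset Set.sdiff_subset).image _).union (Set.finite_range _)

theorem ne (h : ReductionData G G' b v w K) (hG : G.IsFinite) : v ≠ w := by
  rintro rfl
  obtain ⟨χ, hχ⟩ := h.bridge.exists_isCut hG
  exact (hχ h.link).2 rfl rfl

theorem mem_K (h : ReductionData G G' b v w K) {k} (hk : k ∈ K.vertexSet) :
    (∃ x, k = Sum.inl x ∧ x ∈ G.vertexSet ∧ x ≠ v ∧ x ≠ w) ∨ ∃ s, k = Sum.inr s := by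
  rw [h.vert] at hk
  rcases hk with ⟨x, ⟨hx, hx'⟩, rfl⟩ | ⟨s, rfl⟩
  · simp at hx'
    exact Or.inl ⟨x, rfl, hx, hx'.1, hx'.2⟩
  · exact Or.inr ⟨s, rfl⟩

/-- Each half has exactly one edge. -/
theorem exists_half (h : ReductionData G G' b v w K) (hG : G.IsFinite) (s : Bool × Bool) :
    ∃ e k, k ≠ Sum.inr s ∧ K.IsLink e (Sum.inr s) k ∧ ∀ d, K.Inc d (Sum.inr s) → d = e :=
  exists_of_degree_eq_one (h.finite_K hG) (h.degree s)

/-- `x` and `x'` are equal, or both are end vertices of the bridge. -/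
def _root_.Graph.NearEnds (v w x x' : α) : Prop :=
  x = x' ∨ ((x = v ∨ x = w) ∧ (x' = v ∨ x' = w))

theorem nearEnds (k : α ⊕ Bool × Bool) :
    NearEnds v w (glueEnds v w k) (glueAcross v w k) := by
  rcases k with x | ⟨s, i⟩
  · exact Or.inl rfl
  · refine Or.inr ⟨?_, ?_⟩
    · cases s <;> simp [glueEnds]
    · cases i <;> simp [glueAcross]

theorem exists_link' (h : ReductionData G G' b v w K) {d x y} (hl : G.IsLink d x y) (hd : d ≠ b) :
    ∃ x' y', G'.IsLink d x' y' ∧ NearEnds v w x x' ∧ NearEnds v w y y' := by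
  obtain ⟨k, l, hk, rfl, rfl⟩ := h.link_iff.1 ⟨hl, hd⟩
  exact ⟨_, _, (h.link_iff'.2 ⟨k, l, hk, rfl, rfl⟩).1, nearEnds k, nearEnds l⟩

theorem exists_link (h : ReductionData G G' b v w K) {d x y} (hl : G'.IsLink d x y)
    (hd : d ≠ b) : ∃ x' y', G.IsLink d x' y' ∧ NearEnds v w x' x ∧ NearEnds v w y' y := by
  obtain ⟨k, l, hk, rfl, rfl⟩ := h.link_iff'.1 ⟨hl, hd⟩
  exact ⟨_, _, (h.link_iff.2 ⟨k, l, hk, rfl, rfl⟩).1, nearEnds k, nearEnds l⟩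

theorem _root_.Graph.NearEnds.map_eq {v w x x' : α} {ξ : α → Bool} (h : NearEnds v w x x')
    (hξ : ξ v = ξ w) : ξ x = ξ x' := by
  rcases h with rfl | ⟨rfl | rfl, rfl | rfl⟩ <;> simp [hξ]

/-- As `d ≠ b`, the colours of `v` and `w` agree. The reduction only moves edge ends between `v` and
`w`, so the same colouring remains a cut. -/
theorem isCut' (h : ReductionData G G' b v w K) {d : β} {ξ} (hξ : G.IsCut d ξ) (hd : d ≠ b) :
    G'.IsCut d ξ := by
  have hvw : ξ v = ξ w := hξ.eq_of_ne h.link hd.symm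
  intro e x y hl
  by_cases he : e = b
  · subst he
    have : ξ x = ξ y := by
      rcases hl.eq_and_eq_or_eq_and_eq h.link' with ⟨rfl, rfl⟩ | ⟨rfl, rfl⟩ <;> simp [hvw]
    simp [this, hd.symm]
  · obtain ⟨x', y', hl', hx, hy⟩ := h.exists_link hl he
    rw [← hx.map_eq hvw, ← hy.map_eq hvw]
    exact hξ hl'

theorem isCut (h : ReductionData G G' b v w K) {d : β} {ξ} (hξ : G'.IsCut d ξ) (hd : d ≠ b) :
    G.IsCut d ξ := by
  have hvw : ξ v = ξ w := hξ.eq_of_ne h.link' hd.symm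
  intro e x y hl
  by_cases he : e = b
  · subst he
    have : ξ x = ξ y := by
      rcases hl.eq_and_eq_or_eq_and_eq h.link with ⟨rfl, rfl⟩ | ⟨rfl, rfl⟩ <;> simp [hvw]
    simp [this, hd.symm]
  · obtain ⟨x', y', hl', hx, hy⟩ := h.exists_link' hl he
    rw [hx.map_eq hvw, hy.map_eq hvw]
    exact hξ hl'

theorem isConnected' (h : ReductionData G G' b v w K) (hc : G.IsConnected) :
    G'.IsConnected := by
  rw [isConnected_iff] at hc ⊢
  rw [h.vertexSet_eq]
  refine ⟨hc.1, fun ξ hξ => hc.2 ξ fun d x y hl => ?_⟩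
  have hvw : ξ v = ξ w := hξ _ _ _ h.link'
  by_cases he : d = b
  · subst he
    rcases hl.eq_and_eq_or_eq_and_eq h.link with ⟨rfl, rfl⟩ | ⟨rfl, rfl⟩ <;> simp [hvw]
  · obtain ⟨x', y', hl', hx, hy⟩ := h.exists_link' hl he
    rw [hx.map_eq hvw, hy.map_eq hvw]
    exact hξ _ _ _ hl'

theorem inc_iff (h : ReductionData G G' b v w K) {d x} (hv : x ≠ v) (hw : x ≠ w) :
    G'.Inc d x ↔ G.Inc d x := by
  by_cases hd : d = b
  · subst hd
    constructor
    · intro hi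
      rcases hi.eq_or_eq_of_isLink h.link' with h | h <;> contradiction
    · intro hi
      rcases hi.eq_or_eq_of_isLink h.link with h | h <;> contradiction
  · constructor
    · rintro ⟨y, hl⟩
      obtain ⟨x', y', hl', (rfl | hx), -⟩ := h.exists_link hl hd
      · exact hl'.inc_left
      · rcases hx.2 with h | h <;> contradiction
    · rintro ⟨y, hl⟩
      obtain ⟨x', y', hl', (rfl | hx), -⟩ := h.exists_link' hl hd
      · exact hl'.inc_left
      · rcases hx.1 with h | h <;> contradiction

theorem loop_iff (h : ReductionData G G' b v w K) {d x} (hv : x ≠ v) (hw : x ≠ w) :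
    G'.IsLoopAt d x ↔ G.IsLoopAt d x := by
  by_cases hd : d = b
  · subst hd
    constructor
    · intro hi
      rcases hi.inc.eq_or_eq_of_isLink h.link' with h | h <;> contradiction
    · intro hi
      rcases hi.inc.eq_or_eq_of_isLink h.link with h | h <;> contradiction
  · constructor
    · intro hl
      obtain ⟨x', y', hl', (rfl | hx), (rfl | hy)⟩ := h.exists_link hl hd
      · exact hl'
      · rcases hy.2 with h | h <;> contradiction
      · rcases hx.2 with h | h <;> contradiction
      · rcases hx.2 with h | h <;> contradiction
    · intro hl
      obtain ⟨x', y', hl', (rfl | hx), (rfl | hy)⟩ := h.exists_link' hl hd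
      · exact hl'
      · rcases hy.1 with h | h <;> contradiction
      · rcases hx.1 with h | h <;> contradiction
      · rcases hx.1 with h | h <;> contradiction

theorem degree_eq (h : ReductionData G G' b v w K) {x} (hv : x ≠ v) (hw : x ≠ w) :
    G'.degree x = G.degree x := by
  simp only [Graph.degree, h.inc_iff hv hw, h.loop_iff hv hw]

/-- In the reduced graph the end vertices of `b` are incident with one edge from either side
of the bridge. -/
theorem exists_edges (h : ReductionData G G' b v w K) (hG : G.IsFinite) {χ} (hχ : G.IsCut b χ)
    {u : α} (hu : u = v ∨ u = w) : ∃ e f, e ≠ b ∧ f ≠ b ∧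
      (∀ d, G'.Inc d u ↔ d = b ∨ d = e ∨ d = f) ∧ (∀ d, ¬ G'.IsLoopAt d u) ∧
      ∀ x y, G.Inc e x → G.Inc f y → χ x ≠ χ y := by
  have hvw := h.ne hG
  obtain ⟨i, rfl⟩ : ∃ i : Bool, (if i then w else v) = u := by
    rcases hu with rfl | rfl
    · exact ⟨false, rfl⟩
    · exact ⟨true, rfl⟩
  set u := if i then w else v with hu'
  -- In `G'` the vertex `u` is glued from one half of `v` and one half of `w`; `e` and `f` are the
  -- single edges at these halves.
  obtain ⟨e, k, hk, he, he'⟩ := h.exists_half hG (false, i)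
  obtain ⟨f, l, hl, hf, hf'⟩ := h.exists_half hG (true, i)
  have heb : e ≠ b := by
    have := he.edge_mem
    rw [h.edge] at this
    exact this.2
  have hfb : f ≠ b := by
    have := hf.edge_mem
    rw [h.edge] at this
    exact this.2
  have hlv : ∀ {d z}, K.IsLink d (Sum.inr (false, i)) z → χ (glueEnds v w z) = χ v ∧ d ≠ b := by
    intro d z hz
    have h1 : _ ∧ d ≠ b := h.link_iff.2 ⟨_, _, hz, rfl, rfl⟩
    exact ⟨(hχ.eq_of_ne h1.1 h1.2).symm, h1.2⟩
  have hcol : χ v ≠ χ w := (hχ h.link).2 rfl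
  have hhalf : ∀ z ∈ K.vertexSet, glueAcross v w z = u → z = Sum.inr (false, i) ∨
      z = Sum.inr (true, i) := by
    intro z hz hzu
    rcases h.mem_K hz with ⟨x, rfl, -, h1, h2⟩ | ⟨⟨s, j⟩, rfl⟩
    · simp only [glueAcross, hu'] at hzu
      cases i <;> simp_all
    · simp only [glueAcross, hu'] at hzu
      cases i <;> cases j <;> cases s <;> simp_all
  have hul : glueAcross v w (Sum.inr (false, i)) = u := rfl
  have hul' : glueAcross v w (Sum.inr (true, i)) = u := rfl
  refine ⟨e, f, heb, hfb, fun d => ?_, fun d hd => ?_, fun x y hx hy => ?_⟩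
  · by_cases hd : d = b
    · subst hd
      simp only [true_or, iff_true]
      rcases hu with h1 | h1
      · rw [h1]; exact h.link'.inc_left
      · rw [h1]; exact h.link'.inc_right
    · simp only [hd, false_or]
      constructor
      · rintro ⟨y, hy⟩
        obtain ⟨k', l', hkl, hk', hl'⟩ := h.link_iff'.1 ⟨hy, hd⟩
        rcases hhalf _ hkl.left_mem hk' with rfl | rfl
        · exact Or.inl (he' d hkl.inc_left)
        · exact Or.inr (hf' d hkl.inc_left)
      · rintro (rfl | rfl)
        · exact ⟨_, (h.link_iff'.2 ⟨_, _, he, hul, rfl⟩).1⟩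
        · exact ⟨_, (h.link_iff'.2 ⟨_, _, hf, hul', rfl⟩).1⟩
  · have hdb : d ≠ b := by
      rintro rfl
      have h1 := hd.eq_of_inc h.link'.inc_left
      have h2 := hd.eq_of_inc h.link'.inc_right
      exact hvw (h1.symm.trans h2)
    obtain ⟨k', l', hkl, hk', hl'⟩ := h.link_iff'.1 ⟨hd, hdb⟩
    rcases hhalf _ hkl.left_mem hk' with rfl | rfl <;>
      rcases hhalf _ hkl.right_mem hl' with rfl | rfl
    · obtain rfl := he' d hkl.inc_left
      exact hk (he.right_unique hkl)
    · exact hcol (hlv hkl).1.symm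
    · exact hcol (hlv hkl.symm).1.symm
    · obtain rfl := hf' d hkl.inc_left
      exact hl (hf.right_unique hkl)
  · have h1 : G.Inc e v := ⟨_, (h.link_iff.2 ⟨_, _, he, rfl, rfl⟩).1⟩
    have h2 : G.Inc f w := ⟨_, (h.link_iff.2 ⟨_, _, hf, rfl, rfl⟩).1⟩
    rw [hχ.eq_of_inc hx h1 heb, hχ.eq_of_inc hy h2 hfb]
    exact hcol

/-- Besides `b`, one edge from each side of the bridge arrives at `u`. Lying on different sides,
these edges are distinct, and none is a loop. -/
theorem degree_end (h : ReductionData G G' b v w K) (hG : G.IsFinite) {u : α}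
    (hu : u = v ∨ u = w) : G'.degree u = 3 := by
  obtain ⟨χ, hχ⟩ := h.bridge.exists_isCut hG
  obtain ⟨e, f, he, hf, h1, h2, h3⟩ := h.exists_edges hG hχ hu
  have hef : e ≠ f := by
    rintro rfl
    have : e ∈ G.edgeSet := by
      have := ((h1 e).2 (by simp)).edge_mem
      rwa [h.edgeSet_eq] at this
    obtain ⟨x, y, hl⟩ := G.exists_isLink_of_mem_edgeSet this
    exact h3 x x hl.inc_left hl.inc_left rfl
  have h4 : {d | G'.Inc d u} = {b, e, f} := by
    ext d
    simp [h1 d]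
  have h5 : {d | G'.IsLoopAt d u} = ∅ := by
    ext d
    simp [h2 d]
  rw [Graph.degree, h4, h5, Set.ncard_empty, Set.ncard_insert_of_notMem (by simp [he.symm, hf.symm]),
    Set.ncard_pair hef]

theorem genus_eq (h : ReductionData G G' b v w K) : G'.genus = G.genus := by
  rw [genus, genus, h.vertexSet_eq, h.edgeSet_eq]

end ReductionData

/-- Finite connected cubic graphs in which no two bridges share a vertex. -/
structure Good (G : Graph α β) : Prop where
  isFinite : G.IsFinite
  isConnected : G.IsConnected
  degree : ∀ x ∈ G.vertexSet, G.degree x = 3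
  eq_of_inc : ∀ d d' x, G.IsBridge d → G.IsBridge d' → G.Inc d x → G.Inc d' x → d = d'

theorem IsImage.good {α' β' : Type*} [Nonempty α] [Nonempty β] {G : Graph α β} {H : Graph α' β'}
    {φ ψ} (h : IsImage φ ψ G H) (hG : G.Good) : H.Good := by
  refine ⟨h.isFinite_iff.2 hG.isFinite, h.isConnected hG.isConnected, ?_, ?_⟩
  · rw [h.vert]
    rintro _ ⟨a, ha, rfl⟩
    rw [h.degree_eq ha, hG.degree a ha]
  · intro d d' x hd hd' hx hx'
    have h1 := hx.edge_mem
    have h2 := hx'.edge_mem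
    have h3 := hx.vertex_mem
    rw [h.edge] at h1 h2
    rw [h.vert] at h3
    obtain ⟨e, he, rfl⟩ := h1
    obtain ⟨e', he', rfl⟩ := h2
    obtain ⟨a, ha, rfl⟩ := h3
    rw [hG.eq_of_inc e e' a ((h.isBridge_iff hG.isFinite he).1 hd)
      ((h.isBridge_iff hG.isFinite he').1 hd') ((h.inc_iff he ha).1 hx) ((h.inc_iff he' ha).1 hx')]

namespace ReductionData

variable {K : Graph (α ⊕ Bool × Bool) β}

/-- If `b` were a bridge of `G'`, the side of `v` in `G` without `b` would be disconnected by one of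
the two further edges at `v`. This edge would be a second bridge at `v`, which goodness forbids. -/
theorem not_isBridge (h : ReductionData G G' b v w K) (hG : G.Good) : ¬ G'.IsBridge b := by
  classical
  intro hb
  obtain ⟨ξ, hξ⟩ := hb.exists_isCut (h.isFinite' hG.isFinite)
  obtain ⟨χ, hχ⟩ := h.bridge.exists_isCut hG.isFinite
  have hvw := h.ne hG.isFinite
  have hcol : χ v ≠ χ w := (hχ h.link).2 rfl
  have hξ' : ξ v ≠ ξ w := (hξ h.link').2 rfl
  obtain ⟨e, k, hk, he, he'⟩ := h.exists_half hG.isFinite (false, false)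
  have heG : G.IsLink e v (glueEnds v w k) ∧ e ≠ b := h.link_iff.2 ⟨_, _, he, rfl, rfl⟩
  -- On the side of `v` the colouring `ξ` is kept, except that `v` gets the colour of `w`; the other
  -- side is constant. So `ζ` and `ξ` disagree only at the first half of `v`, and the edge `e` there
  -- is the only one that `ζ` cuts.
  set ζ : α → Bool := fun x => if χ x = χ v then (if x = v then ξ w else ξ x) else ξ w with hζ
  refine heG.2 (hG.eq_of_inc e b v (IsCut.isBridge hG.isFinite (χ := ζ) ?_ heG.1.edge_mem) h.bridge
    heG.1.inc_left h.link.inc_left)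
  have hval : ∀ z ∈ K.vertexSet, χ (glueEnds v w z) = χ v →
      (ζ (glueEnds v w z) = ξ (glueAcross v w z) ↔ z ≠ Sum.inr (false, false)) := by
    intro z hz hc
    rcases h.mem_K hz with ⟨x, rfl, -, h1, h2⟩ | ⟨⟨s, j⟩, rfl⟩
    · simp only [glueEnds] at hc
      simp [glueEnds, glueAcross, hζ, hc, h1]
    · cases s
      · cases j
        · simpa [glueEnds, glueAcross, hζ] using hξ'.symm
        · simp [glueEnds, glueAcross, hζ]
      · exact absurd hc hcol.symm
  intro d x y hl
  by_cases hd : d = b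
  · subst hd
    have h1 : ζ v = ξ w := by simp [hζ]
    have h2 : ζ w = ξ w := by simp [hζ, hcol.symm]
    have : ζ x = ζ y := by
      rcases hl.eq_and_eq_or_eq_and_eq h.link with ⟨rfl, rfl⟩ | ⟨rfl, rfl⟩ <;> rw [h1, h2]
    simp [this, heG.2.symm]
  · obtain ⟨k1, k2, hkl, rfl, rfl⟩ := h.link_iff.1 ⟨hl, hd⟩
    have hc := hχ.eq_of_ne hl hd
    by_cases hcv : χ (glueEnds v w k1) = χ v
    · have h1 := hval k1 hkl.left_mem hcv
      have h2 := hval k2 hkl.right_mem (hc ▸ hcv)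
      have h3 : ξ (glueAcross v w k1) = ξ (glueAcross v w k2) :=
        hξ.eq_of_ne (h.link_iff'.2 ⟨_, _, hkl, rfl, rfl⟩).1 hd
      have h4 : d = e ↔ k1 = Sum.inr (false, false) ∨ k2 = Sum.inr (false, false) := by
        constructor
        · rintro rfl
          rcases hkl.eq_and_eq_or_eq_and_eq he with h5 | h5
          · exact Or.inl h5.1
          · exact Or.inr h5.2
        · rintro (rfl | rfl)
          · exact he' d hkl.inc_left
          · exact he' d hkl.inc_right
      have h5 : ¬ (k1 = Sum.inr (false, false) ∧ k2 = Sum.inr (false, false)) := by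
        rintro ⟨rfl, rfl⟩
        obtain rfl := he' d hkl.inc_left
        exact hk (he.right_unique hkl)
      rw [h4]
      by_cases ha : k1 = Sum.inr (false, false) <;> by_cases hb : k2 = Sum.inr (false, false) <;>
        simp only [ha, hb, ne_eq, not_true, not_false_iff, iff_true, iff_false, true_or, or_true,
          or_self, and_self] at h1 h2 h5 ⊢
      · intro h6
        simp_all
      · intro h6
        simp_all
      · simp_all
    · have h1 : ζ (glueEnds v w k1) = ξ w := by simp [hζ, hcv]
      have h2 : ζ (glueEnds v w k2) = ξ w := by simp [hζ, hc ▸ hcv]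
      have h3 : d ≠ e := by
        rintro rfl
        exact hcv (hχ.eq_of_inc hl.inc_left heG.1.inc_left hd)
      simp [h1, h2, h3]

/-- Cuts at edges other than `b` pass in both directions, and `b` stops being a bridge. Hence the
number of bridges drops with each reduction. -/
theorem isBridge_iff (h : ReductionData G G' b v w K) (hG : G.Good) {d} :
    G'.IsBridge d ↔ G.IsBridge d ∧ d ≠ b := by
  constructor
  · intro hd
    have hdb : d ≠ b := by
      rintro rfl
      exact h.not_isBridge hG hd
    obtain ⟨ξ, hξ⟩ := hd.exists_isCut (h.isFinite' hG.isFinite)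
    refine ⟨(h.isCut hξ hdb).isBridge hG.isFinite ?_, hdb⟩
    rw [← h.edgeSet_eq]
    exact hd.1
  · rintro ⟨hd, hdb⟩
    obtain ⟨ξ, hξ⟩ := hd.exists_isCut hG.isFinite
    refine (h.isCut' hξ hdb).isBridge (h.isFinite' hG.isFinite) ?_
    rw [h.edgeSet_eq]
    exact hd.1

/-- Any other bridge avoids `v` and `w`, since bridges are disjoint, so its ends are not moved; `b`
is given the same ends again. -/
theorem link_bridge_iff (h : ReductionData G G' b v w K) (hG : G.Good) {d} (hd : G.IsBridge d)
    {x y} : G'.IsLink d x y ↔ G.IsLink d x y := by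
  by_cases hdb : d = b
  · subst hdb
    rw [h.link.isLink_iff, h.link'.isLink_iff]
  · have key : ∀ u, u = v ∨ u = w → ¬ G.Inc d u := by
      intro u hu hi
      refine hdb (hG.eq_of_inc d b u hd h.bridge hi ?_)
      rcases hu with rfl | rfl
      · exact h.link.inc_left
      · exact h.link.inc_right
    have key' : ∀ u, u = v ∨ u = w → ¬ G'.Inc d u := by
      rintro u hu ⟨y, hy⟩
      obtain ⟨x', y', hl, hx, -⟩ := h.exists_link hy hdb
      refine key x' ?_ hl.inc_left
      rcases hx with rfl | hx
      · exact hu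
      · exact hx.1
    constructor
    · intro hl
      obtain ⟨x', y', hl', hx, hy⟩ := h.exists_link hl hdb
      have h1 : x' = x := hx.resolve_right fun h => key _ h.1 hl'.inc_left
      have h2 : y' = y := hy.resolve_right fun h => key _ h.1 hl'.inc_right
      rwa [← h1, ← h2]
    · intro hl
      obtain ⟨x', y', hl', hx, hy⟩ := h.exists_link' hl hdb
      have h1 : x = x' := hx.resolve_right fun h => key' _ h.2 hl'.inc_left
      have h2 : y = y' := hy.resolve_right fun h => key' _ h.2 hl'.inc_right
      rwa [h1, h2]

theorem good (h : ReductionData G G' b v w K) (hG : G.Good) : G'.Good := by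
  refine ⟨h.isFinite' hG.isFinite, h.isConnected' hG.isConnected, ?_, ?_⟩
  · intro x hx
    rw [h.vertexSet_eq] at hx
    by_cases hv : x = v
    · exact h.degree_end hG.isFinite (Or.inl hv)
    · by_cases hw : x = w
      · exact h.degree_end hG.isFinite (Or.inr hw)
      · rw [h.degree_eq hv hw, hG.degree x hx]
  · intro d d' x hd hd' hx hx'
    rw [h.isBridge_iff hG] at hd hd'
    obtain ⟨y, hy⟩ := hx
    obtain ⟨y', hy'⟩ := hx'
    exact hG.eq_of_inc d d' x hd.1 hd'.1 ((h.link_bridge_iff hG hd.1).1 hy).inc_left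
      ((h.link_bridge_iff hG hd'.1).1 hy').inc_left

end ReductionData

end Graph

/-! ### Sequences of bridge reductions and how to undo them -/

namespace Graph

variable {α β α' β' α'' β'' : Type*} {G G₁ G₂ : Graph α β} {B : Set β}

/-- `x` and `x'` are equal, or both are ends of an edge of `B` other than `d`. -/
def NearIn (G : Graph α β) (B : Set β) (d : β) (x x' : α) : Prop :=
  x = x' ∨ ∃ b ∈ B, b ≠ d ∧ G.Inc b x ∧ G.Inc b x'

/-- `G₁` arises from the good graph `G` by bridge reductions with respect to the bridges in `B`. -/
structure ReducedBy (G G₁ : Graph α β) (B : Set β) : Prop where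
  good : G₁.Good
  vert : G₁.vertexSet = G.vertexSet
  edge : G₁.edgeSet = G.edgeSet
  sub : ∀ b ∈ B, G.IsBridge b
  bridge : ∀ d, G₁.IsBridge d ↔ G.IsBridge d ∧ d ∉ B
  blink : ∀ d, G.IsBridge d → ∀ x y, G₁.IsLink d x y ↔ G.IsLink d x y
  link : ∀ d x y, G.IsLink d x y →
    ∃ x' y', G₁.IsLink d x' y' ∧ NearIn G B d x x' ∧ NearIn G B d y y'
  split : ∀ b ∈ B, ∀ χ, G.IsCut b χ → ∀ u, G.Inc b u → ∃ e f, e ≠ b ∧ f ≠ b ∧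
    (∀ d, G₁.Inc d u ↔ d = b ∨ d = e ∨ d = f) ∧ ∀ x y, G.Inc e x → G.Inc f y → χ x ≠ χ y

namespace ReducedBy

theorem refl (hG : G.Good) : ReducedBy G G ∅ :=
  ⟨hG, rfl, rfl, by simp, by simp, fun _ _ _ _ => Iff.rfl,
    fun d x y h => ⟨x, y, h, Or.inl rfl, Or.inl rfl⟩, by simp⟩

theorem exists_link (h : ReducedBy G G₁ B) {d x' y'} (hl : G₁.IsLink d x' y') :
    ∃ x y, G.IsLink d x y ∧ NearIn G B d x x' ∧ NearIn G B d y y' := by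
  have hd := hl.edge_mem
  rw [h.edge] at hd
  obtain ⟨x, y, hxy⟩ := G.exists_isLink_of_mem_edgeSet hd
  obtain ⟨x2, y2, h1, h2, h3⟩ := h.link d x y hxy
  rcases h1.eq_and_eq_or_eq_and_eq hl with ⟨rfl, rfl⟩ | ⟨rfl, rfl⟩
  · exact ⟨x, y, hxy, h2, h3⟩
  · exact ⟨y, x, hxy.symm, h3, h2⟩

theorem near_map (_h : ReducedBy G G₁ B) {b d x x'} {χ : α → Bool} (hχ : G.IsCut b χ)
    (hb : ∀ b' ∈ B, b' ≠ d → G.Inc b' x' → b' ≠ b) (hn : NearIn G B d x x') : χ x = χ x' := by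
  rcases hn with rfl | ⟨b', hb', hd, hx, hx'⟩
  · rfl
  · exact hχ.eq_of_inc hx hx' (hb b' hb' hd hx')

theorem isCut (h : ReducedBy G G₁ B) {b} {χ : α → Bool} (hχ : G.IsCut b χ) (hb : b ∉ B) :
    G₁.IsCut b χ := by
  intro d x y hl
  obtain ⟨x', y', hl', hx, hy⟩ := h.exists_link hl
  have hne : ∀ z, ∀ b' ∈ B, b' ≠ d → G.Inc b' z → b' ≠ b := by
    rintro _ b' hb' _ _ rfl
    exact hb hb'
  rw [← h.near_map hχ (hne x) hx, ← h.near_map hχ (hne y) hy]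
  exact hχ hl'

/-- The bridges of a good graph are pairwise disjoint. So the ends of `b` have not been touched by
the earlier reductions, and each end of an edge is moved by at most one of them. For this reason it
suffices to record the set of bridges used. -/
theorem insert (hG : G.Good) (h : ReducedBy G G₁ B) {b v w K}
    (hs : ReductionData G₁ G₂ b v w K) : ReducedBy G G₂ (insert b B) := by
  obtain ⟨hbG, hbB⟩ := (h.bridge b).1 hs.bridge
  have hlinkb := (h.blink b hbG v w).1 hs.link
  have hend : ∀ u, u = v ∨ u = w → G.Inc b u := by
    rintro u (rfl | rfl)
    · exact hlinkb.inc_left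
    · exact hlinkb.inc_right
  refine ⟨hs.good h.good, hs.vertexSet_eq.trans h.vert, hs.edgeSet_eq.trans h.edge, ?_, ?_, ?_,
    ?_, ?_⟩
  · rintro b' (rfl | hb')
    · exact hbG
    · exact h.sub b' hb'
  · intro d
    rw [hs.isBridge_iff h.good, h.bridge]
    simp only [Set.mem_insert_iff]
    tauto
  · intro d hd x y
    rw [← h.blink d hd]
    by_cases hdb : d = b
    · subst hdb
      rw [hs.link.isLink_iff, hs.link'.isLink_iff]
    by_cases hdB : d ∈ B
    · have key : ∀ u, u = v ∨ u = w → ¬ G₁.Inc d u := by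
        rintro u hu ⟨z, hz⟩
        exact hdb (hG.eq_of_inc d b u hd hbG ((h.blink d hd _ _).1 hz).inc_left (hend u hu))
      constructor
      · intro hl
        obtain ⟨x', y', hl', hx, hy⟩ := hs.exists_link hl hdb
        have h1 : x' = x := hx.resolve_right fun h => key _ h.1 hl'.inc_left
        have h2 : y' = y := hy.resolve_right fun h => key _ h.1 hl'.inc_right
        rwa [← h1, ← h2]
      · intro hl
        obtain ⟨x', y', hl', hx, hy⟩ := hs.exists_link' hl hdb
        have h1 : x = x' := hx.resolve_right fun h => key _ h.1 hl.inc_left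
        have h2 : y = y' := hy.resolve_right fun h => key _ h.1 hl.inc_right
        rwa [h1, h2]
    · exact hs.link_bridge_iff h.good ((h.bridge d).2 ⟨hd, hdB⟩)
  · intro d x y hl
    obtain ⟨x', y', hl', hx, hy⟩ := h.link d x y hl
    by_cases hdb : d = b
    · subst hdb
      have hl1 := (h.blink d hbG x y).2 hl
      refine ⟨x, y, ?_, Or.inl rfl, Or.inl rfl⟩
      rw [hs.link'.isLink_iff, ← hs.link.isLink_iff]
      exact hl1
    · obtain ⟨x2, y2, hl2, hx2, hy2⟩ := hs.exists_link' hl' hdb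
      have key : ∀ {x x' x2}, NearIn G B d x x' → NearEnds v w x' x2 →
          NearIn G (Insert.insert b B) d x x2 := by
        intro x x' x2 h1 h2
        rcases h2 with rfl | ⟨h2, h3⟩
        · rcases h1 with rfl | ⟨b', hb', h⟩
          · exact Or.inl rfl
          · exact Or.inr ⟨b', Or.inr hb', h⟩
        · rcases h1 with rfl | ⟨b', hb', h4, h5, h6⟩
          · exact Or.inr ⟨b, Or.inl rfl, Ne.symm hdb, hend _ h2, hend _ h3⟩
          · refine absurd hb' ?_
            rw [hG.eq_of_inc b' b x' (h.sub b' hb') hbG h6 (hend _ h2)]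
            exact hbB
      exact ⟨x2, y2, hl2, key hx hx2, key hy hy2⟩
  · rintro b' (rfl | hb') χ hχ u hu
    · obtain ⟨e, f, he, hf, h1, -, h2⟩ := hs.exists_edges h.good.isFinite (h.isCut hχ hbB)
        (hu.eq_or_eq_of_isLink hlinkb)
      refine ⟨e, f, he, hf, h1, fun x y hx hy => ?_⟩
      have key : ∀ {d z}, G.Inc d z → ∃ z', G₁.Inc d z' ∧ χ z = χ z' := by
        rintro d z ⟨z2, hz⟩
        obtain ⟨z', z2', hz', hn, -⟩ := h.link d z z2 hz
        refine ⟨z', hz'.inc_left, h.near_map hχ ?_ hn⟩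
        rintro b'' hb'' _ _ rfl
        exact hbB hb''
      obtain ⟨x', hx1, hx2⟩ := key hx
      obtain ⟨y', hy1, hy2⟩ := key hy
      rw [hx2, hy2]
      exact h2 x' y' hx1 hy1
    · obtain ⟨e, f, he, hf, h1, h2⟩ := h.split b' hb' χ hχ u hu
      have hub : ¬ (u = v ∨ u = w) := by
        intro hu'
        refine hbB ?_
        rw [← hG.eq_of_inc b' b u (h.sub b' hb') hbG hu (hend _ hu')]
        exact hb'
      rw [not_or] at hub
      exact ⟨e, f, he, hf, fun d => by rw [hs.inc_iff hub.1 hub.2, h1], h2⟩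

theorem of_reflTransGen (hG : G.Good) (h : ReflTransGen IsBridgeReduction G G₁) :
    ∃ B, ReducedBy G G₁ B := by
  induction h with
  | refl => exact ⟨∅, refl hG⟩
  | tail _ hs ih =>
    obtain ⟨B, hB⟩ := ih
    obtain ⟨b, v, w, K, hs⟩ := hs.exists_reductionData
    exact ⟨_, hB.insert hG hs⟩

end ReducedBy

/-- A colouring of the edges other than `b` that is constant at every vertex except at the ends
`v` and `w` of `b`, where the two other edges have different colours. -/
structure Splits (S : Graph α β) (b : β) (v w : α) (c : β → Bool) : Prop where
  link : S.IsLink b v w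
  const : ∀ x, x ≠ v → x ≠ w → ∀ d d', S.Inc d x → S.Inc d' x → c d = c d'
  diff : ∀ u, u = v ∨ u = w → ∀ d d', d ≠ b → d' ≠ b → d ≠ d' → S.Inc d u → S.Inc d' u → c d ≠ c d'

section Place

open Classical in
/-- Where the end `x` of `d` goes if, for each `b ∈ B`, the edges at the ends `v b` and `w b` are
regrouped by colour. -/
noncomputable def place (B : Set β) (v w : β → α) (c : β → β → Bool) (d : β) (x : α) : α :=
  if h : ∃ b ∈ B, b ≠ d ∧ (x = v b ∨ x = w b) then
    (if c h.choose d then v h.choose else w h.choose) else x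

/-- No vertex is an end of two edges in `B`, and there are no loops in `B`. -/
structure EndsDisjoint (B : Set β) (v w : β → α) : Prop where
  ne : ∀ b ∈ B, v b ≠ w b
  eq : ∀ b ∈ B, ∀ b' ∈ B, ∀ x, (x = v b ∨ x = w b) → (x = v b' ∨ x = w b') → b = b'

variable {v w : β → α} {c : β → β → Bool}

theorem place_of_mem (hB : EndsDisjoint B v w) {b d x} (hb : b ∈ B) (hd : b ≠ d)
    (hx : x = v b ∨ x = w b) : place B v w c d x = if c b d then v b else w b := by
  have h : ∃ b ∈ B, b ≠ d ∧ (x = v b ∨ x = w b) := ⟨b, hb, hd, hx⟩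
  have h1 := h.choose_spec
  have h2 : h.choose = b := hB.eq _ h1.1 _ hb x h1.2.2 hx
  rw [place, dif_pos h, h2]

theorem place_of_not {d x} (h : ¬ ∃ b ∈ B, b ≠ d ∧ (x = v b ∨ x = w b)) :
    place B v w c d x = x := by
  rw [place, dif_neg h]

/-- The graph obtained by regrouping the ends of the edges. -/
noncomputable def recombine (S : Graph α β) (B : Set β) (v w : β → α) (c : β → β → Bool)
    (hB : ∀ b ∈ B, S.IsLink b (v b) (w b)) : Graph α β where
  vertexSet := S.vertexSet
  IsLink d x y := ∃ x' y', S.IsLink d x' y' ∧ x = place B v w c d x' ∧ y = place B v w c d y'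
  isLink_symm := by
    intro e _
    exact ⟨fun x y ⟨x', y', h, h1, h2⟩ => ⟨y', x', h.symm, h2, h1⟩⟩
  eq_or_eq_of_isLink_of_isLink := by
    rintro e _ _ _ _ ⟨x, y, h, rfl, rfl⟩ ⟨x', y', h', rfl, rfl⟩
    rcases h.left_eq_or_eq h' with rfl | rfl <;> simp
  left_mem_of_isLink := by
    rintro e _ _ ⟨x, y, h, rfl, rfl⟩
    rw [place]
    split_ifs with h1 h2
    · exact (hB _ h1.choose_spec.1).left_mem
    · exact (hB _ h1.choose_spec.1).right_mem
    · exact h.left_mem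

/-- `G` arises from `S` by undoing bridge reductions at the edges in `B`. -/
def IsEncodedBy (S : Graph α β) (v w : β → α) (B : Set β) (G : Graph α' β') : Prop :=
  EndsDisjoint B v w ∧ ∃ (c : β → β → Bool) (hB : ∀ b ∈ B, S.IsLink b (v b) (w b)),
    (∀ b ∈ B, Splits S b (v b) (w b) (c b)) ∧ ∃ φ ψ, IsImage φ ψ (S.recombine B v w c hB) G

/-- The sum of the two colourings modulo 2 is constant at every vertex: at the ends of `b` both
colourings distinguish the same two edges. So it comes from a vertex colouring that is constant
along all edges except possibly `b`, and there too, since otherwise `b` would be a bridge. By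
connectedness it is constant. -/
theorem exists_xor_of_splits {S : Graph α β} (hf : S.IsFinite) (hS : S.IsTwoEdgeConnected) {b x y}
    {c c' : β → Bool} (h : Splits S b x y c) (h' : Splits S b x y c') :
    ∃ κ, ∀ d ∈ S.edgeSet, d ≠ b → c d = xor κ (c' d) := by
  classical
  have hconst : ∀ u d d', d ≠ b → d' ≠ b → S.Inc d u → S.Inc d' u →
      xor (c d) (c' d) = xor (c d') (c' d') := by
    intro u d d' hd hd' hu hu'
    by_cases hxy : u = x ∨ u = y
    · by_cases hdd : d = d'
      · rw [hdd]
      · have h1 := h.diff u hxy d d' hd hd' hdd hu hu'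
        have h2 := h'.diff u hxy d d' hd hd' hdd hu hu'
        revert h1 h2
        cases c d <;> cases c d' <;> cases c' d <;> cases c' d' <;> simp
    · rw [not_or] at hxy
      rw [h.const u hxy.1 hxy.2 d d' hu hu', h'.const u hxy.1 hxy.2 d d' hu hu']
  set ξ : α → Bool := fun u => decide (∃ d, d ≠ b ∧ S.Inc d u ∧ xor (c d) (c' d) = true) with hξ
  have hξd : ∀ u d, d ≠ b → S.Inc d u → ξ u = xor (c d) (c' d) := by
    intro u d hd hu
    rw [hξ]
    simp only
    by_cases ht : xor (c d) (c' d) = true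
    · rw [ht, decide_eq_true_iff]
      exact ⟨d, hd, hu, ht⟩
    · rw [Bool.not_eq_true] at ht
      rw [ht, decide_eq_false_iff_not]
      rintro ⟨d', hd', hu', ht'⟩
      rw [hconst u d d' hd hd' hu hu', ht'] at ht
      exact absurd ht (by simp)
  have hlink : ∀ d p q, S.IsLink d p q → d ≠ b → ξ p = ξ q := by
    intro d p q hl hd
    rw [hξd p d hd hl.inc_left, hξd q d hd hl.inc_right]
  have hxy : ξ x = ξ y := by
    by_contra hne
    refine hS.2 b (IsCut.isBridge hf (χ := ξ) ?_ h.link.edge_mem)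
    intro d p q hl
    by_cases hd : d = b
    · subst hd
      simp only [iff_true]
      rcases hl.eq_and_eq_or_eq_and_eq h.link with ⟨rfl, rfl⟩ | ⟨rfl, rfl⟩
      · exact hne
      · exact Ne.symm hne
    · simp [hd, hlink d p q hl hd]
  refine ⟨ξ x, fun d hd hdb => ?_⟩
  obtain ⟨p, q, hl⟩ := S.exists_isLink_of_mem_edgeSet hd
  have := (isConnected_iff.1 hS.1).2 ξ (fun d p q hl => by
    by_cases hd : d = b
    · subst hd
      rcases hl.eq_and_eq_or_eq_and_eq h.link with ⟨rfl, rfl⟩ | ⟨rfl, rfl⟩ <;> simp [hxy]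
    · exact hlink d p q hl hd) x h.link.left_mem p hl.left_mem
  rw [this, hξd p d hdb hl.inc_left]
  cases c d <;> cases c' d <;> rfl

/-- A graph is determined by the graph it reduces to and the set of the edges used. -/
theorem IsEncodedBy.isIsomorphic {S : Graph α β} (hf : S.IsFinite) (hS : S.IsTwoEdgeConnected)
    {G : Graph α' β'} {H : Graph α'' β''}
    (h : IsEncodedBy S v w B G) (h' : IsEncodedBy S v w B H) : G.IsIsomorphic H := by
  classical
  obtain ⟨hD, c, hB, hc, φ, ψ, hφ⟩ := h
  obtain ⟨_, c', _, hc', φ', ψ', hφ'⟩ := h'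
  refine hφ.isIsomorphic.symm.trans (IsIsomorphic.trans ?_ hφ'.isIsomorphic)
  have hκ : ∀ b, ∃ κ, b ∈ B → ∀ d ∈ S.edgeSet, d ≠ b → c b d = xor κ (c' b d) := by
    intro b
    by_cases hb : b ∈ B
    · obtain ⟨κ, hκ⟩ := exists_xor_of_splits hf hS (hc b hb) (hc' b hb)
      exact ⟨κ, fun _ => hκ⟩
    · exact ⟨false, fun h => absurd h hb⟩
  choose F hF using hκ
  -- Complementing the colouring of `b` exchanges the roles of `v b` and `w b`. The involution `π`
  -- makes this exchange for each `b` whose two colourings are complementary, that is, for `F b =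
  -- true`.
  set π : α → α := fun x => if h : ∃ b ∈ B, F b = true ∧ (x = v b ∨ x = w b) then
    (if x = v h.choose then w h.choose else v h.choose) else x with hπ
  have hπ1 : ∀ b ∈ B, F b = true → π (v b) = w b ∧ π (w b) = v b := by
    intro b hb hFb
    have key : ∀ x, (x = v b ∨ x = w b) → π x = if x = v b then w b else v b := by
      intro x hx
      have h : ∃ b ∈ B, F b = true ∧ (x = v b ∨ x = w b) := ⟨b, hb, hFb, hx⟩
      have h1 : h.choose = b := hD.eq _ h.choose_spec.1 _ hb x h.choose_spec.2.2 hx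
      rw [hπ]
      simp only [dif_pos h]
      rw [h1]
    rw [key _ (Or.inl rfl), key _ (Or.inr rfl)]
    simp [(hD.ne b hb).symm]
  have hπ2 : ∀ x, (¬ ∃ b ∈ B, F b = true ∧ (x = v b ∨ x = w b)) → π x = x := by
    intro x hx
    rw [hπ]
    simp only [dif_neg hx]
  have hππ : ∀ x, π (π x) = x := by
    intro x
    by_cases hx : ∃ b ∈ B, F b = true ∧ (x = v b ∨ x = w b)
    · obtain ⟨b, hb, hFb, rfl | rfl⟩ := hx
      · rw [(hπ1 b hb hFb).1, (hπ1 b hb hFb).2]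
      · rw [(hπ1 b hb hFb).2, (hπ1 b hb hFb).1]
    · rw [hπ2 x hx, hπ2 x hx]
  have hπV : ∀ x ∈ S.vertexSet, π x ∈ S.vertexSet := by
    intro x hx
    by_cases hx' : ∃ b ∈ B, F b = true ∧ (x = v b ∨ x = w b)
    · obtain ⟨b, hb, hFb, rfl | rfl⟩ := hx'
      · rw [(hπ1 b hb hFb).1]; exact (hB b hb).right_mem
      · rw [(hπ1 b hb hFb).2]; exact (hB b hb).left_mem
    · rwa [hπ2 x hx']
  have hmain : ∀ {c c' : β → β → Bool},
      (∀ b, b ∈ B → ∀ d ∈ S.edgeSet, d ≠ b → c b d = xor (F b) (c' b d)) →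
      ∀ d x y, (S.recombine B v w c hB).IsLink d x y →
        (S.recombine B v w c' hB).IsLink d (π x) (π y) := by
    rintro c c' hF d _ _ ⟨x, y, hl, rfl, rfl⟩
    -- The edge `d` is not regrouped at its own ends. If `π` exchanges these ends, then `d` has to
    -- be read in the opposite direction.
    by_cases hd : d ∈ B ∧ F d = true
    · have key : ∀ (c : β → β → Bool) x, (x = v d ∨ x = w d) → place B v w c d x = x := by
        intro c x hx
        refine place_of_not ?_
        rintro ⟨b, hb, hbd, hx'⟩
        exact hbd (hD.eq b hb d hd.1 x hx' hx)
      have hxy := hl.eq_and_eq_or_eq_and_eq (hB d hd.1)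
      refine ⟨y, x, hl.symm, ?_, ?_⟩
      · rw [key c x (by tauto), key c' y (by tauto)]
        rcases hxy with ⟨rfl, rfl⟩ | ⟨rfl, rfl⟩
        · exact (hπ1 d hd.1 hd.2).1
        · exact (hπ1 d hd.1 hd.2).2
      · rw [key c y (by tauto), key c' x (by tauto)]
        rcases hxy with ⟨rfl, rfl⟩ | ⟨rfl, rfl⟩
        · exact (hπ1 d hd.1 hd.2).2
        · exact (hπ1 d hd.1 hd.2).1
    · have key : ∀ x, S.Inc d x → π (place B v w c d x) = place B v w c' d x := by
        intro x hx
        by_cases hb : ∃ b ∈ B, b ≠ d ∧ (x = v b ∨ x = w b)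
        · obtain ⟨b, hb, hbd, hxb⟩ := hb
          rw [place_of_mem hD hb hbd hxb, place_of_mem hD hb hbd hxb,
            hF b hb d hx.edge_mem (Ne.symm hbd)]
          cases hFb : F b
          · have : ∀ u, (u = v b ∨ u = w b) → π u = u := by
              intro u hu
              refine hπ2 u ?_
              rintro ⟨b', hb', hFb', hu'⟩
              rw [hD.eq b hb b' hb' u hu hu', hFb'] at hFb
              exact absurd hFb (by simp)
            cases c' b d <;> simp [this]
          · have := hπ1 b hb hFb
            cases c' b d <;> simp [this]
        · rw [place_of_not hb, place_of_not hb]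
          refine hπ2 x ?_
          rintro ⟨b, hb', hFb, hxb⟩
          by_cases hbd : b = d
          · subst hbd
            exact hd ⟨hb', hFb⟩
          · exact hb ⟨b, hb', hbd, hxb⟩
      exact ⟨x, y, hl, key x hl.inc_left, key y hl.inc_right⟩
  refine IsImage.isIsomorphic (φ := π) (ψ := id) ⟨?_, Function.injective_id.injOn, ?_, ?_⟩
  · intro x _ y _ hxy
    rw [← hππ x, hxy, hππ]
  · change S.vertexSet = π '' S.vertexSet
    ext x
    exact ⟨fun hx => ⟨π x, hπV x hx, hππ x⟩, by rintro ⟨y, hy, rfl⟩; exact hπV y hy⟩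
  · intro d x y
    constructor
    · intro hl
      refine ⟨d, π x, π y, hmain (c := c') (c' := c) (fun b hb d hd hdb => ?_) d x y hl, rfl,
        hππ x, hππ y⟩
      rw [hF b hb d hd hdb]
      cases F b <;> cases c' b d <;> rfl
    · rintro ⟨_, a, b, hl, rfl, rfl, rfl⟩
      exact hmain (fun b hb d hd hdb => hF b hb d hd hdb) _ a b hl

/-- A reduced graph, with the set of the edges used, encodes the original graph. -/
theorem ReducedBy.exists_colouring (hG : G.Good) (h : ReducedBy G G₁ B)
    (hvw : ∀ b ∈ B, G₁.IsLink b (v b) (w b)) : EndsDisjoint B v w ∧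
    ∃ c : β → β → Bool, (∀ b ∈ B, Splits G₁ b (v b) (w b) (c b)) ∧
      ∀ d x y, G₁.IsLink d x y → G.IsLink d (place B v w c d x) (place B v w c d y) := by
  classical
  have hvw' : ∀ b ∈ B, G.IsLink b (v b) (w b) := fun b hb =>
    (h.blink b (h.sub b hb) _ _).1 (hvw b hb)
  have hinc : ∀ b ∈ B, ∀ x, G.Inc b x ↔ x = v b ∨ x = w b := by
    intro b hb x
    constructor
    · exact fun hx => hx.eq_or_eq_of_isLink (hvw' b hb)
    · rintro (rfl | rfl)
      · exact (hvw' b hb).inc_left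
      · exact (hvw' b hb).inc_right
  have hcut : ∀ b, ∃ χ, b ∈ B → G.IsCut b χ := by
    intro b
    by_cases hb : b ∈ B
    · obtain ⟨χ, hχ⟩ := (h.sub b hb).exists_isCut hG.isFinite
      exact ⟨χ, fun _ => hχ⟩
    · exact ⟨fun _ => true, fun h => absurd h hb⟩
  choose χ hχ using hcut
  have hD : EndsDisjoint B v w := by
    constructor
    · intro b hb heq
      have := (hχ b hb (hvw' b hb)).2 rfl
      rw [heq] at this
      exact this rfl
    · intro b hb b' hb' x hx hx'
      exact hG.eq_of_inc b b' x (h.sub b hb) (h.sub b' hb') ((hinc b hb x).2 hx)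
        ((hinc b' hb' x).2 hx')
  -- The colour tells whether `d` lies on the side of `v b` of the bridge `b` of `G`. By `hcd` it
  -- may be read off at any end of `d`.
  set c : β → β → Bool := fun b d => decide (∃ y, G.Inc d y ∧ χ b y = χ b (v b)) with hc
  have hcd : ∀ b ∈ B, ∀ d y, d ≠ b → G.Inc d y → c b d = decide (χ b y = χ b (v b)) := by
    intro b hb d y hd hy
    rw [hc]
    simp only [decide_eq_decide]
    constructor
    · rintro ⟨z, hz, hz'⟩
      rw [← hz', (hχ b hb).eq_of_inc hy hz hd]
    · exact fun h => ⟨y, hy, h⟩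
  refine ⟨hD, c, fun b hb => ⟨hvw b hb, ?_, ?_⟩, ?_⟩
  · intro x hxv hxw
    have key : ∀ d, G₁.Inc d x → c b d = decide (χ b x = χ b (v b)) := by
      rintro d ⟨y, hy⟩
      obtain ⟨x', y', hl, hx, -⟩ := h.exists_link hy
      have hdb : d ≠ b := by
        rintro rfl
        rcases hy.left_eq_or_eq (hvw d hb) with h | h <;> contradiction
      rw [hcd b hb d x' hdb hl.inc_left, h.near_map (hχ b hb) ?_ hx]
      rintro b' hb' - hx' rfl
      rcases (hinc b' hb' x).1 hx' with h | h <;> contradiction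
    intro d d' hd hd'
    rw [key d hd, key d' hd']
  · intro u hu d d' hd hd' hdd hui hui'
    obtain ⟨e, f, he, hf, h1, h2⟩ := h.split b hb (χ b) (hχ b hb) u ((hinc b hb u).2 hu)
    have h3 := ((h1 d).1 hui).resolve_left hd
    have h4 := ((h1 d').1 hui').resolve_left hd'
    have key : c b e ≠ c b f := by
      have heE : e ∈ G.edgeSet := by rw [← h.edge]; exact ((h1 e).2 (by simp)).edge_mem
      have hfE : f ∈ G.edgeSet := by rw [← h.edge]; exact ((h1 f).2 (by simp)).edge_mem
      obtain ⟨x, x', hx⟩ := G.exists_isLink_of_mem_edgeSet heE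
      obtain ⟨y, y', hy⟩ := G.exists_isLink_of_mem_edgeSet hfE
      have := h2 x y hx.inc_left hy.inc_left
      rw [hcd b hb e x he hx.inc_left, hcd b hb f y hf hy.inc_left]
      revert this
      cases χ b x <;> cases χ b y <;> cases χ b (v b) <;> simp
    rcases h3 with rfl | rfl <;> rcases h4 with rfl | rfl
    · exact absurd rfl hdd
    · exact key
    · exact key.symm
    · exact absurd rfl hdd
  · intro d x y hl
    obtain ⟨x', y', hl', hx, hy⟩ := h.exists_link hl
    have key : ∀ x x', G.Inc d x' → NearIn G B d x' x → place B v w c d x = x' := by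
      intro x x' hd hn
      by_cases hb : ∃ b ∈ B, b ≠ d ∧ (x = v b ∨ x = w b)
      · obtain ⟨b, hb, hbd, hxb⟩ := hb
        rw [place_of_mem hD hb hbd hxb, hcd b hb d x' (Ne.symm hbd) hd]
        have hx' : x' = v b ∨ x' = w b := by
          rcases hn with rfl | ⟨b', hb', -, h1, h2⟩
          · exact hxb
          · rw [hD.eq b hb b' hb' x hxb ((hinc b' hb' x).1 h2)]
            exact (hinc b' hb' x').1 h1
        have hne := (hχ b hb (hvw' b hb)).2 rfl
        rcases hx' with rfl | rfl
        · simp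
        · simp [hne.symm]
      · rw [place_of_not hb]
        rcases hn with rfl | ⟨b', hb', hbd, h1, h2⟩
        · rfl
        · exact absurd ⟨b', hb', hbd, (hinc b' hb' x).1 h2⟩ hb
    rw [key x x' hl'.inc_left hx, key y y' hl'.inc_right hy]
    exact hl'

/-- The colourings obtained on `G₁` are pulled back to the isomorphic graph `S`. Thus all graphs
that reduce to copies of `S` are encoded on one fixed graph with fixed names of the ends of its
edges. -/
theorem ReducedBy.isEncodedBy {S : Graph α' β'} (hG : G.Good)
    (h : ReducedBy G G₁ B) {φ : α' → α} {ψ : β' → β} (hφ : IsImage φ ψ S G₁) {v w : β' → α'}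
    (hvw : ∀ e ∈ S.edgeSet, S.IsLink e (v e) (w e)) :
    IsEncodedBy S v w {e | e ∈ S.edgeSet ∧ ψ e ∈ B} G := by
  classical
  by_cases hE : Nonempty β'
  swap
  · refine ⟨⟨fun b => (hE ⟨b⟩).elim, fun b => (hE ⟨b⟩).elim⟩, fun b => (hE ⟨b⟩).elim,
      fun b => (hE ⟨b⟩).elim, fun b => (hE ⟨b⟩).elim, φ, ψ, hφ.injV, fun b => (hE ⟨b⟩).elim, ?_, ?_⟩
    · rw [← h.vert, hφ.vert]
      rfl
    · intro d x y
      constructor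
      · intro hl
        have := hl.edge_mem
        rw [← h.edge, hφ.edge] at this
        obtain ⟨e, -⟩ := this
        exact (hE ⟨e⟩).elim
      · rintro ⟨e, -⟩
        exact (hE ⟨e⟩).elim
  set σ := Function.invFunOn ψ S.edgeSet with hσ
  have hσe : ∀ e ∈ S.edgeSet, σ (ψ e) = e := fun e he => hφ.injE.leftInvOn_invFunOn he
  set B' : Set β' := {e | e ∈ S.edgeSet ∧ ψ e ∈ B} with hB'
  obtain ⟨hD, c, hc, hlink⟩ := h.exists_colouring hG (v := fun b => φ (v (σ b)))
    (w := fun b => φ (w (σ b))) (fun b hb => by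
      have : b ∈ G₁.edgeSet := by rw [h.edge]; exact (h.sub b hb).1
      rw [hφ.edge] at this
      obtain ⟨e, he, rfl⟩ := this
      simp only [hσe e he]
      exact hφ.map_link (hvw e he))
  have hends : ∀ e ∈ B', ∀ x ∈ S.vertexSet, (φ x = φ (v (σ (ψ e))) ∨ φ x = φ (w (σ (ψ e)))) ↔
      x = v e ∨ x = w e := by
    intro e he x hx
    rw [hσe e he.1]
    have h1 := hvw e he.1
    constructor
    · rintro (h2 | h2)
      · exact Or.inl (hφ.injV hx h1.left_mem h2)
      · exact Or.inr (hφ.injV hx h1.right_mem h2)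
    · rintro (rfl | rfl) <;> simp
  have hmemV : ∀ e ∈ B', ∀ x, (x = v e ∨ x = w e) → x ∈ S.vertexSet := by
    rintro e he x (rfl | rfl)
    · exact (hvw e he.1).left_mem
    · exact (hvw e he.1).right_mem
  have hD' : EndsDisjoint B' v w := by
    constructor
    · intro e he heq
      have := hD.ne (ψ e) he.2
      simp only [hσe e he.1] at this
      exact this (by rw [heq])
    · intro e he e' he' x hx hx'
      have hxV := hmemV e he x hx
      exact hφ.injE he.1 he'.1 (hD.eq (ψ e) he.2 (ψ e') he'.2 (φ x) ((hends e he x hxV).2 hx)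
        ((hends e' he' x hxV).2 hx'))
  have hplace : ∀ d x, S.Inc d x →
      place B (fun b => φ (v (σ b))) (fun b => φ (w (σ b))) c (ψ d) (φ x) =
        φ (place B' v w (fun e d => c (ψ e) (ψ d)) d x) := by
    intro d x hdx
    by_cases hb : ∃ b ∈ B', b ≠ d ∧ (x = v b ∨ x = w b)
    · obtain ⟨b, hb, hbd, hxb⟩ := hb
      rw [place_of_mem hD' hb hbd hxb, place_of_mem hD hb.2
        (fun h => hbd (hφ.injE hb.1 hdx.edge_mem h)) ((hends b hb x hdx.vertex_mem).2 hxb)]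
      simp only [hσe b hb.1]
      split_ifs <;> rfl
    · rw [place_of_not hb, place_of_not]
      rintro ⟨b, hbB, hbd, hx⟩
      have : b ∈ G₁.edgeSet := by rw [h.edge]; exact (h.sub b hbB).1
      rw [hφ.edge] at this
      obtain ⟨e, he, rfl⟩ := this
      exact hb ⟨e, ⟨he, hbB⟩, fun h => hbd (by rw [h]),
        (hends e ⟨he, hbB⟩ x hdx.vertex_mem).1 hx⟩
  refine ⟨hD', fun e d => c (ψ e) (ψ d), fun b hb => hvw b hb.1, fun b hb => ⟨hvw b hb.1, ?_, ?_⟩,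
    φ, ψ, hφ.injV, ?_, ?_, ?_⟩
  · intro x hx hx' d d' hd hd'
    have := hc (ψ b) hb.2
    simp only [hσe b hb.1] at this
    have h1 := hvw b hb.1
    refine this.const (φ x) ?_ ?_ _ _ ((hφ.inc_iff hd.edge_mem hd.vertex_mem).2 hd)
      ((hφ.inc_iff hd'.edge_mem hd.vertex_mem).2 hd')
    · exact fun h => hx (hφ.injV hd.vertex_mem h1.left_mem h)
    · exact fun h => hx' (hφ.injV hd.vertex_mem h1.right_mem h)
  · intro u hu d d' hd hd' hdd hdu hdu'
    have := hc (ψ b) hb.2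
    refine this.diff (φ u) ((hends b hb u hdu.vertex_mem).2 hu) _ _ ?_ ?_ ?_
      ((hφ.inc_iff hdu.edge_mem hdu.vertex_mem).2 hdu)
      ((hφ.inc_iff hdu'.edge_mem hdu.vertex_mem).2 hdu')
    · exact fun h => hd (hφ.injE hdu.edge_mem hb.1 h)
    · exact fun h => hd' (hφ.injE hdu'.edge_mem hb.1 h)
    · exact fun h => hdd (hφ.injE hdu.edge_mem hdu'.edge_mem h)
  · rintro e ⟨x, y, x', y', hl, -⟩ e' ⟨x2, y2, x2', y2', hl', -⟩ hee
    exact hφ.injE hl.edge_mem hl'.edge_mem hee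
  · rw [← h.vert, hφ.vert]
    rfl
  · intro d x y
    have hto : ∀ e p q, S.IsLink e p q → G.IsLink (ψ e)
        (φ (place B' v w (fun e d => c (ψ e) (ψ d)) e p))
        (φ (place B' v w (fun e d => c (ψ e) (ψ d)) e q)) := by
      intro e p q hl
      rw [← hplace e p hl.inc_left, ← hplace e q hl.inc_right]
      exact hlink _ _ _ (hφ.map_link hl)
    constructor
    · intro hl
      have := hl.edge_mem
      rw [← h.edge, hφ.edge] at this
      obtain ⟨e, he, rfl⟩ := this
      obtain ⟨p, q, hpq⟩ := S.exists_isLink_of_mem_edgeSet he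
      rcases hl.eq_and_eq_or_eq_and_eq (hto e p q hpq) with ⟨rfl, rfl⟩ | ⟨rfl, rfl⟩
      · exact ⟨e, _, _, ⟨p, q, hpq, rfl, rfl⟩, rfl, rfl, rfl⟩
      · exact ⟨e, _, _, ⟨q, p, hpq.symm, rfl, rfl⟩, rfl, rfl, rfl⟩
    · rintro ⟨e, _, _, ⟨p, q, hpq, rfl, rfl⟩, rfl, rfl, rfl⟩
      exact hto e p q hpq

end Place

end Graph

namespace Graph

variable {α β α' β' γ : Type*} {G G' G₂ A A₂ C C' D S : Graph α β} {b : β} {v w : α}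

/-! ### Bridge reductions commute with retracting leaves and smoothing -/

/-- The hypothesis `h0` says that nothing else is glued to `x₀`, so deleting before and after the
gluing gives the same. -/
theorem map_deleteVerts {K : Graph γ β} {φ : γ → α} (h : K.map φ = A.deleteEdges {b})
    {k₀ : γ} {x₀ : α} (h0 : ∀ k, φ k = x₀ ↔ k = k₀) :
    (K.deleteVerts {k₀}).map φ = (A.deleteVerts {x₀}).deleteEdges {b} := by
  have hl : ∀ d x y, (K.map φ).IsLink d x y ↔ (A.deleteEdges {b}).IsLink d x y := by
    intro d x y; rw [h]
  have hv : (K.map φ).vertexSet = (A.deleteEdges {b}).vertexSet := by rw [h]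
  rw [vertexSet_map, vertexSet_deleteEdges] at hv
  refine Graph.ext ?_ fun d x y => ?_
  · rw [vertexSet_map, vertexSet_deleteEdges, vertexSet_deleteVerts, vertexSet_deleteVerts, ← hv]
    ext x
    simp only [Set.mem_image, Set.mem_sdiff, Set.mem_singleton_iff]
    constructor
    · rintro ⟨k, ⟨hk, hk'⟩, rfl⟩
      exact ⟨⟨k, hk, rfl⟩, by rwa [h0]⟩
    · rintro ⟨⟨k, hk, rfl⟩, hk'⟩
      exact ⟨k, ⟨hk, by rwa [← h0]⟩, rfl⟩
  · have := hl d x y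
    rw [map_isLink, deleteEdges_isLink] at this
    rw [map_isLink, deleteEdges_isLink, deleteVerts_isLink]
    constructor
    · rintro ⟨k, l, hkl, rfl, rfl⟩
      rw [deleteVerts_isLink] at hkl
      have h1 := this.1 ⟨k, l, hkl.1, rfl, rfl⟩
      refine ⟨⟨h1.1, ?_, ?_⟩, h1.2⟩
      · simpa [h0] using hkl.2.1
      · simpa [h0] using hkl.2.2
    · rintro ⟨⟨h1, h2, h3⟩, h4⟩
      obtain ⟨k, l, hkl, rfl, rfl⟩ := this.2 ⟨h1, h4⟩
      refine ⟨k, l, ?_, rfl, rfl⟩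
      rw [deleteVerts_isLink]
      exact ⟨hkl, by simpa [h0] using h2, by simpa [h0] using h3⟩

theorem SmoothStep.map_eq {K K₂ : Graph γ β} {φ : γ → α} (h : K.map φ = A.deleteEdges {b})
    {k₀ k₁ k₂ : γ} {x₀ : α} {e f : β} (h0 : ∀ k, φ k = x₀ ↔ k = k₀)
    (hK : SmoothStep K K₂ k₀ k₁ k₂ e f) (hA : SmoothStep A A₂ x₀ (φ k₁) (φ k₂) e f)
    (he : e ≠ b) : K₂.map φ = A₂.deleteEdges {b} := by
  have hl : ∀ d x y, (K.map φ).IsLink d x y ↔ (A.deleteEdges {b}).IsLink d x y := by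
    intro d x y; rw [h]
  have hv : (K.map φ).vertexSet = (A.deleteEdges {b}).vertexSet := by rw [h]
  rw [vertexSet_map, vertexSet_deleteEdges] at hv
  refine Graph.ext ?_ fun d x y => ?_
  · rw [vertexSet_map, vertexSet_deleteEdges, hK.vert, hA.vert, ← hv]
    ext x
    simp only [Set.mem_image, Set.mem_sdiff, Set.mem_singleton_iff]
    constructor
    · rintro ⟨k, ⟨hk, hk'⟩, rfl⟩
      exact ⟨⟨k, hk, rfl⟩, by rwa [h0]⟩
    · rintro ⟨⟨k, hk, rfl⟩, hk'⟩
      exact ⟨k, ⟨hk, by rwa [← h0]⟩, rfl⟩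
  · have := hl d x y
    rw [map_isLink, deleteEdges_isLink] at this
    rw [map_isLink, deleteEdges_isLink, hA.link]
    constructor
    · rintro ⟨k, l, hkl, rfl, rfl⟩
      rcases (hK.link _ _ _).1 hkl with ⟨rfl, hs⟩ | ⟨h1, h2, h3⟩
      · refine ⟨Or.inl ⟨rfl, ?_⟩, he⟩
        rcases Sym2.eq_iff.1 hs with ⟨rfl, rfl⟩ | ⟨rfl, rfl⟩
        · rfl
        · exact Sym2.eq_swap
      · have h4 := this.1 ⟨k, l, h3, rfl, rfl⟩
        exact ⟨Or.inr ⟨h1, h2, h4.1⟩, h4.2⟩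
    · rintro ⟨⟨rfl, hs⟩ | ⟨h1, h2, h3⟩, h4⟩
      · rcases Sym2.eq_iff.1 hs with ⟨rfl, rfl⟩ | ⟨rfl, rfl⟩
        · exact ⟨k₁, k₂, hK.link_e, rfl, rfl⟩
        · exact ⟨k₂, k₁, hK.link_e.symm, rfl, rfl⟩
      · obtain ⟨k, l, hkl, rfl, rfl⟩ := this.2 ⟨h3, h4⟩
        exact ⟨k, l, (hK.link _ _ _).2 (Or.inr ⟨h1, h2, hkl⟩), rfl, rfl⟩

/-- The result of smoothing over a 2-valent vertex. -/
theorem exists_smoothStep (G : Graph α β) {v x y : α} {e f : β} (h1 : G.degree v = 2)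
    (h2 : e ≠ f) (h3 : x ≠ v) (h4 : y ≠ v) (h5 : G.IsLink e v x) (h6 : G.IsLink f v y)
    (hG : G.IsFinite) : ∃ G', SmoothStep G G' v x y e f := by
  have hne : ∀ {d a c}, d ≠ e → d ≠ f → G.IsLink d a c → a ≠ v := by
    rintro d a c hd hd' hl rfl
    have hs : ({d, e, f} : Set β) ⊆ {d | G.Inc d a} := by
      rintro _ (rfl | rfl | rfl)
      · exact hl.inc_left
      · exact h5.inc_left
      · exact h6.inc_left
    have := Set.ncard_le_ncard hs (hG.inc_finite a)
    rw [Set.ncard_insert_of_notMem (by simp [hd, hd']), Set.ncard_pair h2] at this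
    rw [degree] at h1
    omega
  exact ⟨{ vertexSet := G.vertexSet \ {v}
           IsLink := fun d a c => (d = e ∧ s(a, c) = s(x, y)) ∨ (d ≠ e ∧ d ≠ f ∧ G.IsLink d a c)
           isLink_symm := by
             intro d _
             refine ⟨fun a c h => ?_⟩
             rcases h with ⟨rfl, hs⟩ | ⟨h1, h2, h3⟩
             · exact Or.inl ⟨rfl, by rw [← hs, Sym2.eq_swap]⟩
             · exact Or.inr ⟨h1, h2, h3.symm⟩
           eq_or_eq_of_isLink_of_isLink := by
             rintro d a c a' c' (⟨rfl, hs⟩ | ⟨h1, h2, h3⟩) (⟨h1', hs'⟩ | ⟨h1', h2', h3'⟩)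
             · rw [← hs', Sym2.eq_iff] at hs
               tauto
             · exact absurd rfl h1'
             · exact absurd h1' h1
             · exact h3.left_eq_or_eq h3'
           left_mem_of_isLink := by
             rintro d a c (⟨rfl, hs⟩ | ⟨h1, h2, h3⟩)
             · rcases Sym2.eq_iff.1 hs with ⟨rfl, rfl⟩ | ⟨rfl, rfl⟩
               · exact ⟨h5.right_mem, h3⟩
               · exact ⟨h6.right_mem, h4⟩
             · exact ⟨h3.left_mem, hne h1 h2 h3⟩ }, h1, h2, h3, h4, h5, h6, rfl, fun _ _ _ => Iff.rfl⟩

namespace ReductionData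

variable {K : Graph (α ⊕ Bool × Bool) β}

theorem glueEnds_eq_iff {x₀ : α} (hv : x₀ ≠ v) (hw : x₀ ≠ w) (k : α ⊕ Bool × Bool) :
    glueEnds v w k = x₀ ↔ k = Sum.inl x₀ := by
  rcases k with x | ⟨s, i⟩
  · simp [glueEnds]
  · cases s <;> simp [glueEnds, hv.symm, hw.symm]

theorem glueAcross_eq_iff {x₀ : α} (hv : x₀ ≠ v) (hw : x₀ ≠ w) (k : α ⊕ Bool × Bool) :
    glueAcross v w k = x₀ ↔ k = Sum.inl x₀ := by
  rcases k with x | ⟨s, i⟩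
  · simp [glueAcross]
  · cases i <;> simp [glueAcross, hv.symm, hw.symm]

theorem exists_retractsLeaf (h : ReductionData G G' b v w K) (hG : G.IsFinite)
    (hs : RetractsLeaf G G₂) (hb : G₂.IsBridge b) (hdv : G₂.degree v = G.degree v)
    (hdw : G₂.degree w = G.degree w) :
    ∃ G₂' K₂, ReductionData G₂ G₂' b v w K₂ ∧ RetractsLeaf G' G₂' := by
  have hlb : G₂.IsLink b v w := by
    obtain ⟨x, y, hl⟩ := Graph.exists_isLink_of_mem_edgeSet hb.1
    have h1 := (hs.link_iff.1 hl).1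
    exact (hl.isLink_iff_sym2_eq).2 ((h.link.isLink_iff_sym2_eq.1 h1).symm)
  have hs' := hs
  obtain ⟨x₀, hx₀, hdeg, rfl⟩ := hs
  have hv : x₀ ≠ v := fun h => ((deleteVerts_isLink _ _).1 hlb).2.1 h.symm
  have hw : x₀ ≠ w := fun h => ((deleteVerts_isLink _ _).1 hlb).2.2 h.symm
  -- The leaf does not hang at `v` or `w`, because the degrees of these vertices do not drop.
  have hno : ∀ d s k, K.IsLink d (Sum.inr s) k → k ≠ Sum.inl x₀ := by
    rintro d s _ hl rfl
    have h1 := (h.link_iff.2 ⟨_, _, hl, rfl, rfl⟩).1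
    have h2 : ¬ (G.deleteVerts {x₀}).Inc d (glueEnds v w (Sum.inr s)) := by
      rintro ⟨y, hy⟩
      rw [deleteVerts_isLink] at hy
      have := hy.1.right_unique h1
      exact hy.2.2 this
    have h3 := hs'.degree_lt hG h1.inc_left h2
    obtain ⟨s, i⟩ := s
    cases s
    · exact absurd hdv h3.ne
    · exact absurd hdw h3.ne
  refine ⟨G'.deleteVerts {x₀}, K.deleteVerts {Sum.inl x₀}, ⟨hb, hlb, ?_, ?_,
    map_deleteVerts h.ends (glueEnds_eq_iff hv hw),
    map_deleteVerts h.across (glueAcross_eq_iff hv hw), ?_⟩, x₀, ?_, ?_, rfl⟩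
  · rw [vertexSet_deleteVerts, vertexSet_deleteVerts, h.vert]
    ext k
    rcases k with x | s
    · simp
      tauto
    · simp
  · intro s
    rw [← h.degree s, Graph.degree, Graph.degree]
    have h1 : ∀ d k, (K.deleteVerts {Sum.inl x₀}).IsLink d (Sum.inr s) k ↔
        K.IsLink d (Sum.inr s) k := by
      intro d k
      rw [deleteVerts_isLink]
      exact ⟨fun h => h.1, fun h => ⟨h, by simp, hno d s k h⟩⟩
    simp only [Inc, ← isLink_self_iff, h1]
  · rw [deleteVerts_isLink]
    exact ⟨h.link', hv.symm, hw.symm⟩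
  · rw [h.vertexSet_eq]
    exact hx₀
  · rw [h.degree_eq hv hw, hdeg]

theorem exists_smoothsVertex (h : ReductionData G G' b v w K) (hG : G.IsFinite)
    (hs : SmoothsVertex G G₂) (hb : G₂.IsBridge b) (hvm : v ∈ G₂.vertexSet)
    (hwm : w ∈ G₂.vertexSet) :
    ∃ G₂' K₂, ReductionData G₂ G₂' b v w K₂ ∧ SmoothsVertex G' G₂' := by
  obtain ⟨x₀, y, z, e, f, hs⟩ := hs.exists_smoothStep
  have hv : x₀ ≠ v := by rw [hs.vert] at hvm; exact fun h => hvm.2 h.symm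
  have hw : x₀ ≠ w := by rw [hs.vert] at hwm; exact fun h => hwm.2 h.symm
  obtain ⟨hbe, hbf, hlb⟩ := hs.link_of_ne h.link hv.symm hw.symm
  obtain ⟨k₀, k₁, hk1, h01, h1⟩ := h.link_iff.1 ⟨hs.le, hbe.symm⟩
  obtain ⟨k₀', k₂, hk2, h02, h2⟩ := h.link_iff.1 ⟨hs.lf, hbf.symm⟩
  have hE := glueEnds_eq_iff (v := v) (w := w) hv hw
  have hA := glueAcross_eq_iff (v := v) (w := w) hv hw
  rw [hE] at h01 h02
  subst h01 h02
  have hk1x : k₁ ≠ Sum.inl x₀ := fun h => hs.xv (by rw [← h1]; exact (hE _).2 h)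
  have hk2x : k₂ ≠ Sum.inl x₀ := fun h => hs.yv (by rw [← h2]; exact (hE _).2 h)
  have hdK : K.degree (Sum.inl x₀) = 2 := by
    rw [← hs.degree, Graph.degree, Graph.degree]
    have e1 : {d | K.Inc d (Sum.inl x₀)} = {d | G.Inc d x₀} := by
      ext d
      constructor
      · rintro ⟨k, hk⟩
        exact ⟨_, (h.link_iff.2 ⟨_, _, hk, rfl, rfl⟩).1⟩
      · intro hd
        have hdb : d ≠ b := by
          rcases hs.inc_v hG hd with rfl | rfl
          · exact hbe.symm
          · exact hbf.symm
        obtain ⟨p, hp⟩ := hd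
        obtain ⟨k, l, hkl, hk, -⟩ := h.link_iff.1 ⟨hp, hdb⟩
        rw [hE] at hk
        subst hk
        exact ⟨_, hkl⟩
    have e2 : {d | K.IsLoopAt d (Sum.inl x₀)} = {d | G.IsLoopAt d x₀} := by
      ext d
      constructor
      · intro hk
        exact (h.link_iff.2 ⟨_, _, hk, rfl, rfl⟩).1
      · intro hd
        have hdb : d ≠ b := by
          rcases hs.inc_v hG hd.inc with rfl | rfl
          · exact hbe.symm
          · exact hbf.symm
        obtain ⟨k, l, hkl, hk, hl⟩ := h.link_iff.1 ⟨hd, hdb⟩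
        rw [hE] at hk hl
        subst hk hl
        exact hkl
    rw [e1, e2]
  obtain ⟨K₂, hK₂⟩ := exists_smoothStep K hdK hs.ne hk1x hk2x hk1 hk2 (h.finite_K hG)
  obtain ⟨G₂', hG₂'⟩ := exists_smoothStep G' (v := x₀) (x := glueAcross v w k₁)
    (y := glueAcross v w k₂) (e := e) (f := f)
    (by rw [h.degree_eq hv hw, hs.degree]) hs.ne (fun h => hk1x ((hA _).1 h))
    (fun h => hk2x ((hA _).1 h)) (h.link_iff'.2 ⟨_, _, hk1, rfl, rfl⟩).1
    (h.link_iff'.2 ⟨_, _, hk2, rfl, rfl⟩).1 (h.isFinite' hG)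
  subst h1 h2
  refine ⟨G₂', K₂, ⟨hb, hlb, ?_, ?_, hK₂.map_eq h.ends hE hs hbe.symm,
    hK₂.map_eq h.across hA hG₂' hbe.symm, ?_⟩, hG₂'.smoothsVertex⟩
  · rw [hK₂.vert, hs.vert, h.vert]
    ext k
    rcases k with x | s
    · simp
      tauto
    · simp
  · intro s
    rw [hK₂.degree_eq (h.finite_K hG) (by simp), h.degree s]
  · exact (hG₂'.link_of_ne h.link' hv.symm hw.symm).2.2

/-- Degrees can only drop during retraction, so if those of `v` and `w` agree at both ends of the
sequence, they never change in between. Cuts lift backwards, so `b` is a bridge all along. -/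
theorem exists_retract (h : ReductionData G G' b v w K) (hG : G.IsFinite)
    (hs : ReflTransGen RetractsLeaf G C) (hb : C.IsBridge b) (hdv : C.degree v = G.degree v)
    (hdw : C.degree w = G.degree w) :
    ∃ C' K₂, ReductionData C C' b v w K₂ ∧ ReflTransGen RetractsLeaf G' C' := by
  induction hs using ReflTransGen.head_induction_on generalizing G' K with
  | refl => exact ⟨G', K, h, .refl⟩
  | @head G G₂ hs hp ih =>
    have hG₂ := hs.isFinite hG
    have hr := isRetract_of_reflTransGen hG₂ hp
    have hbE : b ∈ G₂.edgeSet := by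
      obtain ⟨x, y, hl⟩ := Graph.exists_isLink_of_mem_edgeSet hb.1
      exact ((hr.link_iff _ _ _).1 hl).1.edge_mem
    have hb₂ : G₂.IsBridge b := by
      obtain ⟨χ, hχ⟩ := hr.exists_isCut b hb.1 (hb.exists_isCut hr.isFinite)
      exact hχ.isBridge hG₂ hbE
    have h1 := hr.degree_le v
    have h2 := hr.degree_le w
    have h3 := hs.degree_le hG v
    have h4 := hs.degree_le hG w
    obtain ⟨G₂', K₂, h5, h6⟩ := h.exists_retractsLeaf hG hs hb₂ (by omega) (by omega)
    obtain ⟨C', K₃, h7, h8⟩ := ih h5 hG₂ (by omega) (by omega)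
    exact ⟨C', K₃, h7, h8.head h6⟩

theorem exists_smoothing (h : ReductionData G G' b v w K) (hG : G.IsFinite)
    (hs : ReflTransGen SmoothsVertex G S) (hb : S.IsBridge b) (hv : v ∈ S.vertexSet)
    (hw : w ∈ S.vertexSet) :
    ∃ S' K₂, ReductionData S S' b v w K₂ ∧ ReflTransGen SmoothsVertex G' S' := by
  induction hs using ReflTransGen.head_induction_on generalizing G' K with
  | refl => exact ⟨G', K, h, .refl⟩
  | @head G G₂ hs hp ih =>
    have hG₂ : G₂.IsFinite := by
      obtain ⟨_, _, _, _, _, hs⟩ := hs.exists_smoothStep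
      exact hs.isFinite hG
    obtain ⟨m, hr⟩ := exists_isSmoothing hG₂ hp
    have hb₂ : G₂.IsBridge b := by
      obtain ⟨χ, hχ⟩ := hr.exists_isCut b hb.1 (hb.exists_isCut hr.isFinite)
      exact hχ.isBridge hG₂ (hr.edge_mem b hb.1).2
    obtain ⟨G₂', K₂, h5, h6⟩ := h.exists_smoothsVertex hG hs hb₂ (hr.subset hv) (hr.subset hw)
    obtain ⟨C', K₃, h7, h8⟩ := ih h5 hG₂
    exact ⟨C', K₃, h7, h8.head h6⟩

/-- A bridge reduction of a graph induces one of its skeleton. -/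
theorem exists_isSkeletonOf (h : ReductionData C D b v w K) (hC : C.IsFinite)
    (hS : IsSkeletonOf S C) (hb : S.IsBridge b) (hv : v ∈ S.vertexSet) (hw : w ∈ S.vertexSet)
    (hdv : S.degree v = C.degree v) (hdw : S.degree w = C.degree w) :
    ∃ S', IsSkeletonOf S' D ∧ IsBridgeReduction S S' := by
  obtain ⟨C', h1, h2, h3, h4⟩ := hS
  have hr := isRetract_of_reflTransGen hC h1
  obtain ⟨m, hm⟩ := exists_isSmoothing hr.isFinite h3
  have hb' : C'.IsBridge b := by
    obtain ⟨χ, hχ⟩ := hm.exists_isCut b hb.1 (hb.exists_isCut hm.isFinite)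
    exact hχ.isBridge hr.isFinite (hm.edge_mem b hb.1).2
  obtain ⟨D', K₂, h5, h6⟩ := h.exists_retract hC h1 hb' ((hm.degree_eq v hv).symm.trans hdv)
    ((hm.degree_eq w hw).symm.trans hdw)
  obtain ⟨S', K₃, h7, h8⟩ := h5.exists_smoothing hr.isFinite h3 hb hv hw
  -- The reduction creates two 3-valent vertices and keeps the other degrees, so no vertices of
  -- degree 1 or 2 appear and both stopping conditions persist.
  have key : ∀ {G G' : Graph α β} {K}, ReductionData G G' b v w K → G.IsFinite → ∀ n, n ≠ 3 →
      (∀ x ∈ G.vertexSet, G.degree x ≠ n) → ∀ x ∈ G'.vertexSet, G'.degree x ≠ n := by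
    intro G G' K h hG n hn hd x hx
    rw [h.vertexSet_eq] at hx
    by_cases hx' : x = v ∨ x = w
    · rw [h.degree_end hG hx']
      exact hn.symm
    · rw [not_or] at hx'
      rw [h.degree_eq hx'.1 hx'.2]
      exact hd x hx
  exact ⟨S', ⟨D', h6, key h5 hr.isFinite 1 (by simp) h2, h8, key h7 hm.isFinite 2 (by simp) h4⟩,
    h7.isBridgeReduction⟩

end ReductionData

/-! ### Transport along isomorphisms -/

namespace IsImage

variable {φ : α → α'} {ψ : β → β'} {H : Graph α' β'}

theorem exists_retractsLeaf (h : IsImage φ ψ G H) (hs : RetractsLeaf G G₂) :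
    ∃ H₂, IsImage φ ψ G₂ H₂ ∧ RetractsLeaf H H₂ := by
  obtain ⟨v, hv, hd, rfl⟩ := hs
  have hlink : ∀ d x y, (H.deleteVerts {φ v}).IsLink d x y ↔
      ∃ e a c, (G.deleteVerts {v}).IsLink e a c ∧ ψ e = d ∧ φ a = x ∧ φ c = y := by
    intro d x y
    rw [deleteVerts_isLink, h.link]
    constructor
    · rintro ⟨⟨e, a, c, hl, rfl, rfl, rfl⟩, h1, h2⟩
      exact ⟨e, a, c, by rw [deleteVerts_isLink]; exact ⟨hl, fun h => h1 (by rw [h]; rfl),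
        fun h => h2 (by rw [h]; rfl)⟩, rfl, rfl, rfl⟩
    · rintro ⟨e, a, c, hl, rfl, rfl, rfl⟩
      rw [deleteVerts_isLink] at hl
      exact ⟨⟨e, a, c, hl.1, rfl, rfl, rfl⟩, fun h' => hl.2.1 (h.injV hl.1.left_mem hv h'),
        fun h' => hl.2.2 (h.injV hl.1.right_mem hv h')⟩
  refine ⟨H.deleteVerts {φ v}, ⟨h.injV.mono (by simp), h.injE.mono ?_, ?_, hlink⟩, φ v, ?_, ?_, rfl⟩
  · exact deleteVerts_le.edgeSet_mono
  · rw [vertexSet_deleteVerts, vertexSet_deleteVerts, h.vert]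
    ext x
    simp only [Set.mem_sdiff, Set.mem_image, Set.mem_singleton_iff]
    constructor
    · rintro ⟨⟨a, ha, rfl⟩, hx⟩
      exact ⟨a, ⟨ha, fun h => hx (by rw [h])⟩, rfl⟩
    · rintro ⟨a, ⟨ha, hav⟩, rfl⟩
      exact ⟨⟨a, ha, rfl⟩, fun h' => hav (h.injV ha hv h')⟩
  · rw [h.vert]
    exact ⟨v, hv, rfl⟩
  · rw [h.degree_eq hv, hd]

theorem exists_smoothsVertex (h : IsImage φ ψ G H) (hs : SmoothsVertex G G₂) :
    ∃ H₂, IsImage φ ψ G₂ H₂ ∧ SmoothsVertex H H₂ := by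
  obtain ⟨v, x, y, e, f, hs⟩ := hs.exists_smoothStep
  have hE : Set.InjOn ψ G₂.edgeSet := h.injE.mono (by rw [hs.edge]; exact Set.sdiff_subset)
  have hV : Set.InjOn φ G₂.vertexSet := h.injV.mono (by rw [hs.vert]; exact Set.sdiff_subset)
  have hvV := hs.le.left_mem
  have hne : ∀ {a c}, a ∈ G.vertexSet → c ∈ G.vertexSet → a ≠ c → φ a ≠ φ c :=
    fun ha hc hac h' => hac (h.injV ha hc h')
  have hneE : ∀ {a c}, a ∈ G.edgeSet → c ∈ G.edgeSet → a ≠ c → ψ a ≠ ψ c :=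
    fun ha hc hac h' => hac (h.injE ha hc h')
  refine ⟨G₂.image φ ψ hE, isImage_image hV hE, SmoothStep.smoothsVertex (v := φ v) (x := φ x)
    (y := φ y) (e := ψ e) (f := ψ f) ⟨?_, hneE hs.le.edge_mem hs.lf.edge_mem hs.ne,
    hne hs.le.right_mem hvV hs.xv, hne hs.lf.right_mem hvV hs.yv, h.map_link hs.le,
    h.map_link hs.lf, ?_, ?_⟩⟩
  · rw [h.degree_eq hvV, hs.degree]
  · change φ '' G₂.vertexSet = _
    rw [hs.vert, h.vert]
    ext x
    simp only [Set.mem_sdiff, Set.mem_image, Set.mem_singleton_iff]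
    constructor
    · rintro ⟨a, ⟨ha, hav⟩, rfl⟩
      exact ⟨⟨a, ha, rfl⟩, hne ha hvV hav⟩
    · rintro ⟨⟨a, ha, rfl⟩, hx⟩
      exact ⟨a, ⟨ha, fun h => hx (by rw [h])⟩, rfl⟩
  · intro d p q
    change (∃ e a b, G₂.IsLink e a b ∧ ψ e = d ∧ φ a = p ∧ φ b = q) ↔ _
    constructor
    · rintro ⟨e', a, c, hl, rfl, rfl, rfl⟩
      rcases (hs.link _ _ _).1 hl with ⟨rfl, hs'⟩ | ⟨h1, h2, h3⟩
      · refine Or.inl ⟨rfl, ?_⟩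
        rcases Sym2.eq_iff.1 hs' with ⟨rfl, rfl⟩ | ⟨rfl, rfl⟩
        · rfl
        · exact Sym2.eq_swap
      · exact Or.inr ⟨hneE h3.edge_mem hs.le.edge_mem h1, hneE h3.edge_mem hs.lf.edge_mem h2,
          h.map_link h3⟩
    · rintro (⟨rfl, hs'⟩ | ⟨h1, h2, h3⟩)
      · rcases Sym2.eq_iff.1 hs' with ⟨rfl, rfl⟩ | ⟨rfl, rfl⟩
        · exact ⟨e, x, y, hs.link_e, rfl, rfl, rfl⟩
        · exact ⟨e, y, x, hs.link_e.symm, rfl, rfl, rfl⟩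
      · obtain ⟨e', a, c, hl, rfl, rfl, rfl⟩ := (h.link _ _ _).1 h3
        exact ⟨e', a, c, (hs.link _ _ _).2 (Or.inr ⟨fun h => h1 (by rw [h]),
          fun h => h2 (by rw [h]), hl⟩), rfl, rfl, rfl⟩

theorem exists_isSkeletonOf (h : IsImage φ ψ C H) (hS : IsSkeletonOf S C) :
    ∃ S', IsImage φ ψ S S' ∧ IsSkeletonOf S' H := by
  obtain ⟨C', h1, h2, h3, h4⟩ := hS
  have e1 : ∃ H', IsImage φ ψ C' H' ∧ ReflTransGen RetractsLeaf H H' := by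
    clear h2 h3
    induction h1 with
    | refl => exact ⟨H, h, .refl⟩
    | tail _ hs ih =>
      obtain ⟨H', h1, h2⟩ := ih
      obtain ⟨H₂, h3, h4⟩ := h1.exists_retractsLeaf hs
      exact ⟨H₂, h3, h2.tail h4⟩
  obtain ⟨H', h5, h6⟩ := e1
  have e2 : ∃ S', IsImage φ ψ S S' ∧ ReflTransGen SmoothsVertex H' S' := by
    clear h4
    induction h3 with
    | refl => exact ⟨H', h5, .refl⟩
    | tail _ hs ih =>
      obtain ⟨H', h1, h2⟩ := ih
      obtain ⟨H₂, h3, h4⟩ := h1.exists_smoothsVertex hs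
      exact ⟨H₂, h3, h2.tail h4⟩
  obtain ⟨S', h7, h8⟩ := e2
  refine ⟨S', h7, H', h6, ?_, h8, ?_⟩
  · rw [h5.vert]
    rintro _ ⟨a, ha, rfl⟩
    rw [h5.degree_eq ha]
    exact h2 a ha
  · rw [h7.vert]
    rintro _ ⟨a, ha, rfl⟩
    rw [h7.degree_eq ha]
    exact h4 a ha

theorem exists_isBridgeReduction [Nonempty α] [Nonempty β] (h : IsImage φ ψ G H)
    (hG : G.IsFinite) (hs : IsBridgeReduction G G₂) :
    ∃ H₂, IsImage φ ψ G₂ H₂ ∧ IsBridgeReduction H H₂ := by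
  obtain ⟨b, v, w, K, hs⟩ := hs.exists_reductionData
  have hE : Set.InjOn ψ G₂.edgeSet := by rw [hs.edgeSet_eq]; exact h.injE
  have hV : Set.InjOn φ G₂.vertexSet := by rw [hs.vertexSet_eq]; exact h.injV
  have hEK : Set.InjOn ψ K.edgeSet := h.injE.mono (by rw [hs.edge]; exact Set.sdiff_subset)
  have hVK : Set.InjOn (Sum.map φ (id : Bool × Bool → Bool × Bool)) K.vertexSet := by
    intro k hk l hl hkl
    rcases hs.mem_K hk with ⟨x, rfl, hx, -⟩ | ⟨s, rfl⟩ <;>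
      rcases hs.mem_K hl with ⟨y, rfl, hy, -⟩ | ⟨t, rfl⟩
    · simp only [Sum.map_inl, Sum.inl.injEq] at hkl
      rw [h.injV hx hy hkl]
    · simp at hkl
    · simp at hkl
    · simpa using hkl
  have hIm := isImage_image (G := K) hVK hEK
  have hG₂ := isImage_image (G := G₂) hV hE
  have hmap : ∀ {A : Graph α β} {B : Graph α' β'} {g : α ⊕ Bool × Bool → α}
      {g' : α' ⊕ Bool × Bool → α'}, IsImage φ ψ A B → b ∈ A.edgeSet →
      (∀ k, g' (Sum.map φ id k) = φ (g k)) →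
      K.map g = A.deleteEdges {b} → (K.image (Sum.map φ (id : Bool × Bool → Bool × Bool)) ψ hEK).map g' = B.deleteEdges {ψ b} := by
    intro A B g g' hAB hbA hg hK
    have hl : ∀ d x y, (K.map g).IsLink d x y ↔ (A.deleteEdges {b}).IsLink d x y := by
      intro d x y; rw [hK]
    have hv : (K.map g).vertexSet = (A.deleteEdges {b}).vertexSet := by rw [hK]
    rw [vertexSet_map, vertexSet_deleteEdges] at hv
    refine Graph.ext ?_ fun d x y => ?_
    · rw [vertexSet_map, vertexSet_deleteEdges, hAB.vert, ← hv]
      change g' '' (_ '' K.vertexSet) = _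
      rw [Set.image_image, Set.image_image]
      exact Set.image_congr fun k _ => hg k
    · rw [map_isLink, deleteEdges_isLink]
      constructor
      · rintro ⟨_, _, ⟨e, k, l, hkl, rfl, rfl, rfl⟩, rfl, rfl⟩
        have h1 := (hl e (g k) (g l)).1 (by rw [map_isLink]; exact ⟨k, l, hkl, rfl, rfl⟩)
        rw [deleteEdges_isLink] at h1
        rw [hg, hg]
        exact ⟨hAB.map_link h1.1, fun h' => h1.2 (hAB.injE h1.1.edge_mem hbA h')⟩
      · rintro ⟨h1, h2⟩
        obtain ⟨e, a, c, hac, rfl, rfl, rfl⟩ := (hAB.link _ _ _).1 h1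
        have h3 := (hl e a c).2 (by
          rw [deleteEdges_isLink]; exact ⟨hac, fun h => h2 (by rw [h]; rfl)⟩)
        rw [map_isLink] at h3
        obtain ⟨k, l, hkl, rfl, rfl⟩ := h3
        exact ⟨_, _, ⟨e, k, l, hkl, rfl, rfl, rfl⟩, hg k, hg l⟩
  refine ⟨_, hG₂, ψ b, φ v, φ w,
    K.image (Sum.map φ (id : Bool × Bool → Bool × Bool)) ψ hEK, (h.isBridge_iff hG hs.bridge.1).2 hs.bridge,
    h.map_link hs.link, ?_, ?_, ?_, ?_, hG₂.map_link hs.link'⟩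
  · change _ '' K.vertexSet = _
    rw [hs.vert, Set.image_union, Set.image_image, h.vert]
    congr 1
    · ext k
      constructor
      · rintro ⟨x, ⟨hx, hx'⟩, rfl⟩
        simp only [Set.mem_insert_iff, Set.mem_singleton_iff, not_or] at hx'
        refine ⟨φ x, ⟨⟨x, hx, rfl⟩, ?_⟩, rfl⟩
        rintro (h' | h')
        · exact hx'.1 (h.injV hx hs.link.left_mem h')
        · exact hx'.2 (h.injV hx hs.link.right_mem h')
      · rintro ⟨_, ⟨⟨x, hx, rfl⟩, hx'⟩, rfl⟩
        refine ⟨x, ⟨hx, ?_⟩, rfl⟩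
        rintro (rfl | rfl)
        · exact hx' (Or.inl rfl)
        · exact hx' (Or.inr rfl)
    · ext k
      simp
  · intro s
    have : (Sum.inr s : α ⊕ Bool × Bool) ∈ K.vertexSet := by rw [hs.vert]; exact Or.inr ⟨s, rfl⟩
    rw [← hs.degree s]
    exact hIm.degree_eq this
  · refine hmap h hs.bridge.1 ?_ hs.ends
    rintro (x | ⟨s, i⟩)
    · rfl
    · cases s <;> rfl
  · refine hmap hG₂ hs.link'.edge_mem ?_ hs.across
    rintro (x | ⟨s, i⟩)
    · rfl
    · cases i <;> rfl

end IsImage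

end Graph

/-! ### Constructing a bridge reduction by regrouping edges -/

namespace Graph

section Relabel

variable {α β γ : Type*} {G : Graph α β}

/-- The graph in which the end `x` of each edge `d` is moved to `pl d x`. -/
def relabel (G : Graph α β) (pl : β → α → γ) (V : Set γ)
    (hV : ∀ d x, G.Inc d x → pl d x ∈ V) : Graph γ β where
  vertexSet := V
  IsLink d k l := ∃ x y, G.IsLink d x y ∧ k = pl d x ∧ l = pl d y
  isLink_symm := by
    intro d _
    refine ⟨?_⟩
    rintro k l ⟨x, y, h, rfl, rfl⟩
    exact ⟨y, x, h.symm, rfl, rfl⟩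
  eq_or_eq_of_isLink_of_isLink := by
    rintro d _ _ _ _ ⟨x, y, h, rfl, rfl⟩ ⟨x', y', h', rfl, rfl⟩
    rcases h.eq_and_eq_or_eq_and_eq h' with ⟨rfl, rfl⟩ | ⟨rfl, rfl⟩ <;> simp
  left_mem_of_isLink := by
    rintro d _ _ ⟨x, y, h, rfl, rfl⟩
    exact hV _ _ h.inc_left

open Classical in
/-- The new end of `d` if the edges at `v` and `w` other than `b` are regrouped
according to `i`. -/
noncomputable def moveEnd (b : β) (v w : α) (i : β → Bool) (d : β) (x : α) : α :=
  if d ≠ b ∧ (x = v ∨ x = w) then (if i d then w else v) else x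

theorem moveEnd_mem {b : β} {v w : α} (hb : G.IsLink b v w) (i : β → Bool) (d : β) (x : α)
    (h : G.Inc d x) : moveEnd b v w i d x ∈ G.vertexSet := by
  unfold moveEnd
  split_ifs
  · exact hb.right_mem
  · exact hb.left_mem
  · exact h.vertex_mem

open Classical in
/-- The half of `v` or `w` that becomes the end of `d`. -/
noncomputable def splitEnd (v w : α) (i : β → Bool) (d : β) (x : α) : α ⊕ Bool × Bool :=
  if x = v then Sum.inr (false, i d) else if x = w then Sum.inr (true, i d) else Sum.inl x

/-- By `hi`, each of the two groups takes exactly one of the further edges at each end of `b`, which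
makes every half 1-valent. This is how a flip of the triangulation is recognised as a bridge
reduction. -/
theorem reductionData_relabel {b : β} {v w : α} (hG : G.IsFinite) (hb : G.IsBridge b)
    (hl : G.IsLink b v w) (hv : ∀ d, ¬ G.IsLink d v v) (hw : ∀ d, ¬ G.IsLink d w w)
    {i : β → Bool}
    (hi : ∀ u, u = v ∨ u = w → ∀ j, ∃ e, e ≠ b ∧ G.Inc e u ∧ i e = j ∧
      ∀ d, d ≠ b → G.Inc d u → i d = j → d = e) :
    ∃ K, ReductionData G (G.relabel (moveEnd b v w i) G.vertexSet (moveEnd_mem hl i)) b v w K := by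
  obtain ⟨χ, hχ⟩ := hb.exists_isCut hG
  have hne : v ≠ w := by rintro rfl; exact hv _ hl
  have huniq : ∀ d, G.IsLink d v w → d = b := by
    intro d hd
    exact (hχ hd).1 ((hχ hl).2 rfl)
  obtain ⟨K, hKv, hK⟩ : ∃ K : Graph (α ⊕ Bool × Bool) β,
      K.vertexSet = Sum.inl '' (G.vertexSet \ {v, w}) ∪ Set.range Sum.inr ∧
      ∀ d k l, K.IsLink d k l ↔ d ≠ b ∧
        ∃ x y, G.IsLink d x y ∧ k = splitEnd v w i d x ∧ l = splitEnd v w i d y := by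
    refine ⟨(G.deleteEdges {b}).relabel (splitEnd v w i)
      (Sum.inl '' (G.vertexSet \ {v, w}) ∪ Set.range Sum.inr) ?_, rfl, fun d k l => ⟨?_, ?_⟩⟩
    · intro d x hx
      unfold splitEnd
      split_ifs with h1 h2
      · exact Or.inr ⟨_, rfl⟩
      · exact Or.inr ⟨_, rfl⟩
      · exact Or.inl ⟨x, ⟨by simpa using hx.vertex_mem, by simp [h1, h2]⟩, rfl⟩
    · rintro ⟨x, y, h, rfl, rfl⟩
      rw [deleteEdges_isLink] at h
      exact ⟨h.2, x, y, h.1, rfl, rfl⟩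
    · rintro ⟨h, x, y, h1, rfl, rfl⟩
      exact ⟨x, y, by rw [deleteEdges_isLink]; exact ⟨h1, h⟩, rfl, rfl⟩
  have hends : ∀ d x, glueEnds v w (splitEnd v w i d x) = x := by
    intro d x
    unfold splitEnd
    split_ifs with h1 h2 <;> simp_all [glueEnds]
  have hacross : ∀ d x, d ≠ b → glueAcross v w (splitEnd v w i d x) = moveEnd b v w i d x := by
    intro d x hd
    unfold splitEnd moveEnd
    by_cases h1 : x = v
    · simp [h1, hd, glueAcross]
    · by_cases h2 : x = w
      · simp [h2, hne.symm, hd, glueAcross]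
      · simp [h1, h2, glueAcross]
  refine ⟨K, hb, hl, hKv, ?_, ?_, ?_, ?_⟩
  · rintro ⟨s, j⟩
    have hu : (if s then w else v) = v ∨ (if s then w else v) = w := by cases s <;> simp
    obtain ⟨e, he1, he2, he3, he4⟩ := hi _ hu j
    have hsplit : ∀ d x, splitEnd v w i d x = Sum.inr (s, j) ↔
        x = (if s then w else v) ∧ i d = j := by
      intro d x
      unfold splitEnd
      by_cases h1 : x = v
      · subst h1
        cases s <;> simp [hne]
      · by_cases h2 : x = w
        · subst h2
          cases s <;> simp [h1]
        · cases s <;> simp [h1, h2]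
    have hinc : {d | K.Inc d (Sum.inr (s, j))} = {e} := by
      ext d
      constructor
      · rintro ⟨l, hdl⟩
        obtain ⟨h1, x, y, h2, h3, -⟩ := (hK _ _ _).1 hdl
        obtain ⟨rfl, h4⟩ := (hsplit _ _).1 h3.symm
        exact he4 d h1 h2.inc_left h4
      · rintro rfl
        obtain ⟨y, hy⟩ := he2
        exact ⟨_, (hK _ _ _).2 ⟨he1, _, y, hy, ((hsplit _ _).2 ⟨rfl, he3⟩).symm, rfl⟩⟩
    have hloop : {d | K.IsLoopAt d (Sum.inr (s, j))} = ∅ := by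
      ext d
      simp only [Set.mem_ofPred_eq, Set.mem_empty_iff_false, iff_false]
      intro hd
      obtain ⟨h1, x, y, h2, h3, h4⟩ := (hK _ _ _).1 hd
      obtain ⟨rfl, -⟩ := (hsplit _ _).1 h3.symm
      obtain ⟨rfl, -⟩ := (hsplit _ _).1 h4.symm
      cases s
      · exact hv d h2
      · exact hw d h2
    rw [degree, hinc, hloop]
    simp
  · refine Graph.ext ?_ fun d x y => ?_
    · rw [vertexSet_map, vertexSet_deleteEdges, hKv]
      ext x
      constructor
      · rintro ⟨_, (⟨y, hy, rfl⟩ | ⟨⟨s, j⟩, rfl⟩), rfl⟩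
        · exact hy.1
        · cases s
          · exact hl.left_mem
          · exact hl.right_mem
      · intro hx
        by_cases h1 : x = v
        · exact ⟨Sum.inr (false, false), Or.inr ⟨_, rfl⟩, by simp [glueEnds, h1]⟩
        · by_cases h2 : x = w
          · exact ⟨Sum.inr (true, false), Or.inr ⟨_, rfl⟩, by simp [glueEnds, h2]⟩
          · exact ⟨Sum.inl x, Or.inl ⟨x, by simp [hx, h1, h2], rfl⟩, rfl⟩
    · rw [map_isLink, deleteEdges_isLink]
      constructor
      · rintro ⟨k, l, h, rfl, rfl⟩
        obtain ⟨h1, x, y, h2, rfl, rfl⟩ := (hK _ _ _).1 h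
        rw [hends, hends]
        exact ⟨h2, h1⟩
      · rintro ⟨h1, h2⟩
        exact ⟨_, _, (hK _ _ _).2 ⟨h2, x, y, h1, rfl, rfl⟩, hends _ _, hends _ _⟩
  · refine Graph.ext ?_ fun d x y => ?_
    · rw [vertexSet_map, vertexSet_deleteEdges, hKv]
      ext x
      constructor
      · rintro ⟨_, (⟨y, hy, rfl⟩ | ⟨⟨s, j⟩, rfl⟩), rfl⟩
        · exact hy.1
        · cases j
          · exact hl.left_mem
          · exact hl.right_mem
      · intro hx
        replace hx : x ∈ G.vertexSet := hx
        by_cases h1 : x = v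
        · exact ⟨Sum.inr (false, false), Or.inr ⟨_, rfl⟩, by simp [glueAcross, h1]⟩
        · by_cases h2 : x = w
          · exact ⟨Sum.inr (false, true), Or.inr ⟨_, rfl⟩, by simp [glueAcross, h2]⟩
          · exact ⟨Sum.inl x, Or.inl ⟨x, by simp [hx, h1, h2], rfl⟩, rfl⟩
    · rw [map_isLink, deleteEdges_isLink]
      constructor
      · rintro ⟨k, l, h, rfl, rfl⟩
        obtain ⟨h1, x, y, h2, rfl, rfl⟩ := (hK _ _ _).1 h
        rw [hacross _ _ h1, hacross _ _ h1]
        exact ⟨⟨x, y, h2, rfl, rfl⟩, h1⟩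
      · rintro ⟨⟨x, y, h1, rfl, rfl⟩, h2⟩
        exact ⟨_, _, (hK _ _ _).2 ⟨h2, x, y, h1, rfl, rfl⟩, hacross _ _ h2, hacross _ _ h2⟩
  · exact ⟨v, w, hl, by simp [moveEnd], by simp [moveEnd]⟩

end Relabel

/-! ### Counting cubic graphs -/

section Counting

variable {α β : Type*} {G : Graph α β}

/-- Incidences and loops are double counted separately. An edge contributes two incidences, or one
incidence and one loop. -/
theorem sum_degree (hG : G.IsFinite) :
    ∑ v ∈ hG.1.toFinset, G.degree v = 2 * G.edgeSet.ncard := by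
  classical
  have key : ∀ R : β → α → Prop, (∀ e v, R e v → e ∈ G.edgeSet ∧ v ∈ G.vertexSet) →
      ∑ v ∈ hG.1.toFinset, {e | R e v}.ncard = ∑ e ∈ hG.2.toFinset, {v | R e v}.ncard := by
    intro R hR
    have := Finset.sum_card_bipartiteAbove_eq_sum_card_bipartiteBelow (s := hG.1.toFinset)
      (t := hG.2.toFinset) (fun v e => R e v)
    convert this using 2 with v _ e _
    · rw [← Set.ncard_coe_finset]
      congr 1
      ext e
      simpa [Finset.bipartiteAbove] using fun h => (hR _ _ h).1
    · rw [← Set.ncard_coe_finset]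
      congr 1
      ext v
      simpa [Finset.bipartiteBelow] using fun h => (hR _ _ h).2
  unfold degree
  rw [Finset.sum_add_distrib, key (fun e v => G.Inc e v) (fun e v h => ⟨h.edge_mem, h.vertex_mem⟩),
    key (fun e v => G.IsLoopAt e v) (fun e v h => ⟨h.edge_mem, h.vertex_mem⟩),
    ← Finset.sum_add_distrib]
  rw [Finset.sum_congr rfl (g := fun _ => 2), Finset.sum_const, smul_eq_mul, mul_comm,
    ← Set.ncard_eq_toFinset_card _ hG.2]
  intro e he
  obtain ⟨x, y, hxy⟩ := G.exists_isLink_of_mem_edgeSet (by simpa using he)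
  have h1 : {v | G.Inc e v} = {x, y} := by
    ext v
    constructor
    · intro hv
      exact hv.eq_or_eq_of_isLink hxy
    · rintro (rfl | rfl)
      · exact hxy.inc_left
      · exact hxy.inc_right
  rw [h1]
  by_cases h : x = y
  · subst h
    have h2 : {v | G.IsLoopAt e v} = {x} := by
      ext v
      constructor
      · intro hv
        exact hv.inc.eq_or_eq_of_isLink hxy |>.elim id id
      · rintro rfl
        exact hxy
    rw [h2]
    simp
  · have h2 : {v | G.IsLoopAt e v} = ∅ := by
      ext v
      simp only [Set.mem_ofPred_eq, Set.mem_empty_iff_false, iff_false]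
      intro hv
      rcases hxy.eq_and_eq_or_eq_and_eq hv with ⟨h3, h4⟩ | ⟨h3, h4⟩ <;> exact h (h3.trans h4.symm)
    rw [h2, Set.ncard_pair h]
    simp

theorem Good.three_mul_card (hG : G.Good) : 3 * G.vertexSet.ncard = 2 * G.edgeSet.ncard := by
  rw [← sum_degree hG.isFinite, Finset.sum_congr rfl (g := fun _ => 3), Finset.sum_const,
    smul_eq_mul, mul_comm, ← Set.ncard_eq_toFinset_card _ hG.isFinite.1]
  intro v hv
  exact hG.degree v (by simpa using hv)

end Counting

/-- There are finitely many isomorphism classes of graphs with given numbers of vertices and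
edges. -/
theorem finite_classes_of_card (n m : ℕ) : {c | ∃ G : Graph ℕ ℕ, graphClass G = c ∧ G.IsFinite ∧
    G.vertexSet.ncard = n ∧ G.edgeSet.ncard = m}.Finite := by
  classical
  -- After numbering the vertices, a graph is determined up to isomorphism by its matrix of edge
  -- multiplicities, whose entries are at most `m`.
  refine (Set.finite_iUnion (ι := Fin n → Fin n → Fin (m + 1))
    (f := fun M => {c | ∃ G : Graph ℕ ℕ, graphClass G = c ∧ ∃ φ : G.vertexSet ≃ Fin n,
      ∀ v w : G.vertexSet, {e | G.IsLink e v w}.ncard = M (φ v) (φ w)}) ?_).subset ?_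
  · intro M
    refine Set.Subsingleton.finite ?_
    rintro _ ⟨G, rfl, φ, hφ⟩ _ ⟨G', rfl, φ', hφ'⟩
    refine Quotient.sound ⟨φ.trans φ'.symm, fun v w => ?_⟩
    rw [hφ, hφ']
    simp
  · rintro _ ⟨G, rfl, hG, hn, hm⟩
    have := hG.1.to_subtype
    have hc : Nat.card G.vertexSet = n := by rw [Nat.card_coe_set_eq, hn]
    let φ : G.vertexSet ≃ Fin n := (Finite.equivFin _).trans (finCongr hc)
    refine Set.mem_iUnion.2 ⟨fun a b => ⟨{e | G.IsLink e (φ.symm a) (φ.symm b)}.ncard, ?_⟩,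
      G, rfl, φ, fun v w => ?_⟩
    · rw [Nat.lt_succ_iff, ← hm]
      exact Set.ncard_le_ncard (fun e he => he.edge_mem) hG.2
    · simp

/-- A cubic graph of genus `g` has 2g - 2 vertices and 3g - 3 edges. -/
theorem finite_classes_good (g : ℤ) : {c | ∃ G : Graph ℕ ℕ, graphClass G = c ∧ G.Good ∧
    G.genus = g}.Finite := by
  refine (finite_classes_of_card (2 * g - 2).toNat (3 * g - 3).toNat).subset ?_
  rintro _ ⟨G, rfl, hG, rfl⟩
  have h := hG.three_mul_card
  refine ⟨G, rfl, hG.isFinite, ?_, ?_⟩ <;> simp only [genus] <;> omega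

end Graph

/-! ### Areas, differences of terms, and crossing an edge of the subdivision -/

namespace TropicalPolynomial

section Area

variable {p q r x y : ℤ × ℤ}

theorem doubleArea_swap (p q r : ℤ × ℤ) : doubleArea q p r = -doubleArea p q r := by
  simp only [doubleArea]; ring

theorem doubleArea_rotate (p q r : ℤ × ℤ) : doubleArea q r p = doubleArea p q r := by
  simp only [doubleArea]; ring

theorem doubleArea_swap_right (p q r : ℤ × ℤ) : doubleArea p r q = -doubleArea p q r := by
  simp only [doubleArea]; ring

@[simp] theorem doubleArea_self_left (p q : ℤ × ℤ) : doubleArea p q p = 0 := by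
  simp only [doubleArea]; ring

@[simp] theorem doubleArea_self_right (p q : ℤ × ℤ) : doubleArea p q q = 0 := by
  simp only [doubleArea]; ring

@[simp] theorem doubleArea_self (p q : ℤ × ℤ) : doubleArea p p q = 0 := by
  simp only [doubleArea]; ring

/-- Twice the signed area of a triangle with a real vertex `z`. -/
def realArea (p q : ℤ × ℤ) (z : ℝ × ℝ) : ℝ :=
  ((q.1 : ℝ) - p.1) * (z.2 - p.2) - ((q.2 : ℝ) - p.2) * (z.1 - p.1)

theorem doubleArea_cast (p q x : ℤ × ℤ) :
    ((doubleArea p q x : ℤ) : ℝ) = ((q.1 : ℝ) - p.1) * ((x.2 : ℝ) - p.2) -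
      ((q.2 : ℝ) - p.2) * ((x.1 : ℝ) - p.1) := by
  simp [doubleArea]

theorem area_cases {a : ℤ} (h : |a| = 1) : a = 1 ∨ a = -1 := by
  rcases abs_choice a with h' | h' <;> omega

theorem ne_of_doubleArea_ne_zero (h : doubleArea p q r ≠ 0) : p ≠ q ∧ p ≠ r ∧ q ≠ r := by
  refine ⟨?_, ?_, ?_⟩ <;> rintro rfl <;> simp at h

end Area

/-- The vector `q - p` turned by a right angle. -/
def perp (p q : ℤ × ℤ) : ℝ × ℝ := (-((q.2 : ℝ) - p.2), (q.1 : ℝ) - p.1)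

/-- The value of the linear functional `d` at the vector from `p` to `x`. -/
def along (d : ℝ × ℝ) (p x : ℤ × ℤ) : ℝ := ((x.1 : ℝ) - p.1) * d.1 + ((x.2 : ℝ) - p.2) * d.2

theorem along_perp (p q x : ℤ × ℤ) : along (perp p q) p x = doubleArea p q x := by
  rw [doubleArea_cast]; simp only [along, perp]; ring

@[simp] theorem along_self (d : ℝ × ℝ) (p : ℤ × ℤ) : along d p p = 0 := by simp [along]

theorem along_smul (s : ℝ) (d : ℝ × ℝ) (p x : ℤ × ℤ) : along (s • d) p x = s * along d p x := by
  simp only [along, Prod.smul_fst, Prod.smul_snd, smul_eq_mul]; ring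

theorem along_sub_right (d : ℝ × ℝ) (p x y : ℤ × ℤ) : along d x y = along d p y - along d p x := by
  simp only [along]; ring

/-- A vector orthogonal to `q - p` is a multiple of `perp p q`. -/
theorem exists_eq_smul_perp {p q : ℤ × ℤ} (hpq : p ≠ q) {d : ℝ × ℝ} (h : along d p q = 0) :
    ∃ t : ℝ, d = t • perp p q := by
  have hne : ((q.1 : ℝ) - p.1) ^ 2 + ((q.2 : ℝ) - p.2) ^ 2 ≠ 0 := by
    intro h0
    have h1 : ((q.1 : ℝ) - p.1) = 0 := by nlinarith [sq_nonneg ((q.1 : ℝ) - p.1), sq_nonneg ((q.2 : ℝ) - p.2)]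
    have h2 : ((q.2 : ℝ) - p.2) = 0 := by nlinarith [sq_nonneg ((q.1 : ℝ) - p.1), sq_nonneg ((q.2 : ℝ) - p.2)]
    refine hpq (Prod.ext ?_ ?_)
    · exact_mod_cast (sub_eq_zero.1 h1).symm
    · exact_mod_cast (sub_eq_zero.1 h2).symm
  simp only [along] at h
  refine ⟨(-((q.2 : ℝ) - p.2) * d.1 + ((q.1 : ℝ) - p.1) * d.2) /
    (((q.1 : ℝ) - p.1) ^ 2 + ((q.2 : ℝ) - p.2) ^ 2), Prod.ext ?_ ?_⟩
  · simp only [perp, Prod.smul_fst, smul_eq_mul]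
    field_simp
    linear_combination ((q.1 : ℝ) - p.1) * h
  · simp only [perp, Prod.smul_snd, smul_eq_mul]
    field_simp
    linear_combination ((q.2 : ℝ) - p.2) * h

/-- A functional vanishing along two sides of a nondegenerate triangle is zero. -/
theorem eq_zero_of_along {p q r : ℤ × ℤ} (h : doubleArea p q r ≠ 0) {d : ℝ × ℝ}
    (hq : along d p q = 0) (hr : along d p r = 0) : d = 0 := by
  have h' : ((doubleArea p q r : ℤ) : ℝ) ≠ 0 := by exact_mod_cast h
  obtain ⟨t, rfl⟩ := exists_eq_smul_perp (ne_of_doubleArea_ne_zero h).1 hq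
  rw [along_smul, along_perp] at hr
  rw [(mul_eq_zero.1 hr).resolve_right h', zero_smul]

variable {f : TropicalPolynomial} {p q r x y : ℤ × ℤ} {u w : ℝ × ℝ}

/-- Moving the point by `d` changes differences of terms by a linear functional of the exponents.
All statements about the geometry of the curve are derived from this identity. -/
theorem term_sub (f : TropicalPolynomial) (p x : ℤ × ℤ) (w d : ℝ × ℝ) :
    f.term x (w + d) - f.term p (w + d) = f.term x w - f.term p w + along d p x := by
  simp only [term, along, Prod.fst_add, Prod.snd_add]; ring

theorem mem_minimizers_iff (hp : p ∈ f.minimizers w) :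
    x ∈ f.minimizers w ↔ x ∈ f.support ∧ f.term x w = f.term p w := by
  constructor
  · intro hx
    exact ⟨hx.1, le_antisymm (hx.2 _ hp.1) (hp.2 _ hx.1)⟩
  · rintro ⟨h1, h2⟩
    exact ⟨h1, fun q hq => h2 ▸ hp.2 q hq⟩

theorem term_eq (hp : p ∈ f.minimizers w) (hx : x ∈ f.minimizers w) : f.term x w = f.term p w :=
  ((mem_minimizers_iff hp).1 hx).2

theorem lt_of_notMem (hp : p ∈ f.minimizers w) (hx : x ∈ f.support) (h : x ∉ f.minimizers w) :
    f.term p w < f.term x w := by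
  refine lt_of_le_of_ne (hp.2 _ hx) fun h' => h ((mem_minimizers_iff hp).2 ⟨hx, h'.symm⟩)

theorem exists_mem_minimizers (h : f.support.Nonempty) (w : ℝ × ℝ) : ∃ p, p ∈ f.minimizers w := by
  obtain ⟨p, hp, h⟩ := f.support.exists_min_image (fun p => f.term p w) h
  exact ⟨p, hp, h⟩

/-- Moving from `w` in the direction `d`, as long as `p` stays a minimizer. -/
theorem exists_shoot (hp : p ∈ f.minimizers w) (d : ℝ × ℝ)
    (h : ∃ r ∈ f.support, along d p r < 0) :
    ∃ t : ℝ, 0 ≤ t ∧ ((∀ q ∈ f.minimizers w, 0 ≤ along d p q) → 0 < t) ∧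
      p ∈ f.minimizers (w + t • d) ∧
      (∃ x ∈ f.minimizers (w + t • d), along d p x < 0) ∧
      ∀ q ∈ f.minimizers w, along d p q = 0 → q ∈ f.minimizers (w + t • d) := by
  classical
  have hterm : ∀ (t : ℝ) x, f.term x (w + t • d) - f.term p (w + t • d) =
      f.term x w - f.term p w + t * along d p x := by
    intro t x
    rw [term_sub, along_smul]
  -- The parameter `t` is the first time at which a descending term catches up with the term of `p`.
  obtain ⟨x, hx, hmin⟩ := (f.support.filter (fun x => along d p x < 0)).exists_min_image
    (fun x => (f.term x w - f.term p w) / (-along d p x))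
    (by obtain ⟨r, hr, hr'⟩ := h; exact ⟨r, Finset.mem_filter.2 ⟨hr, hr'⟩⟩)
  rw [Finset.mem_filter] at hx
  set t := (f.term x w - f.term p w) / (-along d p x) with ht
  have hneg : 0 < -along d p x := by linarith [hx.2]
  have ht0 : 0 ≤ t := div_nonneg (by linarith [hp.2 x hx.1]) hneg.le
  have hp' : p ∈ f.minimizers (w + t • d) := by
    refine ⟨hp.1, fun y hy => ?_⟩
    have h1 := hterm t y
    have h2 := hp.2 y hy
    by_cases hy' : along d p y < 0
    · have h3 := hmin y (Finset.mem_filter.2 ⟨hy, hy'⟩)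
      change t ≤ _ at h3
      rw [le_div_iff₀ (by linarith)] at h3
      nlinarith
    · nlinarith [mul_nonneg ht0 (not_lt.1 hy')]
  have hx0 : t * -along d p x = f.term x w - f.term p w := div_mul_cancel₀ _ hneg.ne'
  refine ⟨t, ht0, ?_, hp', ⟨x, ?_, hx.2⟩, ?_⟩
  · intro hall
    refine div_pos ?_ hneg
    have := lt_of_notMem hp hx.1 (fun hx' => by linarith [hall x hx'])
    linarith
  · rw [mem_minimizers_iff hp']
    refine ⟨hx.1, ?_⟩
    have h1 := hterm t x
    nlinarith
  · intro q hq hq0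
    rw [mem_minimizers_iff hp']
    have h1 := hterm t q
    rw [hq0, term_eq hp hq] at h1
    exact ⟨hq.1, by linarith⟩

/-- A point is determined by three non-collinear minimizers. -/
theorem eq_of_mem_minimizers (h : doubleArea p q r ≠ 0) (hp : p ∈ f.minimizers u)
    (hq : q ∈ f.minimizers u) (hr : r ∈ f.minimizers u) (hp' : p ∈ f.minimizers w)
    (hq' : q ∈ f.minimizers w) (hr' : r ∈ f.minimizers w) : u = w := by
  have key : ∀ x, x ∈ f.minimizers u → x ∈ f.minimizers w → along (u - w) p x = 0 := by
    intro x h1 h2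
    have := term_sub f p x w (u - w)
    rw [add_sub_cancel, term_eq hp h1, term_eq hp' h2] at this
    linarith
  exact sub_eq_zero.1 (eq_zero_of_along h (key q hq hq') (key r hr hr'))

/-- The vertices of the tropical curve. -/
def IsVertex (f : TropicalPolynomial) (w : ℝ × ℝ) : Prop := IsTwoDimensional (f.minimizers w)

theorem IsVertex.eq_of_subset (h : f.IsVertex u) (h' : f.minimizers u ⊆ f.minimizers w) : u = w := by
  obtain ⟨p, hp, q, hq, r, hr, ha⟩ := h
  exact eq_of_mem_minimizers ha hp hq hr (h' hp) (h' hq) (h' hr)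

theorem finite_isVertex (f : TropicalPolynomial) : {w | f.IsVertex w}.Finite := by
  refine Set.Finite.of_finite_image (f := f.minimizers)
    (f.support.finite_toSet.finite_subsets.subset ?_) ?_
  · rintro _ ⟨w, -, rfl⟩
    exact fun x hx => hx.1
  · intro u hu w _ h
    exact IsVertex.eq_of_subset hu h.subset

theorem isVertex_of_mem (h : doubleArea p q r ≠ 0) (hp : p ∈ f.minimizers w)
    (hq : q ∈ f.minimizers w) (hr : r ∈ f.minimizers w) : f.IsVertex w :=
  ⟨p, hp, q, hq, r, hr, h⟩

/-- An edge of the dual subdivision lies in a triangle on each side on which there are points. -/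
theorem exists_cross (hp : p ∈ f.minimizers w) (hq : q ∈ f.minimizers w)
    (h : ∃ r ∈ f.support, doubleArea p q r < 0) :
    ∃ t : ℝ, 0 ≤ t ∧ ((∀ x ∈ f.minimizers w, 0 ≤ doubleArea p q x) → 0 < t) ∧
      p ∈ f.minimizers (w + t • perp p q) ∧ q ∈ f.minimizers (w + t • perp p q) ∧
      ∃ x ∈ f.minimizers (w + t • perp p q), doubleArea p q x < 0 := by
  obtain ⟨t, h1, h2, h3, ⟨x, h4, h5⟩, h6⟩ := exists_shoot hp (perp p q) (by
    obtain ⟨r, hr, hr'⟩ := h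
    exact ⟨r, hr, by rw [along_perp]; exact_mod_cast hr'⟩)
  refine ⟨t, h1, fun h => h2 fun x hx => ?_, h3, h6 q hq (by simp [along_perp]), x, h4, ?_⟩
  · rw [along_perp]
    exact_mod_cast h x hx
  · rw [along_perp] at h5
    exact_mod_cast h5

theorem IsTwoDimensional.exists_doubleArea_ne {C : Set (ℤ × ℤ)} (h : IsTwoDimensional C)
    (hpq : p ≠ q) : ∃ r ∈ C, doubleArea p q r ≠ 0 := by
  by_contra! hall
  obtain ⟨a, ha, b, hb, c, hc, habc⟩ := h
  have h1 := hall a ha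
  have h2 := hall b hb
  have h3 := hall c hc
  have hR : ∀ z, doubleArea p q z = 0 → along (perp p q) a z = 0 := by
    intro z hz
    rw [along_sub_right _ p, along_perp, along_perp, hz, h1]
    simp
  have := eq_zero_of_along habc (hR b h2) (hR c h3)
  rw [Prod.ext_iff] at this
  simp only [perp, Prod.fst_zero, Prod.snd_zero, neg_eq_zero] at this
  refine hpq (Prod.ext ?_ ?_)
  · exact_mod_cast (sub_eq_zero.1 this.2).symm
  · exact_mod_cast (sub_eq_zero.1 this.1).symm

namespace IsSmooth

variable (hf : f.IsSmooth)
include hf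

theorem nonempty : f.support.Nonempty := by
  obtain ⟨p, hp, -⟩ := hf.1
  exact ⟨p, hp⟩

/-- Any minimizer at a vertex spans a unimodular triangle with the two others. -/
theorem exists_triangle (hw : f.IsVertex w) (hp : p ∈ f.minimizers w) :
    ∃ q r, f.minimizers w = {p, q, r} ∧ doubleArea p q r = 1 := by
  obtain ⟨a, b, c, h, hA⟩ := hf.2 w hw
  rw [h] at hp ⊢
  have key : ∀ a b c : ℤ × ℤ, |doubleArea a b c| = 1 →
      ∃ q r, ({a, b, c} : Set (ℤ × ℤ)) = {a, q, r} ∧ doubleArea a q r = 1 := by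
    intro a b c hA
    rcases area_cases hA with h | h
    · exact ⟨b, c, rfl, h⟩
    · exact ⟨c, b, by rw [Set.pair_comm], by rw [doubleArea_swap_right, h]; rfl⟩
  rcases hp with rfl | rfl | hp
  · exact key _ _ _ hA
  · rw [Set.insert_comm]
    exact key _ _ _ (by rw [doubleArea_swap, abs_neg]; exact hA)
  · rw [Set.mem_singleton_iff] at hp
    subst hp
    have : ({a, b, p} : Set (ℤ × ℤ)) = {p, a, b} := by
      rw [Set.pair_comm, Set.insert_comm]
    rw [this]
    exact key _ _ _ (by rw [← doubleArea_rotate]; exact hA)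

theorem exists_triangle_of_ne (hw : f.IsVertex w) (hp : p ∈ f.minimizers w)
    (hq : q ∈ f.minimizers w) (hpq : p ≠ q) :
    ∃ r, f.minimizers w = {p, q, r} ∧ |doubleArea p q r| = 1 := by
  obtain ⟨a, b, h, hA⟩ := hf.exists_triangle hw hp
  rw [h] at hq
  rcases hq with rfl | rfl | hq
  · exact absurd rfl hpq
  · exact ⟨b, h, by rw [hA]; rfl⟩
  · rw [Set.mem_singleton_iff] at hq
    subst hq
    exact ⟨a, by rw [h, Set.pair_comm], by rw [doubleArea_swap_right, hA]; rfl⟩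

theorem eq_triangle (hw : f.IsVertex w) (hp : p ∈ f.minimizers w)
    (hq : q ∈ f.minimizers w) (hr : r ∈ f.minimizers w) (h : doubleArea p q r ≠ 0) :
    f.minimizers w = {p, q, r} ∧ |doubleArea p q r| = 1 := by
  obtain ⟨a, h1, h2⟩ := hf.exists_triangle_of_ne hw hp hq (ne_of_doubleArea_ne_zero h).1
  have : r = a := by
    rw [h1] at hr
    rcases hr with rfl | rfl | hr
    · simp at h
    · simp at h
    · exact hr
  subst this
  exact ⟨h1, h2⟩

/-- Crossing the edge `pq` of the triangle dual to `w`. -/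
theorem exists_cross (hm : f.minimizers w = {p, q, r})
    (hA : doubleArea p q r = 1) (h : ∃ x ∈ f.support, doubleArea p q x < 0) :
    ∃ t : ℝ, 0 < t ∧ ∃ r', f.minimizers (w + t • perp p q) = {p, q, r'} ∧
      doubleArea p q r' = -1 := by
  obtain ⟨t, -, h2, h3, h4, x, h5, h6⟩ := TropicalPolynomial.exists_cross (f := f) (w := w)
    (p := p) (q := q) (by simp [hm]) (by simp [hm]) h
  refine ⟨t, h2 ?_, x, ?_⟩
  · rw [hm]
    rintro x (rfl | rfl | rfl)
    · simp
    · simp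
    · rw [hA]; norm_num
  · have hv := isVertex_of_mem h6.ne h3 h4 h5
    obtain ⟨h7, h8⟩ := hf.eq_triangle hv h3 h4 h5 h6.ne
    refine ⟨h7, ?_⟩
    rcases area_cases h8 with h | h <;> omega

end IsSmooth

theorem isVertex_triangle (hm : f.minimizers w = {p, q, r}) (hA : doubleArea p q r ≠ 0) :
    f.IsVertex w := isVertex_of_mem hA (by simp [hm]) (by simp [hm]) (by simp [hm])

/-- Triangles on both sides of a common edge. -/
theorem doubleArea_mul_neg (hpq : p ≠ q) (hp : p ∈ f.minimizers u) (hq : q ∈ f.minimizers u)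
    (hp' : p ∈ f.minimizers w) (hq' : q ∈ f.minimizers w) (hr : r ∈ f.minimizers u)
    (hx : x ∈ f.minimizers w) (hr0 : doubleArea p q r ≠ 0) (hx0 : doubleArea p q x ≠ 0)
    (huw : u ≠ w) : doubleArea p q r * doubleArea p q x < 0 := by
  have h0 : ∀ z, f.term z u - f.term p u = f.term z w - f.term p w + along (u - w) p z := by
    intro z
    rw [← term_sub, add_sub_cancel]
  -- Since `p` and `q` tie at both points, `u - w` is a multiple of `perp p q`. The term of `r` is
  -- minimal at `u` but not at `w`, that of `x` conversely, so `t` times the two areas has opposite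
  -- signs.
  obtain ⟨t, ht⟩ := exists_eq_smul_perp hpq (d := u - w) (by
    have := h0 q
    rw [term_eq hp hq, term_eq hp' hq'] at this
    linarith)
  have h1 := h0 r
  have h2 := h0 x
  rw [ht, along_smul, along_perp, term_eq hp hr] at h1
  rw [ht, along_smul, along_perp, term_eq hp' hx] at h2
  have h3 : f.term p w < f.term r w := lt_of_notMem hp' hr.1
    fun h => huw (eq_of_mem_minimizers hr0 hp hq hr hp' hq' h)
  have h4 : f.term p u < f.term x u := lt_of_notMem hp hx.1
    fun h => huw (eq_of_mem_minimizers hx0 hp hq h hp' hq' hx)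
  have h5 : t * (doubleArea p q r : ℤ) < 0 := by linarith
  have h6 : 0 < t * (doubleArea p q x : ℤ) := by linarith
  by_contra hcon
  have h7 : (0 : ℝ) ≤ (doubleArea p q r : ℤ) * (doubleArea p q x : ℤ) := by
    exact_mod_cast not_lt.1 hcon
  nlinarith [mul_neg_of_neg_of_pos h5 h6, mul_nonneg (sq_nonneg t) h7]

end TropicalPolynomial

/-! ### Connectedness of the tropical curve -/

namespace TropicalPolynomial

variable {f : TropicalPolynomial} {p q r x y : ℤ × ℤ} {u w : ℝ × ℝ}

theorem adj_iff : f.curveGraph.Adj u w ↔ f.IsVertex u ∧ f.IsVertex w ∧ u ≠ w ∧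
    (f.minimizers u ∩ f.minimizers w).Nontrivial :=
  ⟨fun ⟨_, h⟩ => ⟨h.1, h.2.1, h.2.2.1, h.2.2.2.1⟩,
    fun h => ⟨s(u, w), h.1, h.2.1, h.2.2.1, h.2.2.2, rfl⟩⟩

theorem exists_isVertex_of_pair (h2 : IsTwoDimensional (f.support : Set (ℤ × ℤ))) (hpq : p ≠ q)
    (hp : p ∈ f.minimizers w) (hq : q ∈ f.minimizers w) :
    ∃ u, f.IsVertex u ∧ p ∈ f.minimizers u ∧ q ∈ f.minimizers u := by
  obtain ⟨r, hr, hA⟩ := h2.exists_doubleArea_ne hpq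
  rcases hA.lt_or_gt with h | h
  · obtain ⟨t, -, -, h3, h4, x, h5, h6⟩ := exists_cross hp hq ⟨r, hr, h⟩
    exact ⟨_, isVertex_of_mem h6.ne h3 h4 h5, h3, h4⟩
  · obtain ⟨t, -, -, h3, h4, x, h5, h6⟩ := exists_cross hq hp
      ⟨r, hr, by rw [doubleArea_swap]; omega⟩
    exact ⟨_, isVertex_of_mem h6.ne h3 h4 h5, h4, h3⟩

/-- Moving in the direction `p - r` lowers the term of `r` relative to that of `p`, so `p` and a
second exponent become minimal on the way; from such a pair one moves on to a vertex. -/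
theorem exists_isVertex_of_mem (h2 : IsTwoDimensional (f.support : Set (ℤ × ℤ)))
    (hp : p ∈ f.minimizers w) : ∃ u, f.IsVertex u ∧ p ∈ f.minimizers u := by
  obtain ⟨r, hr, hrp⟩ : ∃ r ∈ f.support, r ≠ p := by
    obtain ⟨a, ha, b, hb, c, hc, habc⟩ := h2
    by_cases h : a = p
    · exact ⟨b, hb, h ▸ (ne_of_doubleArea_ne_zero habc).1.symm⟩
    · exact ⟨a, ha, h⟩
  have hpos : 0 < ((r.1 : ℝ) - p.1) ^ 2 + ((r.2 : ℝ) - p.2) ^ 2 := by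
    by_contra h
    have h1 : ((r.1 : ℝ) - p.1) = 0 := by
      nlinarith [sq_nonneg ((r.1 : ℝ) - p.1), sq_nonneg ((r.2 : ℝ) - p.2)]
    have h2 : ((r.2 : ℝ) - p.2) = 0 := by
      nlinarith [sq_nonneg ((r.1 : ℝ) - p.1), sq_nonneg ((r.2 : ℝ) - p.2)]
    refine hrp (Prod.ext ?_ ?_)
    · exact_mod_cast sub_eq_zero.1 h1
    · exact_mod_cast sub_eq_zero.1 h2
  obtain ⟨t, -, -, h3, ⟨x, h4, h5⟩, -⟩ := exists_shoot hp
    (-((r.1 : ℝ) - p.1), -((r.2 : ℝ) - p.2)) ⟨r, hr, by simp only [along]; nlinarith⟩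
  have hx : p ≠ x := by rintro rfl; simp at h5
  obtain ⟨u, h6, h7, -⟩ := exists_isVertex_of_pair h2 hx h3 h4
  exact ⟨u, h6, h7⟩

theorem IsSmooth.exists_isVertex (hf : f.IsSmooth) : ∃ u, f.IsVertex u := by
  obtain ⟨p, hp⟩ := exists_mem_minimizers hf.nonempty 0
  obtain ⟨u, hu, -⟩ := exists_isVertex_of_mem hf.1 hp
  exact ⟨u, hu⟩

/-- The point `z` satisfies all linear inequalities with integral coefficients that hold for the
exponent vectors. -/
def InHull (f : TropicalPolynomial) (z : ℝ × ℝ) : Prop :=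
  ∀ p q, (∀ x ∈ f.support, 0 ≤ doubleArea p q x) → 0 ≤ realArea p q z

/-- The point `p` is in the interior of the Newton polygon, in terms of linear functionals. -/
def IsInner (f : TropicalPolynomial) (p : ℤ × ℤ) : Prop :=
  ∀ d : ℝ × ℝ, d ≠ 0 → ∃ x ∈ f.support, along d p x < 0

theorem perp_ne_zero (h : p ≠ q) : perp p q ≠ 0 := by
  intro h0
  rw [Prod.ext_iff] at h0
  simp only [perp, Prod.fst_zero, Prod.snd_zero, neg_eq_zero] at h0
  refine h (Prod.ext ?_ ?_)
  · exact_mod_cast (sub_eq_zero.1 h0.2).symm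
  · exact_mod_cast (sub_eq_zero.1 h0.1).symm

/-- The centroid of three lattice points. -/
noncomputable def centroid (p q r : ℤ × ℤ) : ℝ × ℝ :=
  (((p.1 : ℝ) + q.1 + r.1) / 3, ((p.2 : ℝ) + q.2 + r.2) / 3)

theorem realArea_centroid (a b p q r : ℤ × ℤ) : realArea a b (centroid p q r) =
    ((doubleArea a b p : ℤ) + (doubleArea a b q : ℤ) + (doubleArea a b r : ℤ) : ℝ) / 3 := by
  simp only [doubleArea_cast, realArea, centroid]; ring

theorem inHull_centroid (hp : p ∈ f.support) (hq : q ∈ f.support) (hr : r ∈ f.support) :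
    f.InHull (centroid p q r) := by
  intro a b hab
  rw [realArea_centroid]
  have h1 : (0 : ℝ) ≤ (doubleArea a b p : ℤ) := by exact_mod_cast hab p hp
  have h2 : (0 : ℝ) ≤ (doubleArea a b q : ℤ) := by exact_mod_cast hab q hq
  have h3 : (0 : ℝ) ≤ (doubleArea a b r : ℤ) := by exact_mod_cast hab r hr
  positivity

/-- A triangle of the subdivision that contains the centroid of three non-collinear minimizers
at `u` is dual to `u`. -/
theorem eq_of_centroid {a b c : ℤ × ℤ} (hA : doubleArea p q r = 1) (hp : p ∈ f.minimizers w)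
    (hq : q ∈ f.minimizers w) (hr : r ∈ f.minimizers w) (habc : doubleArea a b c ≠ 0)
    (ha : a ∈ f.minimizers u) (hb : b ∈ f.minimizers u) (hc : c ∈ f.minimizers u)
    (h1 : 0 ≤ realArea p q (centroid a b c)) (h2 : 0 ≤ realArea q r (centroid a b c))
    (h3 : 0 ≤ realArea r p (centroid a b c)) : w = u := by
  have hA' : ((doubleArea p q r : ℤ) : ℝ) = 1 := by exact_mod_cast hA
  -- These are the barycentric coordinates of the centroid in the triangle `pqr`. The difference of
  -- a term at `w` and at `u` is linear in the exponent. It is at most the difference of the minima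
  -- at `p`, `q`, `r` and at least this at `a`, `b`, `c`. Comparing at the centroid gives equality
  -- at `a`, `b`, `c`, which are thus minimal at `w`.
  set l := realArea p q (centroid a b c) with hl
  set m := realArea q r (centroid a b c) with hm
  set n := realArea r p (centroid a b c) with hn
  have hsum : m + n + l = 1 := by
    rw [hl, hm, hn, ← hA', doubleArea_cast]; simp only [realArea]; ring
  have hz1 : m * p.1 + n * q.1 + l * r.1 = (centroid a b c).1 := by
    rw [← one_mul (centroid a b c).1, ← hA', doubleArea_cast, hl, hm, hn]
    simp only [realArea]; ring
  have hz2 : m * p.2 + n * q.2 + l * r.2 = (centroid a b c).2 := by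
    rw [← one_mul (centroid a b c).2, ← hA', doubleArea_cast, hl, hm, hn]
    simp only [realArea]; ring
  have hD : ∀ x : ℤ × ℤ, f.term x w - f.term x u =
      x.1 * (w.1 - u.1) + x.2 * (w.2 - u.2) := by
    intro x; simp only [term]; ring
  have e1 := hD p
  have e2 := hD q
  have e3 := hD r
  have e4 := hD a
  have e5 := hD b
  have e6 := hD c
  have g1 := ha.2 p hp.1
  have g2 := ha.2 q hq.1
  have g3 := ha.2 r hr.1
  have g4 := hp.2 a ha.1
  have g5 := hp.2 b hb.1
  have g6 := hp.2 c hc.1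
  have t1 := term_eq hp hq
  have t2 := term_eq hp hr
  have t3 := term_eq ha hb
  have t4 := term_eq ha hc
  have hle : m * (f.term p w - f.term p u) + n * (f.term q w - f.term q u) +
      l * (f.term r w - f.term r u) ≤ f.term p w - f.term a u := by
    have : f.term p w - f.term a u = m * (f.term p w - f.term a u) +
        n * (f.term p w - f.term a u) + l * (f.term p w - f.term a u) := by
      rw [← add_mul, ← add_mul, hsum, one_mul]
    rw [this]
    gcongr ?_ + ?_ + ?_
    · exact mul_le_mul_of_nonneg_left (by linarith) h2
    · exact mul_le_mul_of_nonneg_left (by linarith) h3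
    · exact mul_le_mul_of_nonneg_left (by linarith) h1
  have heq : m * (f.term p w - f.term p u) + n * (f.term q w - f.term q u) +
      l * (f.term r w - f.term r u) = ((f.term a w - f.term a u) + (f.term b w - f.term b u) +
      (f.term c w - f.term c u)) / 3 := by
    rw [e1, e2, e3, e4, e5, e6]
    simp only [centroid] at hz1 hz2
    linear_combination (w.1 - u.1) * hz1 + (w.2 - u.2) * hz2
  have ha' : a ∈ f.minimizers w := (mem_minimizers_iff hp).2 ⟨ha.1, by linarith⟩
  have hb' : b ∈ f.minimizers w := (mem_minimizers_iff hp).2 ⟨hb.1, by linarith⟩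
  have hc' : c ∈ f.minimizers w := (mem_minimizers_iff hp).2 ⟨hc.1, by linarith⟩
  exact eq_of_mem_minimizers habc ha' hb' hc' ha hb hc

namespace IsSmooth

variable (hf : f.IsSmooth)
include hf

theorem exists_adj_cross (hm : f.minimizers w = {p, q, r})
    (hA : doubleArea p q r = 1) (h : ∃ x ∈ f.support, doubleArea p q x < 0) :
    ∃ t : ℝ, 0 < t ∧ f.curveGraph.Adj w (w + t • perp p q) ∧ ∃ r',
      f.minimizers (w + t • perp p q) = {p, q, r'} ∧ doubleArea p q r' = -1 := by
  obtain ⟨t, ht, r', h1, h2⟩ := hf.exists_cross hm hA h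
  have hpq : p ≠ q := (ne_of_doubleArea_ne_zero (by rw [hA]; norm_num)).1
  refine ⟨t, ht, adj_iff.2 ⟨isVertex_triangle hm (by omega), isVertex_triangle h1 (by omega),
    ?_, p, ?_, q, ?_, hpq⟩, r', h1, h2⟩
  · intro h
    rw [← h, hm] at h1
    have h3 : r' ∈ ({p, q, r} : Set (ℤ × ℤ)) := by rw [h1]; simp
    rcases h3 with rfl | rfl | rfl
    · simp at h2
    · simp at h2
    · omega
  · rw [hm, h1]; simp
  · rw [hm, h1]; simp

/-- From every vertex one can reach a vertex whose dual triangle contains the given point. -/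
theorem exists_reach {z : ℝ × ℝ} (hz : f.InHull z) (hw : f.IsVertex w) :
    ∃ u, ReflTransGen f.curveGraph.Adj w u ∧ f.IsVertex u ∧
      ∀ p q r, f.minimizers u = {p, q, r} → doubleArea p q r = 1 → 0 ≤ realArea p q z := by
  obtain ⟨p₀, hp₀⟩ := exists_mem_minimizers hf.nonempty w
  -- The minimal term at `u` minus the scalar product of `z` and `u` is maximised over the reachable
  -- vertices. Crossing the edge `pq` increases it by `-t * realArea p q z`, so at a maximum `z`
  -- lies on the inner side of each edge.
  obtain ⟨⟨u, a⟩, ⟨hu1, hu2, hu3⟩, hmax⟩ := Set.exists_max_image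
    {k : (ℝ × ℝ) × (ℤ × ℤ) | ReflTransGen f.curveGraph.Adj w k.1 ∧ f.IsVertex k.1 ∧
      k.2 ∈ f.minimizers k.1}
    (fun k => f.term k.2 k.1 - (z.1 * k.1.1 + z.2 * k.1.2))
    ((f.finite_isVertex.prod f.support.finite_toSet).subset fun k hk => ⟨hk.2.1, hk.2.2.1⟩)
    ⟨(w, p₀), .refl, hw, hp₀⟩
  refine ⟨u, hu1, hu2, fun p q r hm hA => ?_⟩
  by_contra hcon
  rw [not_le] at hcon
  obtain ⟨x, hx, hx'⟩ : ∃ x ∈ f.support, doubleArea p q x < 0 := by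
    by_contra! hall
    exact absurd (hz p q hall) (not_le.2 hcon)
  obtain ⟨t, ht, hadj, r', h1, h2⟩ := hf.exists_adj_cross hm hA ⟨x, hx, hx'⟩
  have hp : p ∈ f.minimizers u := by simp [hm]
  have := hmax (u + t • perp p q, p)
    ⟨hu1.tail hadj, isVertex_triangle h1 (by omega), by simp [h1]⟩
  simp only at this
  rw [term_eq hp hu3] at this
  simp only [term, perp, realArea, Prod.fst_add, Prod.snd_add, Prod.smul_fst, Prod.smul_snd,
    smul_eq_mul] at this hcon
  nlinarith

theorem exists_reach_triangle {z : ℝ × ℝ} (hz : f.InHull z) (hw : f.IsVertex w) :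
    ∃ u, ReflTransGen f.curveGraph.Adj w u ∧ ∃ p q r, f.minimizers u = {p, q, r} ∧
      doubleArea p q r = 1 ∧ 0 ≤ realArea p q z ∧ 0 ≤ realArea q r z ∧ 0 ≤ realArea r p z := by
  obtain ⟨u, h1, h2, h3⟩ := hf.exists_reach hz hw
  obtain ⟨p, hp, -⟩ := id h2
  obtain ⟨q, r, hm, hA⟩ := hf.exists_triangle h2 hp
  refine ⟨u, h1, p, q, r, hm, hA, h3 _ _ _ hm hA, h3 q r p ?_ ?_, h3 r p q ?_ ?_⟩
  · rw [hm]; ext; simp; tauto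
  · rw [doubleArea_rotate, hA]
  · rw [hm]; ext; simp; tauto
  · rw [← doubleArea_rotate, hA]

/-- The walk towards the centroid of the triangle dual to `u` ends in a triangle that contains this
centroid, and this can only be the triangle dual to `u`. -/
theorem isConnected : f.curveGraph.IsConnected := by
  refine ⟨hf.exists_isVertex, fun w hw u hu => ?_⟩
  obtain ⟨a, ha, b, hb, c, hc, habc⟩ := id hu
  obtain ⟨v, h1, p, q, r, hm, hA, h2, h3, h4⟩ :=
    hf.exists_reach_triangle (inHull_centroid ha.1 hb.1 hc.1) hw
  have : v = u := eq_of_centroid (w := v) hA (by simp [hm]) (by simp [hm]) (by simp [hm]) habc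
    ha hb hc h2 h3 h4
  exact this ▸ h1

end IsSmooth

end TropicalPolynomial

/-! ### Interior lattice points and the triangles around them -/

namespace TropicalPolynomial

variable {f : TropicalPolynomial} {p q r s x y : ℤ × ℤ} {u v w : ℝ × ℝ}

theorem isInner_of_mem_interiorPoints (h : p ∈ f.interiorPoints) : f.IsInner p := by
  intro d hd
  by_contra! hall
  have hsub : f.newtonPolygon ⊆
      {z : ℝ × ℝ | 0 ≤ (z.1 - p.1) * d.1 + (z.2 - p.2) * d.2} := by
    refine convexHull_min ?_ ?_
    · rintro _ ⟨x, hx, rfl⟩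
      exact hall x hx
    · intro a ha b hb s t hs ht hst
      simp only [Set.mem_ofPred_eq, Prod.fst_add, Prod.snd_add, Prod.smul_fst, Prod.smul_snd,
        smul_eq_mul] at ha hb ⊢
      have : (s * a.1 + t * b.1 - p.1) * d.1 + (s * a.2 + t * b.2 - p.2) * d.2 =
          s * ((a.1 - p.1) * d.1 + (a.2 - p.2) * d.2) +
          t * ((b.1 - p.1) * d.1 + (b.2 - p.2) * d.2) := by
        linear_combination ((p.1 : ℝ) * d.1 + p.2 * d.2) * hst
      rw [this]
      exact add_nonneg (mul_nonneg hs ha) (mul_nonneg ht hb)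
  have hcont : Filter.Tendsto (fun t : ℝ => ((p.1 : ℝ), (p.2 : ℝ)) - t • d) (nhds 0)
      (nhds ((p.1 : ℝ), (p.2 : ℝ))) := by
    have : Continuous (fun t : ℝ => ((p.1 : ℝ), (p.2 : ℝ)) - t • d) := by fun_prop
    exact this.tendsto' _ _ (by simp)
  have hev := (hcont.mono_left (nhdsWithin_le_nhds (s := Set.Ioi 0))).eventually
    (mem_interior_iff_mem_nhds.1 h)
  obtain ⟨t, ht, ht0⟩ := (hev.and self_mem_nhdsWithin).exists
  have h1 := hsub ht
  simp only [Set.mem_ofPred_eq, Prod.fst_sub, Prod.snd_sub, Prod.smul_fst, Prod.smul_snd,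
    smul_eq_mul] at h1
  have h2 : 0 < d.1 ^ 2 + d.2 ^ 2 := by
    by_contra hcon
    refine hd (Prod.ext ?_ ?_) <;> simp only [Prod.fst_zero, Prod.snd_zero] <;>
      nlinarith [sq_nonneg d.1, sq_nonneg d.2]
  have h3 : (0 : ℝ) < t := ht0
  nlinarith [mul_pos h3 h2]

/-- A point not in the interior is separated from it by a functional (Hahn–Banach). As the polygon
is two-dimensional, it lies in the closure of its nonempty interior, so the functional supports the
whole polygon. -/
theorem mem_interiorPoints_iff (h2 : IsTwoDimensional (f.support : Set (ℤ × ℤ))) :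
    p ∈ f.interiorPoints ↔ f.IsInner p := by
  refine ⟨isInner_of_mem_interiorPoints, fun h => ?_⟩
  by_contra hp
  change ((p.1 : ℝ), (p.2 : ℝ)) ∉ interior f.newtonPolygon at hp
  have hconv : Convex ℝ f.newtonPolygon := convex_convexHull ℝ _
  have hmem : ∀ x ∈ f.support, ((x.1 : ℝ), (x.2 : ℝ)) ∈ f.newtonPolygon :=
    fun x hx => subset_convexHull ℝ _ ⟨x, hx, rfl⟩
  have hne : (interior f.newtonPolygon).Nonempty := by
    rw [hconv.interior_nonempty_iff_affineSpan_eq_top]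
    obtain ⟨a, ha, b, hb, c, hc, habc⟩ := h2
    have hA : ((b.1 : ℝ) - a.1) * ((c.2 : ℝ) - a.2) - ((b.2 : ℝ) - a.2) * ((c.1 : ℝ) - a.1) ≠ 0 := by
      rw [← doubleArea_cast]; exact_mod_cast habc
    set A := ((b.1 : ℝ) - a.1) * ((c.2 : ℝ) - a.2) - ((b.2 : ℝ) - a.2) * ((c.1 : ℝ) - a.1) with hAdef
    refine eq_top_iff.2 fun z _ => ?_
    have hsp : ∀ x ∈ f.support, ((x.1 : ℝ), (x.2 : ℝ)) ∈ affineSpan ℝ f.newtonPolygon :=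
      fun x hx => subset_affineSpan ℝ _ (hmem x hx)
    have h1 := (affineSpan ℝ f.newtonPolygon).smul_vsub_vadd_mem (realArea a b z / A)
      (hsp c hc) (hsp a ha) (hsp a ha)
    have h2 := (affineSpan ℝ f.newtonPolygon).smul_vsub_vadd_mem (-realArea a c z / A)
      (hsp b hb) (hsp a ha) h1
    convert h2 using 1
    ext
    · simp only [vsub_eq_sub, vadd_eq_add, Prod.fst_add, Prod.smul_fst, Prod.fst_sub, smul_eq_mul,
        realArea]
      field_simp
      rw [hAdef]
      ring
    · simp only [vsub_eq_sub, vadd_eq_add, Prod.snd_add, Prod.smul_snd, Prod.snd_sub, smul_eq_mul,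
        realArea]
      field_simp
      rw [hAdef]
      ring
  obtain ⟨l, hl⟩ := geometric_hahn_banach_open_point hconv.interior isOpen_interior hp
  have hlin : ∀ z : ℝ × ℝ, l z = z.1 * l (1, 0) + z.2 * l (0, 1) := by
    intro z
    have : z = z.1 • ((1, 0) : ℝ × ℝ) + z.2 • ((0, 1) : ℝ × ℝ) := by ext <;> simp
    conv_lhs => rw [this]
    rw [map_add, map_smul, map_smul]; simp
  have hle : ∀ z ∈ f.newtonPolygon, l z ≤ l ((p.1 : ℝ), (p.2 : ℝ)) := by
    intro z hz
    have hcl : z ∈ closure (interior f.newtonPolygon) := by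
      rw [hconv.closure_interior_eq_closure_of_nonempty_interior hne]
      exact subset_closure hz
    exact closure_minimal (s := interior f.newtonPolygon)
      (t := {z | l z ≤ l ((p.1 : ℝ), (p.2 : ℝ))}) (fun a ha => (hl a ha).le)
      (isClosed_le l.continuous continuous_const) hcl
  have hd : ((-l (1, 0), -l (0, 1)) : ℝ × ℝ) ≠ 0 := by
    intro h0
    rw [Prod.ext_iff] at h0
    simp only [Prod.fst_zero, Prod.snd_zero, neg_eq_zero] at h0
    obtain ⟨z, hz⟩ := hne
    have := hl z hz
    rw [hlin z, hlin ((p.1 : ℝ), (p.2 : ℝ)), h0.1, h0.2] at this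
    simp at this
  obtain ⟨x, hx, hlt⟩ := h _ hd
  have := hle _ (hmem x hx)
  rw [hlin, hlin ((p.1 : ℝ), (p.2 : ℝ))] at this
  simp only [along] at hlt
  nlinarith

theorem IsInner.exists_neg (h : f.IsInner p) (hpq : p ≠ q) :
    ∃ x ∈ f.support, doubleArea p q x < 0 := by
  obtain ⟨x, hx, h1⟩ := h _ (perp_ne_zero hpq)
  rw [along_perp] at h1
  exact ⟨x, hx, by exact_mod_cast h1⟩

/-- A functional that is nonnegative on the exponent vectors, relative to `p`, is positive at
interior points. -/
theorem IsInner.along_pos (h : f.IsInner x) {d : ℝ × ℝ} (hd : d ≠ 0)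
    (hall : ∀ y ∈ f.support, 0 ≤ along d p y) : 0 < along d p x := by
  obtain ⟨y, hy, h1⟩ := h d hd
  rw [along_sub_right d p] at h1
  linarith [hall y hy]

theorem exists_support_functional (h : ¬ f.IsInner p) :
    ∃ d : ℝ × ℝ, d ≠ 0 ∧ ∀ y ∈ f.support, 0 ≤ along d p y := by
  unfold IsInner at h
  push Not at h
  exact h

/-- Coordinates with respect to a unimodular triangle. -/
theorem along_eq (hA : doubleArea p q r = 1) (d : ℝ × ℝ) (x : ℤ × ℤ) : along d p x =
    (doubleArea p x r : ℤ) * along d p q + (doubleArea p q x : ℤ) * along d p r := by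
  have hA' : ((doubleArea p q r : ℤ) : ℝ) = 1 := by exact_mod_cast hA
  rw [← one_mul (along d p x), ← hA', doubleArea_cast, doubleArea_cast, doubleArea_cast]
  simp only [along]
  ring

namespace IsSmooth

variable (hf : f.IsSmooth)
include hf

/-- Among the triangles at an interior lattice point `p` that belong to a class `A`, there is one
that contains the direction opposite to `q - p`, if `A` is closed under crossing edges towards
this direction. -/
theorem exists_star_max (hp : f.IsInner p) (q : ℤ × ℤ) {A : Set (ℝ × ℝ)} (hne : A.Nonempty)
    (hA : ∀ w ∈ A, f.IsVertex w ∧ p ∈ f.minimizers w)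
    (hcl : ∀ w ∈ A, ∀ x y, f.minimizers w = {p, x, y} → 0 < doubleArea p x q * doubleArea p x y →
      ∀ w', f.IsVertex w' → p ∈ f.minimizers w' → x ∈ f.minimizers w' → w' ∈ A) :
    ∃ w ∈ A, ∃ x y, f.minimizers w = {p, x, y} ∧ doubleArea p x y = 1 ∧ doubleArea p x q ≤ 0 ∧
      doubleArea p q y ≤ 0 := by
  -- The scalar product of `q - p` and `w` is maximised over `A`. Crossing one of the two sides at
  -- `p` moves `w` along a normal of this side, and the gain is a positive multiple of the area
  -- whose sign is in question.
  obtain ⟨w, hw, hmax⟩ := Set.exists_max_image A (fun w => along w p q)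
    (f.finite_isVertex.subset fun w hw => (hA w hw).1) hne
  obtain ⟨x, y, hm, hxy⟩ := hf.exists_triangle (hA w hw).1 (hA w hw).2
  obtain ⟨hpx, hpy, -⟩ := ne_of_doubleArea_ne_zero (p := p) (q := x) (r := y) (by omega)
  have hadd : ∀ (t : ℝ) (d : ℝ × ℝ), along (w + t • d) p q = along w p q + t * along d p q := by
    intro t d
    simp only [along, Prod.fst_add, Prod.snd_add, Prod.smul_fst, Prod.smul_snd, smul_eq_mul]
    ring
  refine ⟨w, hw, x, y, hm, hxy, ?_, ?_⟩
  · by_contra! hcon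
    obtain ⟨t, ht, r', h1, h2⟩ := hf.exists_cross hm hxy (hp.exists_neg hpx)
    have := hmax _ (hcl w hw x y hm (by rw [hxy]; omega) _ (isVertex_triangle h1 (by omega))
      (by simp [h1]) (by simp [h1]))
    simp only [hadd, along_perp] at this
    have h3 : (0 : ℝ) < (doubleArea p x q : ℤ) := by exact_mod_cast hcon
    nlinarith
  · by_contra! hcon
    obtain ⟨z, hz, hz'⟩ := hp _ (perp_ne_zero hpy.symm)
    rw [along_sub_right _ y, along_perp, along_perp, doubleArea_self_right] at hz'
    obtain ⟨t, ht, r', h1, h2⟩ := hf.exists_cross (p := y) (q := p) (r := x)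
      (by rw [hm]; ext; simp; tauto) (by rw [doubleArea_rotate x y p, doubleArea_rotate p x y]; exact hxy)
      ⟨z, hz, by
        have : ((doubleArea y p z : ℤ) : ℝ) < 0 := by simpa using hz'
        exact_mod_cast this⟩
    have := hmax _ (hcl w hw y x (by rw [hm, Set.pair_comm])
      (by rw [doubleArea_swap_right p q y, doubleArea_swap_right p x y, hxy]; omega) _
      (isVertex_triangle h1 (by omega)) (by simp [h1]) (by simp [h1]))
    simp only [hadd] at this
    rw [along_sub_right (perp y p) y p q, along_perp, along_perp, doubleArea_self_right] at this
    have h3 : (0 : ℝ) < (doubleArea y p q : ℤ) := by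
      rw [doubleArea_rotate q y p, doubleArea_rotate p q y]
      exact_mod_cast hcon
    have h4 : t * ((doubleArea y p q : ℤ) : ℝ) ≤ 0 := by
      simpa using this
    nlinarith

/-- The neighbours of an interior lattice point `p` other than `q` are connected through the
triangles at `p`. -/
theorem star_colouring (hp : f.IsInner p) (hpq : p ≠ q) (c : ℤ × ℤ → Bool)
    (hc : ∀ w, f.IsVertex w → p ∈ f.minimizers w → ∀ x ∈ f.minimizers w, ∀ y ∈ f.minimizers w,
      x ≠ p → x ≠ q → y ≠ p → y ≠ q → c x = c y)
    (hu : f.IsVertex u) (hpu : p ∈ f.minimizers u) (hx : x ∈ f.minimizers u) (hxp : x ≠ p)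
    (hxq : x ≠ q) (hv : f.IsVertex v) (hpv : p ∈ f.minimizers v) (hy : y ∈ f.minimizers v)
    (hyp : y ≠ p) (hyq : y ≠ q) : c x = c y := by
  -- The triangles at `p` are classified by the colour of their vertices other than `p` and `q`.
  -- Each class is closed under crossing sides at `p` other than `pq`, so each contains a triangle
  -- in the direction opposite to `q`.
  set A : Bool → Set (ℝ × ℝ) := fun κ => {w | f.IsVertex w ∧ p ∈ f.minimizers w ∧
    ∃ z ∈ f.minimizers w, z ≠ p ∧ z ≠ q ∧ c z = κ} with hA
  have key : ∀ κ, (A κ).Nonempty → ∃ w ∈ A κ, ∃ x y, f.minimizers w = {p, x, y} ∧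
      doubleArea p x y = 1 ∧ doubleArea p x q ≤ 0 ∧ doubleArea p q y ≤ 0 := by
    intro κ hne
    refine hf.exists_star_max hp q hne (fun w hw => ⟨hw.1, hw.2.1⟩) ?_
    rintro w ⟨h1, h2, z, h3, h4, h5, h6⟩ x y hm hpos w' h7 h8 h9
    have hx : x ∈ f.minimizers w := by simp [hm]
    have hxp : x ≠ p := by rintro rfl; simp at hpos
    have hxq : x ≠ q := by rintro rfl; simp at hpos
    exact ⟨h7, h8, x, h9, hxp, hxq, (hc w h1 h2 x hx z h3 hxp hxq h4 h5).trans h6⟩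
  obtain ⟨w₁, ⟨h1, h2, z₁, h3, h4, h5, h6⟩, x₁, y₁, h7, h8, h9, h10⟩ :=
    key (c x) ⟨u, hu, hpu, x, hx, hxp, hxq, rfl⟩
  obtain ⟨w₂, ⟨k1, k2, z₂, k3, k4, k5, k6⟩, x₂, y₂, k7, k8, k9, k10⟩ :=
    key (c y) ⟨v, hv, hpv, y, hy, hyp, hyq, rfl⟩
  have hmem : ∀ {w w' : ℝ × ℝ} {z}, p ∈ f.minimizers w → p ∈ f.minimizers w' →
      z ∈ f.minimizers w → 0 ≤ along (w' - w) p z ∧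
      (along (w' - w) p z = 0 → z ∈ f.minimizers w') := by
    intro w w' z g1 g2 g3
    have := term_sub f p z w (w' - w)
    rw [add_sub_cancel, term_eq g1 g3, sub_self, zero_add] at this
    refine ⟨by linarith [g2.2 z g3.1], fun h => (mem_minimizers_iff g2).2 ⟨g3.1, by linarith⟩⟩
  -- Both triangles contain the direction opposite to `q`. Expanding the functionals `w₂ - w₁` and
  -- `w₁ - w₂` at `q` in the respective triangle gives two opposite numbers, both nonpositive. So
  -- all summands vanish, and a vertex of the first triangle with nonzero coefficient also belongs
  -- to the second one.
  have hq1 := along_eq h8 (w₂ - w₁) q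
  have hq2 := along_eq k8 (w₁ - w₂) q
  have hneg : along (w₁ - w₂) p q = -along (w₂ - w₁) p q := by
    simp only [along, Prod.fst_sub, Prod.snd_sub]; ring
  have m1 := hmem h2 k2 (show x₁ ∈ f.minimizers w₁ by simp [h7])
  have m2 := hmem h2 k2 (show y₁ ∈ f.minimizers w₁ by simp [h7])
  have m3 := hmem k2 h2 (show x₂ ∈ f.minimizers w₂ by simp [k7])
  have m4 := hmem k2 h2 (show y₂ ∈ f.minimizers w₂ by simp [k7])
  have c1 : ((doubleArea p x₁ q : ℤ) : ℝ) ≤ 0 := by exact_mod_cast h9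
  have c2 : ((doubleArea p q y₁ : ℤ) : ℝ) ≤ 0 := by exact_mod_cast h10
  have c3 : ((doubleArea p x₂ q : ℤ) : ℝ) ≤ 0 := by exact_mod_cast k9
  have c4 : ((doubleArea p q y₂ : ℤ) : ℝ) ≤ 0 := by exact_mod_cast k10
  have e1 := mul_nonpos_of_nonpos_of_nonneg c2 m1.1
  have e2 := mul_nonpos_of_nonpos_of_nonneg c1 m2.1
  have e3 := mul_nonpos_of_nonpos_of_nonneg c4 m3.1
  have e4 := mul_nonpos_of_nonpos_of_nonneg c3 m4.1
  have z1 : ((doubleArea p q y₁ : ℤ) : ℝ) * along (w₂ - w₁) p x₁ = 0 := by linarith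
  have z2 : ((doubleArea p x₁ q : ℤ) : ℝ) * along (w₂ - w₁) p y₁ = 0 := by linarith
  have fin : ∀ z, z ∈ f.minimizers w₁ → z ≠ p → z ≠ q → along (w₂ - w₁) p z = 0 → c x = c y := by
    intro z g1 g2 g3 g4
    have g5 := (hmem h2 k2 g1).2 g4
    rw [← h6, ← k6, hc w₁ h1 h2 z₁ h3 z g1 h4 h5 g2 g3, hc w₂ k1 k2 z₂ k3 z g5 k4 k5 g2 g3]
  have hx1 : x₁ ∈ f.minimizers w₁ := by simp [h7]
  have hy1 : y₁ ∈ f.minimizers w₁ := by simp [h7]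
  obtain ⟨n1, n2, -⟩ := ne_of_doubleArea_ne_zero (p := p) (q := x₁) (r := y₁) (by omega)
  by_cases hα : doubleArea p q y₁ = 0
  · by_cases hβ : doubleArea p x₁ q = 0
    · exfalso
      have e1 : along (perp p q) p x₁ = 0 := by
        rw [along_perp, doubleArea_swap_right, hβ]; simp
      have e2 : along (perp p q) p y₁ = 0 := by rw [along_perp, hα]; simp
      exact perp_ne_zero hpq (eq_zero_of_along (by omega) e1 e2)
    · refine fin y₁ hy1 n2.symm ?_ ((mul_eq_zero.1 z2).resolve_left (by exact_mod_cast hβ))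
      rintro rfl
      omega
  · refine fin x₁ hx1 n1.symm ?_ ((mul_eq_zero.1 z1).resolve_left (by exact_mod_cast hα))
    rintro rfl
    omega

end IsSmooth

end TropicalPolynomial

/-! ### Edges of the curve, their dual edges, and chords of the polygon -/

namespace TropicalPolynomial

variable {f : TropicalPolynomial} {p q r s x y z : ℤ × ℤ} {u v w : ℝ × ℝ} {e e' : Sym2 (ℝ × ℝ)}

/-- The edge `e` of the tropical curve is dual to the edge `pq` of the subdivision. -/
def DualTo (f : TropicalPolynomial) (e : Sym2 (ℝ × ℝ)) (p q : ℤ × ℤ) : Prop :=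
  ∃ u w, e = s(u, w) ∧ u ≠ w ∧ f.IsVertex u ∧ f.IsVertex w ∧ p ≠ q ∧
    p ∈ f.minimizers u ∧ q ∈ f.minimizers u ∧ p ∈ f.minimizers w ∧ q ∈ f.minimizers w

theorem DualTo.symm (h : f.DualTo e p q) : f.DualTo e q p := by
  obtain ⟨u, w, h1, h2, h3, h4, h5, h6, h7, h8, h9⟩ := h
  exact ⟨u, w, h1, h2, h3, h4, h5.symm, h7, h6, h9, h8⟩

theorem DualTo.ne (h : f.DualTo e p q) : p ≠ q := by
  obtain ⟨u, w, h1, h2, h3, h4, h5, h6, h7, h8, h9⟩ := h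
  exact h5

theorem isLink_iff : f.curveGraph.IsLink e u w ↔
    ∃ p q, p ≠ q ∧ e = s(u, w) ∧ u ≠ w ∧ f.IsVertex u ∧ f.IsVertex w ∧
    p ∈ f.minimizers u ∧ q ∈ f.minimizers u ∧ p ∈ f.minimizers w ∧ q ∈ f.minimizers w := by
  constructor
  · rintro ⟨h1, h2, h3, ⟨p, hp, q, hq, hpq⟩, h5⟩
    exact ⟨p, q, hpq, h5, h3, h1, h2, hp.1, hq.1, hp.2, hq.2⟩
  · rintro ⟨p, q, h1, h2, h3, h4, h5, h6, h7, h8, h9⟩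
    exact ⟨h4, h5, h3, ⟨p, ⟨h6, h8⟩, q, ⟨h7, h9⟩, h1⟩, h2⟩

theorem exists_dualTo (h : e ∈ f.curveGraph.edgeSet) : ∃ p q, f.DualTo e p q := by
  obtain ⟨u, w, hl⟩ := f.curveGraph.exists_isLink_of_mem_edgeSet h
  obtain ⟨p, q, h1, h2, h3, h4, h5, h6, h7, h8, h9⟩ := isLink_iff.1 hl
  exact ⟨p, q, u, w, h2, h3, h4, h5, h1, h6, h7, h8, h9⟩

theorem DualTo.mem_edgeSet (h : f.DualTo e p q) : e ∈ f.curveGraph.edgeSet := by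
  obtain ⟨u, w, h1, h2, h3, h4, h5, h6, h7, h8, h9⟩ := h
  exact (isLink_iff.2 ⟨p, q, h5, h1, h2, h3, h4, h6, h7, h8, h9⟩).edge_mem

theorem dualTo_mk (huw : u ≠ w) (hu : f.IsVertex u) (hw : f.IsVertex w) (hpq : p ≠ q)
    (h1 : p ∈ f.minimizers u) (h2 : q ∈ f.minimizers u) (h3 : p ∈ f.minimizers w)
    (h4 : q ∈ f.minimizers w) : f.DualTo s(u, w) p q :=
  ⟨u, w, rfl, huw, hu, hw, hpq, h1, h2, h3, h4⟩

theorem not_isLoopAt : ¬ f.curveGraph.IsLoopAt e w := fun h => h.2.2.1 rfl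

theorem isFinite_curveGraph (f : TropicalPolynomial) : f.curveGraph.IsFinite := by
  refine ⟨f.finite_isVertex, ?_⟩
  refine ((f.finite_isVertex.prod f.finite_isVertex).image (fun k => s(k.1, k.2))).subset ?_
  intro e he
  obtain ⟨u, w, hl⟩ := f.curveGraph.exists_isLink_of_mem_edgeSet he
  exact ⟨(u, w), ⟨hl.1, hl.2.1⟩, hl.2.2.2.2.symm⟩

theorem degree_eq (w : ℝ × ℝ) : f.curveGraph.degree w = {e | f.curveGraph.Inc e w}.ncard := by
  have : {e | f.curveGraph.IsLoopAt e w} = ∅ :=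
    Set.eq_empty_iff_forall_notMem.2 fun e => not_isLoopAt
  rw [Graph.degree, this]
  simp

theorem eq_of_inc (h : f.curveGraph.Inc s(u, v) w) : w = u ∨ w = v := by
  obtain ⟨y, hy⟩ := h
  have := hy.2.2.2.2
  rw [Sym2.eq_iff] at this
  tauto

theorem DualTo.exists_triangles (hf : f.IsSmooth) (h : f.DualTo e p q) : ∃ u w r s,
    e = s(u, w) ∧ f.minimizers u = {p, q, r} ∧ f.minimizers w = {p, q, s} ∧
    doubleArea p q r = 1 ∧ doubleArea p q s = -1 := by
  obtain ⟨u, w, h1, h2, h3, h4, h5, h6, h7, h8, h9⟩ := h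
  obtain ⟨r, hr, hr'⟩ := hf.exists_triangle_of_ne h3 h6 h7 h5
  obtain ⟨s, hs, hs'⟩ := hf.exists_triangle_of_ne h4 h8 h9 h5
  have := doubleArea_mul_neg h5 h6 h7 h8 h9 (r := r) (x := s) (by simp [hr]) (by simp [hs])
    (by rintro h; simp [h] at hr') (by rintro h; simp [h] at hs') h2
  rcases area_cases hr' with h | h <;> rcases area_cases hs' with h' | h'
  · rw [h, h'] at this; omega
  · exact ⟨u, w, r, s, h1, hr, hs, h, h'⟩
  · exact ⟨w, u, s, r, h1.trans Sym2.eq_swap, hs, hr, h', h⟩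
  · rw [h, h'] at this; omega

theorem ne_of_areas (h1 : f.minimizers u = {p, q, r}) (h2 : f.minimizers w = {p, q, s})
    (h3 : doubleArea p q r = 1) (h4 : doubleArea p q s = -1) : u ≠ w := by
  rintro rfl
  have : s ∈ ({p, q, r} : Set (ℤ × ℤ)) := by rw [← h1, h2]; simp
  rcases this with rfl | rfl | rfl
  · simp at h4
  · simp at h4
  · omega

theorem dualTo_of_areas (h1 : f.minimizers u = {p, q, r}) (h2 : f.minimizers w = {p, q, s})
    (h3 : doubleArea p q r = 1) (h4 : doubleArea p q s = -1) : f.DualTo s(u, w) p q :=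
  dualTo_mk (ne_of_areas h1 h2 h3 h4) (isVertex_triangle h1 (by omega))
    (isVertex_triangle h2 (by omega)) (ne_of_doubleArea_ne_zero (r := r) (by omega)).1
    (by simp [h1]) (by simp [h1]) (by simp [h2]) (by simp [h2])

theorem DualTo.inc_iff (hf : f.IsSmooth) (h : f.DualTo e p q) : f.curveGraph.Inc e w ↔
    f.IsVertex w ∧ p ∈ f.minimizers w ∧ q ∈ f.minimizers w := by
  have hpq := h.ne
  obtain ⟨u, v, r, s, rfl, h1, h2, h3, h4⟩ := h.exists_triangles hf
  constructor
  · intro hw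
    refine ⟨hw.vertex_mem, ?_⟩
    rcases eq_of_inc hw with rfl | rfl
    · simp [h1]
    · simp [h2]
  · rintro ⟨hw, hp, hq⟩
    obtain ⟨a, b, hl⟩ := f.curveGraph.exists_isLink_of_mem_edgeSet h.mem_edgeSet
    have hab := hl.2.2.2.2
    obtain ⟨t, ht, ht'⟩ := hf.exists_triangle_of_ne hw hp hq hpq
    -- A third triangle on `pq` would lie on the opposite side of both given ones, which are on
    -- opposite sides themselves.
    have key : w = u ∨ w = v := by
      by_contra hcon
      push Not at hcon
      have k1 := doubleArea_mul_neg hpq hp hq (w := u) (by simp [h1]) (by simp [h1]) (r := t) (x := r)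
        (by simp [ht]) (by simp [h1]) (by rintro h; simp [h] at ht') (by omega) hcon.1
      have k2 := doubleArea_mul_neg hpq hp hq (w := v) (by simp [h2]) (by simp [h2]) (r := t) (x := s)
        (by simp [ht]) (by simp [h2]) (by rintro h; simp [h] at ht') (by omega) hcon.2
      rw [h3] at k1
      rw [h4] at k2
      omega
    have : w = a ∨ w = b := by
      rw [Sym2.eq_iff] at hab
      rcases hab with ⟨rfl, rfl⟩ | ⟨rfl, rfl⟩ <;> tauto
    rcases this with rfl | rfl
    · exact hl.inc_left
    · exact hl.inc_right

theorem DualTo.unique (hf : f.IsSmooth) (h : f.DualTo e p q) (h' : f.DualTo e' p q) : e = e' := by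
  obtain ⟨u, w, rfl, h2, h3, h4, h5, h6, h7, h8, h9⟩ := id h'
  obtain ⟨a, ha⟩ := (h.inc_iff hf).2 ⟨h3, h6, h7⟩
  have hw := (h.inc_iff hf).2 ⟨h4, h8, h9⟩
  rcases hw.eq_or_eq_of_isLink ha with rfl | rfl
  · exact absurd rfl h2
  · exact ha.2.2.2.2

theorem DualTo.mem_pair (hf : f.IsSmooth) (h : f.DualTo e p q) (h' : f.DualTo e r s) :
    r = p ∨ r = q := by
  obtain ⟨u, w, a, b, rfl, h1, h2, h3, h4⟩ := h.exists_triangles hf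
  obtain ⟨u', w', k1, k2, k3, k4, k5, k6, k7, k8, k9⟩ := h'
  have hr : r ∈ f.minimizers u ∧ r ∈ f.minimizers w := by
    rw [Sym2.eq_iff] at k1
    rcases k1 with ⟨rfl, rfl⟩ | ⟨rfl, rfl⟩
    · exact ⟨k6, k8⟩
    · exact ⟨k8, k6⟩
  rw [h1, h2] at hr
  rcases hr.1 with h | h | h
  · exact Or.inl h
  · exact Or.inr h
  · rcases hr.2 with h' | h' | h'
    · exact Or.inl h'
    · exact Or.inr h'
    · rw [Set.mem_singleton_iff] at h h'
      rw [← h] at h3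
      rw [← h'] at h4
      omega

theorem DualTo.pair_eq (hf : f.IsSmooth) (h : f.DualTo e p q) (h' : f.DualTo e r s) :
    s(p, q) = s(r, s) := by
  have h1 := h.mem_pair hf h'
  have h2 := h.mem_pair hf h'.symm
  have h3 := h'.ne
  rw [Sym2.eq_iff]
  rcases h1 with rfl | rfl <;> rcases h2 with rfl | rfl <;> simp_all

theorem exists_dualTo_of_exists (hf : f.IsSmooth) (hw : f.IsVertex w) (hp : p ∈ f.minimizers w)
    (hq : q ∈ f.minimizers w) (hpq : p ≠ q) (h1 : ∃ x ∈ f.support, doubleArea p q x < 0)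
    (h2 : ∃ x ∈ f.support, 0 < doubleArea p q x) : ∃ e, f.DualTo e p q := by
  obtain ⟨r, hr, hr'⟩ := hf.exists_triangle_of_ne hw hp hq hpq
  rcases area_cases hr' with h | h
  · obtain ⟨t, -, r', k1, k2⟩ := hf.exists_cross hr h h1
    exact ⟨_, dualTo_of_areas hr k1 h k2⟩
  · obtain ⟨t, -, r', k1, k2⟩ := hf.exists_cross (p := q) (q := p) (r := r)
      (by rw [hr, Set.insert_comm]) (by rw [doubleArea_swap, h]; rfl) (by
        obtain ⟨x, hx, hx'⟩ := h2
        exact ⟨x, hx, by rw [doubleArea_swap]; omega⟩)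
    exact ⟨_, (dualTo_of_areas (p := q) (q := p) (by rw [hr, Set.insert_comm]) k1
      (by rw [doubleArea_swap, h]; rfl) k2).symm⟩

theorem IsInner.exists_pos (h : f.IsInner p) (hpq : p ≠ q) :
    ∃ x ∈ f.support, 0 < doubleArea p q x := by
  obtain ⟨x, hx, h1⟩ := h _ (perp_ne_zero hpq.symm)
  rw [along_sub_right _ q, along_perp, along_perp, doubleArea_self_right, Int.cast_zero,
    sub_zero] at h1
  have h2 : doubleArea q p x < 0 := by exact_mod_cast h1
  rw [doubleArea_swap] at h2
  exact ⟨x, hx, by omega⟩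

theorem IsInner.exists_dualTo (h : f.IsInner p) (hf : f.IsSmooth) (hw : f.IsVertex w)
    (hp : p ∈ f.minimizers w) (hq : q ∈ f.minimizers w) (hpq : p ≠ q) : ∃ e, f.DualTo e p q :=
  exists_dualTo_of_exists hf hw hp hq hpq (h.exists_neg hpq) (h.exists_pos hpq)

/-- The pair of lattice points dual to an edge at a vertex with three given minimizers. -/
theorem exists_dualTo_at (hf : f.IsSmooth) (h : f.curveGraph.Inc e w) :
    ∃ p q, f.DualTo e p q ∧ p ∈ f.minimizers w ∧ q ∈ f.minimizers w := by
  obtain ⟨p, q, hd⟩ := TropicalPolynomial.exists_dualTo h.edge_mem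
  exact ⟨p, q, hd, ((hd.inc_iff hf).1 h).2⟩

/-- The edges at `w` inject into the three sides of the dual triangle. If there are three of them,
every side is hit. -/
theorem degree_le_three (hf : f.IsSmooth) (hw : f.IsVertex w) : f.curveGraph.degree w ≤ 3 ∧
    (f.curveGraph.degree w = 3 → ∀ p ∈ f.minimizers w, ∀ q ∈ f.minimizers w, p ≠ q →
      ∃ e, f.DualTo e p q) := by
  classical
  obtain ⟨a, ha, -⟩ := id hw
  obtain ⟨b, c, hm, hA⟩ := hf.exists_triangle hw ha
  choose! P Q hPQ using fun e (h : f.curveGraph.Inc e w) => exists_dualTo_at hf h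
  set T : Set (Sym2 (ℤ × ℤ)) := {s(a, b), s(a, c), s(b, c)} with hT
  have hmaps : (fun e => s(P e, Q e)) '' {e | f.curveGraph.Inc e w} ⊆ T := by
    rintro _ ⟨e, he, rfl⟩
    obtain ⟨h1, h2, h3⟩ := hPQ e he
    have hne := h1.ne
    rw [hm] at h2 h3
    simp only [Set.mem_insert_iff, Set.mem_singleton_iff] at h2 h3
    simp only [hT, Set.mem_insert_iff, Set.mem_singleton_iff, Sym2.eq_iff]
    rcases h2 with h2 | h2 | h2 <;> rcases h3 with h3 | h3 | h3 <;> simp_all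
  have hinj : Set.InjOn (fun e => s(P e, Q e)) {e | f.curveGraph.Inc e w} := by
    intro e he e' he' h
    obtain ⟨h1, -, -⟩ := hPQ e he
    obtain ⟨h2, -, -⟩ := hPQ e' he'
    rcases Sym2.eq_iff.1 h with ⟨h3, h4⟩ | ⟨h3, h4⟩
    · rw [h3, h4] at h1
      exact h1.unique hf h2
    · rw [h3, h4] at h1
      exact h1.unique hf h2.symm
  have hTfin : T.Finite := by simp [hT]
  have hT3 : T.ncard ≤ 3 := by
    refine (Set.ncard_insert_le _ _).trans ?_
    have := Set.ncard_insert_le s(a, c) {s(b, c)}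
    rw [Set.ncard_singleton] at this
    omega
  rw [degree_eq, ← hinj.ncard_image]
  refine ⟨(Set.ncard_le_ncard hmaps hTfin).trans hT3, fun h3 p hp q hq hpq => ?_⟩
  have hEq := Set.eq_of_subset_of_ncard_le hmaps (by omega) hTfin
  have hin : s(p, q) ∈ T := by
    rw [hm] at hp hq
    simp only [Set.mem_insert_iff, Set.mem_singleton_iff] at hp hq
    simp only [hT, Set.mem_insert_iff, Set.mem_singleton_iff, Sym2.eq_iff]
    rcases hp with h2 | h2 | h2 <;> rcases hq with h3 | h3 | h3 <;> simp_all
  rw [← hEq] at hin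
  obtain ⟨e, he, h⟩ := hin
  obtain ⟨h1, -, -⟩ := hPQ e he
  rcases Sym2.eq_iff.1 h with ⟨h3, h4⟩ | ⟨h3, h4⟩
  · rw [h3, h4] at h1; exact ⟨e, h1⟩
  · rw [h3, h4] at h1; exact ⟨e, h1.symm⟩

/-- A point that is a positive combination of support points is an interior point. -/
theorem isInner_of_comb {a b c : ℝ} (hx : x ∈ f.support) (hy : y ∈ f.support) (hz : z ∈ f.support)
    (ha : 0 < a) (hb : 0 < b) (hc : 0 ≤ c) (hA : doubleArea q x y ≠ 0)
    (h : ∀ d, a * along d q x + b * along d q y + c * along d q z = 0) : f.IsInner q := by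
  intro d hd
  by_contra! hall
  have h1 := hall x hx
  have h2 := hall y hy
  have h3 := mul_nonneg hc (hall z hz)
  have h4 := mul_nonneg ha.le h1
  have h5 := mul_nonneg hb.le h2
  have h6 := h d
  refine hd (eq_zero_of_along hA ?_ ?_)
  · exact (mul_eq_zero.1 (show a * along d q x = 0 by linarith)).resolve_left ha.ne'
  · exact (mul_eq_zero.1 (show b * along d q y = 0 by linarith)).resolve_left hb.ne'

/-- A vector parallel to `q - p` is a multiple of `q - p`. -/
theorem exists_ratio (hpq : p ≠ q) (V : ℝ × ℝ)
    (h : ((q.1 : ℝ) - p.1) * V.2 - ((q.2 : ℝ) - p.2) * V.1 = 0) :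
    ∃ k : ℝ, V.1 = k * ((q.1 : ℝ) - p.1) ∧ V.2 = k * ((q.2 : ℝ) - p.2) := by
  obtain ⟨t, ht⟩ := exists_eq_smul_perp hpq (d := (-V.2, V.1)) (by simp only [along]; linarith)
  rw [Prod.ext_iff] at ht
  simp only [perp, Prod.smul_fst, Prod.smul_snd, smul_eq_mul] at ht
  exact ⟨t, ht.2, by linarith [ht.1]⟩

/-- The point where the line through `p` and `q` meets a segment from one side to the other. -/
theorem exists_crossing (hpq : p ≠ q) (x y : ℤ × ℤ) : ∃ k : ℝ, ∀ d,
    (-doubleArea p q y : ℤ) * along d p x + (doubleArea p q x : ℤ) * along d p y =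
      k * along d p q := by
  obtain ⟨k, h1, h2⟩ := exists_ratio hpq
    ((-doubleArea p q y : ℤ) * ((x.1 : ℝ) - p.1) + (doubleArea p q x : ℤ) * ((y.1 : ℝ) - p.1),
     (-doubleArea p q y : ℤ) * ((x.2 : ℝ) - p.2) + (doubleArea p q x : ℤ) * ((y.2 : ℝ) - p.2))
    (by push_cast; rw [doubleArea_cast, doubleArea_cast]; ring)
  refine ⟨k, fun d => ?_⟩
  simp only [along]
  linear_combination d.1 * h1 + d.2 * h2

/-- If the line through the boundary points `p` and `q` separates `x` from `y`, then it meets the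
segment between them in a point between `p` and `q`. -/
theorem crossing_between (hp : p ∈ f.support) (hq : q ∈ f.support) (hp' : ¬ f.IsInner p)
    (hq' : ¬ f.IsInner q) (hx : x ∈ f.support) (hy : y ∈ f.support) (hxA : 0 < doubleArea p q x)
    (hyA : doubleArea p q y < 0) : ∃ k : ℝ, 0 ≤ k ∧ k ≤ (-doubleArea p q y : ℤ) + (doubleArea p q x : ℤ) ∧
      ∀ d, (-doubleArea p q y : ℤ) * along d p x + (doubleArea p q x : ℤ) * along d p y =
        k * along d p q := by
  have hpq : p ≠ q := (ne_of_doubleArea_ne_zero hxA.ne').1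
  obtain ⟨k, hk⟩ := exists_crossing hpq x y
  have ha : (0 : ℝ) < (-doubleArea p q y : ℤ) := by exact_mod_cast (by omega : 0 < -doubleArea p q y)
  have hb : (0 : ℝ) < (doubleArea p q x : ℤ) := by exact_mod_cast hxA
  refine ⟨k, ?_, ?_, hk⟩
  -- For `k < 0`, the point `p` would be a positive combination of `x`, `y` and `q` and hence
  -- interior. For too large `k` the same happens with `q`.
  · by_contra! hcon
    refine hp' (isInner_of_comb (a := (-doubleArea p q y : ℤ)) (b := (doubleArea p q x : ℤ))
      (c := -k) hx hy hq ha hb (by linarith) ?_ fun d => by linarith [hk d])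
    intro h0
    have e1 := hk (perp p x)
    rw [along_perp, along_perp, h0, along_perp, doubleArea_self_right,
      doubleArea_swap_right p q x] at e1
    push_cast at e1
    have := mul_neg_of_neg_of_pos hcon hb
    nlinarith
  · by_contra! hcon
    refine hq' (isInner_of_comb (a := (-doubleArea p q y : ℤ)) (b := (doubleArea p q x : ℤ))
      (c := k - ((-doubleArea p q y : ℤ) + (doubleArea p q x : ℤ))) hx hy hp ha hb (by linarith) ?_
      fun d => ?_)
    · intro h0
      have e1 := hk (perp q x)
      rw [along_sub_right _ q p x, along_sub_right _ q p y, along_sub_right _ q p q, along_perp,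
        along_perp, along_perp, along_perp, h0, doubleArea_self_right, doubleArea_rotate p q x]
        at e1
      push_cast at e1 hcon ha
      simp only [doubleArea_self_left] at e1
      push_cast at e1
      nlinarith [mul_pos hb (sub_pos.2 hcon), mul_pos hb hb]
    · rw [along_sub_right _ p q x, along_sub_right _ p q y, along_sub_right _ p q p, along_self]
      linarith [hk d]

/-- A triangle of the subdivision does not cross the chord between two boundary points. -/
theorem not_straddle (hf : f.IsSmooth) (hp : p ∈ f.minimizers w) (hq : q ∈ f.minimizers w)
    (hp' : ¬ f.IsInner p) (hq' : ¬ f.IsInner q) (hx : x ∈ f.minimizers v)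
    (hy : y ∈ f.minimizers v) (hxA : 0 < doubleArea p q x) (hyA : doubleArea p q y < 0) : False := by
  obtain ⟨k, h1, h2, h3⟩ := crossing_between hp.1 hq.1 hp' hq' hx.1 hy.1 hxA hyA
  have ha : (0 : ℝ) < (-doubleArea p q y : ℤ) := by exact_mod_cast (by omega : 0 < -doubleArea p q y)
  have hb : (0 : ℝ) < (doubleArea p q x : ℤ) := by exact_mod_cast hxA
  have h0 : ∀ z, f.term z v - f.term p v = f.term z w - f.term p w + along (v - w) p z := by
    intro z
    rw [← term_sub, add_sub_cancel]
  have e := h3 (v - w)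
  have e1 := h0 x
  have e2 := h0 y
  have e3 := h0 q
  have g1 := hp.2 x hx.1
  have g2 := hp.2 y hy.1
  have g3 := term_eq hp hq
  have g4 := hx.2 p hp.1
  have g5 := hx.2 q hq.1
  have g6 := term_eq hx hy
  set a : ℝ := ((-doubleArea p q y : ℤ) : ℝ)
  set b : ℝ := ((doubleArea p q x : ℤ) : ℝ)
  -- The segment from `x` to `y` meets the one from `p` to `q`. Evaluating at the meeting point the
  -- change of the terms from `w` to `v` shows that `x` and `y` are minimal at `w` as well, so the
  -- cell dual to `w` would have four vertices.
  have i1 : a * (f.term x w - f.term p w) + b * (f.term y w - f.term p w) =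
      (a + b) * (f.term x v - f.term p v) - k * (f.term q v - f.term p v) := by
    have : along (v - w) p x = f.term x v - f.term p v - (f.term x w - f.term p w) := by linarith
    rw [this] at e
    have : along (v - w) p y = f.term x v - f.term p v - (f.term y w - f.term p w) := by linarith
    rw [this] at e
    have : along (v - w) p q = f.term q v - f.term p v := by linarith
    rw [this] at e
    linarith
  have i2 : (a + b) * (f.term x v - f.term p v) - k * (f.term q v - f.term p v) ≤ 0 := by
    nlinarith [mul_nonneg h1 (sub_nonneg.2 g5), mul_nonneg (sub_nonneg.2 h2) (sub_nonneg.2 g4)]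
  have j1 := mul_nonneg ha.le (sub_nonneg.2 g1)
  have j2 := mul_nonneg hb.le (sub_nonneg.2 g2)
  have hx0 : f.term x w = f.term p w := by
    have : a * (f.term x w - f.term p w) = 0 := by linarith
    linarith [(mul_eq_zero.1 this).resolve_left ha.ne']
  have hy0 : f.term y w = f.term p w := by
    have : b * (f.term y w - f.term p w) = 0 := by linarith
    linarith [(mul_eq_zero.1 this).resolve_left hb.ne']
  have hxw : x ∈ f.minimizers w := (mem_minimizers_iff hp).2 ⟨hx.1, hx0⟩
  have hyw : y ∈ f.minimizers w := (mem_minimizers_iff hp).2 ⟨hy.1, hy0⟩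
  obtain ⟨h, -⟩ := hf.eq_triangle (isVertex_of_mem hxA.ne' hp hq hxw) hp hq hxw hxA.ne'
  rw [h] at hyw
  rcases hyw with rfl | rfl | rfl
  · simp at hyA
  · simp at hyA
  · omega

/-- The only exponent vectors on a chord between two boundary points are these two. -/
theorem eq_of_doubleArea_eq_zero (hp : p ∈ f.support) (hq : q ∈ f.support) (hp' : ¬ f.IsInner p)
    (hq' : ¬ f.IsInner q) (hr : r ∈ f.support) (hs : s ∈ f.support) (hrA : doubleArea p q r = 1)
    (hsA : doubleArea p q s = -1) (hx : x ∈ f.support) (h : doubleArea p q x = 0) :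
    x = p ∨ x = q := by
  have hpq : p ≠ q := (ne_of_doubleArea_ne_zero (r := r) (by omega)).1
  obtain ⟨k, hk0, hk2, hk⟩ := crossing_between hp hq hp' hq' hr hs (by omega) (by omega)
  replace hk : ∀ d, along d p r + along d p s = k * along d p q := by
    intro d
    have := hk d
    rw [hrA, hsA] at this
    push_cast at this
    linarith
  have h' : ((q.1 : ℝ) - p.1) * ((x.2 : ℝ) - p.2) - ((q.2 : ℝ) - p.2) * ((x.1 : ℝ) - p.1) = 0 := by
    rw [← doubleArea_cast]; exact_mod_cast h
  obtain ⟨t, h1, h2⟩ := exists_ratio hpq ((x.1 : ℝ) - p.1, (x.2 : ℝ) - p.2) h'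
  simp only at h1 h2
  have hal : ∀ d, along d p x = t * along d p q := by
    intro d; simp only [along]; rw [h1, h2]; ring
  have ht : ((doubleArea p x r : ℤ) : ℝ) = t := by
    have : ((doubleArea p q r : ℤ) : ℝ) = 1 := by exact_mod_cast hrA
    rw [doubleArea_cast] at this ⊢
    rw [h1, h2]
    linear_combination t * this
  have hzero : ∀ d, along d p q = 0 → 0 ≤ along d p r → 0 ≤ along d p s → d = 0 := by
    intro d hq0 hr0 hs0
    have := hk d
    rw [hq0] at this
    exact eq_zero_of_along (r := r) (by omega) hq0 (by linarith)
  -- Here `x = p + t (q - p)`. For `t < 0` the point `p` lies between `x` and `q`, with `r` and `s`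
  -- on the two sides of the line, and would be interior; for `t > 1` so would `q`. The values
  -- between 0 and 1 are excluded because `t` is the integer `doubleArea p x r`.
  rcases lt_trichotomy t 0 with htn | ht0 | htp
  · refine absurd (fun d hd => ?_) hp'
    by_contra! hall
    have e1 := hall q hq
    have e2 := hall x hx
    rw [hal] at e2
    exact hd (hzero d (le_antisymm (by nlinarith) e1) (hall r hr) (hall s hs))
  · left
    rw [ht0] at h1 h2
    refine Prod.ext ?_ ?_
    · have : (x.1 : ℝ) = p.1 := by linarith
      exact_mod_cast this
    · have : (x.2 : ℝ) = p.2 := by linarith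
      exact_mod_cast this
  · rcases lt_trichotomy t 1 with ht1 | ht1 | ht1
    · rw [← ht] at htp ht1
      have a1 : 0 < doubleArea p x r := by exact_mod_cast htp
      have a2 : doubleArea p x r < 1 := by exact_mod_cast ht1
      omega
    · right
      rw [ht1] at h1 h2
      refine Prod.ext ?_ ?_
      · have : (x.1 : ℝ) = q.1 := by linarith
        exact_mod_cast this
      · have : (x.2 : ℝ) = q.2 := by linarith
        exact_mod_cast this
    · refine absurd (fun d hd => ?_) hq'
      by_contra! hall
      have e1 := hall p hp
      have e2 := hall x hx
      have e3 := hall r hr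
      have e4 := hall s hs
      rw [along_sub_right d p] at e1 e2 e3 e4
      rw [along_self] at e1
      rw [hal] at e2
      have hq0 : along d p q = 0 := le_antisymm (by linarith) (by nlinarith)
      exact hd (hzero d hq0 (by linarith) (by linarith))

open Classical in
/-- The edge dual to a chord between two boundary points is a bridge of the curve. -/
theorem DualTo.exists_isCut (hf : f.IsSmooth) (h : f.DualTo e p q) (hp' : ¬ f.IsInner p)
    (hq' : ¬ f.IsInner q) : ∃ χ, f.curveGraph.IsCut e χ := by
  have hpq := h.ne
  obtain ⟨u, w, r, s, rfl, h1, h2, h3, h4⟩ := h.exists_triangles hf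
  have hpu : p ∈ f.minimizers u := by simp [h1]
  have hqu : q ∈ f.minimizers u := by simp [h1]
  have hru : r ∈ f.minimizers u := by simp [h1]
  have hsw : s ∈ f.minimizers w := by simp [h2]
  refine ⟨fun v => decide (∃ x ∈ f.minimizers v, 0 < doubleArea p q x), ?_⟩
  have key : ∀ {d a b}, f.curveGraph.IsLink d a b → (∃ x ∈ f.minimizers a, 0 < doubleArea p q x) →
      (¬ ∃ x ∈ f.minimizers b, 0 < doubleArea p q x) → d = s(u, w) := by
    rintro d a b hl ⟨x, hx, hxA⟩ hb
    obtain ⟨p', q', hne, rfl, k2, k3, k4, k5, k6, k7, k8⟩ := isLink_iff.1 hl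
    -- As no triangle straddles the chord, a point shared by triangles on different sides lies on
    -- the chord, and only `p` and `q` do.
    have hz : ∀ z, z ∈ f.minimizers a → z ∈ f.minimizers b → z = p ∨ z = q := by
      intro z hza hzb
      refine eq_of_doubleArea_eq_zero hpu.1 hqu.1 hp' hq' hru.1 hsw.1 h3 h4 hza.1 ?_
      refine le_antisymm (not_lt.1 fun h => hb ⟨z, hzb, h⟩) (not_lt.1 fun h => ?_)
      exact not_straddle hf hpu hqu hp' hq' hx hza hxA h
    have hd : f.DualTo s(a, b) p q := by
      rcases hz p' k5 k7 with rfl | rfl <;> rcases hz q' k6 k8 with rfl | rfl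
      · exact absurd rfl hne
      · exact dualTo_mk k2 k3 k4 hne k5 k6 k7 k8
      · exact dualTo_mk k2 k3 k4 hpq k6 k5 k8 k7
      · exact absurd rfl hne
    exact hd.unique hf h
  have hu : ∃ x ∈ f.minimizers u, 0 < doubleArea p q x := ⟨r, hru, by omega⟩
  have hw : ¬ ∃ x ∈ f.minimizers w, 0 < doubleArea p q x := by
    rw [h2]
    rintro ⟨x, rfl | rfl | rfl, hx⟩
    · simp at hx
    · simp at hx
    · omega
  intro d a b hl
  simp only [ne_eq, decide_eq_decide]
  constructor
  · intro hne
    by_cases ha : ∃ x ∈ f.minimizers a, 0 < doubleArea p q x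
    · exact key hl ha fun hb => hne ⟨fun _ => hb, fun _ => ha⟩
    · refine key hl.symm ?_ ha
      by_contra hb
      exact hne ⟨fun h => absurd h ha, fun h => absurd h hb⟩
  · rintro rfl hiff
    have := hl.2.2.2.2
    rw [Sym2.eq_iff] at this
    rcases this with ⟨rfl, rfl⟩ | ⟨rfl, rfl⟩
    · exact hw (hiff.1 hu)
    · exact hw (hiff.2 hu)

/-- An edge dual to an edge at an interior lattice point is not a bridge. -/
theorem DualTo.not_isCut (hf : f.IsSmooth) (h : f.DualTo e p q) (hp : f.IsInner p)
    (χ : ℝ × ℝ → Bool) : ¬ f.curveGraph.IsCut e χ := by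
  classical
  intro hχ
  have hpq := h.ne
  -- The triangles around `p` form a cycle, which remains connected after the edge `pq` is removed:
  -- the colour `χ` is passed on through all other sides at `p`. Colouring the neighbours of `p`
  -- accordingly brings `star_colouring` into play.
  have hsame : ∀ {w w' x}, f.IsVertex w → f.IsVertex w' → p ∈ f.minimizers w →
      p ∈ f.minimizers w' → x ∈ f.minimizers w → x ∈ f.minimizers w' → x ≠ p → x ≠ q →
      χ w = χ w' := by
    intro w w' x h1 h2 h3 h4 h5 h6 h7 h8
    by_cases hw : w = w'
    · rw [hw]
    · have hd := dualTo_mk hw h1 h2 h7.symm h3 h5 h4 h6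
      by_contra hne
      have hl : f.curveGraph.IsLink s(w, w') w w' :=
        isLink_iff.2 ⟨p, x, h7.symm, rfl, hw, h1, h2, h3, h5, h4, h6⟩
      have := (hχ hl).1 hne
      rw [this] at hd
      rcases h.mem_pair hf hd.symm with h | h
      · exact h7 h
      · exact h8 h
  have hcol : ∀ {w x}, f.IsVertex w → p ∈ f.minimizers w → x ∈ f.minimizers w → x ≠ p → x ≠ q →
      decide (∃ v, f.IsVertex v ∧ p ∈ f.minimizers v ∧ x ∈ f.minimizers v ∧ χ v = true) = χ w := by
    intro w x h1 h2 h3 h4 h5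
    by_cases hw : χ w = true
    · rw [hw, decide_eq_true_iff]
      exact ⟨w, h1, h2, h3, hw⟩
    · rw [Bool.not_eq_true] at hw
      rw [hw, decide_eq_false_iff_not]
      rintro ⟨v, k1, k2, k3, k4⟩
      rw [hsame k1 h1 k2 h2 k3 h3 h4 h5, hw] at k4
      exact Bool.false_ne_true k4
  obtain ⟨u, w, r, s, rfl, h1, h2, h3, h4⟩ := h.exists_triangles hf
  have hu : f.IsVertex u := isVertex_triangle h1 (by omega)
  have hw : f.IsVertex w := isVertex_triangle h2 (by omega)
  obtain ⟨-, hpr, hqr⟩ := ne_of_doubleArea_ne_zero (p := p) (q := q) (r := r) (by omega)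
  obtain ⟨-, hps, hqs⟩ := ne_of_doubleArea_ne_zero (p := p) (q := q) (r := s) (by omega)
  have := hf.star_colouring hp hpq (fun x => decide
    (∃ v, f.IsVertex v ∧ p ∈ f.minimizers v ∧ x ∈ f.minimizers v ∧ χ v = true))
    (fun w k1 k2 x k3 y k4 k5 k6 k7 k8 => by
      simp only [hcol k1 k2 k3 k5 k6, hcol k1 k2 k4 k7 k8])
    hu (by simp [h1]) (x := r) (by simp [h1]) hpr.symm hqr.symm hw (by simp [h2]) (y := s)
    (by simp [h2]) hps.symm hqs.symm
  simp only [hcol hu (by simp [h1]) (x := r) (by simp [h1]) hpr.symm hqr.symm,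
    hcol hw (by simp [h2]) (x := s) (by simp [h2]) hps.symm hqs.symm] at this
  have hl : f.curveGraph.IsLink s(u, w) u w := isLink_iff.2 ⟨p, q, hpq, rfl,
    ne_of_areas h1 h2 h3 h4, hu, hw, by simp [h1], by simp [h1], by simp [h2], by simp [h2]⟩
  exact (hχ hl).2 rfl this

end TropicalPolynomial

/-! ### The subdivision at a bridge of the skeleton -/

namespace TropicalPolynomial

open Graph

variable {f : TropicalPolynomial} {p q r s x y z : ℤ × ℤ} {u v w t : ℝ × ℝ} {e e' b : Sym2 (ℝ × ℝ)}

/-- The curve of `f` is smooth, `C` is obtained from it by retracting all leaves, and `S` is its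
skeleton; `m` sends each edge of `C` to the edge of `S` it has been merged into. -/
structure SkeletonData (f : TropicalPolynomial) (C S : Graph (ℝ × ℝ) (Sym2 (ℝ × ℝ)))
    (m : Sym2 (ℝ × ℝ) → Sym2 (ℝ × ℝ)) : Prop where
  smooth : f.IsSmooth
  retracts : ReflTransGen RetractsLeaf f.curveGraph C
  degree_ne_one : ∀ v ∈ C.vertexSet, C.degree v ≠ 1
  smoothing : IsSmoothing C S m
  degree_ne_two : ∀ v ∈ S.vertexSet, S.degree v ≠ 2
  genus_ne_zero : S.genus ≠ 0

theorem exists_skeletonData {S : Graph (ℝ × ℝ) (Sym2 (ℝ × ℝ))} (hf : f.IsSmooth)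
    (hS : S.IsSkeletonOf f.curveGraph) (hg : S.genus ≠ 0) : ∃ C m, SkeletonData f C S m := by
  obtain ⟨C, h1, h2, h3, h4⟩ := hS
  obtain ⟨m, hm⟩ := exists_isSmoothing (isRetract_of_reflTransGen f.isFinite_curveGraph h1).isFinite h3
  exact ⟨C, m, hf, h1, h2, hm, h4, hg⟩

/-- The point `x` beyond one side of a triangle on a chord `pq` is also beyond the chord. -/
theorem pos_of_pos_left (hp : p ∈ f.support) (hq : q ∈ f.support) (hp' : ¬ f.IsInner p)
    (hq' : ¬ f.IsInner q) (hr : r ∈ f.support) (hs : s ∈ f.support) (hrA : doubleArea p q r = 1)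
    (hsA : doubleArea p q s = -1) (hx : x ∈ f.support) (h : 0 < doubleArea p r x) :
    0 < doubleArea p q x := by
  by_contra! hcon
  rcases hcon.lt_or_eq with hlt | h0
  · refine hp' fun d hd => ?_
    by_contra! hall
    have e1 := hall q hq
    have e2 := hall r hr
    have e3 := hall x hx
    rw [along_eq hrA d x, doubleArea_swap_right] at e3
    have c1 : (0 : ℝ) < (doubleArea p r x : ℤ) := by exact_mod_cast h
    have c2 : ((doubleArea p q x : ℤ) : ℝ) < 0 := by exact_mod_cast hlt
    push_cast at e3
    refine hd (eq_zero_of_along (p := p) (q := q) (r := r) (by omega) ?_ ?_) <;> nlinarith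
  · rcases eq_of_doubleArea_eq_zero hp hq hp' hq' hr hs hrA hsA hx h0 with rfl | rfl
    · simp at h
    · rw [doubleArea_swap_right] at h; omega

theorem pos_of_pos_right (hp : p ∈ f.support) (hq : q ∈ f.support) (hp' : ¬ f.IsInner p)
    (hq' : ¬ f.IsInner q) (hr : r ∈ f.support) (hs : s ∈ f.support) (hrA : doubleArea p q r = 1)
    (hsA : doubleArea p q s = -1) (hx : x ∈ f.support) (h : 0 < doubleArea r q x) :
    0 < doubleArea p q x := by
  by_contra! hcon
  rcases hcon.lt_or_eq with hlt | h0
  · refine hq' fun d hd => ?_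
    by_contra! hall
    have e1 := hall p hp
    have e2 := hall r hr
    have e3 := hall x hx
    have hA : doubleArea q r p = 1 := by rw [doubleArea_rotate]; exact hrA
    rw [along_eq hA d x, doubleArea_swap r q x, doubleArea_rotate p q x] at e3
    have c1 : (0 : ℝ) < (doubleArea r q x : ℤ) := by exact_mod_cast h
    have c2 : ((doubleArea p q x : ℤ) : ℝ) < 0 := by exact_mod_cast hlt
    push_cast at e3
    refine hd (eq_zero_of_along (p := q) (q := r) (r := p) (by omega) ?_ ?_) <;> nlinarith
  · rcases eq_of_doubleArea_eq_zero hp hq hp' hq' hr hs hrA hsA hx h0 with rfl | rfl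
    · rw [doubleArea_swap, doubleArea_rotate] at h; omega
    · simp at h

/-- The arithmetic behind the shape of the two triangles on a bridge. -/
theorem strip_arith {A B C D : ℝ} {j k k' m m' : ℤ} (hA : 0 < A) (hC : 0 < C) (hk : 0 < k)
    (hk' : 0 < k') (hB : 0 ≤ B) (hj : B ≤ j * A) (hD : -C ≤ D) (hD' : D ≤ (1 - j) * C)
    (h1 : 0 < m * A + k * B) (h2 : 0 < m' * A - k' * B) (h3 : 0 < -(m * C) + k * D + C)
    (h4 : 0 < -(m' * C) - k' * D + C) : j = 1 ∧ D < 0 ∧ B < A ∧ 0 < B := by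
  have K : (0 : ℝ) < k := by exact_mod_cast hk
  have K' : (0 : ℝ) < k' := by exact_mod_cast hk'
  -- All four bounds are strict. Equality would mean that the supporting line at `p` or at `q`
  -- passes through `r` or `s`. Then integrality bounds `m` and `m'`, and the conditions for the two
  -- interior points at the other supporting line contradict each other.
  have c1 : 0 < B := by
    refine lt_of_le_of_ne hB fun h => ?_
    rw [← h] at h1 h2
    have m1 : (1 : ℝ) ≤ m := by
      have : (0 : ℝ) < m := by by_contra! hc; nlinarith
      exact_mod_cast (by exact_mod_cast this : 0 < m)
    have m2 : (1 : ℝ) ≤ m' := by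
      have : (0 : ℝ) < m' := by by_contra! hc; nlinarith
      exact_mod_cast (by exact_mod_cast this : 0 < m')
    have d1 : 0 < k * D := by nlinarith
    have d2 : k' * D < 0 := by nlinarith
    have d3 := pos_of_mul_pos_right d1 K.le
    nlinarith
  have c2 : -C < D := by
    refine lt_of_le_of_ne hD fun h => ?_
    rw [← h] at h3 h4
    have m1 : (m : ℝ) ≤ -k := by
      have : ((m + k : ℤ) : ℝ) < 1 := by push_cast; by_contra! hc; nlinarith
      have h5 : m + k < 1 := by exact_mod_cast this
      have h6 : m ≤ -k := by omega
      exact_mod_cast h6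
    have m2 : (m' : ℝ) ≤ k' := by
      have : ((m' - k' : ℤ) : ℝ) < 1 := by push_cast; by_contra! hc; nlinarith
      have h5 : m' - k' < 1 := by exact_mod_cast this
      have h6 : m' ≤ k' := by omega
      exact_mod_cast h6
    have d1 : (0 : ℝ) < k * (B - A) := by nlinarith
    have d2 : (0 : ℝ) < k' * (A - B) := by nlinarith
    have := pos_of_mul_pos_right d1 K.le
    have := pos_of_mul_pos_right d2 K'.le
    linarith
  have c3 : B < j * A := by
    refine lt_of_le_of_ne hj fun h => ?_
    rw [h] at h1 h2
    have m1 : (1 : ℝ) ≤ m + k * j := by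
      have : (0 : ℝ) < ((m + k * j : ℤ) : ℝ) := by push_cast; by_contra! hc; nlinarith
      exact_mod_cast (by exact_mod_cast this : 0 < m + k * j)
    have m2 : (1 : ℝ) ≤ m' - k' * j := by
      have : (0 : ℝ) < ((m' - k' * j : ℤ) : ℝ) := by push_cast; by_contra! hc; nlinarith
      exact_mod_cast (by exact_mod_cast this : 0 < m' - k' * j)
    have d1 : (0 : ℝ) < k * (D + j * C) := by nlinarith
    have d2 : (0 : ℝ) < k' * (-D - j * C) := by nlinarith
    have := pos_of_mul_pos_right d1 K.le
    have := pos_of_mul_pos_right d2 K'.le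
    linarith
  have c4 : D < (1 - j) * C := by
    refine lt_of_le_of_ne hD' fun h => ?_
    rw [h] at h3 h4
    have m1 : (m : ℝ) ≤ k * (1 - j) := by
      have : ((m - k * (1 - j) : ℤ) : ℝ) < 1 := by push_cast; by_contra! hc; nlinarith
      have h5 : m - k * (1 - j) < 1 := by exact_mod_cast this
      have h6 : m ≤ k * (1 - j) := by omega
      exact_mod_cast h6
    have m2 : (m' : ℝ) ≤ -(k' * (1 - j)) := by
      have : ((m' + k' * (1 - j) : ℤ) : ℝ) < 1 := by push_cast; by_contra! hc; nlinarith
      have h5 : m' + k' * (1 - j) < 1 := by exact_mod_cast this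
      have h6 : m' ≤ -(k' * (1 - j)) := by omega
      exact_mod_cast h6
    have d1 : (0 : ℝ) < k * (B - (j - 1) * A) := by nlinarith
    have d2 : (0 : ℝ) < k' * ((j - 1) * A - B) := by nlinarith
    have := pos_of_mul_pos_right d1 K.le
    have := pos_of_mul_pos_right d2 K'.le
    linarith
  -- By strictness, `0 < B < j * A` and `-C < D < (1 - j) * C`, so `j` is an integer strictly
  -- between 0 and 2.
  have j1 : (0 : ℝ) < j := by by_contra! hc; nlinarith
  have j2 : (j : ℝ) < 2 := by by_contra! hc; nlinarith
  have j3 : 0 < j := by exact_mod_cast j1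
  have j4 : j < 2 := by exact_mod_cast j2
  have j5 : j = 1 := by omega
  subst j5
  norm_num at c3 c4
  exact ⟨rfl, c4, c3, c1⟩

/-- If there are interior lattice points on both sides of a chord, then the triangles on this chord
form a parallelogram and their third vertices are interior. -/
theorem isInner_third (hp : p ∈ f.support) (hq : q ∈ f.support) (hp' : ¬ f.IsInner p)
    (hq' : ¬ f.IsInner q) (hr : r ∈ f.support) (hs : s ∈ f.support) (hrA : doubleArea p q r = 1)
    (hsA : doubleArea p q s = -1) (hx : f.IsInner x) (hxA : 0 < doubleArea p q x)
    (hy : f.IsInner y) (hyA : doubleArea p q y < 0) : f.IsInner r ∧ r + s = p + q := by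
  have hxs := along_eq hrA
  -- The functionals `d` and `d'` support the polygon at `p` and `q`. In the lattice coordinates of
  -- the triangle `pqr` one has `s - p = j (q - p) - (r - p)` with `j = doubleArea p s r`, so a
  -- parallelogram means `j = 1`.
  obtain ⟨d, hd, hall⟩ := exists_support_functional hp'
  obtain ⟨d', hd', hall'⟩ := exists_support_functional hq'
  have hrA' : doubleArea p q r ≠ 0 := by omega
  have K : (0 : ℝ) < (doubleArea p q x : ℤ) := by exact_mod_cast hxA
  have K' : (0 : ℝ) < -(doubleArea p q y : ℤ) := by
    have : ((doubleArea p q y : ℤ) : ℝ) < 0 := by exact_mod_cast hyA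
    linarith
  have a1 := hall q hq
  have a2 := hall r hr
  have a3 := hall s hs
  have a4 := hx.along_pos hd hall
  have a5 := hy.along_pos hd hall
  have b1 := hall' p hp
  have b2 := hall' r hr
  have b3 := hall' s hs
  have b4 := hx.along_pos hd' hall'
  have b5 := hy.along_pos hd' hall'
  rw [along_sub_right d' p] at b1 b2 b3 b4 b5
  rw [hxs, hsA] at a3 b3
  rw [hxs] at a4 a5 b4 b5
  rw [along_self] at b1
  push_cast at a3 b3
  have hA : 0 < along d p q := by
    refine lt_of_le_of_ne a1 fun h => hd (eq_zero_of_along hrA' h.symm ?_)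
    rw [← h] at a3
    linarith
  have hC : 0 < -along d' p q := by
    refine lt_of_le_of_ne (by linarith) fun h => hd' (eq_zero_of_along hrA' (by linarith) ?_)
    have h' : along d' p q = 0 := by linarith
    rw [h'] at b3 b2
    linarith
  obtain ⟨j1, hD, hBA, hB⟩ := strip_arith (B := along d p r) (D := along d' p r)
    (j := doubleArea p s r) (k := doubleArea p q x) (k' := -doubleArea p q y)
    (m := doubleArea p x r) (m' := doubleArea p y r) hA hC hxA (by omega) a2 (by linarith)
    (by linarith) (by linarith) (by linarith) (by push_cast; linarith) (by linarith)
    (by push_cast; linarith)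
  refine ⟨fun c hc => ?_, ?_⟩
  · by_contra! hallc
    have c1 := hallc p hp
    have c2 := hallc q hq
    have c4 := hx.along_pos hc hallc
    rw [along_sub_right c p] at c1 c2 c4
    rw [along_self] at c1
    rw [hxs c x] at c4
    have k1 : (1 : ℝ) ≤ (doubleArea p q x : ℤ) := by exact_mod_cast hxA
    -- A functional `c` supporting the polygon at `r` would be positive at `x`. By integrality this
    -- forces `doubleArea p x r` to be so small or so large that `x` is beyond the supporting line
    -- at `p` or at `q`.
    rcases lt_trichotomy (along c p q) 0 with h | h | h
    · have e1 : (doubleArea p q x : ℝ) - 1 < -(doubleArea p x r : ℤ) := by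
        by_contra! hcon
        nlinarith [mul_nonneg (sub_nonneg.2 k1) (sub_nonneg.2 (by linarith : along c p r ≤ along c p q))]
      have e2 : ((doubleArea p q x - 1 : ℤ) : ℝ) < ((-(doubleArea p x r) : ℤ) : ℝ) := by
        push_cast; exact e1
      have e3 : doubleArea p q x - 1 < -(doubleArea p x r) := by exact_mod_cast e2
      have e4 : doubleArea p q x ≤ -(doubleArea p x r) := by omega
      have e5 : ((doubleArea p q x : ℤ) : ℝ) ≤ -(doubleArea p x r : ℤ) := by exact_mod_cast e4
      nlinarith
    · rw [h] at c4
      nlinarith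
    · have e1 : (0 : ℝ) < (doubleArea p x r : ℤ) := by
        by_contra! hcon
        nlinarith [mul_nonneg (sub_nonneg.2 k1) (sub_nonneg.2 c1)]
      have e2 : (1 : ℝ) ≤ (doubleArea p x r : ℤ) := by
        have : 0 < doubleArea p x r := by exact_mod_cast e1
        exact_mod_cast this
      nlinarith
  · simp only [doubleArea] at hrA hsA j1
    refine Prod.ext ?_ ?_ <;> simp only [Prod.fst_add, Prod.snd_add]
    · linear_combination (-(s.1 - p.1) : ℤ) * hrA + (r.1 - p.1) * hsA + (q.1 - p.1) * j1
    · linear_combination (-(s.2 - p.2) : ℤ) * hrA + (r.2 - p.2) * hsA + (q.2 - p.2) * j1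

namespace SkeletonData

variable {C S : Graph (ℝ × ℝ) (Sym2 (ℝ × ℝ))} {m : Sym2 (ℝ × ℝ) → Sym2 (ℝ × ℝ)}

theorem isRetract (h : SkeletonData f C S m) : IsRetract f.curveGraph C :=
  isRetract_of_reflTransGen f.isFinite_curveGraph h.retracts

theorem isFinite (h : SkeletonData f C S m) : C.IsFinite := h.isRetract.isFinite

theorem isConnected (h : SkeletonData f C S m) : C.IsConnected :=
  h.isRetract.isConnected h.smooth.isConnected

/-- The vertices whose triangles have an interior lattice point have two edges to vertices of the
same kind, dual to the two sides at such a point. So none of them ever becomes a leaf. -/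
theorem mem_of_isInner (h : SkeletonData f C S m) (hv : f.IsVertex v) (hp : p ∈ f.minimizers v)
    (hp' : f.IsInner p) : v ∈ C.vertexSet := by
  have hf := h.smooth
  refine subset_of_reflTransGen f.isFinite_curveGraph h.retracts
    (X := {v | f.IsVertex v ∧ ∃ p ∈ f.minimizers v, f.IsInner p}) (fun v hv => hv.1) ?_
    ⟨hv, p, hp, hp'⟩
  rintro v ⟨hv, p, hp, hp'⟩
  obtain ⟨a, b, hm, hA⟩ := hf.exists_triangle hv hp
  obtain ⟨hpa, hpb, hab⟩ := ne_of_doubleArea_ne_zero (p := p) (q := a) (r := b) (by omega)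
  have key : ∀ a ∈ f.minimizers v, p ≠ a → ∃ d y, f.DualTo d p a ∧
      (f.IsVertex y ∧ ∃ p ∈ f.minimizers y, f.IsInner p) ∧ f.curveGraph.IsLink d v y := by
    intro a ha hpa
    obtain ⟨d, hd⟩ := hp'.exists_dualTo hf hv hp ha hpa
    obtain ⟨y, hy⟩ := (hd.inc_iff hf).2 ⟨hv, hp, ha⟩
    have := (hd.inc_iff hf).1 hy.inc_right
    exact ⟨d, y, hd, ⟨this.1, p, this.2.1, hp'⟩, hy⟩
  obtain ⟨d, y, h1, h2, h3⟩ := key a (by simp [hm]) hpa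
  obtain ⟨d', y', h4, h5, h6⟩ := key b (by simp [hm]) hpb
  refine ⟨d, d', y, y', ?_, h2, h5, h3, h6⟩
  rintro rfl
  rcases h1.mem_pair hf h4.symm with h | h
  · exact hpb h.symm
  · exact hab h.symm

theorem degree_ne_zero (h : SkeletonData f C S m) (hv : v ∈ C.vertexSet) : C.degree v ≠ 0 := by
  intro h0
  apply h.genus_ne_zero
  rw [h.smoothing.genus_eq]
  exact genus_eq_zero_of_degree_eq_zero h.isFinite h.isConnected hv h0

theorem inc_of_inc (h : SkeletonData f C S m) (he : C.Inc e v) : f.curveGraph.Inc e v := by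
  obtain ⟨y, hy⟩ := he
  exact ((h.isRetract.link_iff _ _ _).1 hy).1.inc_left

theorem degree_eq (h : SkeletonData f C S m) (v : ℝ × ℝ) : C.degree v = {e | C.Inc e v}.ncard := by
  have : {e | C.IsLoopAt e v} = ∅ := Set.eq_empty_iff_forall_notMem.2 fun e he =>
    not_isLoopAt ((h.isRetract.link_iff _ _ _).1 he).1
  rw [Graph.degree, this]
  simp

theorem isVertex (h : SkeletonData f C S m) (hv : v ∈ C.vertexSet) : f.IsVertex v :=
  h.isRetract.subset hv

/-- The dual cell is a triangle, so the degree is at most 3. The values 0, 1 and 2 are excluded by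
the genus, by the end of retraction and by the end of smoothing. In particular nothing has been
retracted at `t`. -/
theorem degree_eq_three (h : SkeletonData f C S m) (ht : t ∈ S.vertexSet) :
    C.degree t = 3 ∧ f.curveGraph.degree t = 3 := by
  have ht' := h.smoothing.subset ht
  have h1 := h.smoothing.degree_eq t ht
  have h2 := h.degree_ne_zero ht'
  have h3 := h.degree_ne_one t ht'
  have h4 := h.degree_ne_two t ht
  have h5 := h.isRetract.degree_le t
  have h6 := (degree_le_three h.smooth (h.isVertex ht')).1
  omega

theorem inc_iff (h : SkeletonData f C S m) (ht : t ∈ S.vertexSet) :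
    C.Inc e t ↔ f.curveGraph.Inc e t := by
  refine ⟨h.inc_of_inc, fun he => ?_⟩
  obtain ⟨h1, h2⟩ := h.degree_eq_three ht
  rw [h.degree_eq] at h1
  rw [TropicalPolynomial.degree_eq] at h2
  have := Set.eq_of_subset_of_ncard_le (s := {e | C.Inc e t}) (t := {e | f.curveGraph.Inc e t})
    (fun e he => h.inc_of_inc he) (by omega) (f.isFinite_curveGraph.inc_finite t)
  have he' : e ∈ {e | f.curveGraph.Inc e t} := he
  rw [← this] at he'
  exact he'

theorem exists_dualTo (h : SkeletonData f C S m) (ht : t ∈ S.vertexSet) (hp : p ∈ f.minimizers t)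
    (hq : q ∈ f.minimizers t) (hpq : p ≠ q) : ∃ e, f.DualTo e p q ∧ C.Inc e t := by
  obtain ⟨e, he⟩ := (degree_le_three h.smooth (h.isVertex (h.smoothing.subset ht))).2
    (h.degree_eq_three ht).2 p hp q hq hpq
  exact ⟨e, he, (h.inc_iff ht).2
    ((he.inc_iff h.smooth).2 ⟨h.isVertex (h.smoothing.subset ht), hp, hq⟩)⟩

theorem mem_of_inc (h : SkeletonData f C S m) (hv : v ∈ C.vertexSet) {e₁ e₂ e₃}
    (h1 : C.Inc e₁ v) (h2 : C.Inc e₂ v) (h3 : C.Inc e₃ v) (h12 : e₁ ≠ e₂) (h13 : e₁ ≠ e₃)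
    (h23 : e₂ ≠ e₃) : v ∈ S.vertexSet := by
  by_contra hS
  have hd := h.smoothing.degree_two v hv hS
  rw [h.degree_eq] at hd
  have : ({e₁, e₂, e₃} : Set (Sym2 (ℝ × ℝ))) ⊆ {e | C.Inc e v} := by
    rintro e (rfl | rfl | rfl) <;> assumption
  have h3 := Set.ncard_le_ncard this (h.isFinite.inc_finite v)
  rw [Set.ncard_eq_three.2 ⟨_, _, _, h12, h13, h23, rfl⟩] at h3
  omega

/-- There is no retracted graph beyond a chord without interior lattice points beyond it. -/
theorem notMem_of_forall (h : SkeletonData f C S m) (n : ℕ) : ∀ {u w p q r s},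
    f.minimizers u = {p, q, r} → f.minimizers w = {p, q, s} → doubleArea p q r = 1 →
    doubleArea p q s = -1 → ¬ f.IsInner p → ¬ f.IsInner q →
    (∀ x ∈ f.support, 0 < doubleArea p q x → ¬ f.IsInner x) →
    (f.support.filter fun x => 0 < doubleArea p q x).card ≤ n → u ∉ C.vertexSet := by
  have hf := h.smooth
  induction n with
  | zero =>
    intro u w p q r s h1 h2 h3 h4 hp hq hno hcard
    have hr : r ∈ f.minimizers u := by simp [h1]
    have : r ∈ f.support.filter fun x => 0 < doubleArea p q x :=
      Finset.mem_filter.2 ⟨hr.1, by omega⟩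
    rw [Nat.le_zero, Finset.card_eq_zero] at hcard
    rw [hcard] at this
    simp at this
  | succ n ih =>
    intro u w p q r s h1 h2 h3 h4 hp hq hno hcard hu
    have hpu : p ∈ f.minimizers u := by simp [h1]
    have hqu : q ∈ f.minimizers u := by simp [h1]
    have hru : r ∈ f.minimizers u := by simp [h1]
    have hsw : s ∈ f.minimizers w := by simp [h2]
    obtain ⟨hpq, hpr, hqr⟩ := ne_of_doubleArea_ne_zero (p := p) (q := q) (r := r) (by omega)
    have hr := hno r hru.1 (by omega)
    -- As `u` is not a leaf of `C`, a second edge leads on through `pr` or `qr`. Since `r` is not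
    -- interior, this side is again a chord, and fewer exponents lie beyond it, because `r` no
    -- longer does.
    obtain ⟨e, he, hne⟩ : ∃ e, C.Inc e u ∧ e ≠ s(u, w) := by
      by_contra! hall
      have h5 := h.degree_ne_zero hu
      have h6 := h.degree_ne_one u hu
      rw [h.degree_eq] at h5 h6
      have := Set.ncard_le_ncard (s := {e | C.Inc e u}) (t := {s(u, w)}) (fun e he => hall e he)
      rw [Set.ncard_singleton] at this
      omega
    obtain ⟨y, hy⟩ := he
    obtain ⟨hl, -, hyC⟩ := (h.isRetract.link_iff _ _ _).1 hy
    obtain ⟨a, b, hab, ha, hb⟩ := exists_dualTo_at hf hl.inc_left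
    have hd := dualTo_of_areas h1 h2 h3 h4
    have hdual : f.DualTo e p r ∨ f.DualTo e q r := by
      rw [h1] at ha hb
      rcases ha with rfl | rfl | rfl <;> rcases hb with rfl | rfl | rfl
      · exact absurd rfl hab.ne
      · exact absurd (hab.unique hf hd) hne
      · exact Or.inl hab
      · exact absurd (hab.unique hf hd.symm) hne
      · exact absurd rfl hab.ne
      · exact Or.inr hab
      · exact Or.inl hab.symm
      · exact Or.inr hab.symm
      · exact absurd rfl hab.ne
    have hv : f.IsVertex u := h.isVertex hu
    rcases hdual with hd' | hd'
    · obtain ⟨hyV, hpy, hry⟩ := (hd'.inc_iff hf).1 hl.inc_right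
      obtain ⟨r', h5, h6⟩ := hf.exists_triangle_of_ne hyV hpy hry hpr
      have hpq' : doubleArea p r q = -1 := by rw [doubleArea_swap_right, h3]
      have h7 := doubleArea_mul_neg hpr hpu hru hpy hry hqu (x := r') (by simp [h5]) (by omega)
        (by rintro h; simp [h] at h6) hl.2.2.1
      have h8 : doubleArea p r r' = 1 := by
        rw [hpq'] at h7
        rcases area_cases h6 with h | h <;> omega
      have hpos : ∀ x ∈ f.support, 0 < doubleArea p r x → 0 < doubleArea p q x :=
        fun x hx => pos_of_pos_left hpu.1 hqu.1 hp hq hru.1 hsw.1 h3 h4 hx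
      refine ih h5 (w := u) (s := q) (by rw [h1, Set.pair_comm]) h8 hpq' hp hr
        (fun x hx hxA => hno x hx (hpos x hx hxA)) ?_ hyC
      refine Nat.lt_succ_iff.1 (lt_of_lt_of_le (Finset.card_lt_card ?_) hcard)
      refine Finset.ssubset_iff_of_subset ?_ |>.2 ⟨r, ?_, ?_⟩
      · intro x hx
        rw [Finset.mem_filter] at hx ⊢
        exact ⟨hx.1, hpos x hx.1 hx.2⟩
      · exact Finset.mem_filter.2 ⟨hru.1, by omega⟩
      · simp
    · obtain ⟨hyV, hqy, hry⟩ := (hd'.inc_iff hf).1 hl.inc_right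
      obtain ⟨r', h5, h6⟩ := hf.exists_triangle_of_ne hyV hry hqy hqr.symm
      have hpq' : doubleArea r q p = -1 := by rw [doubleArea_swap, doubleArea_rotate, h3]
      have h7 := doubleArea_mul_neg hqr.symm hru hqu hry hqy hpu (x := r') (by simp [h5]) (by omega)
        (by rintro h; simp [h] at h6) hl.2.2.1
      have h8 : doubleArea r q r' = 1 := by
        rw [hpq'] at h7
        rcases area_cases h6 with h | h <;> omega
      have hpos : ∀ x ∈ f.support, 0 < doubleArea r q x → 0 < doubleArea p q x :=
        fun x hx => pos_of_pos_right hpu.1 hqu.1 hp hq hru.1 hsw.1 h3 h4 hx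
      refine ih h5 (w := u) (s := p) (by rw [h1]; ext; simp; tauto) h8 hpq' hr hq
        (fun x hx hxA => hno x hx (hpos x hx hxA)) ?_ hyC
      refine Nat.lt_succ_iff.1 (lt_of_lt_of_le (Finset.card_lt_card ?_) hcard)
      refine Finset.ssubset_iff_of_subset ?_ |>.2 ⟨r, ?_, ?_⟩
      · intro x hx
        rw [Finset.mem_filter] at hx ⊢
        exact ⟨hx.1, hpos x hx.1 hx.2⟩
      · exact Finset.mem_filter.2 ⟨hru.1, by omega⟩
      · simp

/-- The shape of the subdivision at a chord whose dual edge survives in the skeleton. -/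
theorem isInner_of_chord (h : SkeletonData f C S m) (hu : f.minimizers u = {p, q, r})
    (hw : f.minimizers w = {p, q, s}) (hr : doubleArea p q r = 1) (hs : doubleArea p q s = -1)
    (hp : ¬ f.IsInner p) (hq : ¬ f.IsInner q) (huC : u ∈ C.vertexSet) (hwC : w ∈ C.vertexSet) :
    f.IsInner r ∧ f.IsInner s ∧ r + s = p + q := by
  have hpu : p ∈ f.minimizers u := by simp [hu]
  have hqu : q ∈ f.minimizers u := by simp [hu]
  have hru : r ∈ f.minimizers u := by simp [hu]
  have hsw : s ∈ f.minimizers w := by simp [hw]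
  obtain ⟨x, -, hxA, hx⟩ : ∃ x ∈ f.support, 0 < doubleArea p q x ∧ f.IsInner x := by
    by_contra! hall
    exact h.notMem_of_forall _ hu hw hr hs hp hq hall le_rfl huC
  have hs' : doubleArea q p s = 1 := by rw [doubleArea_swap, hs]; rfl
  have hr' : doubleArea q p r = -1 := by rw [doubleArea_swap, hr]
  obtain ⟨y, -, hyA, hy⟩ : ∃ x ∈ f.support, 0 < doubleArea q p x ∧ f.IsInner x := by
    by_contra! hall
    exact h.notMem_of_forall _ (u := w) (w := u) (p := q) (q := p) (r := s) (s := r)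
      (by rw [hw, Set.insert_comm]) (by rw [hu, Set.insert_comm]) hs' hr' hq hp hall le_rfl hwC
  have hxA' : doubleArea q p x < 0 := by rw [doubleArea_swap]; omega
  have hyA' : doubleArea p q y < 0 := by rw [doubleArea_swap]; omega
  obtain ⟨h1, h2⟩ := isInner_third hpu.1 hqu.1 hp hq hru.1 hsw.1 hr hs hx hxA hy hyA'
  obtain ⟨h3, -⟩ := isInner_third hqu.1 hpu.1 hq hp hsw.1 hru.1 hs' hr' hy hyA hx hxA'
  exact ⟨h1, h3, h2⟩

/-- The shape of the subdivision at a bridge of the skeleton. -/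
theorem exists_of_isBridge (h : SkeletonData f C S m) (hb : S.IsBridge b) :
    ∃ u w p q r s, b = s(u, w) ∧ S.IsLink b u w ∧ f.minimizers u = {p, q, r} ∧
      f.minimizers w = {p, q, s} ∧ doubleArea p q r = 1 ∧ doubleArea p q s = -1 ∧
      ¬ f.IsInner p ∧ ¬ f.IsInner q ∧ f.IsInner r ∧ f.IsInner s ∧ r + s = p + q := by
  have hf := h.smooth
  -- The cut is lifted from the skeleton to the curve. Edges dual to a side at an interior lattice
  -- point are not cuts, so `b` is dual to a chord between boundary points.
  obtain ⟨χ, hχ⟩ := h.smoothing.exists_isCut b hb.1 (hb.exists_isCut h.smoothing.isFinite)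
  obtain ⟨hmb, hbC⟩ := h.smoothing.edge_mem b hb.1
  obtain ⟨χ', hχ'⟩ := h.isRetract.exists_isCut b hbC ⟨χ, hχ⟩
  obtain ⟨u₀, w₀, hl⟩ := C.exists_isLink_of_mem_edgeSet hbC
  obtain ⟨hl', hu₀, hw₀⟩ := (h.isRetract.link_iff _ _ _).1 hl
  obtain ⟨p, q, hd⟩ := TropicalPolynomial.exists_dualTo hl'.edge_mem
  have hp : ¬ f.IsInner p := fun hp => hd.not_isCut hf hp χ' hχ'
  have hq : ¬ f.IsInner q := fun hq => hd.symm.not_isCut hf hq χ' hχ'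
  obtain ⟨u, w, r, s, rfl, h1, h2, h3, h4⟩ := hd.exists_triangles hf
  have huw : u ∈ C.vertexSet ∧ w ∈ C.vertexSet := by
    have := hl'.2.2.2.2
    rw [Sym2.eq_iff] at this
    rcases this with ⟨rfl, rfl⟩ | ⟨rfl, rfl⟩
    · exact ⟨hu₀, hw₀⟩
    · exact ⟨hw₀, hu₀⟩
  have hlC : C.IsLink s(u, w) u w := by
    rw [h.isRetract.link_iff]
    exact ⟨isLink_iff.2 ⟨p, q, hd.ne, rfl, ne_of_areas h1 h2 h3 h4, h.isVertex huw.1,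
      h.isVertex huw.2, by simp [h1], by simp [h1], by simp [h2], by simp [h2]⟩, huw⟩
  obtain ⟨h5, h6, h7⟩ := h.isInner_of_chord h1 h2 h3 h4 hp hq huw.1 huw.2
  -- Besides the bridge, the edges dual to the two sides at the interior point `r` survive
  -- retraction, so the vertex is 3-valent in `C` and survives smoothing.
  have key : ∀ {u r}, f.minimizers u = {p, q, r} → doubleArea p q r ≠ 0 → f.IsInner r →
      u ∈ C.vertexSet → ∀ e, C.Inc e u → f.DualTo e p q → u ∈ S.vertexSet := by
    intro u r hm hA hr huC e he hd
    obtain ⟨-, hpr, hqr⟩ := ne_of_doubleArea_ne_zero hA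
    have hV := h.isVertex huC
    have hedge : ∀ a ∈ f.minimizers u, r ≠ a → ∃ d, f.DualTo d r a ∧ C.Inc d u := by
      intro a ha hra
      obtain ⟨d, hd⟩ := hr.exists_dualTo hf hV (by simp [hm]) ha hra
      obtain ⟨y, hy⟩ := (hd.inc_iff hf).2 ⟨hV, by simp [hm], ha⟩
      have hy' := (hd.inc_iff hf).1 hy.inc_right
      exact ⟨d, hd, y, (h.isRetract.link_iff _ _ _).2 ⟨hy, huC,
        h.mem_of_isInner hy'.1 hy'.2.1 hr⟩⟩
    obtain ⟨d, hd1, hd2⟩ := hedge p (by simp [hm]) hpr.symm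
    obtain ⟨d', hd1', hd2'⟩ := hedge q (by simp [hm]) hqr.symm
    refine h.mem_of_inc huC he hd2 hd2' ?_ ?_ ?_
    · rintro rfl
      rcases hd.mem_pair hf hd1 with h | h
      · exact hpr h.symm
      · exact hqr h.symm
    · rintro rfl
      rcases hd.mem_pair hf hd1' with h | h
      · exact hpr h.symm
      · exact hqr h.symm
    · rintro rfl
      rcases hd1.mem_pair hf hd1'.symm with h | h
      · exact hqr h
      · exact hd.ne h.symm
  have huS := key h1 (by omega) h5 huw.1 _ hlC.inc_left hd
  have hwS := key h2 (by omega) h6 huw.2 _ hlC.inc_right hd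
  refine ⟨u, w, p, q, r, s, rfl, ?_, h1, h2, h3, h4, hp, hq, h5, h6, h7⟩
  have i1 := h.smoothing.inc _ _ hlC.inc_left huS
  have i2 := h.smoothing.inc _ _ hlC.inc_right hwS
  rw [hmb] at i1 i2
  obtain ⟨y, hy⟩ := i1
  rcases i2.eq_or_eq_of_isLink hy with rfl | rfl
  · exact absurd rfl (ne_of_areas h1 h2 h3 h4)
  · exact hy

/-- At an end of a bridge, the dual triangle has two boundary vertices and one interior vertex. So
only one of its sides is a chord, and no second bridge ends there. -/
theorem good (h : SkeletonData f C S m) : S.Good := by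
  have hf := h.smooth
  refine ⟨h.smoothing.isFinite, h.smoothing.isConnected h.isConnected, fun t ht => ?_, ?_⟩
  · rw [h.smoothing.degree_eq t ht, (h.degree_eq_three ht).1]
  · intro d d' x hd hd' hx hx'
    obtain ⟨u, w, p, q, r, s, rfl, h1, h2, h3, h4, h5, h6, h7, h8, h9, -⟩ := h.exists_of_isBridge hd
    obtain ⟨u', w', p', q', r', s', rfl, k1, k2, k3, k4, k5, k6, k7, k8, k9, -⟩ :=
      h.exists_of_isBridge hd'
    have hD := dualTo_of_areas h2 h3 h4 h5
    have hD' := dualTo_of_areas k2 k3 k4 k5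
    obtain ⟨r₀, hr₀, hr₀'⟩ : ∃ r₀, f.minimizers x = {p, q, r₀} ∧ f.IsInner r₀ := by
      rcases hx.eq_or_eq_of_isLink h1 with rfl | rfl
      · exact ⟨r, h2, h8⟩
      · exact ⟨s, h3, h9⟩
    have hpq' : p' ∈ f.minimizers x ∧ q' ∈ f.minimizers x := by
      rcases hx'.eq_or_eq_of_isLink k1 with rfl | rfl
      · simp [k2]
      · simp [k3]
    rw [hr₀] at hpq'
    have hne := hD'.ne
    have key : ∀ z, z ∈ ({p, q, r₀} : Set (ℤ × ℤ)) → ¬ f.IsInner z → z = p ∨ z = q := by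
      rintro z (rfl | rfl | rfl) hz
      · exact Or.inl rfl
      · exact Or.inr rfl
      · exact absurd hr₀' hz
    have e1 := key _ hpq'.1 k6
    have e2 := key _ hpq'.2 k7
    rcases e1 with rfl | rfl <;> rcases e2 with rfl | rfl
    · exact absurd rfl hne
    · exact hD.unique hf hD'
    · exact hD.unique hf hD'.symm
    · exact absurd rfl hne

end SkeletonData

end TropicalPolynomial

/-! ### Regularity of the flipped triangulation -/

namespace TropicalPolynomial

open Graph

variable {f : TropicalPolynomial} {p q r s x y z : ℤ × ℤ} {u v w t : ℝ × ℝ}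

/-- Two triangles that form a parallelogram with a diagonal `pq` between boundary points. -/
structure IsParallelogram (f : TropicalPolynomial) (u w : ℝ × ℝ) (p q r s : ℤ × ℤ) : Prop where
  smooth : f.IsSmooth
  left : f.minimizers u = {p, q, r}
  right : f.minimizers w = {p, q, s}
  areaLeft : doubleArea p q r = 1
  areaRight : doubleArea p q s = -1
  notInner : ¬ f.IsInner p
  notInner' : ¬ f.IsInner q
  sum : r + s = p + q

/-- The length of the edge dual to the diagonal. -/
def gap (f : TropicalPolynomial) (p r : ℤ × ℤ) (w : ℝ × ℝ) : ℝ := f.term r w - f.term p w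

namespace IsParallelogram

theorem symm (h : IsParallelogram f u w p q r s) : IsParallelogram f w u q p s r where
  smooth := h.smooth
  left := by rw [h.right, Set.insert_comm]
  right := by rw [h.left, Set.insert_comm]
  areaLeft := by rw [doubleArea_swap, h.areaRight]; rfl
  areaRight := by rw [doubleArea_swap, h.areaLeft]
  notInner := h.notInner'
  notInner' := h.notInner
  sum := by rw [add_comm, h.sum, add_comm]

variable (h : IsParallelogram f u w p q r s)
include h

theorem mem₁ : p ∈ f.minimizers u := by simp [h.left]
theorem mem₂ : q ∈ f.minimizers u := by simp [h.left]
theorem mem₃ : r ∈ f.minimizers u := by simp [h.left]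
theorem mem₄ : p ∈ f.minimizers w := by simp [h.right]
theorem mem₅ : q ∈ f.minimizers w := by simp [h.right]
theorem mem₆ : s ∈ f.minimizers w := by simp [h.right]

theorem ne : p ≠ q := (ne_of_doubleArea_ne_zero (by rw [h.areaLeft]; exact one_ne_zero)).1

theorem eq_left (hx : x ∈ f.minimizers u) (hA : doubleArea p q x ≠ 0) : x = r := by
  rw [h.left] at hx
  rcases hx with rfl | rfl | hx
  · simp at hA
  · simp at hA
  · exact hx

theorem eq_right (hx : x ∈ f.minimizers w) (hA : doubleArea p q x ≠ 0) : x = s := by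
  rw [h.right] at hx
  rcases hx with rfl | rfl | hx
  · simp at hA
  · simp at hA
  · exact hx

/-- The vector `u - w` is a multiple of `perp p q`; comparing the terms of `r` at both points
identifies the factor as minus the gap. -/
theorem term_left (x : ℤ × ℤ) : f.term x u - f.term p u =
    f.term x w - f.term p w - gap f p r w * doubleArea p q x := by
  have h0 := fun z => term_sub f p z w (u - w)
  simp only [add_sub_cancel] at h0
  obtain ⟨τ, hτ⟩ := exists_eq_smul_perp h.ne (d := u - w) (by
    have := h0 q
    rw [term_eq h.mem₁ h.mem₂, term_eq h.mem₄ h.mem₅] at this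
    linarith)
  have h1 := h0 r
  rw [hτ, along_smul, along_perp, h.areaLeft, term_eq h.mem₁ h.mem₃] at h1
  rw [h0, hτ, along_smul, along_perp, gap]
  push_cast at h1
  have : τ = -(f.term r w - f.term p w) := by linarith
  rw [this]
  ring

theorem gap_symm : gap f q s u = gap f p r w := by
  have := h.term_left s
  rw [h.areaRight, term_eq h.mem₄ h.mem₆] at this
  push_cast at this
  rw [gap, term_eq h.mem₁ h.mem₂]
  linarith

theorem along_sum (d : ℝ × ℝ) : along d p r + along d p s = along d p q := by
  have h1 := congrArg Prod.fst h.sum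
  have h2 := congrArg Prod.snd h.sum
  simp only [Prod.fst_add, Prod.snd_add] at h1 h2
  have h1' : (r.1 : ℝ) + s.1 = p.1 + q.1 := by exact_mod_cast h1
  have h2' : (r.2 : ℝ) + s.2 = p.2 + q.2 := by exact_mod_cast h2
  simp only [along]
  linear_combination d.1 * h1' + d.2 * h2'

theorem not_straddle (hx : x ∈ f.minimizers v) (hy : y ∈ f.minimizers v)
    (hxA : 0 < doubleArea p q x) (hyA : doubleArea p q y < 0) : False :=
  TropicalPolynomial.not_straddle h.smooth h.mem₁ h.mem₂ h.notInner h.notInner' hx hy hxA hyA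

/-- At the other vertices on the side of `w`, the terms on the side of `u` exceed the minimum by
more than the length of the edge from `u` to `w`. -/
theorem gap_mul_lt (ht : f.IsVertex t) (htw : t ≠ w)
    (hneg : ∀ z ∈ f.minimizers t, doubleArea p q z ≤ 0) (hx : x ∈ f.support)
    (hxA : 0 < doubleArea p q x) (hy : y ∈ f.minimizers t) :
    gap f p r w * doubleArea p q x < f.term x t - f.term y t := by
  obtain ⟨z, hz, hz0⟩ := IsTwoDimensional.exists_doubleArea_ne ht h.ne
  have hzA : doubleArea p q z < 0 := lt_of_le_of_ne (hneg z hz) hz0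
  -- The segment from `x` to `z` crosses the chord between `p` and `q`, whose terms are not below
  -- the minimum at `t`. Hence the excess of `x` over the minimum at `t` is at least the one at `w`,
  -- which in turn is at least the gap times the area, as `p` is minimal at `u`.
  obtain ⟨k, hk0, hk1, hk⟩ := crossing_between h.mem₁.1 h.mem₂.1 h.notInner h.notInner' hx hz.1 hxA hzA
  have hX : (0 : ℝ) < (doubleArea p q x : ℤ) := by exact_mod_cast hxA
  have hZ : (0 : ℝ) < (-doubleArea p q z : ℤ) := by
    exact_mod_cast (by omega : 0 < -doubleArea p q z)
  have h0 := fun z => term_sub f p z w (t - w)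
  simp only [add_sub_cancel] at h0
  have e := hk (t - w)
  have ep := hy.2 p h.mem₁.1
  have eq := hy.2 q h.mem₂.1
  have es := hy.2 s h.mem₆.1
  have ez := term_eq hy hz
  have gz := h.mem₄.2 z hz.1
  have gq := term_eq h.mem₄ h.mem₅
  have gs := term_eq h.mem₄ h.mem₆
  have e1 := h0 x
  have e2 := h0 q
  have e3 := h0 z
  have hu := h.term_left x
  have hux := h.mem₁.2 x hx
  have hcross : (-doubleArea p q z : ℤ) *
      (f.term x t - f.term y t - (f.term x w - f.term p w)) +
      (doubleArea p q x : ℤ) * (-(f.term z w - f.term p w)) =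
      k * (f.term q t - f.term y t) +
      ((-doubleArea p q z : ℤ) + (doubleArea p q x : ℤ) - k) * (f.term p t - f.term y t) := by
    have i1 : along (t - w) p x = f.term x t - f.term p t - (f.term x w - f.term p w) := by linarith
    have i2 : along (t - w) p q = f.term q t - f.term p t := by linarith
    have i3 : along (t - w) p z = f.term y t - f.term p t - (f.term z w - f.term p w) := by linarith
    rw [i1, i2, i3] at e
    linear_combination e
  have hR : 0 ≤ k * (f.term q t - f.term y t) +
      ((-doubleArea p q z : ℤ) + (doubleArea p q x : ℤ) - k) * (f.term p t - f.term y t) :=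
    add_nonneg (mul_nonneg hk0 (by linarith)) (mul_nonneg (by linarith) (by linarith))
  rw [← hcross] at hR
  have hz1 : 0 ≤ (doubleArea p q x : ℤ) * (f.term z w - f.term p w) :=
    mul_nonneg hX.le (by linarith)
  have hAx : 0 ≤ f.term x t - f.term y t - (f.term x w - f.term p w) := by
    by_contra! hc
    have := mul_neg_of_pos_of_neg hZ hc
    linarith
  -- Equality forces `x = r` and `z = s`, and then `p` and `q` are minimal at `t` too, so that `t =
  -- w`.
  refine lt_of_le_of_ne (by linarith) fun heq => ?_
  have hA0 : f.term x t - f.term y t - (f.term x w - f.term p w) = 0 := by linarith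
  have hxu : x ∈ f.minimizers u := (mem_minimizers_iff h.mem₁).2 ⟨hx, by linarith⟩
  have hxr := h.eq_left hxu hxA.ne'
  subst hxr
  rw [hA0] at hR
  have hz2 : f.term z w - f.term p w = 0 := by
    have : (doubleArea p q x : ℤ) * (f.term z w - f.term p w) = 0 := by linarith
    exact (mul_eq_zero.1 this).resolve_left hX.ne'
  have hzw : z ∈ f.minimizers w := (mem_minimizers_iff h.mem₄).2 ⟨hz.1, by linarith⟩
  have hzs := h.eq_right hzw hz0
  subst hzs
  have hs := h.along_sum (t - w)
  have hp0 : f.term p t = f.term y t := by linarith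
  have hq0 : f.term q t = f.term y t := by linarith
  exact htw (eq_of_mem_minimizers hz0 ((mem_minimizers_iff hy).2 ⟨h.mem₁.1, hp0⟩)
    ((mem_minimizers_iff hy).2 ⟨h.mem₂.1, hq0⟩) hz h.mem₄ h.mem₅ h.mem₆)

theorem area_sum (a x : ℤ × ℤ) : doubleArea a x r + doubleArea a x s =
    doubleArea a x p + doubleArea a x q := by
  have h1 := congrArg Prod.fst h.sum
  have h2 := congrArg Prod.snd h.sum
  simp only [Prod.fst_add, Prod.snd_add] at h1 h2
  simp only [doubleArea]
  linear_combination (x.1 - a.1) * h2 - (x.2 - a.2) * h1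

theorem area_psr : doubleArea p s r = 1 := by
  have h1 := h.area_sum p s
  have h2 := h.areaRight
  rw [doubleArea_swap_right] at h2
  simp only [doubleArea_self_left, doubleArea_self_right] at h1
  omega

theorem area_sqr : doubleArea s q r = 1 := by
  have h1 := h.area_sum s q
  have h2 := h.areaRight
  rw [← doubleArea_rotate, doubleArea_swap] at h2
  simp only [doubleArea_self_left, doubleArea_self_right] at h1
  omega

end IsParallelogram

/-- The coefficients are lowered linearly beyond the line through `p` and `q`. -/
noncomputable def bend (f : TropicalPolynomial) (p q : ℤ × ℤ) (T : ℝ) : TropicalPolynomial where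
  support := f.support
  coeff x := f.coeff x - T * max 0 ((doubleArea p q x : ℤ) : ℝ)

theorem term_bend (f : TropicalPolynomial) (p q : ℤ × ℤ) (T : ℝ) (x : ℤ × ℤ) (w : ℝ × ℝ) :
    (f.bend p q T).term x w = f.term x w - T * max 0 ((doubleArea p q x : ℤ) : ℝ) := by
  simp only [term, bend]; ring

theorem minimizers_eq_of {M : Set (ℤ × ℤ)} (hy : y ∈ M) (hM : ∀ x ∈ M, x ∈ f.support)
    (h1 : ∀ x ∈ M, f.term x w = f.term y w)
    (h2 : ∀ x ∈ f.support, x ∉ M → f.term y w < f.term x w) : f.minimizers w = M := by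
  ext x
  constructor
  · intro hx
    by_contra hxM
    exact absurd (hx.2 y (hM y hy)) (not_le.2 (h2 x hx.1 hxM))
  · intro hx
    refine ⟨hM x hx, fun z hz => ?_⟩
    rw [h1 x hx]
    by_cases hzM : z ∈ M
    · exact (h1 z hzM).ge
    · exact (h2 z hz hzM).le

/-- The terms on this side of the line are unchanged; the lowered ones stay above the minimum by
`hlt`. -/
theorem minimizers_bend_left {T : ℝ} (hneg : ∀ z ∈ f.minimizers t, doubleArea p q z ≤ 0)
    (hne : (f.minimizers t).Nonempty)
    (hlt : ∀ x ∈ f.support, 0 < doubleArea p q x → ∀ y ∈ f.minimizers t,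
      T * doubleArea p q x < f.term x t - f.term y t) :
    (f.bend p q T).minimizers t = f.minimizers t := by
  obtain ⟨y, hy⟩ := hne
  have hmax : ∀ x, doubleArea p q x ≤ 0 → max 0 ((doubleArea p q x : ℤ) : ℝ) = 0 := by
    intro x hx
    exact max_eq_left (by exact_mod_cast hx)
  refine minimizers_eq_of hy (fun x hx => hx.1) ?_ ?_
  · intro x hx
    rw [term_bend, term_bend, hmax x (hneg x hx), hmax y (hneg y hy), term_eq hy hx]
  · intro x hx hxM
    rw [term_bend, term_bend, hmax y (hneg y hy)]
    rcases le_or_gt (doubleArea p q x) 0 with h | h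
    · rw [hmax x h]
      linarith [lt_of_notMem hy hx hxM]
    · rw [max_eq_right (by exact_mod_cast h.le)]
      linarith [hlt x hx h y hy]

/-- On the positive side the lowering is linear in the exponent and is compensated by shifting the
point. It is now the terms on the negative side that come down relative to the others, and `hlt`
controls them. -/
theorem minimizers_bend_right {T : ℝ} (hpos : ∀ z ∈ f.minimizers t, 0 ≤ doubleArea p q z)
    (hne : (f.minimizers t).Nonempty)
    (hlt : ∀ x ∈ f.support, doubleArea p q x < 0 → ∀ y ∈ f.minimizers t,
      T * -doubleArea p q x < f.term x t - f.term y t) :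
    (f.bend p q T).minimizers (t + T • perp p q) = f.minimizers t := by
  obtain ⟨y, hy⟩ := hne
  have hmax : ∀ x, 0 ≤ doubleArea p q x →
      max 0 ((doubleArea p q x : ℤ) : ℝ) = (doubleArea p q x : ℤ) := by
    intro x hx
    exact max_eq_right (by exact_mod_cast hx)
  have hterm : ∀ x, f.term x (t + T • perp p q) - f.term y (t + T • perp p q) =
      f.term x t - f.term y t + T * ((doubleArea p q x : ℤ) - (doubleArea p q y : ℤ)) := by
    intro x
    rw [term_sub, along_smul, along_sub_right _ p, along_perp, along_perp]
  refine minimizers_eq_of hy (fun x hx => hx.1) ?_ ?_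
  · intro x hx
    rw [term_bend, term_bend, hmax x (hpos x hx), hmax y (hpos y hy)]
    have := hterm x
    rw [term_eq hy hx] at this
    linarith
  · intro x hx hxM
    rw [term_bend, term_bend, hmax y (hpos y hy)]
    have := hterm x
    rcases le_or_gt 0 (doubleArea p q x) with h | h
    · rw [hmax x h]
      linarith [lt_of_notMem hy hx hxM]
    · rw [max_eq_left (by exact_mod_cast h.le)]
      linarith [hlt x hx h y hy]

theorem eventually_pos {ι : Type*} {F : Set ι} (hF : F.Finite) (a b : ι → ℝ)
    (ha : ∀ i ∈ F, 0 < a i) : ∀ᶠ ε in nhdsWithin (0 : ℝ) (Set.Ioi 0), ∀ i ∈ F, 0 < a i + ε * b i := by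
  rw [Filter.eventually_all_finite hF]
  intro i hi
  have : Filter.Tendsto (fun ε : ℝ => a i + ε * b i) (nhdsWithin 0 (Set.Ioi 0)) (nhds (a i)) := by
    have hc : Continuous (fun ε : ℝ => a i + ε * b i) := by fun_prop
    exact (hc.tendsto' 0 (a i) (by simp)).mono_left nhdsWithin_le_nhds
  exact this.eventually_const_lt (ha i hi)

open Classical in
/-- The vertex of the bent polynomial that corresponds to `t`. -/
noncomputable def bendVertex (f : TropicalPolynomial) (u w : ℝ × ℝ) (p q s : ℤ × ℤ) (T ε : ℝ)
    (t : ℝ × ℝ) : ℝ × ℝ :=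
  if t = u then w + ε • perp p s else if t = w then w + ε • perp s q else
    if ∃ z ∈ f.minimizers t, 0 < doubleArea p q z then t + T • perp p q else t

open Classical in
/-- The minimizers after flipping the diagonal of the parallelogram. -/
noncomputable def flipped (f : TropicalPolynomial) (u w : ℝ × ℝ) (p q r s : ℤ × ℤ) (t : ℝ × ℝ) :
    Set (ℤ × ℤ) :=
  if t = u then {p, r, s} else if t = w then {q, r, s} else f.minimizers t

/-- For `T` equal to the gap, the edge between `u` and `w` is contracted to a point at which `p`,
`q`, `r`, `s` all tie. With `T` larger by a small `ε`, this cell splits along the other diagonal. By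
`gap_mul_lt` the other cells depend on finitely many strict inequalities, which persist for small
`ε`. -/
theorem IsParallelogram.exists_bend (h : IsParallelogram f u w p q r s) : ∃ T ε : ℝ,
    ∀ t, f.IsVertex t → (f.bend p q T).minimizers (bendVertex f u w p q s T ε t) =
      flipped f u w p q r s t := by
  have hfin : ({k : (ℝ × ℝ) × ((ℤ × ℤ) × (ℤ × ℤ)) | f.IsVertex k.1 ∧ k.2.1 ∈ f.support ∧
      k.2.2 ∈ f.minimizers k.1}).Finite :=
    (f.finite_isVertex.prod (f.support.finite_toSet.prod f.support.finite_toSet)).subset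
      fun k hk => ⟨hk.1, hk.2.1, hk.2.2.1⟩
  set T₀ := gap f p r w with hT₀
  have ev1 := eventually_pos (F := {k : (ℝ × ℝ) × ((ℤ × ℤ) × (ℤ × ℤ)) | (f.IsVertex k.1 ∧
      k.2.1 ∈ f.support ∧ k.2.2 ∈ f.minimizers k.1) ∧ k.1 ≠ w ∧
      (∀ z ∈ f.minimizers k.1, doubleArea p q z ≤ 0) ∧ 0 < doubleArea p q k.2.1})
    (hfin.subset fun k hk => hk.1)
    (fun k => f.term k.2.1 k.1 - f.term k.2.2 k.1 - T₀ * doubleArea p q k.2.1)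
    (fun k => -doubleArea p q k.2.1) (by
      rintro ⟨t, x, y⟩ ⟨⟨h1, h2, h3⟩, h4, h5, h6⟩
      exact sub_pos.2 (h.gap_mul_lt h1 h4 h5 h2 h6 h3))
  have ev2 := eventually_pos (F := {k : (ℝ × ℝ) × ((ℤ × ℤ) × (ℤ × ℤ)) | (f.IsVertex k.1 ∧
      k.2.1 ∈ f.support ∧ k.2.2 ∈ f.minimizers k.1) ∧ k.1 ≠ u ∧
      (∀ z ∈ f.minimizers k.1, 0 ≤ doubleArea p q z) ∧ doubleArea p q k.2.1 < 0})
    (hfin.subset fun k hk => hk.1)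
    (fun k => f.term k.2.1 k.1 - f.term k.2.2 k.1 - T₀ * -doubleArea p q k.2.1)
    (fun k => doubleArea p q k.2.1) (by
      rintro ⟨t, x, y⟩ ⟨⟨h1, h2, h3⟩, h4, h5, h6⟩
      have := h.symm.gap_mul_lt h1 h4 (fun z hz => by rw [doubleArea_swap]; linarith [h5 z hz]) h2
        (by rw [doubleArea_swap]; linarith) h3
      rw [h.gap_symm, doubleArea_swap] at this
      push_cast at this
      exact sub_pos.2 this)
  have hsupp : ∀ P : ℤ × ℤ → Prop, {x | x ∈ f.support ∧ P x}.Finite :=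
    fun P => f.support.finite_toSet.subset fun x hx => hx.1
  have ha3 : ∀ x ∈ {x | x ∈ f.support ∧ x ∉ f.minimizers w}, 0 < f.term x w - f.term p w :=
    fun x hx => sub_pos.2 (lt_of_notMem h.mem₄ hx.1 hx.2)
  have ha4 : ∀ x ∈ {x | x ∈ f.support ∧ x ∉ f.minimizers u}, 0 < f.term x u - f.term p u :=
    fun x hx => sub_pos.2 (lt_of_notMem h.mem₁ hx.1 hx.2)
  have ev3 := eventually_pos (hsupp fun x => x ∉ f.minimizers w) _
    (fun x => (doubleArea p s x : ℝ)) ha3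
  have ev4 := eventually_pos (hsupp fun x => x ∉ f.minimizers w) _
    (fun x => (doubleArea s q x : ℝ)) ha3
  have ev5 := eventually_pos (hsupp fun x => x ∉ f.minimizers u) _
    (fun x => (doubleArea p s x : ℝ) - doubleArea p q x) ha4
  have ev6 := eventually_pos (hsupp fun x => x ∉ f.minimizers u) _
    (fun x => (doubleArea s q x : ℝ) - doubleArea p q x) ha4
  obtain ⟨ε, ⟨⟨⟨⟨⟨h1, h2⟩, h3⟩, h4⟩, h5⟩, h6⟩, hε⟩ := (((((ev1.and ev2).and ev3).and ev4).and
    ev5).and ev6 |>.and self_mem_nhdsWithin).exists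
  replace hε : 0 < ε := hε
  refine ⟨T₀ + ε, ε, fun t ht => ?_⟩
  -- Here `{a, c} = {p, q}`. The small shift `δ` keeps `a` and `s` tied, raises `r` by exactly the
  -- additional `ε` by which it has been lowered, and lifts `c` above the minimum.
  have hnew : ∀ a c : ℤ × ℤ, a ∈ f.minimizers w → c ∈ f.minimizers w →
      doubleArea p q a = 0 → doubleArea p q c = 0 → ∀ δ : ℝ × ℝ,
      0 < along δ a c → along δ a s = 0 → along δ a r = ε → c ≠ a → ({p, q} : Set (ℤ × ℤ)) = {a, c} →
      (∀ x ∈ f.support, x ∉ f.minimizers w → 0 < f.term x w - f.term p w + along δ a x) →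
      (∀ x ∈ f.support, x ∉ f.minimizers u →
        0 < f.term x u - f.term p u + along δ a x - ε * doubleArea p q x) →
      (f.bend p q (T₀ + ε)).minimizers (w + δ) = {a, r, s} := by
    intro a c ha hc ha0 hc0 δ g1 g2 g3 hca hpq g4 g5
    have hap := term_eq h.mem₄ ha
    have hdiff : ∀ x, (f.bend p q (T₀ + ε)).term x (w + δ) - (f.bend p q (T₀ + ε)).term a (w + δ) =
        f.term x w - f.term p w + along δ a x -
          (T₀ + ε) * max 0 ((doubleArea p q x : ℤ) : ℝ) := by
      intro x
      have := term_sub f a x w δ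
      rw [term_bend, term_bend, ha0]
      simp only [Int.cast_zero, max_self, mul_zero, sub_zero]
      linarith
    have hu := h.term_left
    refine minimizers_eq_of (by simp : a ∈ _) ?_ ?_ ?_
    · rintro x (rfl | rfl | rfl)
      · exact ha.1
      · exact h.mem₃.1
      · exact h.mem₆.1
    · rintro x (rfl | rfl | rfl)
      · rfl
      · have := hdiff x
        rw [h.areaLeft, g3] at this
        norm_num at this
        have hg : T₀ = f.term x w - f.term p w := rfl
        linarith
      · have := hdiff x
        rw [h.areaRight, g2, term_eq h.mem₄ h.mem₆] at this
        norm_num at this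
        linarith
    · intro x hx hxM
      simp only [Set.mem_insert_iff, Set.mem_singleton_iff, not_or] at hxM
      have := hdiff x
      rcases le_or_gt (doubleArea p q x) 0 with hle | hgt
      · rw [max_eq_left (by exact_mod_cast hle)] at this
        by_cases hxw : x ∈ f.minimizers w
        · have hxc : x = c := by
            rw [h.right, Set.insert_comm] at hxw
            have hxw' : x ∈ ({p, q} : Set (ℤ × ℤ)) ∨ x = s := by
              rcases hxw with rfl | rfl | hxw
              · simp
              · simp
              · exact Or.inr hxw
            rcases hxw' with hxw' | hxw'
            · rw [hpq] at hxw'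
              rcases hxw' with hxw' | hxw'
              · exact absurd hxw' hxM.1
              · exact hxw'
            · exact absurd hxw' hxM.2.2
          rw [hxc] at this ⊢
          rw [term_eq h.mem₄ hc] at this
          linarith
        · linarith [g4 x hx hxw]
      · rw [max_eq_right (by exact_mod_cast hgt.le)] at this
        have hxu : x ∉ f.minimizers u := fun hxu => hxM.2.1 (h.eq_left hxu hgt.ne')
        have e1 := g5 x hx hxu
        rw [hu x, ← hT₀] at e1
        nlinarith
  unfold bendVertex flipped
  by_cases htu : t = u
  · rw [if_pos htu, if_pos htu]
    refine hnew p q h.mem₄ h.mem₅ (by simp) (by simp) _ ?_ ?_ ?_ h.ne.symm rfl ?_ ?_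
    · rw [along_smul, along_perp, doubleArea_swap_right, h.areaRight]
      norm_num
      exact hε
    · rw [along_smul, along_perp]
      simp
    · rw [along_smul, along_perp, h.area_psr]
      simp
    · intro x hx hxM
      rw [along_smul, along_perp]
      exact h3 x ⟨hx, hxM⟩
    · intro x hx hxM
      rw [along_smul, along_perp]
      have := h5 x ⟨hx, hxM⟩
      linarith
  rw [if_neg htu, if_neg htu]
  by_cases htw : t = w
  · rw [if_pos htw, if_pos htw]
    have hal : ∀ x, along (ε • perp s q) q x = ε * (doubleArea s q x : ℤ) := by
      intro x
      rw [along_smul, along_sub_right _ s, along_perp, along_perp, doubleArea_self_right]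
      simp
    refine hnew q p h.mem₅ h.mem₄ (by simp) (by simp) _ ?_ ?_ ?_ h.ne (Set.pair_comm _ _) ?_ ?_
    · rw [hal, ← doubleArea_rotate s q p, doubleArea_swap p q s, h.areaRight]
      norm_num
      exact hε
    · rw [hal]
      simp
    · rw [hal, h.area_sqr]
      simp
    · intro x hx hxM
      rw [hal]
      exact h4 x ⟨hx, hxM⟩
    · intro x hx hxM
      rw [hal]
      have := h6 x ⟨hx, hxM⟩
      linarith
  rw [if_neg htw, if_neg htw]
  have hne : (f.minimizers t).Nonempty := by
    obtain ⟨a, ha, -⟩ := ht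
    exact ⟨a, ha⟩
  by_cases hpos : ∃ z ∈ f.minimizers t, 0 < doubleArea p q z
  · rw [if_pos hpos]
    obtain ⟨z, hz, hzA⟩ := hpos
    have hpos' : ∀ z ∈ f.minimizers t, 0 ≤ doubleArea p q z := by
      intro y hy
      by_contra! hyA
      exact h.not_straddle hz hy hzA hyA
    refine minimizers_bend_right hpos' hne fun x hx hxA y hy => ?_
    have := h2 (t, x, y) ⟨⟨ht, hx, hy⟩, htu, hpos', hxA⟩
    simp only at this
    linarith
  · rw [if_neg hpos]
    push Not at hpos
    refine minimizers_bend_left hpos hne fun x hx hxA y hy => ?_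
    have := h1 (t, x, y) ⟨⟨ht, hx, hy⟩, htw, hpos, hxA⟩
    simp only at this
    linarith

end TropicalPolynomial

/-! ### The flip as a bridge reduction of the curve -/

namespace Graph

theorem exists_edgeMap {α β γ : Type*} (D : Graph α β) (θ : α → γ) [Nonempty γ] :
    ∃ ψ : β → Sym2 γ, ∀ d x y, D.IsLink d x y → ψ d = s(θ x, θ y) := by
  classical
  have : ∀ d, ∃ z : Sym2 γ, ∀ x y, D.IsLink d x y → z = s(θ x, θ y) := by
    intro d
    by_cases h : ∃ x y, D.IsLink d x y
    · obtain ⟨x, y, h⟩ := h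
      refine ⟨s(θ x, θ y), fun x' y' h' => ?_⟩
      rcases h.eq_and_eq_or_eq_and_eq h' with ⟨rfl, rfl⟩ | ⟨rfl, rfl⟩
      · rfl
      · exact Sym2.eq_swap
    · push Not at h
      exact ⟨s(Classical.arbitrary γ, Classical.arbitrary γ), fun x y hxy => absurd hxy (h x y)⟩
  choose ψ hψ using this
  exact ⟨ψ, hψ⟩

end Graph

namespace TropicalPolynomial

open Graph

variable {f g : TropicalPolynomial} {p q r s x y z a c : ℤ × ℤ} {u v w t : ℝ × ℝ}
  {θ : ℝ × ℝ → ℝ × ℝ} {d e : Sym2 (ℝ × ℝ)}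

/-- The subdivision dual to `g` arises from that of `f` by flipping the diagonal of a
parallelogram; `θ` gives the correspondence of the vertices. -/
structure IsFlip (f g : TropicalPolynomial) (θ : ℝ × ℝ → ℝ × ℝ) (u w : ℝ × ℝ) (p q r s : ℤ × ℤ) :
    Prop where
  par : IsParallelogram f u w p q r s
  support : g.support = f.support
  min : ∀ t, f.IsVertex t → g.minimizers (θ t) = flipped f u w p q r s t

theorem DualTo.isLink (h : f.DualTo s(u, w) p q) : f.curveGraph.IsLink s(u, w) u w := by
  obtain ⟨u', w', h1, h2, h3, h4, h5, h6, h7, h8, h9⟩ := h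
  rcases Sym2.eq_iff.1 h1 with ⟨rfl, rfl⟩ | ⟨rfl, rfl⟩
  · exact isLink_iff.2 ⟨p, q, h5, rfl, h2, h3, h4, h6, h7, h8, h9⟩
  · exact isLink_iff.2 ⟨p, q, h5, rfl, h2.symm, h4, h3, h8, h9, h6, h7⟩

namespace IsParallelogram

variable (h : IsParallelogram f u w p q r s)
include h

theorem ne_uw : u ≠ w := ne_of_areas h.left h.right h.areaLeft h.areaRight

theorem vertexLeft : f.IsVertex u := isVertex_triangle h.left (by rw [h.areaLeft]; norm_num)

theorem vertexRight : f.IsVertex w := isVertex_triangle h.right (by rw [h.areaRight]; norm_num)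

theorem dualTo : f.DualTo s(u, w) p q := dualTo_of_areas h.left h.right h.areaLeft h.areaRight

theorem distinct : p ≠ q ∧ p ≠ r ∧ q ≠ r ∧ p ≠ s ∧ q ≠ s ∧ r ≠ s := by
  obtain ⟨h1, h2, h3⟩ := ne_of_doubleArea_ne_zero (p := p) (q := q) (r := r)
    (by rw [h.areaLeft]; norm_num)
  obtain ⟨-, h4, h5⟩ := ne_of_doubleArea_ne_zero (p := p) (q := q) (r := s)
    (by rw [h.areaRight]; norm_num)
  refine ⟨h1, h2, h3, h4, h5, ?_⟩
  rintro rfl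
  have h6 := h.areaLeft
  have h7 := h.areaRight
  omega

omit h in
theorem flipped_left : flipped f u w p q r s u = {p, r, s} := if_pos rfl

theorem flipped_right : flipped f u w p q r s w = {q, r, s} := by
  rw [flipped, if_neg h.ne_uw.symm, if_pos rfl]

omit h in
theorem flipped_of_ne (hu : t ≠ u) (hw : t ≠ w) : flipped f u w p q r s t = f.minimizers t := by
  rw [flipped, if_neg hu, if_neg hw]

theorem not_both (hr : r ∈ f.minimizers t) (hs : s ∈ f.minimizers t) : False :=
  h.not_straddle hr hs (by rw [h.areaLeft]; norm_num) (by rw [h.areaRight]; norm_num)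

theorem eq_or_eq (ht : f.IsVertex t) (hp : p ∈ f.minimizers t) (hq : q ∈ f.minimizers t) :
    t = u ∨ t = w := eq_of_inc ((h.dualTo.inc_iff h.smooth).2 ⟨ht, hp, hq⟩)

theorem exists_triangle_flipped (ht : f.IsVertex t) : ∃ a b c,
    flipped f u w p q r s t = {a, b, c} ∧ doubleArea a b c = 1 := by
  by_cases hu : t = u
  · subst hu
    exact ⟨p, s, r, by rw [flipped_left, Set.pair_comm], h.area_psr⟩
  by_cases hw : t = w
  · subst hw
    exact ⟨s, q, r, by rw [h.flipped_right]; ext; simp; tauto, h.area_sqr⟩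
  obtain ⟨a, ha, -⟩ := id ht
  obtain ⟨b, c, h1, h2⟩ := h.smooth.exists_triangle ht ha
  exact ⟨a, b, c, by rw [flipped_of_ne hu hw, h1], h2⟩

/-- The two new triangles contain both `r` and `s`, which no triangle of `f` does, since it would
straddle the chord. -/
theorem flipped_injOn : Set.InjOn (flipped f u w p q r s) {t | f.IsVertex t} := by
  obtain ⟨-, hpr, hqr, hps, hqs, -⟩ := h.distinct
  have hpq := h.ne
  have key : ∀ {t}, t ≠ u → t ≠ w → r ∈ flipped f u w p q r s t →
      s ∈ flipped f u w p q r s t → False := by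
    intro t h1 h2 h3 h4
    rw [flipped_of_ne h1 h2] at h3 h4
    exact h.not_both h3 h4
  have hL : flipped f u w p q r s u = {p, r, s} := flipped_left
  have hR := h.flipped_right
  intro t ht t' ht' heq
  by_cases h1 : t = u
  · by_cases h2 : t' = u
    · rw [h1, h2]
    · by_cases h3 : t' = w
      · rw [h1, h3, hL, hR] at heq
        have : p ∈ ({q, r, s} : Set (ℤ × ℤ)) := by rw [← heq]; simp
        simp [hpq, hpr, hps] at this
      · rw [h1, hL] at heq
        exact (key h2 h3 (by rw [← heq]; simp) (by rw [← heq]; simp)).elim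
  · by_cases h1' : t = w
    · by_cases h2 : t' = w
      · rw [h1', h2]
      · by_cases h3 : t' = u
        · rw [h1', h3, hL, hR] at heq
          have : p ∈ ({q, r, s} : Set (ℤ × ℤ)) := by rw [heq]; simp
          simp [hpq, hpr, hps] at this
        · rw [h1', hR] at heq
          exact (key h3 h2 (by rw [← heq]; simp) (by rw [← heq]; simp)).elim
    · by_cases h2 : t' = u
      · rw [h2, hL] at heq
        exact (key h1 h1' (by rw [heq]; simp) (by rw [heq]; simp)).elim
      · by_cases h3 : t' = w
        · rw [h3, hR] at heq
          exact (key h1 h1' (by rw [heq]; simp) (by rw [heq]; simp)).elim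
        · rw [flipped_of_ne h1 h1', flipped_of_ne h2 h3] at heq
          exact IsVertex.eq_of_subset ht heq.subset

/-- The two new triangles cover the same parallelogram as the two old ones, so the polygon is still
covered. This shows that the bent polynomial has no further vertices. -/
theorem exists_flipped_contains {z : ℝ × ℝ} (hz : f.InHull z) : ∃ t, f.IsVertex t ∧
    ∃ a b c, flipped f u w p q r s t = {a, b, c} ∧ doubleArea a b c = 1 ∧ 0 ≤ realArea a b z ∧
      0 ≤ realArea b c z ∧ 0 ≤ realArea c a z := by
  have h1 := congrArg Prod.fst h.sum
  have h2 := congrArg Prod.snd h.sum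
  simp only [Prod.fst_add, Prod.snd_add] at h1 h2
  have h1' : (r.1 : ℝ) + s.1 = p.1 + q.1 := by exact_mod_cast h1
  have h2' : (r.2 : ℝ) + s.2 = p.2 + q.2 := by exact_mod_cast h2
  have hr1 : (s.1 : ℝ) = p.1 + q.1 - r.1 := by linarith
  have hr2 : (s.2 : ℝ) = p.2 + q.2 - r.2 := by linarith
  have hA : (((q.1 : ℝ) - p.1) * ((r.2 : ℝ) - p.2) -
      ((q.2 : ℝ) - p.2) * ((r.1 : ℝ) - p.1)) = 1 := by
    rw [← doubleArea_cast]; exact_mod_cast h.areaLeft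
  have i1 : realArea p s z = realArea p q z + realArea r p z := by
    simp only [realArea]; rw [hr1, hr2]; ring
  have i2 : realArea s q z = realArea p q z + realArea q r z := by
    simp only [realArea]; rw [hr1, hr2]; ring
  have i3 : realArea r p z = realArea p s z + realArea q p z := by
    simp only [realArea]; rw [hr1, hr2]; ring
  have i4 : realArea q r z = realArea s q z + realArea q p z := by
    simp only [realArea]; rw [hr1, hr2]; ring
  have i5 : realArea r s z = -realArea s r z := by
    simp only [realArea]; ring
  have hL : ∃ t, f.IsVertex t ∧ flipped f u w p q r s t = {p, s, r} :=
    ⟨u, h.vertexLeft, by rw [flipped_left, Set.pair_comm]⟩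
  have hR : ∃ t, f.IsVertex t ∧ flipped f u w p q r s t = {s, q, r} :=
    ⟨w, h.vertexRight, by rw [h.flipped_right]; ext; simp; tauto⟩
  have fin : 0 ≤ realArea p s z → 0 ≤ realArea r p z → 0 ≤ realArea s q z → 0 ≤ realArea q r z →
      ∃ t, f.IsVertex t ∧ ∃ a b c, flipped f u w p q r s t = {a, b, c} ∧ doubleArea a b c = 1 ∧
      0 ≤ realArea a b z ∧ 0 ≤ realArea b c z ∧ 0 ≤ realArea c a z := by
    intro k1 k2 k3 k4
    rcases le_total 0 (realArea s r z) with hsr | hsr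
    · obtain ⟨t, ht, ht'⟩ := hL
      exact ⟨t, ht, p, s, r, ht', h.area_psr, k1, hsr, k2⟩
    · obtain ⟨t, ht, ht'⟩ := hR
      exact ⟨t, ht, s, q, r, ht', h.area_sqr, k3, k4, by linarith⟩
  obtain ⟨w₀, hw₀⟩ := h.smooth.exists_isVertex
  obtain ⟨t, -, ht, hall⟩ := h.smooth.exists_reach hz hw₀
  by_cases hu : t = u
  · subst hu
    have k1 := hall p q r h.left h.areaLeft
    have k2 := hall q r p (by rw [h.left]; ext; simp; tauto) (by rw [doubleArea_rotate, h.areaLeft])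
    have k3 := hall r p q (by rw [h.left]; ext; simp; tauto)
      (by rw [← doubleArea_rotate, h.areaLeft])
    exact fin (by linarith) k3 (by linarith) k2
  by_cases hw : t = w
  · subst hw
    have hA := h.symm.areaLeft
    have k1 := hall q p s h.symm.left hA
    have k2 := hall p s q (by rw [h.right]; ext; simp; tauto) (by rw [doubleArea_rotate, hA])
    have k3 := hall s q p (by rw [h.right]; ext; simp; tauto)
      (by rw [← doubleArea_rotate, hA])
    exact fin k2 (by linarith) k3 (by linarith)
  obtain ⟨a, ha, -⟩ := id ht
  obtain ⟨b, c, hm, hA⟩ := h.smooth.exists_triangle ht ha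
  refine ⟨t, ht, a, b, c, by rw [flipped_of_ne hu hw, hm], hA, hall a b c hm hA,
    hall b c a ?_ ?_, hall c a b ?_ ?_⟩
  · rw [hm]; ext; simp; tauto
  · rw [doubleArea_rotate, hA]
  · rw [hm]; ext; simp; tauto
  · rw [← doubleArea_rotate, hA]

theorem exists_isFlip : ∃ g θ, IsFlip f g θ u w p q r s := by
  obtain ⟨T, ε, h'⟩ := h.exists_bend
  exact ⟨f.bend p q T, bendVertex f u w p q s T ε, h, rfl, h'⟩

end IsParallelogram

namespace IsFlip

variable (h : IsFlip f g θ u w p q r s)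
include h

theorem isVertex (ht : f.IsVertex t) : g.IsVertex (θ t) := by
  obtain ⟨a, b, c, h1, h2⟩ := h.par.exists_triangle_flipped ht
  exact isVertex_triangle ((h.min t ht).trans h1) (by rw [h2]; norm_num)

/-- The centroid of minimizers at `v` lies in some flipped triangle, and by `eq_of_centroid` the
vertex dual to that triangle is `v`. -/
theorem exists_eq (hv : g.IsVertex v) : ∃ t, f.IsVertex t ∧ θ t = v := by
  obtain ⟨a, ha, b, hb, c, hc, habc⟩ := id hv
  obtain ⟨t, ht, a', b', c', h1, h2, h3, h4, h5⟩ := h.par.exists_flipped_contains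
    (inHull_centroid (f := f) (h.support ▸ ha.1) (h.support ▸ hb.1) (h.support ▸ hc.1))
  have hm := (h.min t ht).trans h1
  exact ⟨t, ht, eq_of_centroid h2 (by simp [hm]) (by simp [hm]) (by simp [hm]) habc ha hb hc h3 h4 h5⟩

theorem isSmooth : g.IsSmooth := by
  refine ⟨by rw [h.support]; exact h.par.smooth.1, fun v hv => ?_⟩
  obtain ⟨t, ht, rfl⟩ := h.exists_eq hv
  obtain ⟨a, b, c, h1, h2⟩ := h.par.exists_triangle_flipped ht
  exact ⟨a, b, c, (h.min t ht).trans h1, by rw [h2]; rfl⟩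

theorem genus_eq : g.genus = f.genus := by
  rw [genus, genus, interiorPoints, interiorPoints, newtonPolygon, newtonPolygon, h.support]

theorem injOn : Set.InjOn θ {t | f.IsVertex t} := by
  intro t ht t' ht' heq
  refine h.par.flipped_injOn ht ht' ?_
  rw [← h.min t ht, ← h.min t' ht', heq]

open Classical in
/-- Regrouping the edges at `u` and `w` according to whether `q` is one of the dual points. -/
theorem exists_reductionData (hr : f.IsInner r) (hs : f.IsInner s) :
    ∃ D K ψ, ReductionData f.curveGraph D s(u, w) u w K ∧ IsImage θ ψ D g.curveGraph := by
  have hf := h.par.smooth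
  have hg := h.isSmooth
  obtain ⟨hpq, hpr, hqr, hps, hqs, hrs⟩ := h.par.distinct
  have hb := h.par.dualTo
  have huw := h.par.ne_uw
  have hL : flipped f u w p q r s u = {p, r, s} := IsParallelogram.flipped_left
  have hR := h.par.flipped_right
  set b : Sym2 (ℝ × ℝ) := s(u, w) with hbdef
  -- After the flip, the triangle `prs` at `θ u` has the sides `pr` and `ps`, one from each end of
  -- the bridge, and the triangle `qrs` at `θ w` has the sides `qr` and `qs`. So the edges involving
  -- `q` are sent to `w`, and the bridge becomes the edge dual to `rs`.
  set i : Sym2 (ℝ × ℝ) → Bool := fun d => decide (∃ a, f.DualTo d q a) with hidef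
  have hi : ∀ {d a c}, f.DualTo d a c → i d = decide (a = q ∨ c = q) := by
    intro d a c hd
    rw [hidef]
    simp only [decide_eq_decide]
    constructor
    · rintro ⟨a', ha'⟩
      exact (hd.mem_pair hf ha').imp Eq.symm Eq.symm
    · rintro (rfl | rfl)
      · exact ⟨c, hd⟩
      · exact ⟨a, hd.symm⟩
  have hlink : f.curveGraph.IsLink b u w := isLink_iff.2 ⟨p, q, hpq, rfl, huw, h.par.vertexLeft,
    h.par.vertexRight, h.par.mem₁, h.par.mem₂, h.par.mem₄, h.par.mem₅⟩
  obtain ⟨χ, hχ⟩ := hb.exists_isCut hf h.par.notInner h.par.notInner'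
  have hbridge := hχ.isBridge f.isFinite_curveGraph hb.mem_edgeSet
  -- the edges at one end of the bridge
  have hends : ∀ {U R}, f.IsVertex U → f.minimizers U = {p, q, R} → f.IsInner R → p ≠ R → q ≠ R →
      ∀ j, ∃ e, e ≠ b ∧ f.curveGraph.Inc e U ∧ i e = j ∧
      ∀ d, d ≠ b → f.curveGraph.Inc d U → i d = j → d = e := by
    intro U R hU hm hR hpR hqR j
    have hpU : p ∈ f.minimizers U := by simp [hm]
    have hqU : q ∈ f.minimizers U := by simp [hm]
    have hRU : R ∈ f.minimizers U := by simp [hm]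
    obtain ⟨e, he⟩ := hR.exists_dualTo hf hU hRU hpU hpR.symm
    obtain ⟨e', he'⟩ := hR.exists_dualTo hf hU hRU hqU hqR.symm
    have hall : ∀ d, d ≠ b → f.curveGraph.Inc d U → d = e ∨ d = e' := by
      intro d hd hinc
      obtain ⟨a, c, hac, ha, hc⟩ := exists_dualTo_at hf hinc
      rw [hm] at ha hc
      rcases ha with rfl | rfl | rfl <;> rcases hc with rfl | rfl | rfl
      · exact absurd rfl hac.ne
      · exact absurd (hac.unique hf hb) hd
      · exact Or.inl (hac.symm.unique hf he)
      · exact absurd (hac.symm.unique hf hb) hd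
      · exact absurd rfl hac.ne
      · exact Or.inr (hac.symm.unique hf he')
      · exact Or.inl (hac.unique hf he)
      · exact Or.inr (hac.unique hf he')
      · exact absurd rfl hac.ne
    have hie : i e = false := by rw [hi he]; simp [hqR.symm, hpq]
    have hie' : i e' = true := by rw [hi he']; simp
    cases j
    · refine ⟨e, ?_, (he.inc_iff hf).2 ⟨hU, hRU, hpU⟩, hie, fun d hd hinc hid => ?_⟩
      · rintro rfl
        rcases hb.mem_pair hf he with h | h
        · exact hpR h.symm
        · exact hqR h.symm
      · rcases hall d hd hinc with rfl | rfl
        · rfl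
        · rw [hie'] at hid
          simp at hid
    · refine ⟨e', ?_, (he'.inc_iff hf).2 ⟨hU, hRU, hqU⟩, hie', fun d hd hinc hid => ?_⟩
      · rintro rfl
        rcases hb.mem_pair hf he' with h | h
        · exact hpR h.symm
        · exact hqR h.symm
      · rcases hall d hd hinc with rfl | rfl
        · rw [hie] at hid
          simp at hid
        · rfl
  obtain ⟨K, hK⟩ := reductionData_relabel f.isFinite_curveGraph hbridge hlink
    (fun d => not_isLoopAt) (fun d => not_isLoopAt) (i := i) (by
      rintro U (rfl | rfl)
      · exact hends h.par.vertexLeft h.par.left hr hpr hqr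
      · exact hends h.par.vertexRight h.par.right hs hps hqs)
  set D := f.curveGraph.relabel (moveEnd b u w i) f.curveGraph.vertexSet (moveEnd_mem hlink i)
    with hD
  have hDlink : ∀ d x' y', D.IsLink d x' y' ↔ ∃ x y, f.curveGraph.IsLink d x y ∧
      x' = moveEnd b u w i d x ∧ y' = moveEnd b u w i d y := fun _ _ _ => Iff.rfl
  clear_value D
  -- minimizers after moving
  have hmove : ∀ {d x a c}, d ≠ b → f.DualTo d a c → f.IsVertex x → a ∈ f.minimizers x →
      c ∈ f.minimizers x → f.IsVertex (moveEnd b u w i d x) ∧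
      a ∈ flipped f u w p q r s (moveEnd b u w i d x) ∧
      c ∈ flipped f u w p q r s (moveEnd b u w i d x) := by
    intro d x a c hd hac hx ha hc
    refine ⟨moveEnd_mem hlink i d x ((hac.inc_iff hf).2 ⟨hx, ha, hc⟩), ?_⟩
    have hid := hi hac
    unfold moveEnd
    have key : ∀ {R}, R ≠ p → R ≠ q → (R = r ∨ R = s) → f.minimizers x = {p, q, R} →
        a ∈ flipped f u w p q r s (if i d then w else u) ∧
        c ∈ flipped f u w p q r s (if i d then w else u) := by
      intro R hRp hRq hR' hm
      rw [hid]
      rw [hm] at ha hc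
      rcases ha with rfl | rfl | rfl <;> rcases hc with rfl | rfl | rfl
      · exact absurd rfl hac.ne
      · exact absurd (hac.unique hf hb) hd
      · rcases hR' with rfl | rfl <;> simp [hL, hpq, hRq]
      · exact absurd (hac.symm.unique hf hb) hd
      · exact absurd rfl hac.ne
      · rcases hR' with rfl | rfl <;> simp [hR]
      · rcases hR' with rfl | rfl <;> simp [hL, hpq, hRq]
      · rcases hR' with rfl | rfl <;> simp [hR]
      · exact absurd rfl hac.ne
    by_cases hxu : x = u
    · rw [if_pos ⟨hd, Or.inl hxu⟩]
      exact key hpr.symm hqr.symm (Or.inl rfl) (by rw [hxu, h.par.left])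
    · by_cases hxw : x = w
      · rw [if_pos ⟨hd, Or.inr hxw⟩]
        exact key hps.symm hqs.symm (Or.inr rfl) (by rw [hxw, h.par.right])
      · rw [if_neg (fun hh => hh.2.elim hxu hxw), IsParallelogram.flipped_of_ne hxu hxw]
        exact ⟨ha, hc⟩
  -- This undoes the move: a pair of points in a flipped triangle, other than the new diagonal,
  -- already lies in a triangle of `f`, and the old vertex determines the new one.
  have hback : ∀ {x' a c}, a ≠ c → f.IsVertex x' → a ∈ flipped f u w p q r s x' →
      c ∈ flipped f u w p q r s x' → ¬ (a = r ∧ c = s) → ¬ (a = s ∧ c = r) →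
      ∃ x, f.IsVertex x ∧ a ∈ f.minimizers x ∧ c ∈ f.minimizers x ∧
        x' = if x = u ∨ x = w then (if a = q ∨ c = q then w else u) else x := by
    intro x' a c hac hx' ha hc h1 h2
    have vL := h.par.vertexLeft
    have vR := h.par.vertexRight
    have m1 := h.par.mem₁
    have m2 := h.par.mem₂
    have m3 := h.par.mem₃
    have m4 := h.par.mem₄
    have m5 := h.par.mem₅
    have m6 := h.par.mem₆
    by_cases hxu : x' = u
    · rw [hxu, hL] at ha hc
      rcases ha with ha | ha | ha <;> rcases hc with hc | hc | hc <;> subst ha <;> subst hc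
      · exact absurd rfl hac
      · exact ⟨u, vL, m1, m3, by simp [hxu, hpq, hqr.symm]⟩
      · exact ⟨w, vR, m4, m6, by simp [hxu, hpq, hqs.symm]⟩
      · exact ⟨u, vL, m3, m1, by simp [hxu, hpq, hqr.symm]⟩
      · exact absurd rfl hac
      · exact absurd ⟨rfl, rfl⟩ h1
      · exact ⟨w, vR, m6, m4, by simp [hxu, hpq, hqs.symm]⟩
      · exact absurd ⟨rfl, rfl⟩ h2
      · exact absurd rfl hac
    · by_cases hxw : x' = w
      · rw [hxw, hR] at ha hc
        rcases ha with ha | ha | ha <;> rcases hc with hc | hc | hc <;> subst ha <;> subst hc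
        · exact absurd rfl hac
        · exact ⟨u, vL, m2, m3, by simp [hxw]⟩
        · exact ⟨w, vR, m5, m6, by simp [hxw]⟩
        · exact ⟨u, vL, m3, m2, by simp [hxw]⟩
        · exact absurd rfl hac
        · exact absurd ⟨rfl, rfl⟩ h1
        · exact ⟨w, vR, m6, m5, by simp [hxw]⟩
        · exact absurd ⟨rfl, rfl⟩ h2
        · exact absurd rfl hac
      · rw [IsParallelogram.flipped_of_ne hxu hxw] at ha hc
        exact ⟨x', hx', ha, hc, by rw [if_neg (fun hh => hh.elim hxu hxw)]⟩
  -- the links of `D` give links of the new curve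
  have hto : ∀ {d x' y'}, D.IsLink d x' y' → f.IsVertex x' ∧ f.IsVertex y' ∧ x' ≠ y' ∧
      ((d = b ∧ g.DualTo s(θ x', θ y') r s) ∨
        ∃ a c, d ≠ b ∧ f.DualTo d a c ∧ g.DualTo s(θ x', θ y') a c) := by
    intro d x' y' hl
    obtain ⟨x, y, hxy, rfl, rfl⟩ := (hDlink _ _ _).1 hl
    by_cases hd : d = b
    · subst hd
      have hmv : ∀ x, moveEnd b u w i b x = x := fun x => if_neg fun hh => hh.1 rfl
      rw [hmv, hmv]
      have hx := hxy.left_mem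
      have hy := hxy.right_mem
      refine ⟨hx, hy, hxy.2.2.1, Or.inl ⟨rfl, ?_⟩⟩
      have hmem : ∀ {x}, x = u ∨ x = w → r ∈ g.minimizers (θ x) ∧ s ∈ g.minimizers (θ x) := by
        rintro x (rfl | rfl)
        · rw [h.min _ h.par.vertexLeft, hL]; simp
        · rw [h.min _ h.par.vertexRight, hR]; simp
      have hm1 := hmem (eq_of_inc hxy.inc_left)
      have hm2 := hmem (eq_of_inc hxy.inc_right)
      exact dualTo_mk (fun hh => hxy.2.2.1 (h.injOn hx hy hh)) (h.isVertex hx) (h.isVertex hy) hrs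
        hm1.1 hm1.2 hm2.1 hm2.2
    · obtain ⟨a, c, hne, hs', hxy', hx, hy, hax, hcx, hay, hcy⟩ := isLink_iff.1 hxy
      have hac : f.DualTo d a c := ⟨x, y, hs', hxy', hx, hy, hne, hax, hcx, hay, hcy⟩
      obtain ⟨k1, k2, k3⟩ := hmove hd hac hx hax hcx
      obtain ⟨k4, k5, k6⟩ := hmove hd hac hy hay hcy
      have hdist : moveEnd b u w i d x ≠ moveEnd b u w i d y := by
        unfold moveEnd
        by_cases hx' : x = u ∨ x = w <;> by_cases hy' : y = u ∨ y = w
        · exfalso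
          apply hd
          rw [hs', hbdef, Sym2.eq_iff]
          rcases hx' with rfl | rfl <;> rcases hy' with rfl | rfl
          · exact absurd rfl hxy'
          · simp
          · simp
          · exact absurd rfl hxy'
        · rw [if_pos ⟨hd, hx'⟩, if_neg (fun hh : d ≠ b ∧ (y = u ∨ y = w) => hy' hh.2)]
          intro hh
          apply hy'
          rw [← hh]
          cases i d <;> simp
        · rw [if_neg (fun hh => hx' hh.2), if_pos ⟨hd, hy'⟩]
          intro hh
          apply hx'
          rw [hh]
          cases i d <;> simp
        · rw [if_neg (fun hh => hx' hh.2), if_neg (fun hh => hy' hh.2)]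
          exact hxy'
      refine ⟨k1, k4, hdist, Or.inr ⟨a, c, hd, hac, dualTo_mk (fun hh => hdist (h.injOn k1 k4 hh))
        (h.isVertex k1) (h.isVertex k4) hne ?_ ?_ ?_ ?_⟩⟩
      · rw [h.min _ k1]; exact k2
      · rw [h.min _ k1]; exact k3
      · rw [h.min _ k4]; exact k5
      · rw [h.min _ k4]; exact k6
  have hnot : ∀ {d a c}, f.DualTo d a c → (r = a ∨ r = c) → (s = a ∨ s = c) → False := by
    intro d a c hac h1 h2
    obtain ⟨x, y, -, -, -, -, -, ha, hc, -, -⟩ := hac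
    refine h.par.not_both (t := x) ?_ ?_
    · rcases h1 with rfl | rfl <;> assumption
    · rcases h2 with rfl | rfl <;> assumption
  obtain ⟨ψ, hψ⟩ := exists_edgeMap D θ
  have hDV : D.vertexSet = {t | f.IsVertex t} := hK.vertexSet_eq
  refine ⟨D, K, ψ, hK, by rw [hDV]; exact h.injOn, ?_, ?_, ?_⟩
  · intro d hd d' hd' heq
    obtain ⟨x, y, hxy⟩ := D.exists_isLink_of_mem_edgeSet hd
    obtain ⟨x', y', hxy'⟩ := D.exists_isLink_of_mem_edgeSet hd'
    rw [hψ _ _ _ hxy, hψ _ _ _ hxy'] at heq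
    obtain ⟨-, -, -, k⟩ := hto hxy
    obtain ⟨-, -, -, k'⟩ := hto hxy'
    rw [heq] at k
    rcases k with ⟨k1, k2⟩ | ⟨a, c, k1, k2, k3⟩ <;> rcases k' with ⟨k1', k2'⟩ | ⟨a', c', k1', k2', k3'⟩
    · rw [k1, k1']
    · exact (hnot k2' (k3'.mem_pair hg k2) (k3'.mem_pair hg k2.symm)).elim
    · exact (hnot k2 (k3.mem_pair hg k2') (k3.mem_pair hg k2'.symm)).elim
    · have := k3.pair_eq hg k3'
      rw [Sym2.eq_iff] at this
      rcases this with ⟨rfl, rfl⟩ | ⟨rfl, rfl⟩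
      · exact k2.unique hf k2'
      · exact k2.unique hf k2'.symm
  · rw [hDV]
    ext v
    constructor
    · intro hv
      obtain ⟨t, ht, rfl⟩ := h.exists_eq hv
      exact ⟨t, ht, rfl⟩
    · rintro ⟨t, ht, rfl⟩
      exact h.isVertex ht
  · intro e v₁ v₂
    constructor
    · intro hl
      obtain ⟨a, c, hne, rfl, hv, hv1, hv2, ha1, hc1, ha2, hc2⟩ := isLink_iff.1 hl
      obtain ⟨x', hx', rfl⟩ := h.exists_eq hv1
      obtain ⟨y', hy', rfl⟩ := h.exists_eq hv2
      rw [h.min _ hx'] at ha1 hc1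
      rw [h.min _ hy'] at ha2 hc2
      have hxy' : x' ≠ y' := fun hh => hv (by rw [hh])
      suffices hsuf : ∃ d, D.IsLink d x' y' by
        obtain ⟨d, hd⟩ := hsuf
        exact ⟨d, x', y', hd, hψ _ _ _ hd, rfl, rfl⟩
      by_cases hcase : (a = r ∧ c = s) ∨ (a = s ∧ c = r)
      · have hmem : ∀ {x}, a ∈ flipped f u w p q r s x → c ∈ flipped f u w p q r s x →
            x = u ∨ x = w := by
          intro x h1 h2
          by_contra! hcon
          rw [IsParallelogram.flipped_of_ne hcon.1 hcon.2] at h1 h2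
          rcases hcase with ⟨rfl, rfl⟩ | ⟨rfl, rfl⟩
          · exact h.par.not_both h1 h2
          · exact h.par.not_both h2 h1
        have hmv : ∀ x, moveEnd b u w i b x = x := fun x => if_neg fun hh => hh.1 rfl
        refine ⟨b, (hDlink _ _ _).2 ⟨x', y', ?_, (hmv _).symm, (hmv _).symm⟩⟩
        rcases hmem ha1 hc1 with rfl | rfl <;> rcases hmem ha2 hc2 with rfl | rfl
        · exact absurd rfl hxy'
        · exact hlink
        · exact hlink.symm
        · exact absurd rfl hxy'
      · rw [not_or] at hcase
        obtain ⟨x, hx, hax, hcx, hxe⟩ := hback hne hx' ha1 hc1 hcase.1 hcase.2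
        obtain ⟨y, hy, hay, hcy, hye⟩ := hback hne hy' ha2 hc2 hcase.1 hcase.2
        have hxy : x ≠ y := by
          rintro rfl
          exact hxy' (hxe.trans hye.symm)
        have hac : f.DualTo s(x, y) a c := dualTo_mk hxy hx hy hne hax hcx hay hcy
        have hd : s(x, y) ≠ b := by
          intro hd
          rw [hd] at hac
          have hmem : ∀ {x'}, f.IsVertex x' → p ∈ flipped f u w p q r s x' →
              q ∈ flipped f u w p q r s x' → False := by
            intro x' hx' h1 h2
            by_cases hxu : x' = u
            · rw [hxu, hL] at h2
              simp [hpq.symm, hqr, hqs] at h2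
            · by_cases hxw : x' = w
              · rw [hxw, hR] at h1
                simp [hpq, hpr, hps] at h1
              · rw [IsParallelogram.flipped_of_ne hxu hxw] at h1 h2
                exact (h.par.eq_or_eq hx' h1 h2).elim hxu hxw
          have := hb.pair_eq hf hac
          rw [Sym2.eq_iff] at this
          rcases this with ⟨rfl, rfl⟩ | ⟨rfl, rfl⟩
          · exact hmem hx' ha1 hc1
          · exact hmem hx' hc1 ha1
        have hmv : ∀ {z z'}, (z' = if z = u ∨ z = w then (if a = q ∨ c = q then w else u) else z) →
            z' = moveEnd b u w i s(x, y) z := by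
          intro z z' hz
          rw [hz, moveEnd, hi hac]
          by_cases hzz : z = u ∨ z = w
          · simp only [if_pos hzz, if_pos (show s(x, y) ≠ b ∧ (z = u ∨ z = w) from ⟨hd, hzz⟩),
              decide_eq_true_eq]
          · rw [if_neg hzz, if_neg fun hh => hzz hh.2]
        exact ⟨s(x, y), (hDlink _ _ _).2 ⟨x, y, hac.isLink, hmv hxe, hmv hye⟩⟩
    · rintro ⟨d, x', y', hl, rfl, rfl, rfl⟩
      rw [hψ _ _ _ hl]
      obtain ⟨h1, h2, h3, k⟩ := hto hl
      rcases k with ⟨-, k⟩ | ⟨a, c, -, -, k⟩ <;> exact k.isLink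

end IsFlip

end TropicalPolynomial

/-! ### Troplanar graphs reduce to 2-edge-connected ones -/

namespace TropicalPolynomial

open Graph

variable {α β : Type*} {G G' : Graph α β} {f : TropicalPolynomial} {b : β}

theorem isFinite_of_isSkeletonOf {S : Graph (ℝ × ℝ) (Sym2 (ℝ × ℝ))}
    (hS : S.IsSkeletonOf f.curveGraph) : S.IsFinite := by
  obtain ⟨C, h1, -, h3, -⟩ := hS
  obtain ⟨m, hm⟩ := exists_isSmoothing (isRetract_of_reflTransGen f.isFinite_curveGraph h1).isFinite h3
  exact hm.isFinite

theorem GivesRiseTo.exists_skeletonData [Nonempty α] [Nonempty β] (h : f.GivesRiseTo G)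
    (hG : G.IsFinite) (hg : G.genus ≠ 0) : ∃ S C m φ ψ, S.IsSkeletonOf f.curveGraph ∧
      SkeletonData f C S m ∧ IsImage φ ψ S G := by
  obtain ⟨hf, -, S, hS, hSG⟩ := h
  obtain ⟨φ, ψ, hφ⟩ := hSG.exists_isImage (isFinite_of_isSkeletonOf hS) hG
  obtain ⟨C, m, hm⟩ := TropicalPolynomial.exists_skeletonData hf hS (by rwa [← hφ.genus_eq])
  exact ⟨S, C, m, φ, ψ, hS, hm, hφ⟩

theorem GivesRiseTo.good [Nonempty α] [Nonempty β] (h : f.GivesRiseTo G)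
    (hG : G.IsFinite) (hg : G.genus ≠ 0) : G.Good := by
  obtain ⟨S, C, m, φ, ψ, -, hm, hφ⟩ := h.exists_skeletonData hG hg
  exact hφ.good hm.good

/-- At a bridge of the skeleton, the dual triangles form a parallelogram. Flipping it gives a smooth
curve with the same Newton polygon; the resulting reduction of the curve passes to the skeleton and
along the isomorphism to `G`. -/
theorem GivesRiseTo.exists_reductionData [Nonempty α] [Nonempty β] (h : f.GivesRiseTo G)
    (hG : G.IsFinite) (hg : G.genus ≠ 0) (hb : G.IsBridge b) :
    ∃ G₁ b' v w K, ReductionData G G₁ b' v w K ∧ G₁.IsTroplanar := by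
  obtain ⟨S, C, m, φ, ψ, hS, hm, hφ⟩ := h.exists_skeletonData hG hg
  have hbE := hb.1
  rw [hφ.edge] at hbE
  obtain ⟨e, he, rfl⟩ := hbE
  rw [hφ.isBridge_iff hm.good.isFinite he] at hb
  obtain ⟨u, w, p, q, r, s, rfl, hl, h1, h2, h3, h4, h5, h6, h7, h8, h9⟩ := hm.exists_of_isBridge hb
  obtain ⟨g, θ, hfl⟩ := IsParallelogram.exists_isFlip (f := f) (u := u) (w := w)
    ⟨h.1, h1, h2, h3, h4, h5, h6, h9⟩
  obtain ⟨D, K, κ, hD, hκ⟩ := hfl.exists_reductionData h7 h8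
  have hdeg : ∀ t ∈ S.vertexSet, S.degree t = f.curveGraph.degree t := fun t ht => by
    rw [hm.smoothing.degree_eq t ht, (hm.degree_eq_three ht).1, (hm.degree_eq_three ht).2]
  obtain ⟨S', hS', hred⟩ := hD.exists_isSkeletonOf f.isFinite_curveGraph hS hb hl.left_mem
    hl.right_mem (hdeg _ hl.left_mem) (hdeg _ hl.right_mem)
  obtain ⟨S'', hS'', hsk⟩ := hκ.exists_isSkeletonOf hS'
  obtain ⟨G₁, hG₁, hGred⟩ := hφ.exists_isBridgeReduction hm.good.isFinite hred
  obtain ⟨b', v, w, K', hK'⟩ := hGred.exists_reductionData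
  refine ⟨G₁, b', v, w, K', hK', hK'.isFinite' hG, g, hfl.isSmooth, ?_, S'', hsk, ?_⟩
  · rw [hfl.genus_eq]; exact h.2.1
  · exact hS''.isIsomorphic.symm.trans hG₁.isIsomorphic

theorem _root_.Graph.IsTroplanar.good [Nonempty α] [Nonempty β] (h : G.IsTroplanar)
    (hg : G.genus ≠ 0) : G.Good := by
  obtain ⟨hG, f, hf⟩ := h
  exact hf.good hG hg

/-- Bridge reductions turn a troplanar graph into a 2-edge-connected one. -/
theorem _root_.Graph.IsTroplanar.exists_isTwoEdgeConnected [Nonempty α] [Nonempty β]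
    (h : G.IsTroplanar) (hg : G.genus ≠ 0) : ∃ G', ReflTransGen IsBridgeReduction G G' ∧
      G'.IsTroplanar ∧ G'.genus = G.genus ∧ G'.IsTwoEdgeConnected := by
  induction hn : {e | G.IsBridge e}.ncard using Nat.strong_induction_on generalizing G with
  | _ n ih =>
  have hgood := h.good hg
  by_cases hb : ∃ b, G.IsBridge b
  · obtain ⟨b, hb⟩ := hb
    obtain ⟨hG, f, hf⟩ := h
    obtain ⟨G₁, b', v, w, K, hK, h₁⟩ := hf.exists_reductionData hG hg hb
    have hlt : {e | G₁.IsBridge e}.ncard < n := by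
      rw [← hn]
      refine Set.ncard_lt_ncard ⟨fun d hd => ((hK.isBridge_iff hgood).1 hd).1, fun hh => ?_⟩
        (hG.2.subset fun d hd => hd.1)
      exact hK.not_isBridge hgood (hh hK.bridge)
    obtain ⟨G', h1, h2, h3, h4⟩ := ih _ hlt h₁ (by rwa [hK.genus_eq]) rfl
    exact ⟨G', .head hK.isBridgeReduction h1, h2, by rw [h3, hK.genus_eq], h4⟩
  · push Not at hb
    exact ⟨G, .refl, h, rfl, hgood.isConnected, hb⟩

end TropicalPolynomial

/-! ### Loops and parallel edges -/

namespace Graph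

variable {α β : Type*} {S : Graph α β}

/-- A loop at a 3-valent vertex forces the third edge to be a bridge. -/
theorem not_isLoopAt_of_degree (hS : S.IsFinite) (hb : ∀ e, ¬ S.IsBridge e) {t : α}
    (ht : S.degree t = 3) (d : β) : ¬ S.IsLoopAt d t := by
  classical
  intro hd
  set I := {e | S.Inc e t}
  set L := {e | S.IsLoopAt e t}
  have hI : I.Finite := hS.inc_finite t
  have hLI : L ⊆ I := fun e he => he.inc
  have h3 : I.ncard + L.ncard = 3 := ht
  have hL : 0 < L.ncard := (Set.ncard_pos (hI.subset hLI)).2 ⟨d, hd⟩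
  have hle := Set.ncard_le_ncard hLI hI
  have hsub : (I \ L).ncard = 1 := by
    rw [Set.ncard_sdiff hLI (hI.subset hLI)]
    omega
  obtain ⟨e, he⟩ := Set.ncard_eq_one.1 hsub
  have he' : e ∈ I \ L := by rw [he]; rfl
  refine hb e (IsCut.isBridge hS (χ := fun x => decide (x = t)) ?_ he'.1.edge_mem)
  intro d' x y hl
  have key : ∀ {x y}, S.IsLink d' x y → x = t → y ≠ t → d' = e := by
    rintro x y hl rfl hy
    have : d' ∈ I \ L := ⟨hl.inc_left, fun hloop => by
      rcases hl.left_eq_or_eq hloop with h | h <;>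
      · rcases IsLink.eq_and_eq_or_eq_and_eq hl hloop with h | h
        · exact hy h.2
        · exact hy h.2⟩
    rw [he] at this
    exact this
  constructor
  · intro hne
    by_cases hx : x = t
    · by_cases hy : y = t
      · simp [hx, hy] at hne
      · exact key hl hx hy
    · by_cases hy : y = t
      · exact key hl.symm hy hx
      · simp [hx, hy] at hne
  · rintro rfl
    by_cases hx : x = t <;> by_cases hy : y = t
    · exact absurd (show S.IsLoopAt d' t by subst hx; subst hy; exact hl) he'.2
    · simp [hx, hy]
    · simp [hx, hy]
    · rcases he'.1.eq_or_eq_of_isLink hl with h | h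
      · exact absurd h.symm hx
      · exact absurd h.symm hy

/-- Exchanging the names of two parallel edges. -/
theorem IsLink.swap_iff [DecidableEq β] {e e' d : β} {v w a b : α} (h : S.IsLink e v w)
    (h' : S.IsLink e' v w) : S.IsLink (Equiv.swap e e' d) a b ↔ S.IsLink d a b := by
  have key : ∀ {e e' : β}, S.IsLink e v w → S.IsLink e' v w → S.IsLink e a b → S.IsLink e' a b := by
    intro e e' h h' hab
    rcases h.eq_and_eq_or_eq_and_eq hab with ⟨rfl, rfl⟩ | ⟨rfl, rfl⟩
    · exact h'
    · exact h'.symm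
  by_cases h1 : d = e
  · subst h1
    rw [Equiv.swap_apply_left]
    exact ⟨key h' h, key h h'⟩
  · by_cases h2 : d = e'
    · subst h2
      rw [Equiv.swap_apply_right]
      exact ⟨key h h', key h' h⟩
    · rw [Equiv.swap_apply_of_ne_of_ne h1 h2]

/-- Parallel edges are interchangeable, so an isomorphism may be changed by exchanging them. This
makes it possible to replace an edge of the encoding by a parallel one. -/
theorem IsImage.comp_swap [DecidableEq β] {α' β' : Type*} {H : Graph α' β'} {φ : α → α'}
    {ψ : β → β'} (h : IsImage φ ψ S H) {e e' : β} {v w : α} (he : S.IsLink e v w)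
    (he' : S.IsLink e' v w) : IsImage φ (ψ ∘ Equiv.swap e e') S H := by
  have hmem : ∀ d ∈ S.edgeSet, Equiv.swap e e' d ∈ S.edgeSet := by
    intro d hd
    obtain ⟨a, b, hl⟩ := S.exists_isLink_of_mem_edgeSet hd
    exact ((he.swap_iff he').2 hl).edge_mem
  refine ⟨h.injV, ?_, h.vert, fun d x y => ?_⟩
  · intro d hd d' hd' heq
    exact (Equiv.swap e e').injective (h.injE (hmem d hd) (hmem d' hd') heq)
  · rw [h.link]
    constructor
    · rintro ⟨d, a, b, hl, rfl, rfl, rfl⟩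
      exact ⟨Equiv.swap e e' d, a, b, (he.swap_iff he').2 hl, by simp, rfl, rfl⟩
    · rintro ⟨d, a, b, hl, rfl, rfl, rfl⟩
      exact ⟨_, a, b, (he.swap_iff he').2 hl, rfl, rfl, rfl⟩

end Graph

namespace TropicalPolynomial

open Graph

variable {f : TropicalPolynomial} {C S : Graph (ℝ × ℝ) (Sym2 (ℝ × ℝ))}
  {m : Sym2 (ℝ × ℝ) → Sym2 (ℝ × ℝ)} {p q r s x y z : ℤ × ℤ} {u v w t : ℝ × ℝ}
  {d d' e e' b : Sym2 (ℝ × ℝ)}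

/-! ### Colourings of the edges dual to the edges at an interior lattice point -/

/-- This is `star_colouring` with each neighbour `y` of `x` replaced by the edge of the curve dual
to `xy`. -/
theorem star_eq_of_ne (hf : f.IsSmooth) (hx : f.IsInner x) {y₀ : ℤ × ℤ} (hy₀ : x ≠ y₀)
    {k : Sym2 (ℝ × ℝ) → Bool} (hk : ∀ t d d' y z, y ≠ y₀ → z ≠ y₀ → f.DualTo d x y →
      f.DualTo d' x z → f.curveGraph.Inc d t → f.curveGraph.Inc d' t → k d = k d')
    (hd : f.DualTo d x y) (hd' : f.DualTo d' x z) (hy : y ≠ y₀) (hz : z ≠ y₀) : k d = k d' := by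
  classical
  set K : ℤ × ℤ → Bool := fun y => decide (∃ d, f.DualTo d x y ∧ k d = true) with hK
  have hKd : ∀ {d y}, f.DualTo d x y → K y = k d := by
    intro d y hd
    rw [hK]
    cases hkd : k d
    · simp only [decide_eq_false_iff_not]
      rintro ⟨d', h1, h2⟩
      rw [h1.unique hf hd, hkd] at h2
      simp at h2
    · exact decide_eq_true ⟨d, hd, hkd⟩
  obtain ⟨u, -, -, -, hu, -, -, hxu, hyu, -⟩ := id hd
  obtain ⟨v, -, -, -, hv, -, -, hxv, hzv, -⟩ := id hd'
  rw [← hKd hd, ← hKd hd']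
  refine hf.star_colouring hx hy₀ K ?_ hu hxu hyu hd.ne.symm hy hv hxv hzv hd'.ne.symm hz
  intro w hw hxw a ha c hc hax hay hcx hcy
  obtain ⟨d, hd⟩ := hx.exists_dualTo hf hw hxw ha hax.symm
  obtain ⟨d', hd'⟩ := hx.exists_dualTo hf hw hxw hc hcx.symm
  rw [hKd hd, hKd hd']
  exact hk w d d' a c hay hcy hd hd' ((hd.inc_iff hf).2 ⟨hw, hxw, ha⟩)
    ((hd'.inc_iff hf).2 ⟨hw, hxw, hc⟩)

/-- A colouring of the edges dual to the edges at an interior lattice point cannot change at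
exactly one triangle. -/
theorem star_eq_at (hf : f.IsSmooth) (hx : f.IsInner x)
    {k : Sym2 (ℝ × ℝ) → Bool} (hk : ∀ t d d' y z, t ≠ v → f.DualTo d x y →
      f.DualTo d' x z → f.curveGraph.Inc d t → f.curveGraph.Inc d' t → k d = k d')
    (hd : f.DualTo d x y) (hd' : f.DualTo d' x z) (hv : f.curveGraph.Inc d v)
    (hv' : f.curveGraph.Inc d' v) : k d = k d' := by
  by_cases hyz : y = z
  · subst hyz
    rw [hd.unique hf hd']
  obtain ⟨hv, hxv, hyv⟩ := (hd.inc_iff hf).1 hv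
  obtain ⟨-, -, hzv⟩ := (hd'.inc_iff hf).1 hv'
  obtain ⟨a, ha, -⟩ := hf.exists_triangle_of_ne hv hxv hyv hd.ne
  have hza : z = a := by
    rw [ha] at hzv
    rcases hzv with h | h | h
    · exact absurd h hd'.ne.symm
    · exact absurd h.symm hyz
    · exact h
  subst hza
  -- The way around `x` that avoids the triangle at `v` is taken: first across the other triangle on
  -- `xy`, then through the star of `x` without `y`. There, the triangle at `v` contributes only the
  -- neighbour `z`, so no change can occur.
  obtain ⟨v', hv', hxv', hyv', hne⟩ : ∃ v', f.IsVertex v' ∧ x ∈ f.minimizers v' ∧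
      y ∈ f.minimizers v' ∧ v' ≠ v := by
    obtain ⟨u, w, -, h1, h2, h3, -, h4, h5, h6, h7⟩ := id hd
    by_cases hu : u = v
    · exact ⟨w, h3, h6, h7, fun h => h1 (hu.trans h.symm)⟩
    · exact ⟨u, h2, h4, h5, hu⟩
  obtain ⟨c, hc, hA⟩ := hf.exists_triangle_of_ne hv' hxv' hyv' hd.ne
  have hcx : x ≠ c ∧ y ≠ c := by
    have := ne_of_doubleArea_ne_zero (p := x) (q := y) (r := c) (by intro h; simp [h] at hA)
    exact this.2
  have hcv' : c ∈ f.minimizers v' := by rw [hc]; simp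
  obtain ⟨d'', hd''⟩ := hx.exists_dualTo hf hv' hxv' hcv' hcx.1
  rw [hk v' d d'' y c hne hd hd'' ((hd.inc_iff hf).2 ⟨hv', hxv', hyv'⟩)
    ((hd''.inc_iff hf).2 ⟨hv', hxv', hcv'⟩)]
  refine star_eq_of_ne hf hx hd.ne ?_ hd'' hd' hcx.2.symm (Ne.symm hyz)
  intro t e e' a a' hay hay' he he' het het'
  by_cases htv : t = v
  · subst htv
    have h1 := ((he.inc_iff hf).1 het).2.2
    have h2 := ((he'.inc_iff hf).1 het').2.2
    rw [ha] at h1 h2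
    simp only [Set.mem_insert_iff, Set.mem_singleton_iff, he.ne.symm, hay, he'.ne.symm, hay',
      false_or] at h1 h2
    subst h1
    subst h2
    rw [he.unique hf he']
  · exact hk t e e' a a' htv he he' het het'

theorem star_eq (hf : f.IsSmooth) (hx : f.IsInner x)
    {k : Sym2 (ℝ × ℝ) → Bool} (hk : ∀ t d d' y z, f.DualTo d x y →
      f.DualTo d' x z → f.curveGraph.Inc d t → f.curveGraph.Inc d' t → k d = k d')
    (hd : f.DualTo d x y) (hd' : f.DualTo d' x z) : k d = k d' := by
  obtain ⟨y₀, hy₀⟩ := Infinite.exists_notMem_finset ({x, y, z} : Finset (ℤ × ℤ))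
  simp only [Finset.mem_insert, Finset.mem_singleton, not_or] at hy₀
  exact star_eq_of_ne hf hx (Ne.symm hy₀.1) (fun t d d' y z _ _ => hk t d d' y z) hd hd'
    (Ne.symm hy₀.2.1) (Ne.symm hy₀.2.2)

/-! ### The graph induced on the interior lattice points -/

/-- At the midpoint of the edge, exactly those terms are minimal that are minimal at both ends. -/
theorem DualTo.exists_minimizers_eq (hf : f.IsSmooth) (h : f.DualTo e p q) :
    ∃ w, f.minimizers w = {p, q} := by
  obtain ⟨u, w, h1, h2, h3, h4, h5, h6, h7, h8, h9⟩ := id h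
  have hmid : ∀ x, f.term x ((u.1 + w.1) / 2, (u.2 + w.2) / 2) =
      (f.term x u + f.term x w) / 2 := fun x => by simp only [term]; ring
  refine ⟨((u.1 + w.1) / 2, (u.2 + w.2) / 2), ?_⟩
  ext x
  constructor
  · rintro ⟨hx, hx'⟩
    have hle := hx' p h6.1
    rw [hmid, hmid] at hle
    have hu := h6.2 x hx
    have hw := h8.2 x hx
    have hxu : x ∈ f.minimizers u := ⟨hx, fun y hy => by linarith [h6.2 y hy]⟩
    have hxw : x ∈ f.minimizers w := ⟨hx, fun y hy => by linarith [h8.2 y hy]⟩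
    by_cases hxp : x = p
    · exact Or.inl hxp
    · have := dualTo_mk h2 h3 h4 hxp hxu h6 hxw h8
      rw [← h1] at this
      exact h.mem_pair hf this
  · have key : ∀ {x}, x ∈ f.minimizers u → x ∈ f.minimizers w →
        x ∈ f.minimizers ((u.1 + w.1) / 2, (u.2 + w.2) / 2) := by
      intro x hu hw
      refine ⟨hu.1, fun y hy => ?_⟩
      rw [hmid, hmid]
      linarith [hu.2 y hy, hw.2 y hy]
    rintro (rfl | rfl)
    · exact key h6 h8
    · exact key h7 h9

theorem DualTo.isLink_interiorGraph (hf : f.IsSmooth) (h : f.DualTo e p q) (hp : f.IsInner p)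
    (hq : f.IsInner q) : f.interiorGraph.IsLink s(p, q) p q :=
  ⟨(mem_interiorPoints_iff hf.1).2 hp, (mem_interiorPoints_iff hf.1).2 hq, h.ne,
    h.exists_minimizers_eq hf, rfl⟩

theorem exists_dualTo_of_isLink (hf : f.IsSmooth) {z : Sym2 (ℤ × ℤ)}
    (h : f.interiorGraph.IsLink z p q) :
    f.IsInner p ∧ f.IsInner q ∧ z = s(p, q) ∧ ∃ e, f.DualTo e p q := by
  obtain ⟨h1, h2, h3, ⟨w, hw⟩, rfl⟩ := h
  rw [mem_interiorPoints_iff hf.1] at h1 h2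
  obtain ⟨u, hu, hp, hq⟩ := exists_isVertex_of_pair hf.1 h3 (w := w) (by simp [hw]) (by simp [hw])
  exact ⟨h1, h2, rfl, h1.exists_dualTo hf hu hp hq h3⟩

theorem isFinite_interiorGraph (h : f.interiorPoints.Finite) : f.interiorGraph.IsFinite := by
  refine ⟨h, ((h.prod h).image fun x => s(x.1, x.2)).subset fun z hz => ?_⟩
  obtain ⟨p, q, hl⟩ := f.interiorGraph.exists_isLink_of_mem_edgeSet hz
  exact ⟨(p, q), ⟨hl.1, hl.2.1⟩, hl.2.2.2.2.symm⟩

/-- No side of a triangle with three interior lattice points as vertices is a bridge. -/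
theorem not_isBridge_of_triangle (hf : f.IsSmooth) (hI : f.interiorPoints.Finite)
    (ht : f.IsVertex t) (hp : p ∈ f.minimizers t) (hq : q ∈ f.minimizers t)
    (hr : r ∈ f.minimizers t) (hp' : f.IsInner p) (hq' : f.IsInner q) (hr' : f.IsInner r)
    (hpq : p ≠ q) (hpr : p ≠ r) (hqr : q ≠ r) : ¬ f.interiorGraph.IsBridge s(p, q) := by
  intro hb
  obtain ⟨χ, hχ⟩ := hb.exists_isCut (isFinite_interiorGraph hI)
  obtain ⟨e, he⟩ := hp'.exists_dualTo hf ht hp hq hpq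
  obtain ⟨e₁, he₁⟩ := hp'.exists_dualTo hf ht hp hr hpr
  obtain ⟨e₂, he₂⟩ := hq'.exists_dualTo hf ht hq hr hqr
  have h0 := (hχ (he.isLink_interiorGraph hf hp' hq')).2 rfl
  have h1 : χ p = χ r := by
    by_contra hne
    have := (hχ (he₁.isLink_interiorGraph hf hp' hr')).1 hne
    simp [hqr.symm, hpq] at this
  have h2 : χ q = χ r := by
    by_contra hne
    have := (hχ (he₂.isLink_interiorGraph hf hq' hr')).1 hne
    simp [hqr.symm, hpr.symm, hpq.symm] at this
  exact h0 (h1.trans h2.symm)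

end TropicalPolynomial

/-! ### Edges of a bridgeless skeleton that can arise from bridges -/

namespace TropicalPolynomial

open Graph

variable {f : TropicalPolynomial} {C S : Graph (ℝ × ℝ) (Sym2 (ℝ × ℝ))}
  {m : Sym2 (ℝ × ℝ) → Sym2 (ℝ × ℝ)} {p q r s x y z : ℤ × ℤ} {u v w t : ℝ × ℝ}
  {d d' e e' b : Sym2 (ℝ × ℝ)}

theorem exists_third (hf : f.IsSmooth) (ht : f.IsVertex t) (hp : p ∈ f.minimizers t)
    (hq : q ∈ f.minimizers t) (hpq : p ≠ q) :
    ∃ r, f.minimizers t = {p, q, r} ∧ p ≠ r ∧ q ≠ r := by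
  obtain ⟨r, hr, hA⟩ := hf.exists_triangle_of_ne ht hp hq hpq
  have := ne_of_doubleArea_ne_zero (p := p) (q := q) (r := r) (by intro h; simp [h] at hA)
  exact ⟨r, hr, this.2⟩

namespace SkeletonData

variable (h : SkeletonData f C S m)
include h

theorem mem_edgeSet (hd : f.DualTo d p q) (hp : f.IsInner p) : d ∈ C.edgeSet := by
  obtain ⟨u, w, rfl, h2, h3, h4, h5, h6, h7, h8, h9⟩ := hd
  exact ((h.isRetract.link_iff _ _ _).2 ⟨isLink_iff.2 ⟨p, q, h5, rfl, h2, h3, h4, h6, h7, h8, h9⟩,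
    h.mem_of_isInner h3 h6 hp, h.mem_of_isInner h4 h8 hp⟩).edge_mem

theorem inc_of_dualTo (hd : f.DualTo d p q) (hp : f.IsInner p) (ht : f.curveGraph.Inc d t) :
    C.Inc d t := by
  obtain ⟨a, b, hl⟩ := C.exists_isLink_of_mem_edgeSet (h.mem_edgeSet hd hp)
  rcases ht.eq_or_eq_of_isLink ((h.isRetract.link_iff _ _ _).1 hl).1 with rfl | rfl
  · exact hl.inc_left
  · exact hl.inc_right

/-- Every side of the triangle contains `p` or `q`, so all three dual edges survive retraction and
the vertex is 3-valent. -/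
theorem mem_of_two (ht : f.IsVertex t) (hp : p ∈ f.minimizers t) (hq : q ∈ f.minimizers t)
    (hpq : p ≠ q) (hp' : f.IsInner p) (hq' : f.IsInner q) : t ∈ S.vertexSet := by
  have hf := h.smooth
  obtain ⟨r, hr, hpr, hqr⟩ := exists_third hf ht hp hq hpq
  have hr' : r ∈ f.minimizers t := by simp [hr]
  obtain ⟨e₁, h1⟩ := hp'.exists_dualTo hf ht hp hq hpq
  obtain ⟨e₂, h2⟩ := hp'.exists_dualTo hf ht hp hr' hpr
  obtain ⟨e₃, h3⟩ := hq'.exists_dualTo hf ht hq hr' hqr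
  refine h.mem_of_inc (h.mem_of_isInner ht hp hp')
    (h.inc_of_dualTo h1 hp' ((h1.inc_iff hf).2 ⟨ht, hp, hq⟩))
    (h.inc_of_dualTo h2 hp' ((h2.inc_iff hf).2 ⟨ht, hp, hr'⟩))
    (h.inc_of_dualTo h3 hq' ((h3.inc_iff hf).2 ⟨ht, hq, hr'⟩)) ?_ ?_ ?_
  · rintro rfl
    rcases h1.mem_pair hf h2.symm with k | k
    · exact hpr k.symm
    · exact hqr k.symm
  · rintro rfl
    rcases h1.mem_pair hf h3.symm with k | k
    · exact hpr k.symm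
    · exact hqr k.symm
  · rintro rfl
    rcases h2.mem_pair hf h3 with k | k
    · exact hpq k.symm
    · exact hqr k

variable (hb : ∀ e, ¬ S.IsBridge e)
include hb

/-- A chord between boundary points whose dual edge survives would give a bridge of the skeleton. -/
theorem isInner_or (hd : d ∈ C.edgeSet) (hpq : f.DualTo d p q) : f.IsInner p ∨ f.IsInner q := by
  by_contra! hcon
  obtain ⟨χ, hχ⟩ := hpq.exists_isCut h.smooth hcon.1 hcon.2
  exact hb _ ((h.smoothing.isCut _ _ (h.isRetract.isCut hχ)).isBridge h.smoothing.isFinite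
    (h.smoothing.map_mem _ hd))

theorem exists_inner_pair (ht : t ∈ S.vertexSet) (hp : p ∈ f.minimizers t) (hq : q ∈ f.minimizers t)
    (hpq : p ≠ q) (hq' : ¬ f.IsInner q) :
    ∃ r, f.minimizers t = {p, q, r} ∧ f.IsInner r ∧ p ≠ r ∧ q ≠ r := by
  obtain ⟨r, hr, hpr, hqr⟩ := exists_third h.smooth (h.isVertex (h.smoothing.subset ht)) hp hq hpq
  obtain ⟨e, he, he'⟩ := h.exists_dualTo ht hq (q := r) (by simp [hr]) hqr
  exact ⟨r, hr, (h.isInner_or hb he'.edge_mem he).resolve_left hq', hpr, hqr⟩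

omit hb in
theorem map_eq_iff {P : Sym2 (ℝ × ℝ) → Prop} (hP : ∀ d d' t, t ∉ S.vertexSet → C.Inc d t →
    C.Inc d' t → P d → P d') (hd : d ∈ C.edgeSet) (hd' : d' ∈ C.edgeSet) (hm : m d = m d') :
    P d ↔ P d' := by
  have := h.smoothing.eqvGen d hd d' hd' hm
  clear hm hd hd'
  induction this with
  | rel _ _ hr =>
    obtain ⟨t, h1, h2, h3⟩ := hr
    exact ⟨hP _ _ t h1 h2 h3, hP _ _ t h1 h3 h2⟩
  | refl _ => rfl
  | symm _ _ _ ih => exact ih.symm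
  | trans _ _ _ _ _ ih₁ ih₂ => exact ih₁.trans ih₂

omit hb in
/-- An edge dual to an edge between two interior lattice points is an edge of the skeleton. -/
theorem eq_of_map_eq (hd : f.DualTo d p q) (hp : f.IsInner p) (hq : f.IsInner q)
    (hd' : d' ∈ C.edgeSet) (hm : m d' = m d) : d' = d := by
  refine (h.map_eq_iff (P := fun e => e = d) ?_ hd' (h.mem_edgeSet hd hp) hm).2 rfl
  rintro _ e t ht h1 - rfl
  obtain ⟨k1, k2, k3⟩ := (hd.inc_iff h.smooth).1 (h.inc_of_inc h1)
  exact absurd (h.mem_of_two k1 k2 k3 hd.ne hp hq) ht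

omit hb in
theorem map_eq (hd : f.DualTo d p q) (hp : f.IsInner p) (hq : f.IsInner q) : m d = d := by
  have hmd := h.smoothing.map_mem d (h.mem_edgeSet hd hp)
  have := h.smoothing.edge_mem _ hmd
  exact h.eq_of_map_eq hd hp hq this.2 this.1

/-- Without bridges, the cubic skeleton has no loops, so `t` has three distinct edges both in `C`
and in `S`. -/
theorem injOn_inc (ht : t ∈ S.vertexSet) : Set.InjOn m {d | C.Inc d t} := by
  have hl : {d | S.IsLoopAt d t} = ∅ := Set.eq_empty_iff_forall_notMem.2 fun d =>
    not_isLoopAt_of_degree h.smoothing.isFinite hb (h.good.degree t ht) d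
  have h3 := h.good.degree t ht
  have h3' := (h.degree_eq_three ht).1
  rw [Graph.degree, hl, Set.ncard_empty, add_zero] at h3
  rw [h.degree_eq] at h3'
  have hfin : {d | C.Inc d t}.Finite := h.isFinite.inc_finite t
  refine Set.injOn_of_ncard_image_eq ?_ hfin
  rw [h3', ← h3]
  congr 1
  ext d
  constructor
  · rintro ⟨d', hd', rfl⟩
    exact h.smoothing.inc _ _ hd' ht
  · intro hd
    obtain ⟨d', rfl, hd'⟩ := h.smoothing.exists_inc d t hd
    exact ⟨d', hd', rfl⟩

variable {c : Sym2 (ℝ × ℝ) → Bool} (hc : Splits S b v w c)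
include hc

omit hb in
theorem colour_eq (hv : t ≠ v) (hw : t ≠ w) (hd : C.Inc d t) (hd' : C.Inc d' t) :
    c (m d) = c (m d') := by
  by_cases ht : t ∈ S.vertexSet
  · exact hc.const t hv hw _ _ (h.smoothing.inc _ _ hd ht) (h.smoothing.inc _ _ hd' ht)
  · rw [h.smoothing.eq_of_inc d d' t hd hd' ht]

theorem colour_ne (hu : u = v ∨ u = w) (hd : C.Inc d u) (hd' : C.Inc d' u) (hdb : m d ≠ b)
    (hdb' : m d' ≠ b) (hne : d ≠ d') : c (m d) ≠ c (m d') := by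
  have hmem : u ∈ S.vertexSet := by
    rcases hu with rfl | rfl
    · exact hc.link.left_mem
    · exact hc.link.right_mem
  exact hc.diff u hu _ _ hdb hdb' (fun hm => hne (h.injOn_inc hb hmem hd hd' hm))
    (h.smoothing.inc _ _ hd hmem) (h.smoothing.inc _ _ hd' hmem)

/-- An edge of the skeleton that splits it and is dual to an edge between two interior lattice
points gives a bridge. -/
theorem isBridge_of_splits (hI : f.interiorPoints.Finite) (hvw : v ≠ w) (hbS : b ∈ S.edgeSet)
    (hd : f.DualTo b p q) (hp : f.IsInner p)
    (hq : f.IsInner q) : f.interiorGraph.IsBridge s(p, q) := by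
  classical
  have hf := h.smooth
  have hmb := h.map_eq hd hp hq
  have hend : ∀ {u}, S.Inc b u → C.Inc b u := by
    intro u hu
    obtain ⟨d, h1, h2⟩ := h.smoothing.exists_inc b u hu
    rwa [← h.eq_of_map_eq hd hp hq h2.edge_mem (h1.trans hmb.symm)]
  have hv := h.inc_of_inc (hend hc.link.inc_left)
  have hw := h.inc_of_inc (hend hc.link.inc_right)
  have hnb : ∀ {d}, d ∈ C.edgeSet → d ≠ b → m d ≠ b := fun hdC hne hm =>
    hne (h.eq_of_map_eq hd hp hq hdC (hm.trans hmb.symm))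
  have hinc : ∀ {d x y t}, f.IsInner x → f.DualTo d x y → f.curveGraph.Inc d t → C.Inc d t :=
    fun hx hd ht => h.inc_of_dualTo hd hx ht
  -- The triangles at `v` and `w` share only the side `pq`, so another interior point `x` belongs to
  -- at most one of them. Around `x` the colour could change only there, hence by `star_eq_at` it
  -- never changes.
  have hother : ∀ {x}, f.IsInner x → x ≠ p → x ≠ q → ∀ {d d' y z}, f.DualTo d x y →
      f.DualTo d' x z → c (m d) = c (m d') := by
    intro x hx hxp hxq d d' y z hdx hdx'
    obtain ⟨kv, kv1, kv2⟩ := (hd.inc_iff hf).1 hv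
    obtain ⟨kw, kw1, kw2⟩ := (hd.inc_iff hf).1 hw
    obtain ⟨u₀, hu₀⟩ : ∃ u₀, ∀ t, t ≠ u₀ → x ∈ f.minimizers t → t ≠ v ∧ t ≠ w := by
      by_cases hxv : x ∈ f.minimizers v
      · refine ⟨v, fun t ht hxt => ⟨ht, ?_⟩⟩
        rintro rfl
        have h1 := dualTo_mk hvw kv kw hd.ne kv1 kv2 kw1 kw2
        have h2 := dualTo_mk hvw kv kw hxp hxv kv1 hxt kw1
        exact (h1.mem_pair hf h2).elim hxp hxq
      · refine ⟨w, fun t ht hxt => ⟨?_, ht⟩⟩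
        rintro rfl
        exact hxv hxt
    have hk : ∀ t d d' y z, t ≠ u₀ → f.DualTo d x y → f.DualTo d' x z → f.curveGraph.Inc d t →
        f.curveGraph.Inc d' t → c (m d) = c (m d') := by
      intro t d d' y z ht h1 h2 h3 h4
      obtain ⟨k1, k2⟩ := hu₀ t ht ((h1.inc_iff hf).1 h3).2.1
      exact h.colour_eq hc k1 k2 (hinc hx h1 h3) (hinc hx h2 h4)
    refine star_eq hf hx (k := fun d => c (m d)) (fun t d d' y z h1 h2 h3 h4 => ?_) hdx hdx'
    by_cases ht : t = u₀
    · subst ht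
      exact star_eq_at hf hx (k := fun d => c (m d)) hk h1 h2 h3 h4
    · exact hk t d d' y z ht h1 h2 h3 h4
  -- At an end of the edge dual to `b`, the triangles at `v` and `w` contribute only one neighbour
  -- besides the other end, so the remaining edges have the same colour.
  have hsame : ∀ {x x'}, f.DualTo b x x' → f.IsInner x → ∀ {d d' y z}, d ≠ b → d' ≠ b →
      f.DualTo d x y → f.DualTo d' x z → c (m d) = c (m d') := by
    intro x x' hb' hx d d' y z hdb hdb' hdx hdx'
    have hne : ∀ {d y}, d ≠ b → f.DualTo d x y → y ≠ x' := by
      rintro d y hdb hdx rfl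
      exact hdb (hdx.unique hf hb')
    refine star_eq_of_ne hf hx hb'.ne (k := fun d => c (m d)) ?_ hdx hdx' (hne hdb hdx)
      (hne hdb' hdx')
    intro t d d' y z hy hz h1 h2 h3 h4
    by_cases ht : t = v ∨ t = w
    · have htb : f.curveGraph.Inc b t := by
        rcases ht with rfl | rfl
        · exact hv
        · exact hw
      obtain ⟨kt, kx, kx'⟩ := (hb'.inc_iff hf).1 htb
      obtain ⟨r, hr, -, -⟩ := exists_third hf kt kx kx' hb'.ne
      have hmem : ∀ {d y}, y ≠ x' → f.DualTo d x y → f.curveGraph.Inc d t → y = r := by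
        intro d y hy hdx hdt
        have := ((hdx.inc_iff hf).1 hdt).2.2
        rw [hr] at this
        simpa [hdx.ne.symm, hy] using this
      have e1 := hmem hy h1 h3
      have e2 := hmem hz h2 h4
      subst e1
      subst e2
      rw [h1.unique hf h2]
    · rw [not_or] at ht
      exact h.colour_eq hc ht.1 ht.2 (hinc hx h1 h3) (hinc hx h2 h4)
  have hall : ∀ {x}, f.IsInner x → ∀ {d d' y z}, d ≠ b → d' ≠ b →
      f.DualTo d x y → f.DualTo d' x z → c (m d) = c (m d') := by
    intro x hx d d' y z hdb hdb' hdx hdx'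
    by_cases hxp : x = p
    · subst hxp
      exact hsame hd hx hdb hdb' hdx hdx'
    · by_cases hxq : x = q
      · subst hxq
        exact hsame hd.symm hx hdb hdb' hdx hdx'
      · exact hother hx hxp hxq hdx hdx'
  -- An interior point takes the common colour of the edges dual to its sides, apart from `b`. An
  -- edge of the interior graph other than `pq` joins points of the same colour, while `p` and `q`
  -- differ because of the two other sides of the triangle at `v`.
  set χ : ℤ × ℤ → Bool := fun x => decide (∃ d y, f.DualTo d x y ∧ d ≠ b ∧ c (m d) = true) with hχ
  have hχd : ∀ {x d y}, f.IsInner x → d ≠ b → f.DualTo d x y → χ x = c (m d) := by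
    intro x d y hx hdb hdx
    rw [hχ]
    cases hcd : c (m d)
    · simp only [decide_eq_false_iff_not]
      rintro ⟨d', y', h1, h2, h3⟩
      rw [hall hx h2 hdb h1 hdx, hcd] at h3
      simp at h3
    · exact decide_eq_true ⟨d, y, hdx, hdb, hcd⟩
  have hpq : χ p ≠ χ q := by
    obtain ⟨kv, kp, kq⟩ := (hd.inc_iff hf).1 hv
    obtain ⟨r, hr, hpr, hqr⟩ := exists_third hf kv kp kq hd.ne
    have kr : r ∈ f.minimizers v := by simp [hr]
    obtain ⟨d₁, h1⟩ := hp.exists_dualTo hf kv kp kr hpr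
    obtain ⟨d₂, h2⟩ := hq.exists_dualTo hf kv kq kr hqr
    have hb1 : d₁ ≠ b := by
      rintro rfl
      exact (hd.mem_pair hf h1.symm).elim hpr.symm hqr.symm
    have hb2 : d₂ ≠ b := by
      rintro rfl
      exact (hd.mem_pair hf h2.symm).elim hpr.symm hqr.symm
    have k1 := hinc hp h1 ((h1.inc_iff hf).2 ⟨kv, kp, kr⟩)
    have k2 := hinc hq h2 ((h2.inc_iff hf).2 ⟨kv, kq, kr⟩)
    rw [hχd hp hb1 h1, hχd hq hb2 h2]
    refine h.colour_ne hb hc (Or.inl rfl) k1 k2 (hnb k1.edge_mem hb1) (hnb k2.edge_mem hb2) ?_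
    rintro rfl
    exact (h1.mem_pair hf h2).elim hd.ne.symm hqr
  refine IsCut.isBridge (isFinite_interiorGraph hI) (χ := χ) ?_
    (hd.isLink_interiorGraph hf hp hq).edge_mem
  intro z x y hl
  obtain ⟨hx, hy, rfl, e, he⟩ := exists_dualTo_of_isLink hf hl
  by_cases heb : e = b
  · subst heb
    refine iff_of_true ?_ (he.pair_eq hf hd)
    rcases Sym2.eq_iff.1 (he.pair_eq hf hd) with ⟨rfl, rfl⟩ | ⟨rfl, rfl⟩
    · exact hpq
    · exact hpq.symm
  · refine iff_of_false (fun hne => hne ?_) fun hs => heb ?_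
    · rw [hχd hx heb he, hχd hy heb he.symm]
    · rcases Sym2.eq_iff.1 hs with ⟨rfl, rfl⟩ | ⟨rfl, rfl⟩
      · exact he.unique hf hd
      · exact he.symm.unique hf hd

/-- If an edge of the skeleton that splits it is dual to an edge between an interior lattice point
and a boundary point, then it is parallel to an edge dual to one between interior lattice points. -/
theorem exists_parallel_of_splits (hvw : v ≠ w)
    (hd : f.DualTo b p q) (hp : f.IsInner p) (hq : ¬ f.IsInner q) :
    ∃ b' r, f.DualTo b' p r ∧ f.IsInner r ∧ S.IsLink b' v w := by
  classical
  have hf := h.smooth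
  have hbC := h.mem_edgeSet hd hp
  have hmb := (h.smoothing.edge_mem _ hc.link.edge_mem).1
  -- A vertex smoothed away has at most one interior point in its triangle. So all the edges merged
  -- into `b` are dual to sides from the same `p` to boundary points.
  have hpath : ∀ {d}, d ∈ C.edgeSet → m d = b → ∃ x, f.DualTo d p x ∧ ¬ f.IsInner x := by
    intro d hdC hdm
    refine (h.map_eq_iff (P := fun d => ∃ x, f.DualTo d p x ∧ ¬ f.IsInner x) ?_ hbC hdC
      (hmb.trans hdm.symm)).1 ⟨q, hd, hq⟩
    rintro d d' t ht hdt hdt' ⟨x, hx, hx'⟩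
    obtain ⟨kt, kp, kx⟩ := (hx.inc_iff hf).1 (h.inc_of_inc hdt)
    obtain ⟨a, a', ha, k1, k2⟩ := exists_dualTo_at hf (h.inc_of_inc hdt')
    have hone : ∀ {y}, y ∈ f.minimizers t → f.IsInner y → y = p := by
      intro y hy hy'
      by_contra hne
      exact ht (h.mem_of_two kt hy kp hne hy' hp)
    rcases h.isInner_or hb hdt'.edge_mem ha with hi | hi
    · obtain rfl := hone k1 hi
      exact ⟨a', ha, fun hi' => ha.ne (hone k2 hi').symm⟩
    · obtain rfl := hone k2 hi
      exact ⟨a, ha.symm, fun hi' => ha.ne (hone k1 hi')⟩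
  have hend : ∀ {u}, S.Inc b u → ∃ x r d, f.minimizers u = {p, x, r} ∧ f.IsVertex u ∧
      f.DualTo d p x ∧ ¬ f.IsInner x ∧ f.IsInner r ∧ p ≠ r ∧ x ≠ r ∧ p ≠ x ∧ m d = b ∧ C.Inc d u := by
    intro u hu
    obtain ⟨d, h1, h2⟩ := h.smoothing.exists_inc b u hu
    obtain ⟨x, hx, hx'⟩ := hpath h2.edge_mem h1
    obtain ⟨kt, kp, kx⟩ := (hx.inc_iff hf).1 (h.inc_of_inc h2)
    obtain ⟨r, hr, hr', hpr, hxr⟩ := h.exists_inner_pair hb hu.vertex_mem kp kx hx.ne hx'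
    exact ⟨x, r, d, hr, kt, hx, hx', hr', hpr, hxr, hx.ne, h1, h2⟩
  obtain ⟨x, r, d, hmv, hv, hdx, hx, hr, hpr, hxr, hpx, hdm, hdv⟩ := hend hc.link.inc_left
  obtain ⟨_, _, d', -, hw, hdx', -, -, -, -, -, -, hdw⟩ := hend hc.link.inc_right
  have kp : p ∈ f.minimizers v := by simp [hmv]
  have kr : r ∈ f.minimizers v := by simp [hmv]
  have kx : x ∈ f.minimizers v := by simp [hmv]
  have kpw : p ∈ f.minimizers w := ((hdx'.inc_iff hf).1 (h.inc_of_inc hdw)).2.1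
  obtain ⟨e₁, he₁⟩ := hr.exists_dualTo hf hv kr kp hpr.symm
  obtain ⟨e₂, he₂⟩ := hr.exists_dualTo hf hv kr kx hxr.symm
  -- Here `r` is the other interior vertex of the triangle at `v`. The colour changes at `v` between
  -- the two sides at `r`. It cannot change only once around `r`, so the triangle at `w` contains
  -- `r` as well, and the edge dual to `pr` joins `v` and `w`.
  have hrw : r ∈ f.minimizers w := by
    by_contra hrw
    have i1 := (he₁.inc_iff hf).2 ⟨hv, kr, kp⟩
    have i2 := (he₂.inc_iff hf).2 ⟨hv, kr, kx⟩
    have j1 := h.inc_of_dualTo he₁ hr i1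
    have j2 := h.inc_of_dualTo he₂ hr i2
    have hinj := h.injOn_inc hb hc.link.left_mem
    refine h.colour_ne hb hc (Or.inl rfl) j1 j2 (fun hm => ?_) (fun hm => ?_) ?_
      (star_eq_at hf hr (k := fun d => c (m d)) ?_ he₁ he₂ i1 i2)
    · obtain rfl := hinj j1 hdv (hm.trans hdm.symm)
      exact (hdx.mem_pair hf he₁).elim hpr.symm hxr.symm
    · obtain rfl := hinj j2 hdv (hm.trans hdm.symm)
      exact (hdx.mem_pair hf he₂).elim hpr.symm hxr.symm
    · rintro rfl
      exact (he₁.mem_pair hf he₂.symm).elim hxr hpx.symm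
    · intro t d d' y z ht h1 h2 h3 h4
      refine h.colour_eq hc ht ?_ (h.inc_of_dualTo h1 hr h3) (h.inc_of_dualTo h2 hr h4)
      rintro rfl
      exact hrw ((h1.inc_iff hf).1 h3).2.1
  have hm := h.map_eq he₁ hr hp
  have hS : ∀ {u}, f.IsVertex u → p ∈ f.minimizers u → r ∈ f.minimizers u → S.Inc e₁ u := by
    intro u hu h1 h2
    have := h.smoothing.inc _ _ (h.inc_of_dualTo he₁ hr ((he₁.inc_iff hf).2 ⟨hu, h2, h1⟩))
      (h.mem_of_two hu h1 h2 hpr hp hr)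
    rwa [hm] at this
  obtain ⟨y, hy⟩ := hS hv kp kr
  refine ⟨e₁, r, he₁.symm, hr, ?_⟩
  rcases (hS hw kpw hrw).eq_or_eq_of_isLink hy with rfl | rfl
  · exact absurd rfl hvw
  · exact hy

end SkeletonData

end TropicalPolynomial

/-! ### Counting the graphs that reduce to a given one -/

namespace Graph

variable {α β α' β' : Type*} {G G₁ : Graph α β}

theorem isFinite_and_genus_eq (h : ReflTransGen IsBridgeReduction G G₁) (hG : G.IsFinite) :
    G₁.IsFinite ∧ G₁.genus = G.genus := by
  induction h with
  | refl => exact ⟨hG, rfl⟩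
  | tail _ hs ih =>
    obtain ⟨b, v, w, K, hK⟩ := hs.exists_reductionData
    exact ⟨hK.isFinite' ih.1, hK.genus_eq.trans ih.2⟩

end Graph

namespace TropicalPolynomial

open Graph

variable {α β : Type*} {f : TropicalPolynomial} {C S : Graph (ℝ × ℝ) (Sym2 (ℝ × ℝ))}
  {m : Sym2 (ℝ × ℝ) → Sym2 (ℝ × ℝ)}

/-- The edges of the skeleton that are dual to bridges of the graph induced on the interior lattice
points. -/
def dualBridges (f : TropicalPolynomial) (S : Graph (ℝ × ℝ) (Sym2 (ℝ × ℝ))) :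
    Set (Sym2 (ℝ × ℝ)) :=
  {e | e ∈ S.edgeSet ∧ ∃ p q, f.DualTo e p q ∧ f.IsInner p ∧ f.IsInner q ∧
    f.interiorGraph.IsBridge s(p, q)}

namespace SkeletonData

variable (h : SkeletonData f C S m) (hI : f.interiorPoints.Finite)
include h hI

/-- Two such edges at one vertex would make its triangle have three interior vertices, and then no
side is a bridge. So the edges are pairwise disjoint and have twice as many ends. -/
theorem ncard_dualBridges_le : 2 * (f.dualBridges S).ncard ≤ S.vertexSet.ncard := by
  classical
  have hf := h.smooth
  have hends : ∀ e : f.dualBridges S, ∃ u w, e.1 = s(u, w) ∧ u ≠ w ∧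
      u ∈ S.vertexSet ∧ w ∈ S.vertexSet := by
    rintro ⟨e, -, p, q, ⟨u, w, h1, h2, h3, h4, h5, h6, h7, h8, h9⟩, hp, hq, -⟩
    exact ⟨u, w, h1, h2, h.mem_of_two h3 h6 h7 h5 hp hq, h.mem_of_two h4 h8 h9 h5 hp hq⟩
  choose u w h1 h2 h3 h4 using hends
  have hdisj : ∀ {e e' : f.dualBridges S} {t}, f.curveGraph.Inc e.1 t → f.curveGraph.Inc e'.1 t →
      e = e' := by
    rintro ⟨e, -, p, q, he, hp, hq, hb⟩ ⟨e', -, p', q', he', hp', hq', hb'⟩ t (ht : f.curveGraph.Inc e t)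
      (ht' : f.curveGraph.Inc e' t)
    obtain ⟨kt, kp, kq⟩ := (he.inc_iff hf).1 ht
    obtain ⟨-, kp', kq'⟩ := (he'.inc_iff hf).1 ht'
    have hmem : ∀ {x}, x ∈ f.minimizers t → f.IsInner x → x = p ∨ x = q := by
      intro x hx hx'
      by_contra! hne
      exact not_isBridge_of_triangle hf hI kt kp kq hx hp hq hx' he.ne hne.1.symm hne.2.symm hb
    refine Subtype.ext ?_
    rcases hmem kp' hp' with rfl | rfl <;> rcases hmem kq' hq' with rfl | rfl
    · exact absurd rfl he'.ne
    · exact he.unique hf he'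
    · exact he.unique hf he'.symm
    · exact absurd rfl he'.ne
  have hinc : ∀ (e : f.dualBridges S) (i : Bool),
      f.curveGraph.Inc e.1 (if i then u e else w e) := by
    rintro e i
    obtain ⟨-, p, q, hd, -⟩ := e.2
    have hl : f.curveGraph.IsLink e.1 (u e) (w e) := by
      have := h1 e
      rw [this] at hd ⊢
      exact hd.isLink
    cases i
    · exact hl.inc_right
    · exact hl.inc_left
  have hfin : S.vertexSet.Finite := h.smoothing.isFinite.1
  have hDfin : (f.dualBridges S).Finite := h.smoothing.isFinite.2.subset fun e he => he.1
  have := hDfin.to_subtype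
  have := hfin.to_subtype
  let F : f.dualBridges S × Bool → S.vertexSet := fun x =>
    ⟨if x.2 then u x.1 else w x.1, by cases x.2; exacts [h4 x.1, h3 x.1]⟩
  have hF : Function.Injective F := by
    rintro ⟨e, i⟩ ⟨e', i'⟩ heq
    have heq' : (if i then u e else w e) = if i' then u e' else w e' := congrArg Subtype.val heq
    obtain rfl := hdisj (hinc e i) (heq' ▸ hinc e' i')
    cases i <;> cases i'
    · rfl
    · exact absurd heq'.symm (h2 e)
    · exact absurd heq' (h2 e)
    · rfl
  have hcard := Nat.card_le_card_of_injective F hF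
  rw [Nat.card_prod, Nat.card_coe_set_eq, Nat.card_coe_set_eq, Nat.card_eq_fintype_card (α := Bool),
    Fintype.card_bool] at hcard
  omega

/-- Every graph that reduces to the skeleton is encoded by a set of edges of the skeleton that are
dual to bridges. -/
theorem exists_isEncodedBy [Nonempty α] [Nonempty β] {G G₁ : Graph α β} (hS : S.IsTwoEdgeConnected)
    (hG : G.Good) (hred : ReflTransGen IsBridgeReduction G G₁) (hSG : S.IsIsomorphic G₁)
    {v w : Sym2 (ℝ × ℝ) → ℝ × ℝ} (hvw : ∀ e ∈ S.edgeSet, S.IsLink e (v e) (w e)) :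
    ∃ A ⊆ f.dualBridges S, IsEncodedBy S v w A G := by
  classical
  obtain ⟨B, hB⟩ := ReducedBy.of_reflTransGen hG hred
  obtain ⟨φ, ψ, hφ⟩ := hSG.exists_isImage h.smoothing.isFinite hB.good.isFinite
  -- The induction is on the number of used edges whose dual edge has a boundary point. Each of
  -- these is exchanged with a parallel edge between interior points; the latter is not in use,
  -- since used edges are disjoint.
  induction hn : {e | e ∈ S.edgeSet ∧ ψ e ∈ B ∧
    ∃ p q, f.DualTo e p q ∧ ¬ f.IsInner q}.ncard using Nat.strong_induction_on generalizing ψ with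
  | _ n ih =>
  have henc := hB.isEncodedBy hG hφ hvw
  by_cases hbad : ∃ e ∈ S.edgeSet, ψ e ∈ B ∧ ∃ p q, f.DualTo e p q ∧ ¬ f.IsInner q
  · obtain ⟨e, he, heB, p, q, hd, hq⟩ := hbad
    obtain ⟨hdisj, c, -, hc, -⟩ := henc
    have hp := (h.isInner_or hS.2 (h.smoothing.edge_mem e he).2 hd).resolve_right hq
    obtain ⟨b', r, hd', hr, hl⟩ := h.exists_parallel_of_splits hS.2 (hc e ⟨he, heB⟩)
      (hdisj.ne e ⟨he, heB⟩) hd hp hq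
    have hinner : ∀ {x y}, f.DualTo b' x y → f.IsInner y := by
      intro x y hxy
      rcases hd'.mem_pair h.smooth hxy.symm with rfl | rfl
      · exact hp
      · exact hr
    have hne : e ≠ b' := by
      rintro rfl
      exact hq (hinner hd)
    have hb'B : ψ b' ∉ B := by
      intro hb'B
      have hlb := hvw b' hl.edge_mem
      refine hne (hdisj.eq e ⟨he, heB⟩ b' ⟨hl.edge_mem, hb'B⟩ (v e) (Or.inl rfl) ?_)
      exact hl.inc_left.eq_or_eq_of_isLink hlb
    refine ih _ ?_ _ (hφ.comp_swap (hvw e he) hl) rfl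
    rw [← hn]
    refine Set.ncard_lt_ncard ⟨?_, fun hh => ?_⟩ (h.smoothing.isFinite.2.subset fun d hd => hd.1)
    · rintro d ⟨k1, k2, x, y, k3, k4⟩
      have hdb : d ≠ b' := by
        rintro rfl
        exact k4 (hinner k3)
      by_cases hde : d = e
      · subst hde
        rw [Function.comp_apply, Equiv.swap_apply_left] at k2
        exact absurd k2 hb'B
      · rw [Function.comp_apply, Equiv.swap_apply_of_ne_of_ne hde hdb] at k2
        exact ⟨k1, k2, x, y, k3, k4⟩
    · have := (hh ⟨he, heB, p, q, hd, hq⟩).2.1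
      rw [Function.comp_apply, Equiv.swap_apply_left] at this
      exact hb'B this
  · push Not at hbad
    refine ⟨_, ?_, henc⟩
    rintro e ⟨he, heB⟩
    obtain ⟨p, q, hd⟩ := TropicalPolynomial.exists_dualTo
      ((h.isRetract.link_iff _ _ _).1
        (C.exists_isLink_of_mem_edgeSet (h.smoothing.edge_mem e he).2).choose_spec.choose_spec).1.edge_mem
    have hq := hbad e he heB p q hd
    have hp := hbad e he heB q p hd.symm
    obtain ⟨hdisj, c, -, hc, -⟩ := henc
    exact ⟨he, p, q, hd, hp, hq, h.isBridge_of_splits hS.2 (hc e ⟨he, heB⟩) hI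
      (hdisj.ne e ⟨he, heB⟩) he hd hp hq⟩

end SkeletonData

end TropicalPolynomial

open TropicalPolynomial

theorem graphClass_eq_iff {G G' : Graph ℕ ℕ} : graphClass G = graphClass G' ↔ G.IsIsomorphic G' :=
  Quotient.eq (r := graphSetoid)

/-- The graphs that reduce to a given one are encoded by sets of edges of its skeleton. -/
theorem TropicalPolynomial.GivesRiseTo.exists_encoding {f : TropicalPolynomial} {G' : Graph ℕ ℕ}
    (h : f.GivesRiseTo G') (hG' : G'.IsFinite) (hg : G'.genus ≠ 0) (h2 : G'.IsTwoEdgeConnected) :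
    ∃ (S : Graph (ℝ × ℝ) (Sym2 (ℝ × ℝ))) (F : Set (Sym2 (ℝ × ℝ)) → GraphClass), f.IsSmooth ∧
      (f.dualBridges S).Finite ∧ 2 * ((f.dualBridges S).ncard : ℤ) ≤ 2 * G'.genus - 2 ∧
      ∀ c ∈ reducingClasses G', ∃ A ⊆ f.dualBridges S, F A = c := by
  classical
  obtain ⟨S, C, m, φ, ψ, -, hm, hφ⟩ := h.exists_skeletonData hG' hg
  have hfin := hm.smoothing.isFinite
  have hI : f.interiorPoints.Finite := Set.finite_of_ncard_ne_zero (by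
    have := h.2.1
    unfold genus at this
    omega)
  obtain ⟨φ', ψ', hφ'⟩ := hφ.isIsomorphic.symm.exists_isImage hG' hfin
  have hS : S.IsTwoEdgeConnected := hφ'.isTwoEdgeConnected hG' h2
  have hex : ∀ e : Sym2 (ℝ × ℝ), ∃ v w, e ∈ S.edgeSet → S.IsLink e v w := by
    intro e
    by_cases he : e ∈ S.edgeSet
    · obtain ⟨v, w, hl⟩ := S.exists_isLink_of_mem_edgeSet he
      exact ⟨v, w, fun _ => hl⟩
    · exact ⟨0, 0, fun h => absurd h he⟩
  choose v w hvw using hex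
  -- By `IsEncodedBy.isIsomorphic` all graphs encoded by `A` are isomorphic, so any choice gives the
  -- right class. The default value for other sets is irrelevant.
  refine ⟨S, fun A => if hA : ∃ G : Graph ℕ ℕ, Graph.IsEncodedBy S v w A G then
    graphClass hA.choose else graphClass G', h.1, hfin.2.subset fun e he => he.1, ?_, ?_⟩
  -- The cubic skeleton has 2g - 2 vertices.
  · have h3 := hm.good.three_mul_card
    have h4 := hm.ncard_dualBridges_le hI
    rw [hφ.genus_eq, Graph.genus]
    omega
  · rintro _ ⟨G, rfl, hG, G'', hred, hiso⟩
    obtain ⟨k1, k2⟩ := Graph.isFinite_and_genus_eq hred hG.1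
    obtain ⟨φ₁, ψ₁, h₁⟩ := hiso.exists_isImage k1 hG'
    have hgood := hG.good (by rw [← k2, ← h₁.genus_eq]; exact hg)
    obtain ⟨A, hA, henc⟩ := hm.exists_isEncodedBy hI hS hgood hred
      (hφ.isIsomorphic.trans hiso.symm) (v := v) (w := w) (fun e he => hvw e he)
    refine ⟨A, hA, ?_⟩
    have hex : ∃ G : Graph ℕ ℕ, Graph.IsEncodedBy S v w A G := ⟨G, henc⟩
    simp only [dif_pos hex]
    exact graphClass_eq_iff.2 (hex.choose_spec.isIsomorphic hfin hS henc)

theorem corollary3p9 (g : ℕ) (hg : 2 ≤ g) :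
    -- there are finitely many troplanar graphs of genus g, and T(g) ≤ 2^(g-1) T⁽²⁾(g)
    ((troplanarClasses g).Finite ∧
      (troplanarClasses g).ncard ≤
        2 ^ (g - 1) * (twoEdgeConnectedTroplanarClasses g).ncard) ∧
    -- every troplanar graph bridge-reduces to a 2-edge-connected one
    (∀ G : Graph ℕ ℕ, G.IsTroplanar → G.genus = g →
      ∃ G' : Graph ℕ ℕ, G.BridgeReducesTo G' ∧
        G'.IsTroplanar ∧ G'.genus = g ∧ G'.IsTwoEdgeConnected) ∧
    -- at most 2^(g-1) troplanar graphs reduce to a given one, and they are indexed by sets of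
    -- bridges of the graph induced on the interior lattice points
    (∀ G' : Graph ℕ ℕ, G'.IsTroplanar → G'.genus = g → G'.IsTwoEdgeConnected →
      (reducingClasses G').Finite ∧ (reducingClasses G').ncard ≤ 2 ^ (g - 1) ∧
      ∀ f : TropicalPolynomial, f.GivesRiseTo G' →
        ∃ Φ : Set (Sym2 (ℤ × ℤ)) → GraphClass,
          ∀ c ∈ reducingClasses G', ∃ B ⊆ {e | f.interiorGraph.IsBridge e}, Φ B = c) := by
  have hne : ∀ {G : Graph ℕ ℕ}, G.genus = g → G.genus ≠ 0 := by
    intro G h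
    rw [h]
    exact_mod_cast (by omega : g ≠ 0)
  have part2 : ∀ G : Graph ℕ ℕ, G.IsTroplanar → G.genus = g →
      ∃ G' : Graph ℕ ℕ, G.BridgeReducesTo G' ∧
        G'.IsTroplanar ∧ G'.genus = g ∧ G'.IsTwoEdgeConnected := by
    intro G hG hGg
    obtain ⟨G', h1, h2, h3, h4⟩ := hG.exists_isTwoEdgeConnected (hne hGg)
    exact ⟨G', ⟨G', h1, .refl _⟩, h2, h3.trans hGg, h4⟩
  have bound : ∀ G' : Graph ℕ ℕ, G'.IsTroplanar → G'.genus = g → G'.IsTwoEdgeConnected →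
      (reducingClasses G').Finite ∧ (reducingClasses G').ncard ≤ 2 ^ (g - 1) := by
    rintro G' ⟨hfin, f, hf⟩ hGg h2
    obtain ⟨S, F, -, hD, hcard, hF⟩ := hf.exists_encoding hfin (hne hGg) h2
    have hsub : reducingClasses G' ⊆ F '' (𝒫 f.dualBridges S) := fun c hc => by
      obtain ⟨A, hA, h⟩ := hF c hc
      exact ⟨A, hA, h⟩
    have hP : (𝒫 f.dualBridges S).Finite := hD.finite_subsets
    refine ⟨(hP.image F).subset hsub, ?_⟩
    refine (Set.ncard_le_ncard hsub (hP.image F)).trans ((Set.ncard_image_le hP).trans ?_)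
    rw [Set.ncard_powerset _ hD]
    exact Nat.pow_le_pow_right (by norm_num) (by omega)
  refine ⟨?_, part2, fun G' hG' hGg h2 => ⟨(bound G' hG' hGg h2).1, (bound G' hG' hGg h2).2, ?_⟩⟩
  · have hT : (twoEdgeConnectedTroplanarClasses g).Finite := by
      refine (Graph.finite_classes_good g).subset ?_
      rintro _ ⟨G, rfl, hG, hGg, -⟩
      exact ⟨G, rfl, hG.good (hne hGg), hGg⟩
    have := hT.to_subtype
    choose R h1 h2 h3 h4 using fun c : twoEdgeConnectedTroplanarClasses g => c.2
    -- By statement 2 every class reduces to the chosen representative of some 2-edge-connected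
    -- class.
    have hsub : troplanarClasses g ⊆ ⋃ c, reducingClasses (R c) := by
      rintro _ ⟨G, rfl, hG, hGg⟩
      obtain ⟨G', ⟨G'', hr, hi⟩, k2, k3, k4⟩ := part2 G hG hGg
      refine Set.mem_iUnion.2 ⟨⟨graphClass G', G', rfl, k2, k3, k4⟩, G, rfl, hG, G'', hr, ?_⟩
      exact hi.trans (graphClass_eq_iff.1 (h1 _)).symm
    have hb := fun c => bound (R c) (h2 c) (h3 c) (h4 c)
    have hU : (⋃ c, reducingClasses (R c)).Finite := Set.finite_iUnion fun c => (hb c).1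
    refine ⟨hU.subset hsub, (Set.ncard_le_ncard hsub hU).trans ?_⟩
    have := Fintype.ofFinite (twoEdgeConnectedTroplanarClasses g)
    refine (Set.ncard_iUnion_le_of_fintype _).trans ((Finset.sum_le_card_nsmul _ _ _
      fun c _ => (hb c).2).trans ?_)
    rw [Finset.card_univ, ← Nat.card_eq_fintype_card, Nat.card_coe_set_eq, smul_eq_mul, mul_comm]
  · intro f hf
    obtain ⟨S, F, hsm, -, -, hF⟩ := hf.exists_encoding hG'.1 (hne hGg) h2
    -- A set of bridges of the interior graph is translated into the set of dual edges of the
    -- skeleton. Duality is one-to-one on these, so every subset of `dualBridges` is reached.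
    refine ⟨fun B => F {e | e ∈ f.dualBridges S ∧ ∃ p q, f.DualTo e p q ∧ s(p, q) ∈ B},
      fun c hc => ?_⟩
    obtain ⟨A, hA, rfl⟩ := hF c hc
    refine ⟨{z | ∃ e ∈ A, ∃ p q, f.DualTo e p q ∧ z = s(p, q)}, ?_, ?_⟩
    · rintro _ ⟨e, he, p, q, hd, rfl⟩
      obtain ⟨-, p', q', hd', -, -, hb⟩ := hA he
      change f.interiorGraph.IsBridge s(p, q)
      rwa [hd.pair_eq hsm hd']
    · refine congrArg F (Set.ext fun e => ?_)
      constructor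
      · rintro ⟨-, p, q, hd, e', he', p', q', hd', heq⟩
        rcases Sym2.eq_iff.1 heq with ⟨rfl, rfl⟩ | ⟨rfl, rfl⟩
        · rwa [hd.unique hsm hd']
        · rwa [hd.symm.unique hsm hd']
      · intro he
        obtain ⟨-, p, q, hd, -⟩ := hA he
        exact ⟨hA he, p, q, hd, e, he, p, q, hd, rfl⟩
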